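/- Let $(W,H,\mu)$ be an abstract Wiener space: $W$ is a separable Banach space, $H$ a Hilbert space densely embedded in $W$ by $i:H\to W$ (so $i^*:W^*\to H$), and under $\mu$ each $l\in W^*$ is $N(0,|i^*l|_H^2)$. Let $\mathcal S$ be the set of functionals $\Phi(\omega)=\varphi(\langle l_1,\omega\rangle,\dots,\langle l_n,\omega\rangle)$ with $l_j\in W^*$, $\varphi\in C_b^\infty(\mathbb R^n)$, with gradient $\nabla\Phi=\sum_j\partial_j\varphi(\langle l_1,\cdot\rangle,\dots,\langle l_n,\cdot\rangle)\,i^*l_j$. For $1\le p<\infty$ let $\mathbb D_{p,1}$, $\mathbb D_{p,2}$ and $\mathbb D_{p,1}(H)$ be the usual Sobolev spaces (completions of $\mathcal S$, resp. of the finite sums $\sum_k\Phi_kh_k$ with $\Phi_k\in\mathcal S$, $h_k\in H$, in the $L^p(\mu)$ norms of the function and of its gradients, with Hilbert–Schmidt norms on $H\otimes H$). For $v\in L^1(\mu;H)$, the divergence $\delta v\in L^1(\mu)$, if it exists, is the function with $E(v,\nabla\Phi)_H=E(\Phi\,\delta v)$ for all $\Phi\in\mathcal S$. Fix $1\le p<\infty$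 and an orthonormal basis $(e_n)_{n\in\mathbb N}$ of $H$ with $e_n\in i^*(W^*)$. Let $A(\omega)$ be a measurable random bounded operator on $H$ which is a.s. skew-symmetric and maps $\mathbb D_{p,1}(H)$ into $\mathbb D_{p,1}(H)$. Assume that the divergences $\delta(Ae_n)$ exist in $L^1(\mu)$ and that the series $B=\sum_n\delta(Ae_n)\,e_n$ converges in $L^1(\mu;W)$. Let $(t,\omega)\mapsto T_t\omega\in W$, $t\in\mathbb R$, be jointly measurable, each $T_t$ preserving $\mu$, such that $$\frac{dT_t\omega}{dt}=B(T_t\omega),\qquad T_0\omega=\omega ,$$ that is, a.s. $T_t\omega=\omega+\int_0^tB(T_r\omega)\,dr$ for all $t$; and let $T$ be a stationary process: for all $n$, $t_1,\dots,t_n,\tau\in\mathbb R$ and $\varphi_1,\dots,\varphi_n\in\mathcal S$, the vectors $(\varphi_j(T_{t_j}\omega))_j$ and $(\varphi_j(T_{t_j+\tau}\omega))_j$ have the same law. Let $f_0\in\mathcal S$ be such that $f(t,\cdot):=f_0(T_t\,\cdot)\in\mathbb D_{p,2}$ for all $t$. Then $f$ solves $$\frac{df(t,\omega)}{dt}=\delta\big(A(\omega)\nabla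 f(t,\omega)\big),\qquad f(0,\omega)=f_0(\omega).$$ Precisely, $\delta(A\nabla f(t,\cdot))$ exists in $L^1(\mu)$ for every $t$ and has a jointly measurable version $d(t,\omega)$; for every $t$ it is the limit in $L^1(\mu)$ of $\varepsilon^{-1}(f(t+\varepsilon,\cdot)-f(t,\cdot))$ as $\varepsilon\to0$; a.s. $f(t,\omega)=f_0(\omega)+\int_0^td(r,\omega)\,dr$ for all $t$; and a.s., at every $t$ at which $s\mapsto T_s\omega$ is differentiable with derivative $B(T_t\omega)$, $s\mapsto f(s,\omega)$ is differentiable with derivative $d(t,\omega)$. If moreover $p>1$, then for every $t$ for which $\nabla f(t,\omega)\in W^*$ a.s. (i.e. $\nabla f(t,\omega)=i^*U(\omega)$ a.s. with $U(\omega)\in W^*$), the derivative is given by $$\frac{df(t,\omega)}{dt}=\delta\big(A\nabla f(t,\cdot)\big)(\omega)=\langle\nabla f(t,\omega),B(\omega)\rangle\qquad\text{a.s.}$$ -/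

import Mathlib

open MeasureTheory ProbabilityTheory Filter Topology
open scoped ENNReal NNReal InnerProductSpace

noncomputable section

namespace WienerFlow

variable {W H : Type*}
  [NormedAddCommGroup W] [NormedSpace ℝ W] [MeasurableSpace W]
  [NormedAddCommGroup H] [InnerProductSpace ℝ H] [CompleteSpace H]

/-- The embedding `i* : W* → H` dual to `i : H → W`, with `H` identified with its own dual:
`⟪i* l, h⟫ = l (i h)`. -/
def dualEmb (i : H →L[ℝ] W) (l : StrongDual ℝ W) : H :=
  (InnerProductSpace.toDual ℝ H).symm (l.comp i)

/-- `(W, H, μ)` is an abstract Wiener space: `H` is densely embedded in `W` through `i`, and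
under `μ` every `l ∈ W*` is a centered Gaussian variable of variance `|i* l|²`. -/
structure IsAbstractWienerSpace (i : H →L[ℝ] W) (μ : Measure W) : Prop where
  injective : Function.Injective i
  dense : DenseRange i
  gaussian : ∀ l : StrongDual ℝ W, μ.map l = gaussianReal 0 (‖dualEmb i l‖₊ ^ 2)

/-- The class `C_b^∞` of smooth functions which are bounded together with all derivatives. -/
def IsCbInfty {n : ℕ} (φ : (Fin n → ℝ) → ℝ) : Prop :=
  ContDiff ℝ ((⊤ : ℕ∞) : WithTop ℕ∞) φ ∧ ∀ k : ℕ, ∃ C : ℝ, ∀ x, ‖iteratedFDeriv ℝ k φ x‖ ≤ C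

/-- The smooth functionals `𝒮`: `Φ(ω) = φ(l₁ ω, …, lₙ ω)` with `lⱼ ∈ W*` and `φ ∈ C_b^∞(ℝⁿ)`. -/
def IsSmoothFunctional (Φ : W → ℝ) : Prop :=
  ∃ (n : ℕ) (l : Fin n → StrongDual ℝ W) (φ : (Fin n → ℝ) → ℝ),
    IsCbInfty φ ∧ Φ = fun ω => φ (fun j => l j ω)

/-- The gradient of a smooth functional, as an `H`-valued function. For
`Φ(ω) = φ(l₁ ω, …, lₙ ω)` the Fréchet derivative at `ω` is `∑ ∂ⱼφ(l₁ ω, …, lₙ ω) lⱼ ∈ W*`,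
which is then mapped to `H`. -/
def smoothGrad (i : H →L[ℝ] W) (Φ : W → ℝ) (ω : W) : H :=
  dualEmb i (fderiv ℝ Φ ω)

/-- The smooth `H`-valued functions `𝒮(H)`: finite sums `∑ Φₖ hₖ`, `Φₖ ∈ 𝒮`, `hₖ ∈ H`. -/
def IsSmoothField (F : W → H) : Prop :=
  ∃ (m : ℕ) (Φ : Fin m → W → ℝ) (h : Fin m → H),
    (∀ k, IsSmoothFunctional (Φ k)) ∧ F = fun ω => ∑ k, Φ k ω • h k

/-- The gradient of a smooth `H`-valued function `F = ∑ Φₖ hₖ`, as an operator on `H`: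
`∇F(ω) = ∑ ∇Φₖ(ω) ⊗ hₖ`, i.e. `x ↦ ∑ ⟪∇Φₖ(ω), x⟫ hₖ`. -/
def fieldGrad (i : H →L[ℝ] W) (F : W → H) (ω : W) : H →L[ℝ] H :=
  (fderiv ℝ F ω).comp i

/-- The Hilbert–Schmidt norm of an operator on `H`. -/
def hsNorm (K : H →L[ℝ] H) : ℝ≥0∞ :=
  ⨆ (n : ℕ) (v : Fin n → H) (_ : Orthonormal ℝ v), (∑ j, ‖K (v j)‖ₑ ^ 2) ^ (1 / 2 : ℝ)

/-- `f ∈ 𝔻_{p,1}` and `∇f = u`: there are smooth `Φₙ` with `Φₙ → f` in `L^p(μ)` and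
`∇Φₙ → u` in `L^p(μ; H)`. -/
def IsGradient (i : H →L[ℝ] W) (μ : Measure W) (p : ℝ≥0∞) (f : W → ℝ) (u : W → H) : Prop :=
  MemLp f p μ ∧ MemLp u p μ ∧ ∃ Φ : ℕ → W → ℝ, (∀ n, IsSmoothFunctional (Φ n)) ∧
    Tendsto (fun n => eLpNorm (fun ω => Φ n ω - f ω) p μ) atTop (𝓝 0) ∧
    Tendsto (fun n => eLpNorm (fun ω => smoothGrad i (Φ n) ω - u ω) p μ) atTop (𝓝 0)

/-- `v ∈ 𝔻_{p,1}(H)`: `v` is the `L^p` limit of elements of `𝒮(H)` whose gradients form a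
Cauchy sequence in `L^p(μ; H ⊗ H)` (Hilbert–Schmidt norm). -/
def MemD1 (i : H →L[ℝ] W) (μ : Measure W) (p : ℝ≥0∞) (v : W → H) : Prop :=
  MemLp v p μ ∧ ∃ F : ℕ → W → H, (∀ n, IsSmoothField (F n)) ∧
    Tendsto (fun n => eLpNorm (fun ω => F n ω - v ω) p μ) atTop (𝓝 0) ∧
    Tendsto (fun k : ℕ × ℕ =>
      eLpNorm (fun ω => hsNorm (fieldGrad i (F k.1) ω - fieldGrad i (F k.2) ω)) p μ)
      atTop (𝓝 0)

/-- `f ∈ 𝔻_{p,2}`: `f` is the `L^p` limit of elements of `𝒮` whose first gradients form a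
Cauchy sequence in `L^p(μ; H)` and whose second gradients form a Cauchy sequence in
`L^p(μ; H ⊗ H)` (Hilbert–Schmidt norm). -/
def MemD2 (i : H →L[ℝ] W) (μ : Measure W) (p : ℝ≥0∞) (f : W → ℝ) : Prop :=
  MemLp f p μ ∧ ∃ Φ : ℕ → W → ℝ, (∀ n, IsSmoothFunctional (Φ n)) ∧
    Tendsto (fun n => eLpNorm (fun ω => Φ n ω - f ω) p μ) atTop (𝓝 0) ∧
    Tendsto (fun k : ℕ × ℕ =>
      eLpNorm (fun ω => smoothGrad i (Φ k.1) ω - smoothGrad i (Φ k.2) ω) p μ) atTop (𝓝 0) ∧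
    Tendsto (fun k : ℕ × ℕ =>
      eLpNorm (fun ω => hsNorm (fieldGrad i (smoothGrad i (Φ k.1)) ω -
        fieldGrad i (smoothGrad i (Φ k.2)) ω)) p μ) atTop (𝓝 0)

/-- `d = δ v`: the `H`-valued integrable `v` has divergence `d ∈ L¹(μ)`, that is
`E ⟪v, ∇Φ⟫ = E (Φ d)` for every `Φ ∈ 𝒮`. -/
def IsDivergence (i : H →L[ℝ] W) (μ : Measure W) (v : W → H) (d : W → ℝ) : Prop :=
  Integrable v μ ∧ Integrable d μ ∧ ∀ Φ : W → ℝ, IsSmoothFunctional Φ →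
    ∫ ω, ⟪v ω, smoothGrad i Φ ω⟫_ℝ ∂μ = ∫ ω, Φ ω * d ω ∂μ

/-- `(T_t)` is a stationary process of measure preserving transformations of `W`:
for smooth `φ₁, …, φₙ` the law of `(φ₁(T_{t₁+τ}), …, φₙ(T_{tₙ+τ}))` does not depend on `τ`. -/
structure IsStationaryProcess (μ : Measure W) (T : ℝ → W → W) : Prop where
  measurePreserving : ∀ t, MeasurePreserving (T t) μ μ
  stationary : ∀ (n : ℕ) (t : Fin n → ℝ) (φ : Fin n → W → ℝ),
    (∀ j, IsSmoothFunctional (φ j)) → ∀ τ : ℝ,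
      μ.map (fun ω j => φ j (T (t j) ω)) = μ.map (fun ω j => φ j (T (t j + τ) ω))

/-- `dX_t/dt = D_t`, `X_0 = x`, along almost every path, in integrated form:
almost surely, `X_t = x + ∫₀ᵗ D_r dr` for all `t ∈ ℝ`. -/
def SolvesPathwise {E : Type*} [NormedAddCommGroup E] [NormedSpace ℝ E] (μ : Measure W)
    (X D : ℝ → W → E) (x : W → E) : Prop :=
  ∀ᵐ ω ∂μ, ∀ t : ℝ, IntervalIntegrable (fun r => D r ω) volume 0 t ∧
    X t ω = x ω + ∫ r in (0 : ℝ)..t, D r ω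

end WienerFlow

end

/-! Write f(t) = f₀ ∘ T_t. Almost every path of T is a primitive of B(T), so the chain rule gives
df/dt = d with d(t) = Df₀(T_t)(B(T_t)), and invariance of μ makes t ↦ d(t) continuous in L¹(μ). This
settles all statements about derivatives (`CbSmooth.comp_primitive`, `tendsto_eLpNorm_slope_flow`).
It remains to identify d(t) with δ(A∇f(t)) and, for p > 1, with ⟨∇f(t), B⟩.

The link between A and B is E⟪A∇Φ, ∇Ψ⟫ = E[Ψ DΦ(B)] for smooth Φ, Ψ (`integral_inner_smoothGrad`).
Testing δ(A eₙ) on Ψ ∂ₙΦ and summing over n produces the left side plus the trace of the skew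
operator A against the symmetric second gradient of Φ, which is zero. The limit in n uses that A is
essentially bounded, and this is automatic: by the open mapping theorem A acts boundedly on
𝔻_{p,1}(H), so ‖Aⁿh‖_p ≤ Cⁿ for a constant unit vector h, while skewness gives ‖Ah‖ⁿ ≤ ‖Aⁿh‖;
Markov's inequality and n → ∞ yield ‖A‖ ≤ C a.s. (`exists_sobolev_bound`, `ae_norm_le_of_skew`).
Stationarity gives E[Ψ d(t)] = -E[f(t) DΨ(B)] (`IsStationaryProcess.integral_mul_fderiv`). The link,
with Ψ as the differentiated functional and f(t) as the test function, and skewness turn the right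
side into E⟪A∇f(t), ∇Ψ⟫ (`isDivergence_clm_of_flow`).

For the formula with ⟨∇f, B⟩ the difficulty is that gradients of smooth functionals approximate ∇f =
i*U only in H, whereas B lives only in W, and U(B) is not known to be integrable. B is replaced by
S_N, the first N coordinates of the average of B over the coordinates beyond N. Then S_N is
H-valued, i S_N → B in L¹(μ; W), and DΦ_k(i S_N) → U(i S_N) a.e. along smooth Φ_k approximating f.
The limits pass through the integrals by Vitali's theorem; uniform integrability comes from |E⟪A∇Φ,
∇χ⟫| ≤ K ‖∇Φ‖_{𝔻_{p,1}} ‖χ‖_q (`IsAbstractWienerSpace.exists_divergence_clm_bound`), which survives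
the averaging because resampling coordinates preserves μ ⊗ μ
(`enorm_integral_mul_fderiv_mixCoords_le`, `IsAbstractWienerSpace.integral_mul_apply_eq`).

That bound rests on continuity of the divergence from 𝔻_{r,1}(H) to L^r
(`IsAbstractWienerSpace.exists_divergence_bound`), proved by rotations. Gaussian integration by
parts writes E⟪F, ∇χ⟫ as a Gaussian linear form in F against rotations of χ, plus the limit of a
Gaussian bilinear form in ∇F against double singular integrals of χ over rotation angles. The
singular integrals are bounded on L^q, q = 4m, by M. Riesz' theorem on the circle
(`exists_conjPoissonKer_bound`) transferred to Gaussian space through rotation invariance of μ ⊗ μ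
(`IsAbstractWienerSpace.exists_transference_bound`). -/

noncomputable section

set_option linter.unusedSectionVars false

namespace WienerFlow

/-! ### Smooth functions bounded together with all derivatives -/

section CbSmooth

variable {E F G : Type*} [NormedAddCommGroup E] [NormedSpace ℝ E]
  [NormedAddCommGroup F] [NormedSpace ℝ F] [NormedAddCommGroup G] [NormedSpace ℝ G]

/-- Smooth functions between normed spaces which are bounded together with all derivatives. -/
def CbSmooth (f : E → F) : Prop :=
  ContDiff ℝ ((⊤ : ℕ∞) : WithTop ℕ∞) f ∧ ∀ k : ℕ, ∃ C : ℝ, ∀ x, ‖iteratedFDeriv ℝ k f x‖ ≤ C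

lemma natCast_le_smooth (k : ℕ) : (k : WithTop ℕ∞) ≤ ((⊤ : ℕ∞) : WithTop ℕ∞) := by
  exact_mod_cast le_top

lemma CbSmooth.contDiff {f : E → F} (hf : CbSmooth f) :
    ContDiff ℝ ((⊤ : ℕ∞) : WithTop ℕ∞) f := hf.1

lemma CbSmooth.differentiable {f : E → F} (hf : CbSmooth f) : Differentiable ℝ f :=
  hf.1.differentiable (by simp)

lemma CbSmooth.continuous {f : E → F} (hf : CbSmooth f) : Continuous f := hf.1.continuous

lemma CbSmooth.const (c : F) : CbSmooth (fun _ : E => c) := by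
  refine ⟨contDiff_const, fun k => ⟨‖c‖, fun x => ?_⟩⟩
  rcases Nat.eq_zero_or_pos k with rfl | hk
  · simp
  · rw [iteratedFDeriv_const_of_ne hk.ne']
    simp

lemma CbSmooth.add {f g : E → F} (hf : CbSmooth f) (hg : CbSmooth g) :
    CbSmooth (fun x => f x + g x) := by
  refine ⟨hf.1.add hg.1, fun k => ?_⟩
  obtain ⟨C, hC⟩ := hf.2 k
  obtain ⟨D, hD⟩ := hg.2 k
  refine ⟨C + D, fun x => ?_⟩
  have h : iteratedFDeriv ℝ k (fun x => f x + g x) x =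
      iteratedFDeriv ℝ k f x + iteratedFDeriv ℝ k g x :=
    iteratedFDeriv_add_apply (hf.1.contDiffAt.of_le (natCast_le_smooth k))
      (hg.1.contDiffAt.of_le (natCast_le_smooth k))
  rw [h]
  exact (norm_add_le _ _).trans (add_le_add (hC x) (hD x))

lemma CbSmooth.clm_comp (L : F →L[ℝ] G) {f : E → F} (hf : CbSmooth f) :
    CbSmooth (fun x => L (f x)) := by
  refine ⟨L.contDiff.comp hf.1, fun k => ?_⟩
  obtain ⟨C, hC⟩ := hf.2 k
  refine ⟨‖L‖ * C, fun x => ?_⟩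
  exact (L.norm_iteratedFDeriv_comp_left (hf.1.contDiffAt) (natCast_le_smooth k)).trans
    (mul_le_mul_of_nonneg_left (hC x) (norm_nonneg _))

lemma CbSmooth.comp_clm {f : F → G} (hf : CbSmooth f) (L : E →L[ℝ] F) :
    CbSmooth (fun x => f (L x)) := by
  refine ⟨hf.1.comp L.contDiff, fun k => ?_⟩
  obtain ⟨C, hC⟩ := hf.2 k
  refine ⟨C * ‖L‖ ^ k, fun x => ?_⟩
  have h := L.iteratedFDeriv_comp_right hf.1 x (natCast_le_smooth k)
  have h2 : iteratedFDeriv ℝ k (fun x => f (L x)) x = iteratedFDeriv ℝ k (f ∘ L) x := rfl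
  rw [h2, h]
  refine (ContinuousMultilinearMap.norm_compContinuousLinearMap_le _ _).trans ?_
  simp only [Finset.prod_const, Finset.card_univ, Fintype.card_fin]
  exact mul_le_mul_of_nonneg_right (hC _) (by positivity)

lemma CbSmooth.comp_add_right {f : E → F} (hf : CbSmooth f) (a : E) :
    CbSmooth (fun x => f (x + a)) := by
  refine ⟨hf.1.comp (contDiff_id.add contDiff_const), fun k => ?_⟩
  obtain ⟨C, hC⟩ := hf.2 k
  refine ⟨C, fun x => ?_⟩
  rw [iteratedFDeriv_comp_add_right]
  exact hC _

lemma CbSmooth.mul {f g : E → ℝ} (hf : CbSmooth f) (hg : CbSmooth g) :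
    CbSmooth (fun x => f x * g x) := by
  refine ⟨hf.1.mul hg.1, fun k => ?_⟩
  choose C hC using hf.2
  choose D hD using hg.2
  refine ⟨∑ i ∈ Finset.range (k + 1), (k.choose i : ℝ) * C i * D (k - i), fun x => ?_⟩
  refine (norm_iteratedFDeriv_mul_le hf.1 hg.1 x (natCast_le_smooth k)).trans ?_
  refine Finset.sum_le_sum fun i _ => ?_
  have := (norm_nonneg _).trans (hC i x)
  gcongr
  · exact hC i x
  · exact hD _ x

lemma CbSmooth.comp {g : F → G} {f : E → F} (hg : CbSmooth g) (hf : CbSmooth f) :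
    CbSmooth (fun x => g (f x)) := by
  refine ⟨hg.1.comp hf.1, fun k => ?_⟩
  choose C hC using hg.2
  choose D hD using hf.2
  -- The estimate for derivatives of a composition asks for a single number whose `i`-th power
  -- bounds the `i`-th derivative of `f` for `1 ≤ i ≤ k`. Adding 1 to each summand makes the sum at
  -- least 1, hence at most each of these powers.
  refine ⟨k.factorial * (∑ i ∈ Finset.range (k + 1), |C i|) *
    (∑ i ∈ Finset.range (k + 1), (|D i| + 1)) ^ k, fun x => ?_⟩
  have h2 : iteratedFDeriv ℝ k (fun x => g (f x)) x = iteratedFDeriv ℝ k (g ∘ f) x := rfl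
  rw [h2]
  refine norm_iteratedFDeriv_comp_le hg.1 hf.1 (natCast_le_smooth k) x (fun i hi => ?_)
    (fun i h1 hi => ?_)
  · exact ((hC i _).trans (le_abs_self _)).trans
      (Finset.single_le_sum (f := fun i => |C i|) (fun _ _ => abs_nonneg _)
        (Finset.mem_range.2 (Nat.lt_succ_of_le hi)))
  · have h3 : |D i| + 1 ≤ ∑ i ∈ Finset.range (k + 1), (|D i| + 1) :=
      Finset.single_le_sum (f := fun i => |D i| + 1) (fun _ _ => by positivity)
        (Finset.mem_range.2 (Nat.lt_succ_of_le hi))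
    have h4 : 1 ≤ ∑ i ∈ Finset.range (k + 1), (|D i| + 1) :=
      le_trans (by linarith [abs_nonneg (D i)]) h3
    calc ‖iteratedFDeriv ℝ i f x‖ ≤ |D i| + 1 := by linarith [hD i x, le_abs_self (D i)]
      _ ≤ _ := h3
      _ ≤ _ := le_self_pow₀ h4 (by omega)

lemma CbSmooth.fderiv {f : E → F} (hf : CbSmooth f) : CbSmooth (fderiv ℝ f) := by
  refine ⟨hf.1.fderiv_right (by simp), fun k => ?_⟩
  obtain ⟨C, hC⟩ := hf.2 (k + 1)
  exact ⟨C, fun x => by rw [norm_iteratedFDeriv_fderiv]; exact hC x⟩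

lemma CbSmooth.fderiv_apply {f : E → F} (hf : CbSmooth f) (w : E) :
    CbSmooth (fun x => _root_.fderiv ℝ f x w) :=
  hf.fderiv.clm_comp (ContinuousLinearMap.apply ℝ F w)

lemma CbSmooth.exists_bound {f : E → F} (hf : CbSmooth f) : ∃ C, ∀ x, ‖f x‖ ≤ C := by
  obtain ⟨C, hC⟩ := hf.2 0
  exact ⟨C, fun x => by simpa using hC x⟩

lemma CbSmooth.exists_fderiv_bound {f : E → F} (hf : CbSmooth f) :
    ∃ C, ∀ x, ‖_root_.fderiv ℝ f x‖ ≤ C := hf.fderiv.exists_bound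

end CbSmooth

/-! ### The class 𝒮 in coordinate-free form -/

section SmoothFunctional

variable {W H : Type*} [NormedAddCommGroup W] [NormedSpace ℝ W]
  [NormedAddCommGroup H] [InnerProductSpace ℝ H] [CompleteSpace H]

/-- `f` depends on its argument only through finitely many continuous linear functionals. -/
def IsCylindrical {α : Type*} (f : W → α) : Prop :=
  ∃ s : Finset (StrongDual ℝ W), ∀ x y, (∀ l ∈ s, l x = l y) → f x = f y

lemma IsCylindrical.map {α β : Type*} {f : W → α} (hf : IsCylindrical f) (g : α → β) :
    IsCylindrical (fun x => g (f x)) := by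
  obtain ⟨s, hs⟩ := hf
  exact ⟨s, fun x y h => congrArg g (hs x y h)⟩

lemma IsCylindrical.map₂ {α β γ : Type*} {f : W → α} {g : W → β} (hf : IsCylindrical f)
    (hg : IsCylindrical g) (h : α → β → γ) : IsCylindrical (fun x => h (f x) (g x)) := by
  classical
  obtain ⟨s, hs⟩ := hf
  obtain ⟨t, ht⟩ := hg
  refine ⟨s ∪ t, fun x y hxy => ?_⟩
  simp only
  rw [hs x y fun l hl => hxy l (Finset.mem_union_left _ hl),
    ht x y fun l hl => hxy l (Finset.mem_union_right _ hl)]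

lemma IsCylindrical.comp_affine {α : Type*} {f : W → α} (hf : IsCylindrical f)
    (C : W →L[ℝ] W) (a : W) : IsCylindrical (fun x => f (C x + a)) := by
  classical
  obtain ⟨s, hs⟩ := hf
  refine ⟨s.image fun l => l.comp C, fun x y hxy => hs _ _ fun l hl => ?_⟩
  have := hxy _ (Finset.mem_image_of_mem (fun l => l.comp C) hl)
  simp only [ContinuousLinearMap.comp_apply] at this
  simp [this]

/-- Translation by `x - y` is invisible to every functional in `s`, so it leaves `f` invariant. -/
lemma fderiv_eq_of_cylindrical {F : Type*} [NormedAddCommGroup F] [NormedSpace ℝ F] {f : W → F}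
    {s : Finset (StrongDual ℝ W)} (hs : ∀ x y, (∀ l ∈ s, l x = l y) → f x = f y) {x y : W}
    (hxy : ∀ l ∈ s, l x = l y) : fderiv ℝ f x = fderiv ℝ f y := by
  have h : (fun z => f (z + (x - y))) = f := by
    funext z
    exact hs _ _ fun l hl => by simp [hxy l hl]
  have h2 := fderiv_comp_add_right (𝕜 := ℝ) (f := f) (x := y) (x - y)
  rw [h] at h2
  simpa using h2.symm

lemma IsCylindrical.fderiv {F : Type*} [NormedAddCommGroup F] [NormedSpace ℝ F] {f : W → F}
    (hf : IsCylindrical f) : IsCylindrical (fderiv ℝ f) := by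
  obtain ⟨s, hs⟩ := hf
  exact ⟨s, fun x y hxy => fderiv_eq_of_cylindrical hs hxy⟩

/-- `f` is constant along the line `x + t w`. -/
lemma fderiv_apply_eq_zero_of_cylindrical {F : Type*} [NormedAddCommGroup F] [NormedSpace ℝ F]
    {f : W → F} (hd : Differentiable ℝ f)
    {s : Finset (StrongDual ℝ W)} (hs : ∀ x y, (∀ l ∈ s, l x = l y) → f x = f y) (x : W) {w : W}
    (hw : ∀ l ∈ s, l w = 0) : fderiv ℝ f x w = 0 := by
  have h1 : HasDerivAt (fun t : ℝ => f (x + t • w)) (fderiv ℝ f (x + (0 : ℝ) • w) w) 0 := by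
    have := (hd (x + (0 : ℝ) • w)).hasFDerivAt.comp_hasDerivAt (0 : ℝ)
      (((hasDerivAt_id (0 : ℝ)).smul_const w).const_add x)
    simpa [Function.comp_def] using this
  have h2 : (fun t : ℝ => f (x + t • w)) = fun _ => f x := by
    funext t
    exact hs _ _ fun l hl => by simp [hw l hl]
  rw [h2] at h1
  have h3 := h1.unique (hasDerivAt_const (0 : ℝ) (f x))
  simpa using h3

/-- This description splits every stability property of 𝒮 (sums, products, composition,
differentiation, affine substitution) into two independent easy checks. To recover a function on
`ℝⁿ`, `Φ` is composed with a linear section of the map formed by the functionals. -/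
lemma isSmoothFunctional_iff (Φ : W → ℝ) :
    IsSmoothFunctional Φ ↔ CbSmooth Φ ∧ IsCylindrical Φ := by
  classical
  constructor
  · rintro ⟨n, l, φ, hφ, rfl⟩
    refine ⟨?_, Finset.univ.image l, fun x y hxy => ?_⟩
    · exact CbSmooth.comp_clm (f := φ) hφ (ContinuousLinearMap.pi l)
    · refine congrArg φ (funext fun j => hxy _ (by simp))
  · rintro ⟨hΦ, s, hs⟩
    set n := s.card
    let ε := s.equivFin
    let l : Fin n → StrongDual ℝ W := fun j => (ε.symm j : StrongDual ℝ W)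
    let L : W →ₗ[ℝ] (Fin n → ℝ) := (ContinuousLinearMap.pi l : W →L[ℝ] (Fin n → ℝ))
    -- The functionals may be linearly dependent, so `L` need not be onto. A section is chosen on
    -- its range and extended arbitrarily to `ℝⁿ`; only its values on the range matter.
    obtain ⟨σ₀, hσ₀⟩ := L.rangeRestrict.exists_rightInverse_of_surjective
      (LinearMap.range_rangeRestrict L)
    obtain ⟨σ, hσ⟩ := σ₀.exists_extend
    let σ' : (Fin n → ℝ) →L[ℝ] W := LinearMap.toContinuousLinearMap σ
    have key : ∀ x, L (σ (L x)) = L x := by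
      intro x
      have h1 : σ (L x) = σ₀ (L.rangeRestrict x) := by
        rw [← hσ]; rfl
      have h2 := LinearMap.congr_fun hσ₀ (L.rangeRestrict x)
      rw [h1]
      exact congrArg Subtype.val h2
    refine ⟨n, l, fun v => Φ (σ' v), hΦ.comp_clm σ', ?_⟩
    funext x
    refine hs _ _ fun m hm => ?_
    have := congrFun (key x) (ε ⟨m, hm⟩)
    simp only [L, l, ContinuousLinearMap.coe_coe, ContinuousLinearMap.coe_pi', ε,
      Equiv.symm_apply_apply] at this
    exact this.symm

lemma IsSmoothFunctional.cbSmooth {Φ : W → ℝ} (h : IsSmoothFunctional Φ) : CbSmooth Φ :=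
  ((isSmoothFunctional_iff Φ).1 h).1

lemma IsSmoothFunctional.isCylindrical {Φ : W → ℝ} (h : IsSmoothFunctional Φ) :
    IsCylindrical Φ := ((isSmoothFunctional_iff Φ).1 h).2

lemma IsSmoothFunctional.continuous {Φ : W → ℝ} (h : IsSmoothFunctional Φ) : Continuous Φ :=
  h.cbSmooth.continuous

lemma IsSmoothFunctional.differentiable {Φ : W → ℝ} (h : IsSmoothFunctional Φ) :
    Differentiable ℝ Φ := h.cbSmooth.differentiable

lemma IsSmoothFunctional.const (c : ℝ) : IsSmoothFunctional (fun _ : W => c) :=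
  (isSmoothFunctional_iff _).2 ⟨CbSmooth.const c, ∅, fun _ _ _ => rfl⟩

lemma IsSmoothFunctional.add {Φ Ψ : W → ℝ} (h : IsSmoothFunctional Φ)
    (h' : IsSmoothFunctional Ψ) : IsSmoothFunctional (fun x => Φ x + Ψ x) :=
  (isSmoothFunctional_iff _).2 ⟨h.cbSmooth.add h'.cbSmooth,
    h.isCylindrical.map₂ h'.isCylindrical (· + ·)⟩

lemma IsSmoothFunctional.mul {Φ Ψ : W → ℝ} (h : IsSmoothFunctional Φ)
    (h' : IsSmoothFunctional Ψ) : IsSmoothFunctional (fun x => Φ x * Ψ x) :=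
  (isSmoothFunctional_iff _).2 ⟨h.cbSmooth.mul h'.cbSmooth,
    h.isCylindrical.map₂ h'.isCylindrical (· * ·)⟩

lemma IsSmoothFunctional.const_mul {Φ : W → ℝ} (c : ℝ) (h : IsSmoothFunctional Φ) :
    IsSmoothFunctional (fun x => c * Φ x) := (IsSmoothFunctional.const c).mul h

lemma IsSmoothFunctional.sub {Φ Ψ : W → ℝ} (h : IsSmoothFunctional Φ)
    (h' : IsSmoothFunctional Ψ) : IsSmoothFunctional (fun x => Φ x - Ψ x) := by
  simpa [sub_eq_add_neg] using h.add (h'.const_mul (-1))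

lemma IsSmoothFunctional.sum {ι : Type*} (s : Finset ι) {Φ : ι → W → ℝ}
    (h : ∀ k ∈ s, IsSmoothFunctional (Φ k)) : IsSmoothFunctional (fun x => ∑ k ∈ s, Φ k x) := by
  classical
  induction s using Finset.induction_on with
  | empty => simpa using IsSmoothFunctional.const (W := W) 0
  | insert a s ha ih =>
    simp only [Finset.sum_insert ha]
    exact (h a (by simp)).add (ih fun k hk => h k (by simp [hk]))

lemma IsSmoothFunctional.comp {Φ : W → ℝ} (h : IsSmoothFunctional Φ) {θ : ℝ → ℝ}
    (hθ : CbSmooth θ) : IsSmoothFunctional (fun x => θ (Φ x)) :=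
  (isSmoothFunctional_iff _).2 ⟨hθ.comp h.cbSmooth, h.isCylindrical.map θ⟩

lemma IsSmoothFunctional.fderiv_apply {Φ : W → ℝ} (h : IsSmoothFunctional Φ) (w : W) :
    IsSmoothFunctional (fun x => fderiv ℝ Φ x w) :=
  (isSmoothFunctional_iff _).2 ⟨h.cbSmooth.fderiv_apply w,
    h.isCylindrical.fderiv.map fun L => L w⟩

lemma IsSmoothFunctional.comp_affine {Φ : W → ℝ} (h : IsSmoothFunctional Φ) (C : W →L[ℝ] W)
    (a : W) : IsSmoothFunctional (fun x => Φ (C x + a)) :=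
  (isSmoothFunctional_iff _).2 ⟨(h.cbSmooth.comp_add_right a).comp_clm C,
    h.isCylindrical.comp_affine C a⟩

lemma IsSmoothFunctional.of_linear {θ : ℝ → ℝ} (hθ : CbSmooth θ) (l : StrongDual ℝ W) :
    IsSmoothFunctional (fun x => θ (l x)) :=
  (isSmoothFunctional_iff _).2 ⟨hθ.comp_clm l, {l}, fun x y h => by
    simp only [h l (by simp)]⟩

lemma IsSmoothFunctional.exists_bound {Φ : W → ℝ} (h : IsSmoothFunctional Φ) :
    ∃ C, ∀ x, ‖Φ x‖ ≤ C := h.cbSmooth.exists_bound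

lemma CbSmooth.cos : CbSmooth Real.cos := by
  refine ⟨Real.contDiff_cos, fun k => ⟨1, fun x => ?_⟩⟩
  rw [norm_iteratedFDeriv_eq_norm_iteratedDeriv]
  exact Real.abs_iteratedDeriv_cos_le_one k x

lemma CbSmooth.sin : CbSmooth Real.sin := by
  refine ⟨Real.contDiff_sin, fun k => ⟨1, fun x => ?_⟩⟩
  rw [norm_iteratedFDeriv_eq_norm_iteratedDeriv]
  exact Real.abs_iteratedDeriv_sin_le_one k x

/-- A smooth function which is the identity on `[-R, R]`. -/
lemma exists_smooth_truncation (R : ℝ) :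
    ∃ θ : ℝ → ℝ, CbSmooth θ ∧ ∀ x, |x| ≤ R → θ x = x ∧ deriv θ x = 1 := by
  -- The inner radius exceeds `R`, so `θ` is the identity in a neighbourhood of each point of `[-R,
  -- R]`, endpoints included, and its derivative is 1 there.
  let f : ContDiffBump (0 : ℝ) := ⟨|R| + 1, |R| + 2, by positivity, by linarith⟩
  let θ : ℝ → ℝ := fun x => x * f x
  have hc : ContDiff ℝ ((⊤ : ℕ∞) : WithTop ℕ∞) θ := contDiff_id.mul f.contDiff
  have hs : HasCompactSupport θ := f.hasCompactSupport.mul_left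
  refine ⟨θ, ⟨hc, fun k => ?_⟩, fun x hx => ?_⟩
  · have h1 : Continuous (iteratedFDeriv ℝ k θ) := hc.continuous_iteratedFDeriv (natCast_le_smooth k)
    exact h1.bounded_above_of_compact_support (hs.iteratedFDeriv k)
  · have hx' : x ∈ Metric.ball (0 : ℝ) (|R| + 1) := by
      rw [mem_ball_zero_iff, Real.norm_eq_abs]
      linarith [le_abs_self R]
    have heq : θ =ᶠ[𝓝 x] id := by
      filter_upwards [Metric.isOpen_ball.mem_nhds hx'] with y hy
      simp only [θ, id]
      rw [f.one_of_mem_closedBall (Metric.ball_subset_closedBall hy), mul_one]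
    exact ⟨heq.eq_of_nhds, by rw [heq.deriv_eq]; exact deriv_id x⟩

end SmoothFunctional

/-! ### Gradients of smooth functionals and smooth fields -/

section Gradient

variable {W H : Type*} [NormedAddCommGroup W] [NormedSpace ℝ W]
  [NormedAddCommGroup H] [InnerProductSpace ℝ H] [CompleteSpace H]

/-- `dualEmb` as a continuous linear map. -/
def dualEmbL (i : H →L[ℝ] W) : StrongDual ℝ W →L[ℝ] H :=
  LinearMap.mkContinuous
    { toFun := dualEmb i
      map_add' := fun l m => by simp [dualEmb, ContinuousLinearMap.add_comp]
      map_smul' := fun c l => by simp [dualEmb, ContinuousLinearMap.smul_comp] } ‖i‖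
    (fun l => by
      change ‖(InnerProductSpace.toDual ℝ H).symm (l.comp i)‖ ≤ _
      rw [LinearIsometryEquiv.norm_map]
      exact (l.opNorm_comp_le i).trans_eq (mul_comm _ _))

lemma dualEmbL_apply (i : H →L[ℝ] W) (l : StrongDual ℝ W) : dualEmbL i l = dualEmb i l := rfl

lemma dualEmb_inner (i : H →L[ℝ] W) (l : StrongDual ℝ W) (h : H) :
    ⟪dualEmb i l, h⟫_ℝ = l (i h) := by
  simp [dualEmb]

lemma inner_dualEmb (i : H →L[ℝ] W) (l : StrongDual ℝ W) (h : H) :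
    ⟪h, dualEmb i l⟫_ℝ = l (i h) := by
  rw [real_inner_comm, dualEmb_inner]

lemma smoothGrad_inner (i : H →L[ℝ] W) (Φ : W → ℝ) (x : W) (h : H) :
    ⟪smoothGrad i Φ x, h⟫_ℝ = fderiv ℝ Φ x (i h) := dualEmb_inner i _ h

lemma inner_smoothGrad (i : H →L[ℝ] W) (Φ : W → ℝ) (x : W) (h : H) :
    ⟪h, smoothGrad i Φ x⟫_ℝ = fderiv ℝ Φ x (i h) := inner_dualEmb i _ h

lemma smoothGrad_eq (i : H →L[ℝ] W) (Φ : W → ℝ) :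
    smoothGrad i Φ = fun x => dualEmbL i (fderiv ℝ Φ x) := rfl

lemma CbSmooth.smoothGrad (i : H →L[ℝ] W) {Φ : W → ℝ} (h : CbSmooth Φ) :
    CbSmooth (smoothGrad i Φ) := h.fderiv.clm_comp (dualEmbL i)

lemma smoothGrad_mul (i : H →L[ℝ] W) {Φ Ψ : W → ℝ} (h : Differentiable ℝ Φ)
    (h' : Differentiable ℝ Ψ) (x : W) :
    smoothGrad i (fun x => Φ x * Ψ x) x = Φ x • smoothGrad i Ψ x + Ψ x • smoothGrad i Φ x := by
  simp only [smoothGrad_eq, fderiv_fun_mul (h x) (h' x), map_add, map_smul]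

lemma smoothGrad_comp (i : H →L[ℝ] W) {Φ : W → ℝ} {θ : ℝ → ℝ} (h : Differentiable ℝ Φ)
    (hθ : Differentiable ℝ θ) (x : W) :
    smoothGrad i (fun x => θ (Φ x)) x = deriv θ (Φ x) • smoothGrad i Φ x := by
  have : HasFDerivAt (fun x => θ (Φ x)) (deriv θ (Φ x) • fderiv ℝ Φ x) x :=
    (hθ (Φ x)).hasDerivAt.comp_hasFDerivAt x (h x).hasFDerivAt
  simp only [smoothGrad_eq, this.fderiv, map_smul]

/-- The gradient of a smooth functional is a smooth field. -/
lemma IsSmoothFunctional.exists_fderiv_eq {Φ : W → ℝ} (h : IsSmoothFunctional Φ) :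
    ∃ (n : ℕ) (l : Fin n → StrongDual ℝ W) (φ : Fin n → W → ℝ),
      (∀ j, IsSmoothFunctional (φ j)) ∧ ∀ x, fderiv ℝ Φ x = ∑ j, φ j x • l j := by
  obtain ⟨n, l, φ, hφ, rfl⟩ := h
  have hφ' : CbSmooth φ := hφ
  refine ⟨n, l, fun j x => fderiv ℝ φ (fun k => l k x) (Pi.single j 1), fun j => ?_, fun x => ?_⟩
  · exact ⟨n, l, fun v => fderiv ℝ φ v (Pi.single j 1), hφ'.fderiv_apply _, rfl⟩
  · have h1 : HasFDerivAt (fun x => φ (fun k => l k x))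
        ((fderiv ℝ φ (fun k => l k x)).comp (ContinuousLinearMap.pi l)) x :=
      (hφ'.differentiable _).hasFDerivAt.comp x (ContinuousLinearMap.pi l).hasFDerivAt
    rw [h1.fderiv]
    ext w
    simp only [ContinuousLinearMap.comp_apply, sum_apply,
      smul_apply, smul_eq_mul]
    have h2 : (ContinuousLinearMap.pi l) w = ∑ j, (l j w) • (Pi.single j (1 : ℝ) : Fin n → ℝ) := by
      rw [← pi_eq_sum_univ']
      ext j
      simp
    rw [h2, map_sum]
    simp [mul_comm]

lemma IsSmoothFunctional.isSmoothField_smoothGrad (i : H →L[ℝ] W) {Φ : W → ℝ}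
    (h : IsSmoothFunctional Φ) : IsSmoothField (smoothGrad i Φ) := by
  obtain ⟨n, l, φ, hφ, he⟩ := h.exists_fderiv_eq
  refine ⟨n, φ, fun j => dualEmb i (l j), hφ, ?_⟩
  funext x
  simp only [smoothGrad_eq, he, map_sum, map_smul]
  rfl

lemma IsSmoothField.cbSmooth {F : W → H} (h : IsSmoothField F) : CbSmooth F := by
  obtain ⟨m, Φ, k, hΦ, rfl⟩ := h
  have : ∀ s : Finset (Fin m), CbSmooth (fun ω => ∑ j ∈ s, Φ j ω • k j) := by
    classical
    intro s
    induction s using Finset.induction_on with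
    | empty => simpa using CbSmooth.const (E := W) (0 : H)
    | insert a s ha ih =>
      simp only [Finset.sum_insert ha]
      exact ((hΦ a).cbSmooth.clm_comp ((ContinuousLinearMap.id ℝ ℝ).smulRight (k a))).add ih
  exact this Finset.univ

lemma IsSmoothField.add {F G : W → H} (hF : IsSmoothField F) (hG : IsSmoothField G) :
    IsSmoothField (fun x => F x + G x) := by
  obtain ⟨m, Φ, k, hΦ, rfl⟩ := hF
  obtain ⟨n, Ψ, l, hΨ, rfl⟩ := hG
  refine ⟨m + n, Fin.append Φ Ψ, Fin.append k l, fun j => ?_, ?_⟩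
  · refine Fin.addCases (fun j => ?_) (fun j => ?_) j <;> simp [hΦ, hΨ]
  · funext x
    simp [Fin.sum_univ_add]

lemma IsSmoothField.const_smul {F : W → H} (hF : IsSmoothField F) (c : ℝ) :
    IsSmoothField (fun x => c • F x) := by
  obtain ⟨m, Φ, k, hΦ, rfl⟩ := hF
  exact ⟨m, fun j x => c * Φ j x, k, fun j => (hΦ j).const_mul c, by
    funext x; simp [Finset.smul_sum, mul_smul]⟩

lemma IsSmoothField.const (h : H) : IsSmoothField (fun _ : W => h) :=
  ⟨1, fun _ _ => 1, fun _ => h, fun _ => IsSmoothFunctional.const 1, by simp⟩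

lemma IsSmoothField.inner {F : W → H} (hF : IsSmoothField F) (h : H) :
    IsSmoothFunctional (fun x => ⟪F x, h⟫_ℝ) := by
  obtain ⟨m, Φ, k, hΦ, rfl⟩ := hF
  simp only [sum_inner, real_inner_smul_left]
  exact IsSmoothFunctional.sum _ fun j _ => by simpa [mul_comm] using (hΦ j).const_mul ⟪k j, h⟫_ℝ

end Gradient

/-! ### Convergence in L^p -/

section Convergence

variable {Ω E : Type*} [MeasurableSpace Ω] {P : Measure Ω} [NormedAddCommGroup E]

/-- Dominated convergence for the integral of `‖f‖ ^ p`, followed by the root. Filters other than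
`atTop` are allowed because limits in the time variable are taken too. -/
lemma tendsto_eLpNorm_zero_of_dominated {ι : Type*} {l : Filter ι} [l.IsCountablyGenerated]
    {p : ℝ≥0∞} (hp : p ≠ 0) (hp' : p ≠ ∞) {f : ι → Ω → E} {G : Ω → ℝ}
    (hf : ∀ᶠ n in l, AEStronglyMeasurable (f n) P) (hG : MemLp G p P)
    (hb : ∀ᶠ n in l, ∀ᵐ x ∂P, ‖f n x‖ ≤ G x)
    (hl : ∀ᵐ x ∂P, Tendsto (fun n => f n x) l (𝓝 0)) :
    Tendsto (fun n => eLpNorm (f n) p P) l (𝓝 0) := by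
  have hpos : 0 < p.toReal := ENNReal.toReal_pos hp hp'
  have h1 : Tendsto (fun n => ∫⁻ x, ‖f n x‖ₑ ^ p.toReal ∂P) l (𝓝 (∫⁻ _, 0 ∂P)) := by
    refine tendsto_lintegral_filter_of_dominated_convergence' (fun x => ‖G x‖ₑ ^ p.toReal) ?_ ?_ ?_ ?_
    · filter_upwards [hf] with n hn
      exact hn.enorm.pow_const _
    · filter_upwards [hb] with n hn
      filter_upwards [hn] with x hx
      gcongr
      rw [← ofReal_norm, ← ofReal_norm]
      exact ENNReal.ofReal_le_ofReal (hx.trans (le_abs_self _))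
    · exact ((lintegral_rpow_enorm_lt_top_of_eLpNorm_lt_top hp hp' hG.2)).ne
    · filter_upwards [hl] with x hx
      have h2 : Tendsto (fun n => ‖f n x‖ₑ) l (𝓝 0) := by
        simpa [Function.comp_def] using (continuous_enorm.tendsto (0 : E)).comp hx
      have h3 := ((ENNReal.continuous_rpow_const (y := p.toReal)).tendsto 0).comp h2
      rw [ENNReal.zero_rpow_of_pos hpos] at h3
      exact h3
  simp only [lintegral_zero] at h1
  have h4 := ((ENNReal.continuous_rpow_const (y := 1 / p.toReal)).tendsto 0).comp h1
  rw [ENNReal.zero_rpow_of_pos (by positivity)] at h4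
  refine h4.congr fun n => ?_
  rw [eLpNorm_eq_lintegral_rpow_enorm_toReal hp hp']
  rfl

lemma tendsto_eLpNorm_zero_of_bounded [IsFiniteMeasure P] {ι : Type*} {l : Filter ι}
    [l.IsCountablyGenerated]
    {p : ℝ≥0∞} (hp : p ≠ 0) (hp' : p ≠ ∞) {f : ι → Ω → E} {C : ℝ}
    (hf : ∀ᶠ n in l, AEStronglyMeasurable (f n) P)
    (hb : ∀ᶠ n in l, ∀ᵐ x ∂P, ‖f n x‖ ≤ C)
    (hl : ∀ᵐ x ∂P, Tendsto (fun n => f n x) l (𝓝 0)) :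
    Tendsto (fun n => eLpNorm (f n) p P) l (𝓝 0) :=
  tendsto_eLpNorm_zero_of_dominated hp hp' hf (memLp_const C) hb hl

lemma exists_subseq_tendsto_ae {p : ℝ≥0∞} (hp : p ≠ 0) {f : ℕ → Ω → E} {g : Ω → E}
    (hf : ∀ n, AEStronglyMeasurable (f n) P) (hg : AEStronglyMeasurable g P)
    (h : Tendsto (fun n => eLpNorm (fun x => f n x - g x) p P) atTop (𝓝 0)) :
    ∃ ns : ℕ → ℕ, StrictMono ns ∧ ∀ᵐ x ∂P, Tendsto (fun k => f (ns k) x) atTop (𝓝 (g x)) :=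
  (tendstoInMeasure_of_tendsto_eLpNorm hp hf hg h).exists_seq_tendsto_ae

lemma tendsto_integral_of_eLpNorm [NormedSpace ℝ E] {ι : Type*} {l : Filter ι} {f : ι → Ω → E}
    {g : Ω → E} (hf : ∀ᶠ n in l, Integrable (f n) P) (hg : Integrable g P)
    (h : Tendsto (fun n => eLpNorm (fun x => f n x - g x) 1 P) l (𝓝 0)) :
    Tendsto (fun n => ∫ x, f n x ∂P) l (𝓝 (∫ x, g x ∂P)) :=
  tendsto_integral_of_L1' g hg.1 hf h

lemma integral_comp_of_measurePreserving [NormedSpace ℝ E] {Ω' : Type*} [MeasurableSpace Ω']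
    {Q : Measure Ω'} {τ : Ω → Ω'} (hτ : MeasurePreserving τ P Q) {g : Ω' → E}
    (hg : AEStronglyMeasurable g Q) : ∫ x, g (τ x) ∂P = ∫ y, g y ∂Q := by
  rw [← hτ.map_eq] at hg ⊢
  exact (integral_map hτ.aemeasurable hg).symm

lemma eLpNorm_one_mul_le {f g : Ω → ℝ} {C : ℝ} (hf : ∀ᵐ x ∂P, ‖f x‖ ≤ C) :
    eLpNorm (fun x => f x * g x) 1 P ≤ ENNReal.ofReal C * eLpNorm g 1 P := by
  have := eLpNorm_le_mul_eLpNorm_of_ae_le_mul (μ := P) (f := fun x => f x * g x) (g := g) (c := C)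
    (by filter_upwards [hf] with x hx; rw [norm_mul]; gcongr) 1
  exact this

end Convergence

/-! ### Gaussian measure: orthogonal invariance and integration by parts -/

section Gaussian

variable {W H : Type*} [NormedAddCommGroup W] [NormedSpace ℝ W] [CompleteSpace W]
    [TopologicalSpace.SeparableSpace W] [MeasurableSpace W] [BorelSpace W]
    [NormedAddCommGroup H] [InnerProductSpace ℝ H] [CompleteSpace H]
    {i : H →L[ℝ] W} {μ : Measure W}

lemma IsAbstractWienerSpace.isGaussian (hμ : IsAbstractWienerSpace i μ) : IsGaussian μ :=
  isGaussian_of_map_eq_gaussianReal fun L => ⟨_, _, hμ.gaussian L⟩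

lemma IsAbstractWienerSpace.isProbabilityMeasure (hμ : IsAbstractWienerSpace i μ) :
    IsProbabilityMeasure μ := by
  have := hμ.isGaussian
  infer_instance

lemma IsAbstractWienerSpace.charFunDual (hμ : IsAbstractWienerSpace i μ) (l : StrongDual ℝ W) :
    charFunDual μ l = Complex.exp (-(‖dualEmb i l‖ ^ 2 / 2 : ℝ)) := by
  rw [charFunDual_eq_charFun_map_one, hμ.gaussian, charFun_gaussianReal]
  congr 1
  simp

lemma IsAbstractWienerSpace.memLp_dual (hμ : IsAbstractWienerSpace i μ) (l : StrongDual ℝ W)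
    {p : ℝ≥0∞} (hp : p ≠ ∞) : MemLp l p μ := by
  have := hμ.isGaussian
  exact IsGaussian.memLp_dual μ l p hp

lemma IsAbstractWienerSpace.integrable_dual (hμ : IsAbstractWienerSpace i μ)
    (l : StrongDual ℝ W) : Integrable l μ :=
  memLp_one_iff_integrable.1 (hμ.memLp_dual l (by simp))

lemma IsAbstractWienerSpace.integral_sq (hμ : IsAbstractWienerSpace i μ) (l : StrongDual ℝ W) :
    ∫ x, l x ^ 2 ∂μ = ‖dualEmb i l‖ ^ 2 := by
  have h1 : ∫ x, l x ^ 2 ∂μ = ∫ y, y ^ 2 ∂(μ.map l) := by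
    rw [integral_map l.continuous.aemeasurable (by fun_prop)]
  rw [h1, hμ.gaussian]
  have h2 := variance_fun_id_gaussianReal (μ := 0) (v := ‖dualEmb i l‖₊ ^ 2)
  rw [variance_eq_integral (by fun_prop)] at h2
  have h3 := integral_id_gaussianReal (μ := 0) (v := ‖dualEmb i l‖₊ ^ 2)
  simp only [h3, sub_zero] at h2
  rw [h2]
  simp

/-- Orthogonal transformations of `W × W` preserve `μ ⊗ μ`. -/
lemma IsAbstractWienerSpace.measurePreserving_pair (hμ : IsAbstractWienerSpace i μ)
    (C D C' D' : W →L[ℝ] W)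
    (h : ∀ l l' : StrongDual ℝ W,
      ‖dualEmb i (l.comp C + l'.comp C')‖ ^ 2 + ‖dualEmb i (l.comp D + l'.comp D')‖ ^ 2 =
        ‖dualEmb i l‖ ^ 2 + ‖dualEmb i l'‖ ^ 2) :
    MeasurePreserving (fun x : W × W => (C x.1 + D x.2, C' x.1 + D' x.2)) (μ.prod μ)
      (μ.prod μ) := by
  have := hμ.isProbabilityMeasure
  have := UniformSpace.secondCountable_of_separable W
  let R : W × W →L[ℝ] W × W := (C.coprod D).prod (C'.coprod D')
  have hR : (fun x : W × W => (C x.1 + D x.2, C' x.1 + D' x.2)) = R := by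
    funext x
    simp [R]
  refine ⟨by fun_prop, ?_⟩
  have : IsProbabilityMeasure ((μ.prod μ).map R) :=
    Measure.isProbabilityMeasure_map R.continuous.aemeasurable
  rw [hR]
  -- A finite measure is determined by its characteristic functional. For `μ ⊗ μ` this is the
  -- exponential of minus one half of the quadratic form that the hypothesis declares invariant.
  refine Measure.ext_of_charFunDual (funext fun L => ?_)
  rw [charFunDual_map, charFunDual_prod, charFunDual_prod, hμ.charFunDual, hμ.charFunDual,
    hμ.charFunDual, hμ.charFunDual, ← Complex.exp_add, ← Complex.exp_add]
  congr 1
  have h1 : (L.comp R).comp (.inl ℝ W W) =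
      (L.comp (.inl ℝ W W)).comp C + (L.comp (.inr ℝ W W)).comp C' := by
    ext x
    simp [R, ← map_add]
  have h2 : (L.comp R).comp (.inr ℝ W W) =
      (L.comp (.inl ℝ W W)).comp D + (L.comp (.inr ℝ W W)).comp D' := by
    ext x
    simp [R, ← map_add]
  rw [h1, h2]
  have h3 := h (L.comp (.inl ℝ W W)) (L.comp (.inr ℝ W W))
  have h4 : ((‖dualEmb i (L.comp (.inl ℝ W W))‖ ^ 2 + ‖dualEmb i (L.comp (.inr ℝ W W))‖ ^ 2 : ℝ)
    : ℂ) = _ := congrArg _ h3.symm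
  push_cast at h4 ⊢
  linear_combination (1 / 2 : ℂ) * h4

lemma IsAbstractWienerSpace.measurePreserving_combo (hμ : IsAbstractWienerSpace i μ)
    (C D C' D' : W →L[ℝ] W)
    (h : ∀ l l' : StrongDual ℝ W,
      ‖dualEmb i (l.comp C + l'.comp C')‖ ^ 2 + ‖dualEmb i (l.comp D + l'.comp D')‖ ^ 2 =
        ‖dualEmb i l‖ ^ 2 + ‖dualEmb i l'‖ ^ 2) :
    MeasurePreserving (fun x : W × W => C x.1 + D x.2) (μ.prod μ) μ := by
  have := hμ.isProbabilityMeasure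
  exact measurePreserving_fst.comp (hμ.measurePreserving_pair C D C' D' h)

lemma norm_dualEmb_rotation (a b : ℝ) (hab : a ^ 2 + b ^ 2 = 1) (l l' : StrongDual ℝ W) :
    ‖dualEmb i (l.comp (a • ContinuousLinearMap.id ℝ W) +
        l'.comp (-b • ContinuousLinearMap.id ℝ W))‖ ^ 2 +
      ‖dualEmb i (l.comp (b • ContinuousLinearMap.id ℝ W) +
        l'.comp (a • ContinuousLinearMap.id ℝ W))‖ ^ 2 =
      ‖dualEmb i l‖ ^ 2 + ‖dualEmb i l'‖ ^ 2 := by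
  have h (c d : ℝ) : dualEmb i (l.comp (c • ContinuousLinearMap.id ℝ W) +
        l'.comp (d • ContinuousLinearMap.id ℝ W)) = c • dualEmb i l + d • dualEmb i l' := by
    simp only [← dualEmbL_apply, map_add, ContinuousLinearMap.comp_smul,
      ContinuousLinearMap.comp_id, map_smul]
  rw [h, h]
  simp only [← real_inner_self_eq_norm_sq, inner_add_left, inner_add_right, real_inner_smul_left,
    real_inner_smul_right, real_inner_comm (dualEmb i l) (dualEmb i l')]
  linear_combination (⟪dualEmb i l, dualEmb i l⟫_ℝ + ⟪dualEmb i l', dualEmb i l'⟫_ℝ) * hab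

lemma IsAbstractWienerSpace.measurePreserving_rotation_pair (hμ : IsAbstractWienerSpace i μ)
    {a b : ℝ} (hab : a ^ 2 + b ^ 2 = 1) :
    MeasurePreserving (fun x : W × W => (a • x.1 + b • x.2, -b • x.1 + a • x.2)) (μ.prod μ)
      (μ.prod μ) := by
  have := hμ.measurePreserving_pair (a • ContinuousLinearMap.id ℝ W)
    (b • ContinuousLinearMap.id ℝ W) (-b • ContinuousLinearMap.id ℝ W)
    (a • ContinuousLinearMap.id ℝ W) (norm_dualEmb_rotation a b hab)
  simpa using this

lemma IsAbstractWienerSpace.measurePreserving_rotation (hμ : IsAbstractWienerSpace i μ)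
    {a b : ℝ} (hab : a ^ 2 + b ^ 2 = 1) :
    MeasurePreserving (fun x : W × W => a • x.1 + b • x.2) (μ.prod μ) μ := by
  have := hμ.isProbabilityMeasure
  exact measurePreserving_fst.comp (hμ.measurePreserving_rotation_pair hab)

/-- Gaussian integration by parts on the line. -/
lemma integral_id_mul_gaussianReal (v : ℝ≥0) {f f' : ℝ → ℝ} {C : ℝ}
    (hf : ∀ x, HasDerivAt f (f' x) x) (hf'c : Continuous f') (hC : ∀ x, ‖f x‖ ≤ C)
    (hC' : ∀ x, ‖f' x‖ ≤ C) :
    ∫ x, x * f x ∂(gaussianReal 0 v) = v * ∫ x, f' x ∂(gaussianReal 0 v) := by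
  rcases eq_or_ne v 0 with rfl | hv
  · simp [gaussianReal_zero_var]
  have hv' : (v : ℝ) ≠ 0 := by exact_mod_cast hv
  have hfc : Continuous f := continuous_iff_continuousAt.2 fun x => (hf x).continuousAt
  -- The density solves `ρ' = -(x / v) ρ`, so the claim is ordinary integration by parts against
  -- `ρ`.
  have hd : ∀ x, HasDerivAt (gaussianPDFReal 0 v) (-(x / v) * gaussianPDFReal 0 v x) x := by
    intro x
    have h1 : HasDerivAt (fun x : ℝ => -(x - 0) ^ 2 / (2 * v)) (-(x / v)) x := by
      have := ((((hasDerivAt_id x).sub_const 0).pow 2).neg.div_const (2 * (v : ℝ))).congr_deriv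
        (g' := -(x / v)) (by simp; field_simp)
      exact this
    have h2 := ((h1.exp).const_mul (Real.sqrt (2 * Real.pi * v))⁻¹).congr_deriv
      (g' := -(x / v) * gaussianPDFReal 0 v x) (by rw [gaussianPDFReal_def]; ring)
    rw [gaussianPDFReal_def] at h2 ⊢
    exact h2
  have hint : Integrable (gaussianPDFReal 0 v) := integrable_gaussianPDFReal 0 v
  have hxint : Integrable (fun x => x * gaussianPDFReal 0 v x) := by
    have h1 : Integrable (fun x : ℝ => x) (gaussianReal 0 v) :=
      memLp_one_iff_integrable.1 (memLp_id_gaussianReal' 1 (by simp))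
    rw [gaussianReal_of_var_ne_zero _ hv, integrable_withDensity_iff_integrable_smul'
      (measurable_gaussianPDF _ _) (ae_of_all _ fun _ => gaussianPDF_lt_top)] at h1
    refine h1.congr (ae_of_all _ fun x => ?_)
    simp [mul_comm]
  have key := integral_mul_deriv_eq_deriv_mul_of_integrable (u := f) (u' := f')
    (v := gaussianPDFReal 0 v) (v' := fun x => -(x / v) * gaussianPDFReal 0 v x)
    (fun x _ => hf x) (fun x _ => hd x) ?_ ?_ ?_
  · rw [integral_gaussianReal_eq_integral_smul hv, integral_gaussianReal_eq_integral_smul hv]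
    simp only [smul_eq_mul]
    have h3 : ∫ x, gaussianPDFReal 0 v x * (x * f x) =
        -(v : ℝ) * ∫ x, f x * (-(x / v) * gaussianPDFReal 0 v x) := by
      rw [← integral_const_mul]
      congr 1
      funext x
      field_simp
    rw [h3, key]
    simp only [neg_mul, mul_neg, neg_neg]
    congr 2
    funext x
    ring
  · have : Integrable (fun x => f x * (x * gaussianPDFReal 0 v x)) :=
      hxint.bdd_mul hfc.aestronglyMeasurable (ae_of_all _ hC)
    refine (this.const_mul (-(v : ℝ)⁻¹)).congr (ae_of_all _ fun x => ?_)
    simp only [Pi.mul_apply]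
    field_simp
  · exact hint.bdd_mul hf'c.aestronglyMeasurable (ae_of_all _ hC')
  · exact hint.bdd_mul hfc.aestronglyMeasurable (ae_of_all _ hC)

/-- Gaussian integration by parts. -/
lemma IsAbstractWienerSpace.integral_mul_eq (hμ : IsAbstractWienerSpace i μ)
    (l : StrongDual ℝ W) {g : W → ℝ} (hg : CbSmooth g) :
    ∫ x, l x * g x ∂μ = ∫ x, fderiv ℝ g x (i (dualEmb i l)) ∂μ := by
  have := hμ.isProbabilityMeasure
  have := UniformSpace.secondCountable_of_separable W
  obtain ⟨C, hC⟩ := hg.exists_bound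
  obtain ⟨C', hC'⟩ := hg.exists_fderiv_bound
  set h := dualEmb i l with hh
  -- A functional of variance zero vanishes almost everywhere and the direction of differentiation
  -- is zero, so both sides vanish.
  by_cases h0 : h = 0
  · have h1 : ∫ x, l x ^ 2 ∂μ = 0 := by rw [hμ.integral_sq, ← hh, h0]; simp
    have h2 : (fun x => l x ^ 2) =ᵐ[μ] 0 :=
      (integral_eq_zero_iff_of_nonneg (fun x => sq_nonneg _)
        ((hμ.memLp_dual l (p := 2) (by simp)).integrable_sq)).1 h1
    have h3 : (fun x => l x * g x) =ᵐ[μ] 0 := by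
      filter_upwards [h2] with x hx
      have : l x = 0 := by simpa using hx
      simp [this]
    rw [integral_congr_ae h3, h0]
    simp
  · set s : ℝ := ‖h‖ ^ 2 with hs
    have hs0 : s ≠ 0 := by positivity
    have hli : l (i h) = s := by rw [← dualEmb_inner, ← hh, real_inner_self_eq_norm_sq]
    -- `D` projects onto the line of `i h` along the kernel of `l`. Replacing the `D`-component of
    -- `x` by that of an independent `y` does not change the law, and for fixed `x` the claim
    -- reduces to the one-dimensional identity in the Gaussian variable `l y`.
    let D : W →L[ℝ] W := s⁻¹ • l.smulRight (i h)
    let C₀ : W →L[ℝ] W := ContinuousLinearMap.id ℝ W - D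
    have hD : ∀ m : StrongDual ℝ W, dualEmb i (m.comp D) = (s⁻¹ * ⟪dualEmb i m, h⟫_ℝ) • h := by
      intro m
      have : m.comp D = (s⁻¹ * ⟪dualEmb i m, h⟫_ℝ) • l := by
        ext x
        simp [D, dualEmb_inner]
        ring
      rw [this, ← dualEmbL_apply, map_smul, dualEmbL_apply]
    have hC0 : ∀ m : StrongDual ℝ W, dualEmb i (m.comp C₀) =
        dualEmb i m - (s⁻¹ * ⟪dualEmb i m, h⟫_ℝ) • h := by
      intro m
      have : m.comp C₀ = m - m.comp D := by
        ext x
        simp [C₀]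
      rw [this, ← hD, ← dualEmbL_apply, map_sub]
      rfl
    have hpres := hμ.measurePreserving_combo C₀ D D C₀ (by
      intro m m'
      have e1 : dualEmb i (m.comp C₀ + m'.comp D) = dualEmb i (m.comp C₀) +
        dualEmb i (m'.comp D) := (dualEmbL i).map_add _ _
      have e2 : dualEmb i (m.comp D + m'.comp C₀) = dualEmb i (m.comp D) +
        dualEmb i (m'.comp C₀) := (dualEmbL i).map_add _ _
      rw [e1, e2, hC0, hC0, hD, hD]
      simp only [← real_inner_self_eq_norm_sq, inner_add_left, inner_add_right, inner_sub_left,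
        inner_sub_right, real_inner_smul_left, real_inner_smul_right,
        real_inner_comm h (dualEmb i m), real_inner_comm h (dualEmb i m')]
      have e3 : ⟪h, h⟫_ℝ = s := real_inner_self_eq_norm_sq h
      rw [e3]
      field_simp
      ring)
    have hlR : ∀ x : W × W, l (C₀ x.1 + D x.2) = l x.2 := by
      intro x
      simp [C₀, D, hli]
      field_simp
      ring
    have hgc := hg.continuous
    have hint : Integrable (fun x => l x * g x) μ :=
      (hμ.integrable_dual l).mul_bdd hgc.aestronglyMeasurable (ae_of_all _ hC)
    have hintd : Integrable (fun x => fderiv ℝ g x (i h)) μ :=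
      Integrable.of_bound ((hg.fderiv_apply (i h)).continuous.aestronglyMeasurable)
        (C' * ‖i h‖) (ae_of_all _ fun x => ((fderiv ℝ g x).le_opNorm _).trans
          (mul_le_mul_of_nonneg_right (hC' x) (norm_nonneg _)))
    rw [← integral_comp_of_measurePreserving hpres hint.1,
      ← integral_comp_of_measurePreserving hpres hintd.1]
    have hp1 := integral_prod _ (hpres.integrable_comp_of_integrable hint)
    have hp2 := integral_prod _ (hpres.integrable_comp_of_integrable hintd)
    simp only [Function.comp_apply] at hp1 hp2
    rw [hp1, hp2]
    congr 1
    funext x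
    have hDy : ∀ y, D y = (s⁻¹ * l y) • i h := fun y => by simp [D, smul_smul]
    have hder : ∀ t : ℝ, HasDerivAt (fun t : ℝ => g (C₀ x + (s⁻¹ * t) • i h))
        (s⁻¹ * fderiv ℝ g (C₀ x + (s⁻¹ * t) • i h) (i h)) t := by
      intro t
      have h1 : HasDerivAt (fun t : ℝ => C₀ x + (s⁻¹ * t) • i h) (s⁻¹ • i h) t := by
        have := ((((hasDerivAt_id t).const_mul s⁻¹).smul_const (i h)).const_add (C₀ x))
        simpa using this
      have h2 := (hg.differentiable (C₀ x + (s⁻¹ * t) • i h)).hasFDerivAt.comp_hasDerivAt t h1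
      simpa [Function.comp_def] using h2
    have hcont : Continuous fun t : ℝ => C₀ x + (s⁻¹ * t) • i h := by fun_prop
    have hcd : Continuous fun t : ℝ => s⁻¹ * fderiv ℝ g (C₀ x + (s⁻¹ * t) • i h) (i h) :=
      ((hg.fderiv_apply (i h)).continuous.comp hcont).const_mul _
    have key := integral_id_mul_gaussianReal (‖h‖₊ ^ 2) hder
      hcd (C := max C (|s⁻¹| * (C' * ‖i h‖)))
      (fun t => (hC _).trans (le_max_left _ _)) (fun t => by
        refine le_trans ?_ (le_max_right _ _)
        rw [norm_mul, Real.norm_eq_abs]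
        refine mul_le_mul_of_nonneg_left ?_ (abs_nonneg _)
        exact ((fderiv ℝ g _).le_opNorm _).trans
          (mul_le_mul_of_nonneg_right (hC' _) (norm_nonneg _)))
    have hcg : Continuous fun t : ℝ => t * g (C₀ x + (s⁻¹ * t) • i h) :=
      continuous_id.mul (hg.continuous.comp hcont)
    rw [← hμ.gaussian l, integral_map l.continuous.aemeasurable hcg.aestronglyMeasurable,
      integral_map l.continuous.aemeasurable hcd.aestronglyMeasurable, ← integral_const_mul] at key
    have hv : ((‖h‖₊ ^ 2 : ℝ≥0) : ℝ) = s := by simp [hs]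
    rw [hv] at key
    calc ∫ y, l (C₀ x + D y) * g (C₀ x + D y) ∂μ
        = ∫ y, l y * g (C₀ x + (s⁻¹ * l y) • i h) ∂μ := by
          congr 1
          funext y
          rw [hlR (x, y), hDy]
      _ = _ := key
      _ = _ := by
          congr 1
          funext y
          rw [hDy]
          field_simp

end Gaussian

/-! ### Density of 𝒮 and tests for convergence -/

section Density

variable {W H : Type*} [NormedAddCommGroup W] [NormedSpace ℝ W] [CompleteSpace W]
    [TopologicalSpace.SeparableSpace W] [MeasurableSpace W] [BorelSpace W]
    [NormedAddCommGroup H] [InnerProductSpace ℝ H] [CompleteSpace H]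
    {μ : Measure W}

lemma IsSmoothFunctional.aestronglyMeasurable {Φ : W → ℝ} (h : IsSmoothFunctional Φ) :
    AEStronglyMeasurable Φ μ := by
  have := UniformSpace.secondCountable_of_separable W
  exact h.continuous.aestronglyMeasurable

lemma IsSmoothFunctional.memLp [IsFiniteMeasure μ] {Φ : W → ℝ} (h : IsSmoothFunctional Φ)
    (p : ℝ≥0∞) : MemLp Φ p μ := by
  obtain ⟨C, hC⟩ := h.exists_bound
  exact MemLp.of_bound h.aestronglyMeasurable C (ae_of_all _ hC)

lemma IsSmoothFunctional.integrable [IsFiniteMeasure μ] {Φ : W → ℝ} (h : IsSmoothFunctional Φ) :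
    Integrable Φ μ := memLp_one_iff_integrable.1 (h.memLp 1)

lemma integrable_smooth_mul {Φ g : W → ℝ} (h : IsSmoothFunctional Φ) (hg : Integrable g μ) :
    Integrable (fun x => Φ x * g x) μ := by
  obtain ⟨C, hC⟩ := h.exists_bound
  exact hg.bdd_mul h.aestronglyMeasurable (ae_of_all _ hC)

/-- An integrable function which is orthogonal to all smooth functionals vanishes. -/
lemma ae_eq_zero_of_forall_integral_smooth [IsFiniteMeasure μ] {g : W → ℝ} (hg : Integrable g μ)
    (h : ∀ Φ : W → ℝ, IsSmoothFunctional Φ → ∫ x, Φ x * g x ∂μ = 0) : g =ᵐ[μ] 0 := by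
  have := UniformSpace.secondCountable_of_separable W
  -- The positive and negative parts of `g` are densities of two finite measures. The functions `cos
  -- l` and `sin l` belong to 𝒮, so testing `g` on them shows that these measures have the same
  -- characteristic functional.
  let a : W → ℝ≥0∞ := fun x => ENNReal.ofReal (g x)
  let b : W → ℝ≥0∞ := fun x => ENNReal.ofReal (-g x)
  have ha : AEMeasurable a μ := hg.1.aemeasurable.ennreal_ofReal
  have hb : AEMeasurable b μ := hg.1.aemeasurable.neg.ennreal_ofReal
  have hai : ∫⁻ x, a x ∂μ ≠ ∞ := (hg.lintegral_lt_top).ne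
  have hbi : ∫⁻ x, b x ∂μ ≠ ∞ := (hg.neg.lintegral_lt_top).ne
  have : IsFiniteMeasure (μ.withDensity a) := isFiniteMeasure_withDensity hai
  have : IsFiniteMeasure (μ.withDensity b) := isFiniteMeasure_withDensity hbi
  have key : μ.withDensity a = μ.withDensity b := by
    refine Measure.ext_of_charFunDual (funext fun l => ?_)
    rw [charFunDual_apply, charFunDual_apply,
      integral_withDensity_eq_integral_toReal_smul₀ ha (ae_of_all _ fun _ => ENNReal.ofReal_lt_top),
      integral_withDensity_eq_integral_toReal_smul₀ hb (ae_of_all _ fun _ => ENNReal.ofReal_lt_top),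
      ← sub_eq_zero]
    have hce : Continuous fun x : W => Complex.exp (l x * Complex.I) := by fun_prop
    have hbe : ∀ x : W, ‖Complex.exp (l x * Complex.I)‖ ≤ 1 := fun x =>
      (Complex.norm_exp_ofReal_mul_I _).le
    have hi1 : Integrable (fun x => (a x).toReal • Complex.exp (l x * Complex.I)) μ := by
      have : Integrable (fun x => (a x).toReal) μ := integrable_toReal_of_lintegral_ne_top ha hai
      exact this.smul_bdd 1 hce.aestronglyMeasurable (ae_of_all _ hbe)
    have hi2 : Integrable (fun x => (b x).toReal • Complex.exp (l x * Complex.I)) μ := by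
      have : Integrable (fun x => (b x).toReal) μ := integrable_toReal_of_lintegral_ne_top hb hbi
      exact this.smul_bdd 1 hce.aestronglyMeasurable (ae_of_all _ hbe)
    rw [← integral_sub hi1 hi2]
    have e1 : ∀ x, (a x).toReal • Complex.exp (l x * Complex.I) -
        (b x).toReal • Complex.exp (l x * Complex.I) =
        ((Real.cos (l x) * g x : ℝ) : ℂ) + ((Real.sin (l x) * g x : ℝ) : ℂ) * Complex.I := by
      intro x
      have : (a x).toReal - (b x).toReal = g x := by
        simp only [a, b, ENNReal.toReal_ofReal']
        rcases le_total 0 (g x) with h0 | h0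
        · rw [max_eq_left h0, max_eq_right (by linarith)]; ring
        · rw [max_eq_right h0, max_eq_left (by linarith)]; ring
      rw [← sub_smul, this, Complex.exp_mul_I, Complex.real_smul]
      push_cast
      ring
    have hs1 := IsSmoothFunctional.of_linear CbSmooth.cos l
    have hs2 := IsSmoothFunctional.of_linear CbSmooth.sin l
    simp only [e1]
    rw [integral_add (integrable_smooth_mul hs1 hg).ofReal
      ((integrable_smooth_mul hs2 hg).ofReal.mul_const _), integral_mul_const,
      integral_complex_ofReal, integral_complex_ofReal, h _ hs1, h _ hs2]
    simp
  have h2 := (withDensity_eq_iff ha hb hai).1 key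
  filter_upwards [h2] with x hx
  simp only [a, b] at hx
  rcases le_total 0 (g x) with h0 | h0
  · rw [ENNReal.ofReal_of_nonpos (by linarith : -g x ≤ 0), ENNReal.ofReal_eq_zero] at hx
    exact le_antisymm hx h0
  · rw [ENNReal.ofReal_of_nonpos h0] at hx
    have := ENNReal.ofReal_eq_zero.1 hx.symm
    have h1 : 0 ≤ g x := by linarith
    exact le_antisymm h0 h1

lemma ae_eq_of_forall_integral_smooth [IsFiniteMeasure μ] {f g : W → ℝ} (hf : Integrable f μ)
    (hg : Integrable g μ)
    (h : ∀ Φ : W → ℝ, IsSmoothFunctional Φ → ∫ x, Φ x * f x ∂μ = ∫ x, Φ x * g x ∂μ) :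
    f =ᵐ[μ] g := by
  have := ae_eq_zero_of_forall_integral_smooth (hf.sub hg) fun Φ hΦ => by
    simp only [Pi.sub_apply, mul_sub]
    rw [integral_sub (integrable_smooth_mul hΦ hf) (integrable_smooth_mul hΦ hg), h Φ hΦ, sub_self]
  filter_upwards [this] with x hx
  simpa [sub_eq_zero] using hx

/-- Smooth functionals are dense in `L²`. -/
lemma exists_smooth_tendsto_eLpNorm_two [IsFiniteMeasure μ] {f : W → ℝ} (hf : MemLp f 2 μ) :
    ∃ Φ : ℕ → W → ℝ, (∀ n, IsSmoothFunctional (Φ n)) ∧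
      Tendsto (fun n => eLpNorm (fun x => Φ n x - f x) 2 μ) atTop (𝓝 0) := by
  let K : Submodule ℝ (Lp ℝ 2 μ) :=
    { carrier := {g | ∃ Φ : W → ℝ, IsSmoothFunctional Φ ∧ g =ᵐ[μ] Φ}
      add_mem' := by
        rintro a b ⟨Φ, hΦ, ha⟩ ⟨Ψ, hΨ, hb⟩
        refine ⟨_, hΦ.add hΨ, ?_⟩
        filter_upwards [Lp.coeFn_add a b, ha, hb] with x h1 h2 h3
        rw [h1, Pi.add_apply, h2, h3]
      zero_mem' := ⟨_, IsSmoothFunctional.const 0, Lp.coeFn_zero _ _ _⟩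
      smul_mem' := by
        rintro c a ⟨Φ, hΦ, ha⟩
        refine ⟨_, hΦ.const_mul c, ?_⟩
        filter_upwards [Lp.coeFn_smul c a, ha] with x h1 h2
        rw [h1, Pi.smul_apply, h2, smul_eq_mul] }
  -- Density in a Hilbert space: whatever is orthogonal to all smooth functionals vanishes by
  -- `ae_eq_zero_of_forall_integral_smooth`.
  have hK : K.topologicalClosure = ⊤ := by
    rw [Submodule.topologicalClosure_eq_top_iff, Submodule.eq_bot_iff]
    intro g hg
    rw [Submodule.mem_orthogonal] at hg
    have h1 : (g : W → ℝ) =ᵐ[μ] 0 := by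
      refine ae_eq_zero_of_forall_integral_smooth
        (memLp_one_iff_integrable.1 ((Lp.memLp g).mono_exponent (by norm_num))) fun Φ hΦ => ?_
      have h2 := hg ((hΦ.memLp 2).toLp Φ) ⟨Φ, hΦ, MemLp.coeFn_toLp _⟩
      rw [L2.inner_def] at h2
      rw [← h2]
      refine integral_congr_ae ?_
      filter_upwards [(hΦ.memLp (μ := μ) 2).coeFn_toLp] with x hx
      rw [hx]
      simp [mul_comm]
    exact (Lp.eq_zero_iff_ae_eq_zero).2 h1
  have hmem : hf.toLp f ∈ closure (K : Set (Lp ℝ 2 μ)) := by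
    rw [← Submodule.topologicalClosure_coe, hK]
    trivial
  obtain ⟨u, hu, hlim⟩ := mem_closure_iff_seq_limit.1 hmem
  choose Φ hΦ hae using hu
  refine ⟨Φ, hΦ, ?_⟩
  have h3 := (Lp.tendsto_Lp_iff_tendsto_eLpNorm' _ _).1 hlim
  refine h3.congr fun n => eLpNorm_congr_ae ?_
  filter_upwards [hae n, hf.coeFn_toLp] with x h1 h2
  rw [Pi.sub_apply, h1, h2]

/-- Bounded functions are limits of uniformly bounded sequences of smooth functionals. -/
lemma exists_smooth_bounded_tendsto_ae [IsFiniteMeasure μ] {f : W → ℝ}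
    (hf : AEStronglyMeasurable f μ) {R : ℝ} (hR : ∀ᵐ x ∂μ, |f x| ≤ R) :
    ∃ (Φ : ℕ → W → ℝ) (C : ℝ), (∀ n, IsSmoothFunctional (Φ n)) ∧ (∀ n x, ‖Φ n x‖ ≤ C) ∧
      ∀ᵐ x ∂μ, Tendsto (fun n => Φ n x) atTop (𝓝 (f x)) := by
  obtain ⟨Φ, hΦ, hlim⟩ := exists_smooth_tendsto_eLpNorm_two (MemLp.of_bound hf R hR)
  obtain ⟨ns, hns, hae⟩ := exists_subseq_tendsto_ae (by norm_num)
    (fun n => (hΦ n).aestronglyMeasurable) hf hlim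
  -- Composition with a truncation fixing `[-R, R]` bounds the sequence uniformly and does not alter
  -- its limit.
  obtain ⟨θ, hθ, hθR⟩ := exists_smooth_truncation R
  obtain ⟨C, hC⟩ := hθ.exists_bound
  refine ⟨fun n x => θ (Φ (ns n) x), C, fun n => (hΦ _).comp hθ, fun n x => hC _, ?_⟩
  filter_upwards [hae, hR] with x hx hx'
  have := (hθ.continuous.tendsto (f x)).comp hx
  rwa [(hθR _ hx').1] at this

/-- Convergence of measure preserving maps can be tested on smooth functionals. -/
lemma tendsto_eLpNorm_comp_sub [IsFiniteMeasure μ] {Ω E ι : Type*} [MeasurableSpace Ω]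
    {P : Measure Ω} [NormedAddCommGroup E] [NormedSpace ℝ E] {l : Filter ι} {τ : ι → Ω → W}
    {τ₀ : Ω → W} (hτ : ∀ n, MeasurePreserving (τ n) P μ) (hτ₀ : MeasurePreserving τ₀ P μ)
    (h : ∀ Φ : W → ℝ, IsSmoothFunctional Φ →
      Tendsto (fun n => eLpNorm (fun x => Φ (τ n x) - Φ (τ₀ x)) 1 P) l (𝓝 0))
    {g : W → E} (hg : MemLp g 1 μ) :
    Tendsto (fun n => eLpNorm (fun x => g (τ n x) - g (τ₀ x)) 1 P) l (𝓝 0) := by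
  -- All maps preserve the measure, so `(g - g') ∘ τ n` has the norm of `g - g'` for every `n`: the
  -- property passes to `L¹` limits. It therefore suffices to have it on a dense class, built from
  -- smooth functionals approximating indicators.
  let Good : (W → E) → Prop := fun g => AEStronglyMeasurable g μ ∧
    Tendsto (fun n => eLpNorm (fun x => g (τ n x) - g (τ₀ x)) 1 P) l (𝓝 0)
  have hdense : ∀ {ε : ℝ≥0∞}, ε ≠ 0 → ∃ g' : W → E, eLpNorm (g - g') 1 μ ≤ ε ∧ Good g' := by
    intro ε hε
    refine MemLp.induction_dense (by simp) Good ?_ ?_ (fun f hf => hf.1) hg hε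
    · intro c s hs _ ε hε
      obtain ⟨Φ, C, hΦ, hC, hae⟩ := exists_smooth_bounded_tendsto_ae (μ := μ) (R := 1)
        (f := s.indicator fun _ => (1 : ℝ)) (aestronglyMeasurable_const.indicator hs)
        (ae_of_all _ fun x => by by_cases hx : x ∈ s <;> simp [hx])
      have h1 : Tendsto (fun n => eLpNorm (fun x => Φ n x • c - s.indicator (fun _ => c) x) 1 μ)
          atTop (𝓝 0) := by
        refine tendsto_eLpNorm_zero_of_bounded (C := (C + 1) * ‖c‖) one_ne_zero (by simp)
          (Eventually.of_forall fun n => ((hΦ n).aestronglyMeasurable.smul_const c).sub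
            (aestronglyMeasurable_const.indicator hs)) (Eventually.of_forall fun n =>
              ae_of_all _ fun x => ?_) ?_
        · refine (norm_sub_le _ _).trans ?_
          rw [norm_smul, add_mul]
          refine add_le_add (mul_le_mul_of_nonneg_right (hC n x) (norm_nonneg _)) ?_
          rw [one_mul]
          exact norm_indicator_le_norm_self _ _
        · filter_upwards [hae] with x hx
          have h2 := (hx.smul_const c).sub_const (s.indicator (fun _ => c) x)
          convert h2 using 2
          by_cases hx : x ∈ s <;> simp [hx]
      obtain ⟨n, hn⟩ := (h1.eventually_le_const (pos_iff_ne_zero.2 hε)).exists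
      refine ⟨fun x => Φ n x • c, hn, (hΦ n).aestronglyMeasurable.smul_const c, ?_⟩
      have h3 := ENNReal.Tendsto.mul_const (b := ‖c‖ₑ) (h (Φ n) (hΦ n)) (Or.inr (by simp))
      rw [zero_mul] at h3
      refine tendsto_of_tendsto_of_tendsto_of_le_of_le tendsto_const_nhds h3 (fun _ => zero_le)
        fun m => ?_
      simp only [← sub_smul]
      rw [eLpNorm_one_eq_lintegral_enorm, eLpNorm_one_eq_lintegral_enorm,
        ← lintegral_mul_const' _ _ (by simp)]
      simp [enorm_smul]
    · intro f g hf hg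
      refine ⟨hf.1.add hg.1, ?_⟩
      have h3 := hf.2.add hg.2
      rw [add_zero] at h3
      refine tendsto_of_tendsto_of_tendsto_of_le_of_le tendsto_const_nhds h3 (fun _ => zero_le)
        fun m => ?_
      have h4 : (fun x => (f + g) (τ m x) - (f + g) (τ₀ x)) =
          (fun x => f (τ m x) - f (τ₀ x)) + (fun x => g (τ m x) - g (τ₀ x)) := by
        funext x
        simp only [Pi.add_apply]
        abel
      simp only [h4]
      exact eLpNorm_add_le ((hf.1.comp_measurePreserving (hτ m)).sub
        (hf.1.comp_measurePreserving hτ₀)) ((hg.1.comp_measurePreserving (hτ m)).sub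
        (hg.1.comp_measurePreserving hτ₀)) le_rfl
  rw [ENNReal.tendsto_nhds_zero]
  intro ε hε
  obtain ⟨g', hg', hgm, hgl⟩ := hdense (ε := ε / 3) (ENNReal.div_pos hε.ne' (by simp)).ne'
  have h5 : ε / 3 > 0 := ENNReal.div_pos hε.ne' (by simp)
  filter_upwards [(ENNReal.tendsto_nhds_zero.1 hgl) (ε / 3) h5] with n hn
  have h6 : (fun x => g (τ n x) - g (τ₀ x)) =
      ((g - g') ∘ τ n + fun x => g' (τ n x) - g' (τ₀ x)) - (g - g') ∘ τ₀ := by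
    funext x
    simp only [Pi.add_apply, Pi.sub_apply, Function.comp_apply]
    abel
  have hm : AEStronglyMeasurable (g - g') μ := hg.1.sub hgm
  have hm' : AEStronglyMeasurable (fun x => g' (τ n x) - g' (τ₀ x)) P :=
    (hgm.comp_measurePreserving (hτ n)).sub (hgm.comp_measurePreserving hτ₀)
  calc eLpNorm (fun x => g (τ n x) - g (τ₀ x)) 1 P
      ≤ eLpNorm ((g - g') ∘ τ n + fun x => g' (τ n x) - g' (τ₀ x)) 1 P +
        eLpNorm ((g - g') ∘ τ₀) 1 P := by
        rw [h6]
        exact eLpNorm_sub_le ((hm.comp_measurePreserving (hτ n)).add hm')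
          (hm.comp_measurePreserving hτ₀) le_rfl
    _ ≤ (eLpNorm ((g - g') ∘ τ n) 1 P + eLpNorm (fun x => g' (τ n x) - g' (τ₀ x)) 1 P) +
        eLpNorm ((g - g') ∘ τ₀) 1 P := by
        gcongr
        exact eLpNorm_add_le (hm.comp_measurePreserving (hτ n)) hm' le_rfl
    _ ≤ (ε / 3 + ε / 3) + ε / 3 := by
        rw [eLpNorm_comp_measurePreserving hm (hτ n), eLpNorm_comp_measurePreserving hm hτ₀]
        gcongr
    _ = ε := ENNReal.add_thirds ε

end Density

/-! ### Chain rule along absolutely continuous paths -/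

section ChainRule

variable {E F : Type*} [NormedAddCommGroup E] [NormedSpace ℝ E] [CompleteSpace E]

/-- Applied with `x` the primitive of `‖D‖`, whose increments dominate those of `f ∘ X`; thus only
absolute continuity of a real-valued primitive is used. -/
lemma AbsolutelyContinuousOnInterval.of_dist_le {X Y : Type*} [PseudoMetricSpace X]
    [PseudoMetricSpace Y] (K : ℝ≥0) {x : ℝ → X} {y : ℝ → Y} {a b : ℝ}
    (hx : AbsolutelyContinuousOnInterval x a b)
    (h : ∀ s ∈ Set.uIcc a b, ∀ t ∈ Set.uIcc a b, dist (y s) (y t) ≤ K * dist (x s) (x t)) :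
    AbsolutelyContinuousOnInterval y a b := by
  rw [absolutelyContinuousOnInterval_iff] at hx ⊢
  intro ε hε
  obtain ⟨δ, hδ, h'⟩ := hx (ε / (K + 1)) (by positivity)
  refine ⟨δ, hδ, fun I hI hI' => ?_⟩
  calc ∑ j ∈ Finset.range I.1, dist (y (I.2 j).1) (y (I.2 j).2)
      ≤ ∑ j ∈ Finset.range I.1, (K : ℝ) * dist (x (I.2 j).1) (x (I.2 j).2) :=
        Finset.sum_le_sum fun j hj => h _ (hI.1 j hj).1 _ (hI.1 j hj).2
    _ = K * ∑ j ∈ Finset.range I.1, dist (x (I.2 j).1) (x (I.2 j).2) := by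
        rw [Finset.mul_sum]
    _ ≤ K * (ε / (K + 1)) := by gcongr; exact (h' I hI hI').le
    _ < (K + 1) * (ε / (K + 1)) := by gcongr; linarith
    _ = ε := by field_simp

/-- The chain rule along an absolutely continuous path. -/
lemma CbSmooth.comp_primitive {f : E → ℝ} (hf : CbSmooth f) {X D : ℝ → E} {x : E}
    (hX : ∀ t, IntervalIntegrable D volume 0 t ∧ X t = x + ∫ r in (0 : ℝ)..t, D r) (t : ℝ) :
    IntervalIntegrable (fun r => _root_.fderiv ℝ f (X r) (D r)) volume 0 t ∧
      f (X t) = f x + ∫ r in (0 : ℝ)..t, _root_.fderiv ℝ f (X r) (D r) := by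
  obtain ⟨C, hC⟩ := hf.exists_fderiv_bound
  have hlip : LipschitzWith C.toNNReal f :=
    lipschitzWith_of_nnnorm_fderiv_le hf.differentiable fun y => by
      rw [← NNReal.coe_le_coe, coe_nnnorm]
      exact (hC y).trans (Real.le_coe_toNNReal C)
  have hint (a b : ℝ) : IntervalIntegrable D volume a b := (hX a).1.symm.trans (hX b).1
  have hac : AbsolutelyContinuousOnInterval (fun t => f (X t)) 0 t := by
    have h1 := (hX t).1.norm.absolutelyContinuousOnInterval_intervalIntegral (c := 0)
      Set.left_mem_uIcc
    refine AbsolutelyContinuousOnInterval.of_dist_le C.toNNReal h1 fun a _ b _ => ?_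
    refine (hlip.dist_le_mul _ _).trans ?_
    gcongr
    rw [dist_eq_norm, dist_eq_norm, (hX a).2, (hX b).2, add_sub_add_left_eq_sub,
      intervalIntegral.integral_interval_sub_left (hX a).1 (hX b).1,
      intervalIntegral.integral_interval_sub_left (hX a).1.norm (hX b).1.norm]
    exact intervalIntegral.norm_integral_le_abs_integral_norm
  -- At almost every time `X` is differentiable with derivative `D r` and the classical chain rule
  -- applies. Absolute continuity of `f ∘ X` then recovers its increments from its derivative.
  have hd : ∀ᵐ r : ℝ, r ∈ Set.uIcc 0 t →
      deriv (fun s => f (X s)) r = _root_.fderiv ℝ f (X r) (D r) := by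
    filter_upwards [(hX t).1.ae_hasDerivAt_integral] with r hr hrt
    have h1 : HasDerivAt X (D r) r := by
      have h2 := (hr hrt 0 (by simp)).const_add x
      have h3 : X = fun t => x + ∫ r in (0 : ℝ)..t, D r := by
        funext s
        exact (hX s).2
      rwa [← h3] at h2
    exact ((hf.differentiable (X r)).hasFDerivAt.comp_hasDerivAt r h1).deriv
  have hX0 : X 0 = x := by simpa using (hX 0).2
  constructor
  · refine hac.intervalIntegrable_deriv.congr_ae ?_
    rw [EventuallyEq, ae_restrict_iff' measurableSet_uIoc]
    filter_upwards [hd] with r hr hrt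
    exact hr (Set.uIoc_subset_uIcc hrt)
  · have h1 := hac.integral_deriv_eq_sub
    rw [hX0] at h1
    rw [← intervalIntegral.integral_congr_ae (f := deriv fun s => f (X s)), h1]
    · ring
    · filter_upwards [hd] with r hr hrt
      exact hr (Set.uIoc_subset_uIcc hrt)

end ChainRule

/-! ### The flow: L¹-differentiability and stationarity -/

section Flow

variable {W H : Type*} [NormedAddCommGroup W] [NormedSpace ℝ W] [CompleteSpace W]
    [TopologicalSpace.SeparableSpace W] [MeasurableSpace W] [BorelSpace W]
    [NormedAddCommGroup H] [InnerProductSpace ℝ H] [CompleteSpace H]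
    {μ : Measure W}

/-- The derivative is a finite combination of fixed functionals with smooth coefficients, which
gives measurability of the pairing; integrability follows from the bound on the derivative. -/
lemma IsSmoothFunctional.memLp_fderiv_apply {Φ : W → ℝ} (hΦ : IsSmoothFunctional Φ) {B : W → W}
    (hB : MemLp B 1 μ) : MemLp (fun x => fderiv ℝ Φ x (B x)) 1 μ := by
  obtain ⟨n, l, φ, hφ, hd⟩ := hΦ.exists_fderiv_eq
  obtain ⟨C, hC⟩ := hΦ.cbSmooth.exists_fderiv_bound
  have hm : AEStronglyMeasurable (fun x => fderiv ℝ Φ x (B x)) μ := by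
    have : (fun x => fderiv ℝ Φ x (B x)) = fun x => ∑ j, φ j x * l j (B x) := by
      funext x
      simp [hd]
    rw [this]
    exact Finset.aestronglyMeasurable_fun_sum _ fun j _ =>
      (hφ j).aestronglyMeasurable.mul ((l j).continuous.comp_aestronglyMeasurable hB.1)
  exact hB.of_le_mul (c := C) hm (ae_of_all _ fun x =>
    ((fderiv ℝ Φ x).le_opNorm _).trans (by gcongr; exact hC x))

lemma SolvesPathwise.comp_smooth {B : W → W} {T : ℝ → W → W}
    (hT : SolvesPathwise μ T (fun t x => B (T t x)) id) {Φ : W → ℝ}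
    (hΦ : IsSmoothFunctional Φ) :
    SolvesPathwise μ (fun t x => Φ (T t x)) (fun t x => fderiv ℝ Φ (T t x) (B (T t x))) Φ := by
  filter_upwards [hT] with x hx t
  exact hΦ.cbSmooth.comp_primitive hx t

lemma SolvesPathwise.ae_continuous {E : Type*} [NormedAddCommGroup E] [NormedSpace ℝ E]
    {X D : ℝ → W → E} {x₀ : W → E}
    (h : SolvesPathwise μ X D x₀) : ∀ᵐ x ∂μ, Continuous fun t => X t x := by
  filter_upwards [h] with x hx
  have h1 : (fun t => X t x) = fun t => x₀ x + ∫ r in (0 : ℝ)..t, D r x :=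
    funext fun t => (hx t).2
  rw [h1]
  exact continuous_const.add (intervalIntegral.continuous_primitive
    (fun a b => (hx a).1.symm.trans (hx b).1) 0)

lemma SolvesPathwise.ae_zero {E : Type*} [NormedAddCommGroup E] [NormedSpace ℝ E]
    {X D : ℝ → W → E} {x₀ : W → E}
    (h : SolvesPathwise μ X D x₀) : ∀ᵐ x ∂μ, X 0 x = x₀ x := by
  filter_upwards [h] with x hx
  simpa using (hx 0).2

/-- Strong continuity of composition with the flow. Continuity of paths gives it for smooth
functionals by bounded convergence, and invariance of `μ` extends it to all integrable `g`; this is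
needed for `DΦ(B)`, which need not be continuous. -/
lemma tendsto_eLpNorm_flow [IsFiniteMeasure μ] {B : W → W} {T : ℝ → W → W}
    (hTp : ∀ t, MeasurePreserving (T t) μ μ)
    (hT : SolvesPathwise μ T (fun t x => B (T t x)) id) {E : Type*} [NormedAddCommGroup E]
    [NormedSpace ℝ E] {g : W → E} (hg : MemLp g 1 μ) (t : ℝ) :
    Tendsto (fun s => eLpNorm (fun x => g (T s x) - g (T t x)) 1 μ) (𝓝 t) (𝓝 0) := by
  refine tendsto_eLpNorm_comp_sub hTp (hTp t) (fun Φ hΦ => ?_) hg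
  obtain ⟨C, hC⟩ := hΦ.exists_bound
  refine tendsto_eLpNorm_zero_of_bounded (C := C + C) one_ne_zero (by simp)
    (Eventually.of_forall fun s => ?_) (Eventually.of_forall fun s => ae_of_all _ fun x => ?_) ?_
  · exact (hΦ.aestronglyMeasurable.comp_measurePreserving (hTp s)).sub
      (hΦ.aestronglyMeasurable.comp_measurePreserving (hTp t))
  · exact (norm_sub_le _ _).trans (add_le_add (hC _) (hC _))
  · filter_upwards [hT.ae_continuous] with x hx
    have : Tendsto (fun s => Φ (T s x) - Φ (T t x)) (𝓝 t) (𝓝 (Φ (T t x) - Φ (T t x))) :=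
      ((hΦ.continuous.comp hx).tendsto t).sub tendsto_const_nhds
    simpa using this

lemma aestronglyMeasurable_uncurry_flow [SFinite μ] {T : ℝ → W → W}
    (hTm : Measurable (Function.uncurry T))
    (hTp : ∀ t, MeasurePreserving (T t) μ μ) {E : Type*} [NormedAddCommGroup E]
    {g : W → E} (hg : AEStronglyMeasurable g μ) (ν : Measure ℝ) [SFinite ν] :
    AEStronglyMeasurable (fun z : ℝ × W => g (T z.1 z.2)) (ν.prod μ) := by
  have h : Measure.QuasiMeasurePreserving (Function.uncurry T) (ν.prod μ) μ :=
    QuasiMeasurePreserving.prod_of_right hTm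
      (ae_of_all _ fun t => (hTp t).quasiMeasurePreserving)
  exact hg.comp_quasiMeasurePreserving h

/-- Smooth functionals are differentiable along the flow in `L¹`. -/
lemma tendsto_eLpNorm_slope_flow [IsFiniteMeasure μ] {B : W → W} {T : ℝ → W → W}
    (hTm : Measurable (Function.uncurry T))
    (hTp : ∀ t, MeasurePreserving (T t) μ μ) (hB : MemLp B 1 μ)
    (hT : SolvesPathwise μ T (fun t x => B (T t x)) id) {Φ : W → ℝ}
    (hΦ : IsSmoothFunctional Φ) (t : ℝ) :
    Tendsto (fun ε : ℝ => eLpNorm (fun x => ε⁻¹ * (Φ (T (t + ε) x) - Φ (T t x)) -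
      fderiv ℝ Φ (T t x) (B (T t x))) 1 μ) (𝓝[≠] 0) (𝓝 0) := by
  set g : W → ℝ := fun x => fderiv ℝ Φ x (B x) with hg_def
  have hg : MemLp g 1 μ := hΦ.memLp_fderiv_apply hB
  have hcont := tendsto_eLpNorm_flow hTp hT hg t
  rw [ENNReal.tendsto_nhds_zero] at hcont ⊢
  intro η hη
  obtain ⟨δ, hδ, hball⟩ := Metric.eventually_nhds_iff.1 (hcont η hη)
  have hsmall : ∀ᶠ ε : ℝ in 𝓝[≠] 0, |ε| < δ ∧ ε ≠ 0 := by
    refine (eventually_nhdsWithin_of_eventually_nhds ?_).and self_mem_nhdsWithin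
    filter_upwards [Metric.ball_mem_nhds (0 : ℝ) hδ] with ε hε
    simpa using hε
  filter_upwards [hsmall] with ε ⟨hε, hε0⟩
  have hmeas : AEMeasurable (fun z : W × ℝ => ‖g (T z.2 z.1) - g (T t z.1)‖ₑ)
      (μ.prod (volume.restrict (Set.uIoc t (t + ε)))) := by
    have h1 := (aestronglyMeasurable_uncurry_flow hTm hTp hg.1
      (volume.restrict (Set.uIoc t (t + ε)))).prod_swap
    have h2 : AEStronglyMeasurable (fun z : W × ℝ => g (T t z.1))
        (μ.prod (volume.restrict (Set.uIoc t (t + ε)))) :=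
      (hg.1.comp_measurePreserving (hTp t)).comp_fst
    exact (h1.sub h2).enorm
  rw [eLpNorm_one_eq_lintegral_enorm]
  -- The difference quotient minus `g ∘ T_t` is the mean, over times `s` between `t` and `t + ε`, of
  -- `g ∘ T_s - g ∘ T_t`. After Fubini each time contributes at most `η`.
  calc ∫⁻ x, ‖ε⁻¹ * (Φ (T (t + ε) x) - Φ (T t x)) - g (T t x)‖ₑ ∂μ
      ≤ ∫⁻ x, ‖ε⁻¹‖ₑ * (∫⁻ s in Set.uIoc t (t + ε), ‖g (T s x) - g (T t x)‖ₑ) ∂μ := by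
        refine lintegral_mono_ae ?_
        filter_upwards [hT.comp_smooth hΦ] with x hx
        have hi : IntervalIntegrable (fun r => g (T r x)) volume t (t + ε) :=
          (hx t).1.symm.trans (hx (t + ε)).1
        have h1 : Φ (T (t + ε) x) - Φ (T t x) = ∫ r in t..(t + ε), g (T r x) := by
          rw [(hx t).2, (hx (t + ε)).2, add_sub_add_left_eq_sub,
            intervalIntegral.integral_interval_sub_left (hx (t + ε)).1 (hx t).1]
        have h2 : ε⁻¹ * (Φ (T (t + ε) x) - Φ (T t x)) - g (T t x) =
            ε⁻¹ * ∫ r in t..(t + ε), (g (T r x) - g (T t x)) := by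
          rw [intervalIntegral.integral_sub hi (by simp), ← h1, intervalIntegral.integral_const,
            add_sub_cancel_left, smul_eq_mul]
          field_simp
        rw [h2, enorm_mul]
        gcongr
        rw [intervalIntegral.intervalIntegral_eq_integral_uIoc, enorm_smul]
        refine (mul_le_of_le_one_left' ?_).trans (enorm_integral_le_lintegral_enorm _)
        split_ifs <;> simp
    _ = ‖ε⁻¹‖ₑ * ∫⁻ x, (∫⁻ s in Set.uIoc t (t + ε), ‖g (T s x) - g (T t x)‖ₑ) ∂μ :=
        lintegral_const_mul' _ _ (by simp)
    _ = ‖ε⁻¹‖ₑ * ∫⁻ s in Set.uIoc t (t + ε), (∫⁻ x, ‖g (T s x) - g (T t x)‖ₑ ∂μ) := by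
        rw [lintegral_lintegral_swap hmeas]
    _ ≤ ‖ε⁻¹‖ₑ * ∫⁻ s in Set.uIoc t (t + ε), η := by
        gcongr ‖ε⁻¹‖ₑ * ?_
        refine setLIntegral_mono' measurableSet_uIoc fun s hs => ?_
        rw [← eLpNorm_one_eq_lintegral_enorm]
        refine hball ?_
        have h3 : |s - t| ≤ |t + ε - t| := Set.abs_sub_left_of_mem_uIcc (Set.uIoc_subset_uIcc hs)
        rw [Real.dist_eq]
        refine h3.trans_lt (by simpa using hε)
    _ = η := by
        rw [setLIntegral_const, Real.volume_uIoc, add_sub_cancel_left, mul_comm η, ← mul_assoc,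
          ← Real.enorm_eq_ofReal_abs, ← enorm_mul, inv_mul_cancel₀ hε0]
        simp

/-- Stationarity turns the time derivative of `f₀ ∘ T_t` into a derivative of the test
functional. -/
lemma IsStationaryProcess.integral_mul_fderiv [IsProbabilityMeasure μ] {B : W → W} {T : ℝ → W → W}
    (hTs : IsStationaryProcess μ T) (hTm : Measurable (Function.uncurry T)) (hB : MemLp B 1 μ)
    (hT : SolvesPathwise μ T (fun t x => B (T t x)) id) {Φ Ψ : W → ℝ}
    (hΦ : IsSmoothFunctional Φ) (hΨ : IsSmoothFunctional Ψ) (t : ℝ) :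
    ∫ x, Ψ x * fderiv ℝ Φ (T t x) (B (T t x)) ∂μ =
      -∫ x, Φ (T t x) * fderiv ℝ Ψ x (B x) ∂μ := by
  have hTp := hTs.measurePreserving
  obtain ⟨CΦ, hCΦ⟩ := hΦ.exists_bound
  obtain ⟨CΨ, hCΨ⟩ := hΨ.exists_bound
  have mΦ (s : ℝ) : AEStronglyMeasurable (fun x => Φ (T s x)) μ :=
    hΦ.aestronglyMeasurable.comp_measurePreserving (hTp s)
  have mΨ (s : ℝ) : AEStronglyMeasurable (fun x => Ψ (T s x)) μ :=
    hΨ.aestronglyMeasurable.comp_measurePreserving (hTp s)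
  have iΦ (s : ℝ) : Integrable (fun x => Φ (T s x)) μ :=
    Integrable.of_bound (mΦ s) CΦ (ae_of_all _ fun x => hCΦ _)
  have iΨ (s : ℝ) : Integrable (fun x => Ψ (T s x)) μ :=
    Integrable.of_bound (mΨ s) CΨ (ae_of_all _ fun x => hCΨ _)
  have gΦ : Integrable (fun x => fderiv ℝ Φ (T t x) (B (T t x))) μ :=
    (hTp t).integrable_comp_of_integrable
      (memLp_one_iff_integrable.1 (hΦ.memLp_fderiv_apply hB))
  have gΨ : Integrable (fun x => fderiv ℝ Ψ x (B x)) μ :=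
    memLp_one_iff_integrable.1 (hΨ.memLp_fderiv_apply hB)
  have hT0 := hT.ae_zero
  -- shifting time
  have hshift (ε : ℝ) : ∫ x, Ψ x * Φ (T (t + ε) x) ∂μ = ∫ x, Ψ (T (-ε) x) * Φ (T t x) ∂μ := by
    have hst := hTs.stationary 2 ![0, t + ε] ![Ψ, Φ]
      (fun j => by fin_cases j <;> simp [hΦ, hΨ]) (-ε)
    have hmm (a b : ℝ) (τ : ℝ) : AEMeasurable
        (fun x (j : Fin 2) => (![Ψ, Φ] : Fin 2 → W → ℝ) j (T ((![a, b] : Fin 2 → ℝ) j + τ) x)) μ := by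
      refine aemeasurable_pi_lambda _ fun j => ?_
      fin_cases j
      · exact (mΨ _).aemeasurable
      · exact (mΦ _).aemeasurable
    have hcont : AEStronglyMeasurable (fun y : Fin 2 → ℝ => y 0 * y 1)
        (μ.map (fun x (j : Fin 2) =>
          (![Ψ, Φ] : Fin 2 → W → ℝ) j (T ((![0, t + ε] : Fin 2 → ℝ) j) x))) := by
      apply Continuous.aestronglyMeasurable
      fun_prop
    have h1 := integral_map (by simpa using hmm 0 (t + ε) 0) hcont
    have hcont' := hcont
    rw [hst] at h1 hcont'
    rw [integral_map (hmm 0 (t + ε) (-ε)) hcont'] at h1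
    simp only [Matrix.cons_val_zero, Matrix.cons_val_one, zero_add, add_neg_cancel_right] at h1
    rw [h1]
    refine integral_congr_ae ?_
    filter_upwards [hT0] with x hx
    rw [hx]
    rfl
  have hL : Tendsto (fun ε : ℝ => ∫ x, Ψ x * (ε⁻¹ * (Φ (T (t + ε) x) - Φ (T t x))) ∂μ) (𝓝[≠] 0)
      (𝓝 (∫ x, Ψ x * fderiv ℝ Φ (T t x) (B (T t x)) ∂μ)) := by
    refine tendsto_integral_of_eLpNorm (Eventually.of_forall fun ε => ?_)
      (integrable_smooth_mul hΨ gΦ) ?_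
    · exact integrable_smooth_mul hΨ (((iΦ _).sub (iΦ _)).const_mul _)
    · have h1 := ENNReal.Tendsto.const_mul (a := ENNReal.ofReal CΨ)
        (tendsto_eLpNorm_slope_flow hTm hTp hB hT hΦ t) (Or.inr (by simp))
      rw [mul_zero] at h1
      refine tendsto_of_tendsto_of_tendsto_of_le_of_le tendsto_const_nhds h1 (fun _ => zero_le)
        fun ε => ?_
      simp only [← mul_sub]
      exact eLpNorm_one_mul_le (ae_of_all _ hCΨ)
  have hR : Tendsto (fun ε : ℝ => ∫ x, Φ (T t x) * (ε⁻¹ * (Ψ (T (0 + ε) x) - Ψ (T 0 x))) ∂μ)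
      (𝓝[≠] 0) (𝓝 (∫ x, Φ (T t x) * fderiv ℝ Ψ x (B x) ∂μ)) := by
    refine tendsto_integral_of_eLpNorm (Eventually.of_forall fun ε => ?_)
      (gΨ.bdd_mul (mΦ t) (ae_of_all _ fun x => hCΦ _)) ?_
    · exact (((iΨ _).sub (iΨ _)).const_mul _).bdd_mul (mΦ t) (ae_of_all _ fun x => hCΦ _)
    · have h1 := ENNReal.Tendsto.const_mul (a := ENNReal.ofReal CΦ)
        (tendsto_eLpNorm_slope_flow hTm hTp hB hT hΨ 0) (Or.inr (by simp))
      rw [mul_zero] at h1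
      refine tendsto_of_tendsto_of_tendsto_of_le_of_le tendsto_const_nhds h1 (fun _ => zero_le)
        fun ε => ?_
      simp only [← mul_sub]
      refine (eLpNorm_one_mul_le (ae_of_all _ fun x => hCΦ (T t x))).trans_eq ?_
      congr 1
      refine eLpNorm_congr_ae ?_
      filter_upwards [hT0] with x hx
      simp only [id] at hx
      rw [hx]
  -- Shifting time by `-ε` has moved the increment to `Ψ ∘ T_{-ε}`, so its difference quotient is
  -- taken at `-ε`; this is the origin of the minus sign.
  have hneg : Tendsto (fun ε : ℝ => -ε) (𝓝[≠] 0) (𝓝[≠] 0) := by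
    refine tendsto_nhdsWithin_iff.2 ⟨?_, ?_⟩
    · have : Tendsto (fun ε : ℝ => -ε) (𝓝 0) (𝓝 (-0)) := continuous_neg.tendsto 0
      rw [neg_zero] at this
      exact this.mono_left nhdsWithin_le_nhds
    · filter_upwards [self_mem_nhdsWithin] with ε hε
      simpa using hε
  have hR' := (hR.comp hneg).neg
  refine tendsto_nhds_unique hL (hR'.congr fun ε => ?_)
  simp only [Function.comp_apply, zero_add]
  have e1 : ∫ x, Ψ x * (ε⁻¹ * (Φ (T (t + ε) x) - Φ (T t x))) ∂μ =
      ε⁻¹ * (∫ x, Ψ x * Φ (T (t + ε) x) ∂μ - ∫ x, Ψ x * Φ (T t x) ∂μ) := by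
    rw [← integral_sub (integrable_smooth_mul hΨ (iΦ _)) (integrable_smooth_mul hΨ (iΦ _)),
      ← integral_const_mul]
    congr 1
    funext x
    ring
  have e2 : ∫ x, Φ (T t x) * ((-ε)⁻¹ * (Ψ (T (-ε) x) - Ψ (T 0 x))) ∂μ =
      (-ε)⁻¹ * (∫ x, Ψ (T (-ε) x) * Φ (T t x) ∂μ - ∫ x, Ψ x * Φ (T t x) ∂μ) := by
    rw [← integral_sub ((iΦ t).bdd_mul (mΨ _) (ae_of_all _ fun x => hCΨ _))
      (integrable_smooth_mul hΨ (iΦ _)), ← integral_const_mul]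
    refine integral_congr_ae ?_
    filter_upwards [hT0] with x hx
    simp only [id] at hx
    rw [hx]
    ring
  rw [e1, e2, hshift, inv_neg]
  ring

end Flow

/-! ### The Hilbert–Schmidt norm -/

section HilbertSchmidt

variable {H : Type*} [NormedAddCommGroup H] [InnerProductSpace ℝ H] [CompleteSpace H]

lemma enorm_sq_eq_tsum (e : HilbertBasis ℕ ℝ H) (x : H) :
    ‖x‖ₑ ^ 2 = ∑' k, ‖⟪e k, x⟫_ℝ‖ₑ ^ 2 := by
  have h1 := (e.hasSum_inner_mul_inner x x)
  rw [real_inner_self_eq_norm_sq] at h1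
  have h2 : (fun k => ⟪x, e k⟫_ℝ * ⟪e k, x⟫_ℝ) = fun k => ‖⟪e k, x⟫_ℝ‖ ^ 2 := by
    funext k
    rw [real_inner_comm, Real.norm_eq_abs, sq_abs, sq]
  rw [h2] at h1
  have h3 : (fun k => ‖⟪e k, x⟫_ℝ‖ₑ ^ 2) = fun k => ENNReal.ofReal (‖⟪e k, x⟫_ℝ‖ ^ 2) := by
    funext k
    rw [ENNReal.ofReal_pow (norm_nonneg _), ofReal_norm]
  rw [h3, ← ENNReal.ofReal_tsum_of_nonneg (fun k => by positivity) h1.summable, h1.tsum_eq,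
    ENNReal.ofReal_pow (norm_nonneg _), ofReal_norm]

lemma sum_enorm_inner_sq_le {ι : Type*} [Fintype ι] {v : ι → H} (hv : Orthonormal ℝ v) (x : H) :
    ∑ j, ‖⟪v j, x⟫_ℝ‖ₑ ^ 2 ≤ ‖x‖ₑ ^ 2 := by
  have h := hv.sum_inner_products_le (x := x) (s := Finset.univ)
  simp only [← ofReal_norm, ← ENNReal.ofReal_pow (norm_nonneg _)]
  rw [← ENNReal.ofReal_sum_of_nonneg fun j _ => by positivity]
  exact ENNReal.ofReal_le_ofReal h

lemma sum_le_hsNorm_sq (K : H →L[ℝ] H) {ι : Type*} [Fintype ι] {v : ι → H}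
    (hv : Orthonormal ℝ v) : ∑ j, ‖K (v j)‖ₑ ^ 2 ≤ hsNorm K ^ 2 := by
  let E := Fintype.equivFin ι
  have h : (∑ j, ‖K (v (E.symm j))‖ₑ ^ 2) ^ (1 / 2 : ℝ) ≤ hsNorm K :=
    le_iSup_of_le (Fintype.card ι) (le_iSup_of_le (fun j => v (E.symm j))
      (le_iSup_of_le (hv.comp _ E.symm.injective) le_rfl))
  have h2 := pow_le_pow_left₀ (zero_le (a := _)) h 2
  rw [← ENNReal.rpow_natCast, ← ENNReal.rpow_mul] at h2
  simp only [Nat.cast_ofNat, one_div, isUnit_iff_ne_zero, ne_eq, OfNat.ofNat_ne_zero,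
    not_false_eq_true, IsUnit.inv_mul_cancel, ENNReal.rpow_one] at h2
  rwa [← Equiv.sum_comp E.symm]

lemma hsNorm_le_of_forall {K : H →L[ℝ] H} {c : ℝ≥0∞}
    (h : ∀ (n : ℕ) (v : Fin n → H), Orthonormal ℝ v → ∑ j, ‖K (v j)‖ₑ ^ 2 ≤ c ^ 2) :
    hsNorm K ≤ c := by
  refine iSup_le fun n => iSup_le fun v => iSup_le fun hv => ?_
  calc (∑ j, ‖K (v j)‖ₑ ^ 2) ^ (1 / 2 : ℝ) ≤ (c ^ 2) ^ (1 / 2 : ℝ) := by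
        gcongr
        exact h n v hv
    _ = c := by
        rw [← ENNReal.rpow_natCast, ← ENNReal.rpow_mul]
        simp

lemma hsNorm_add_le (K L : H →L[ℝ] H) : hsNorm (K + L) ≤ hsNorm K + hsNorm L := by
  refine iSup_le fun n => iSup_le fun v => iSup_le fun hv => ?_
  have h := ENNReal.Lp_add_le Finset.univ (fun j => ‖K (v j)‖ₑ) (fun j => ‖L (v j)‖ₑ)
    (p := 2) (by norm_num)
  simp only [ENNReal.rpow_ofNat] at h
  refine le_trans ?_ (h.trans (add_le_add ?_ ?_))
  · gcongr with j
    exact enorm_add_le _ _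
  · exact le_iSup_of_le n (le_iSup_of_le v (le_iSup_of_le hv le_rfl))
  · exact le_iSup_of_le n (le_iSup_of_le v (le_iSup_of_le hv le_rfl))

lemma hsNorm_smul_le (c : ℝ) (K : H →L[ℝ] H) : hsNorm (c • K) ≤ ‖c‖ₑ * hsNorm K := by
  refine hsNorm_le_of_forall fun n v hv => ?_
  simp only [smul_apply, enorm_smul, mul_pow, ← Finset.mul_sum]
  gcongr
  exact sum_le_hsNorm_sq K hv

lemma hsNorm_zero : hsNorm (0 : H →L[ℝ] H) = 0 :=
  le_antisymm (hsNorm_le_of_forall fun n v _ => by simp) zero_le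

lemma hsNorm_rankOne_le (a h : H) :
    hsNorm ((innerSL ℝ a).smulRight h) ≤ ‖a‖ₑ * ‖h‖ₑ := by
  refine hsNorm_le_of_forall fun n v hv => ?_
  simp only [ContinuousLinearMap.smulRight_apply, innerSL_apply_apply, enorm_smul, mul_pow,
    ← Finset.sum_mul]
  gcongr
  refine le_trans (le_of_eq ?_) (sum_enorm_inner_sq_le hv a)
  simp only [real_inner_comm a]

/-- Expanding `K v` in the basis and passing to the adjoint, Bessel's inequality for the system `v`
bounds its contribution by the basis sum. The countable sum, unlike the supremum over all systems,
shows measurability of `hsNorm`. -/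
lemma hsNorm_sq_eq_tsum (e : HilbertBasis ℕ ℝ H) (K : H →L[ℝ] H) :
    hsNorm K ^ 2 = ∑' k, ‖K (e k)‖ₑ ^ 2 := by
  have hadj (x y : H) : ‖⟪x, K y⟫_ℝ‖ₑ = ‖⟪y, K.adjoint x⟫_ℝ‖ₑ := by
    rw [ContinuousLinearMap.adjoint_inner_right, real_inner_comm]
  apply le_antisymm
  · have h : hsNorm K ≤ (∑' k, ‖K (e k)‖ₑ ^ 2) ^ (1 / 2 : ℝ) := by
      refine hsNorm_le_of_forall fun n v hv => ?_
      rw [← ENNReal.rpow_natCast, ← ENNReal.rpow_mul]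
      simp only [Nat.cast_ofNat, one_div, isUnit_iff_ne_zero, ne_eq, OfNat.ofNat_ne_zero,
        not_false_eq_true, IsUnit.inv_mul_cancel, ENNReal.rpow_one]
      calc ∑ j, ‖K (v j)‖ₑ ^ 2 = ∑ j, ∑' k, ‖⟪v j, K.adjoint (e k)⟫_ℝ‖ₑ ^ 2 := by
            simp only [enorm_sq_eq_tsum e (K _), hadj]
        _ = ∑' k, ∑ j, ‖⟪v j, K.adjoint (e k)⟫_ℝ‖ₑ ^ 2 :=
            (Summable.tsum_finsetSum fun _ _ => ENNReal.summable).symm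
        _ ≤ ∑' k, ‖K.adjoint (e k)‖ₑ ^ 2 :=
            ENNReal.tsum_le_tsum fun k => sum_enorm_inner_sq_le hv _
        _ = ∑' k, ∑' l, ‖⟪e l, K.adjoint (e k)⟫_ℝ‖ₑ ^ 2 := by
            simp only [← enorm_sq_eq_tsum e]
        _ = ∑' l, ∑' k, ‖⟪e l, K.adjoint (e k)⟫_ℝ‖ₑ ^ 2 := ENNReal.tsum_comm
        _ = ∑' l, ‖K (e l)‖ₑ ^ 2 := by
            simp only [← hadj, ← enorm_sq_eq_tsum e]
    calc hsNorm K ^ 2 ≤ ((∑' k, ‖K (e k)‖ₑ ^ 2) ^ (1 / 2 : ℝ)) ^ 2 := by gcongr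
      _ = _ := by
        rw [← ENNReal.rpow_natCast, ← ENNReal.rpow_mul]
        simp
  · rw [ENNReal.tsum_eq_iSup_nat]
    refine iSup_le fun n => ?_
    rw [← Fin.sum_univ_eq_sum_range (fun k => ‖K (e k)‖ₑ ^ 2)]
    exact sum_le_hsNorm_sq K (e.orthonormal.comp _ Fin.val_injective)

lemma aemeasurable_hsNorm {Ω : Type*} [MeasurableSpace Ω] {P : Measure Ω}
    (e : HilbertBasis ℕ ℝ H) {K : Ω → H →L[ℝ] H}
    (hK : ∀ k, AEStronglyMeasurable (fun x => K x (e k)) P) :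
    AEMeasurable (fun x => hsNorm (K x)) P := by
  have h : (fun x => hsNorm (K x)) = fun x => (∑' k, ‖K x (e k)‖ₑ ^ 2) ^ (1 / 2 : ℝ) := by
    funext x
    rw [← hsNorm_sq_eq_tsum, ← ENNReal.rpow_natCast, ← ENNReal.rpow_mul]
    simp
  rw [h]
  exact (AEMeasurable.tsum fun k => (hK k).enorm.pow_const 2).pow_const _

lemma separableSpace_of_hilbertBasis (e : HilbertBasis ℕ ℝ H) :
    TopologicalSpace.SeparableSpace H := by
  have h1 : TopologicalSpace.IsSeparable (Set.univ : Set H) := by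
    have h2 := ((Set.countable_range e).isSeparable.span (R := ℝ)).closure
    rw [← Submodule.topologicalClosure_coe, e.dense_span] at h2
    simpa using h2
  exact TopologicalSpace.isSeparable_univ_iff.1 h1

end HilbertSchmidt

/-! ### The 𝔻_{p,1}(H) norm on smooth fields -/

section SobolevNorm

variable {W H : Type*} [NormedAddCommGroup W] [NormedSpace ℝ W] [CompleteSpace W]
    [TopologicalSpace.SeparableSpace W] [MeasurableSpace W] [BorelSpace W]
    [NormedAddCommGroup H] [InnerProductSpace ℝ H] [CompleteSpace H]
    {i : H →L[ℝ] W} {μ : Measure W} {p : ℝ≥0∞}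

lemma IsSmoothField.aestronglyMeasurable {F : W → H} (h : IsSmoothField F) :
    AEStronglyMeasurable F μ := by
  have := UniformSpace.secondCountable_of_separable W
  exact h.cbSmooth.continuous.aestronglyMeasurable

lemma IsSmoothField.memLp [IsFiniteMeasure μ] {F : W → H} (h : IsSmoothField F) (p : ℝ≥0∞) :
    MemLp F p μ := by
  obtain ⟨C, hC⟩ := h.cbSmooth.exists_bound
  exact MemLp.of_bound h.aestronglyMeasurable C (ae_of_all _ hC)

lemma IsSmoothField.aestronglyMeasurable_fieldGrad {F : W → H} (h : IsSmoothField F) (x : H) :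
    AEStronglyMeasurable (fun w => fieldGrad i F w x) μ := by
  have := UniformSpace.secondCountable_of_separable W
  exact (h.cbSmooth.fderiv_apply (i x)).continuous.aestronglyMeasurable

lemma IsSmoothField.aemeasurable_hsNorm (e : HilbertBasis ℕ ℝ H) {F : W → H}
    (h : IsSmoothField F) : AEMeasurable (fun w => hsNorm (fieldGrad i F w)) μ :=
  WienerFlow.aemeasurable_hsNorm e fun k => h.aestronglyMeasurable_fieldGrad (e k)

lemma IsSmoothField.fieldGrad_add {F G : W → H} (hF : IsSmoothField F) (hG : IsSmoothField G)
    (w : W) : fieldGrad i (fun x => F x + G x) w = fieldGrad i F w + fieldGrad i G w := by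
  simp only [fieldGrad, fderiv_fun_add (hF.cbSmooth.differentiable w)
    (hG.cbSmooth.differentiable w), ContinuousLinearMap.add_comp]

lemma IsSmoothField.fieldGrad_const_smul {F : W → H} (hF : IsSmoothField F) (c : ℝ) (w : W) :
    fieldGrad i (fun x => c • F x) w = c • fieldGrad i F w := by
  simp only [fieldGrad, fderiv_fun_const_smul (hF.cbSmooth.differentiable w),
    ContinuousLinearMap.smul_comp]

lemma IsSmoothField.fieldGrad_sub {F G : W → H} (hF : IsSmoothField F) (hG : IsSmoothField G)
    (w : W) : fieldGrad i (fun x => F x - G x) w = fieldGrad i F w - fieldGrad i G w := by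
  simp only [fieldGrad, fderiv_fun_sub (hF.cbSmooth.differentiable w)
    (hG.cbSmooth.differentiable w), ContinuousLinearMap.sub_comp]

/-- The gradient is a finite sum of rank one operators built from bounded vectors. -/
lemma IsSmoothField.exists_hsNorm_le {F : W → H} (hF : IsSmoothField F) :
    ∃ C : ℝ, ∀ w, hsNorm (fieldGrad i F w) ≤ ENNReal.ofReal C := by
  classical
  obtain ⟨m, Φ, h, hΦ, rfl⟩ := hF
  choose C hC using fun k => (hΦ k).cbSmooth.exists_fderiv_bound
  have hC0 (k) : 0 ≤ C k := (norm_nonneg _).trans (hC k 0)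
  refine ⟨∑ k, C k * ‖dualEmbL i‖ * ‖h k‖, fun w => ?_⟩
  have h1 : fieldGrad i (fun x => ∑ k, Φ k x • h k) w =
      ∑ k, (innerSL ℝ (smoothGrad i (Φ k) w)).smulRight (h k) := by
    ext x
    have h2 : HasFDerivAt (fun x => ∑ k, Φ k x • h k)
        (∑ k, (fderiv ℝ (Φ k) w).smulRight (h k)) w :=
      HasFDerivAt.fun_sum fun k _ => ((hΦ k).differentiable w).hasFDerivAt.smul_const (h k)
    simp only [fieldGrad, h2.fderiv, ContinuousLinearMap.comp_apply, sum_apply,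
      ContinuousLinearMap.smulRight_apply, innerSL_apply_apply, smoothGrad_inner]
  rw [h1]
  have hD (k) : 0 ≤ C k * ‖dualEmbL i‖ * ‖h k‖ := by have := hC0 k; positivity
  have h3 : ∀ s : Finset (Fin m), hsNorm (∑ k ∈ s,
      (innerSL ℝ (smoothGrad i (Φ k) w)).smulRight (h k)) ≤
      ENNReal.ofReal (∑ k ∈ s, C k * ‖dualEmbL i‖ * ‖h k‖) := by
    intro s
    induction s using Finset.induction_on with
    | empty => simp [hsNorm_zero]
    | insert k s hk ih =>
      rw [Finset.sum_insert hk, Finset.sum_insert hk, ENNReal.ofReal_add (hD k)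
        (Finset.sum_nonneg fun k _ => hD k)]
      refine (hsNorm_add_le _ _).trans (add_le_add ((hsNorm_rankOne_le _ _).trans ?_) ih)
      rw [ENNReal.ofReal_mul (p := C k * ‖dualEmbL i‖) (by have := hC0 k; positivity),
        ofReal_norm]
      gcongr
      rw [← ofReal_norm]
      refine ENNReal.ofReal_le_ofReal ?_
      rw [smoothGrad_eq, mul_comm]
      exact ((dualEmbL i).le_opNorm _).trans (by gcongr; exact hC k w)
  exact h3 Finset.univ

/-- The `𝔻_{p,1}(H)` norm of a smooth field. -/
def sobolevNorm (i : H →L[ℝ] W) (μ : Measure W) (p : ℝ≥0∞) (F : W → H) : ℝ≥0∞ :=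
  eLpNorm F p μ + eLpNorm (fun w => hsNorm (fieldGrad i F w)) p μ

lemma IsSmoothField.eLpNorm_hsNorm_lt_top [IsFiniteMeasure μ] {F : W → H} (hF : IsSmoothField F) :
    eLpNorm (fun w => hsNorm (fieldGrad i F w)) p μ < ∞ := by
  obtain ⟨C, hC⟩ := hF.exists_hsNorm_le (i := i)
  calc eLpNorm (fun w => hsNorm (fieldGrad i F w)) p μ
      ≤ eLpNorm (fun _ : W => |C|) p μ := eLpNorm_mono_enorm fun w => by
        rw [enorm_eq_self]
        refine (hC w).trans ?_
        rw [Real.enorm_abs, Real.enorm_eq_ofReal_abs]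
        exact ENNReal.ofReal_le_ofReal (le_abs_self C)
    _ < ∞ := (memLp_const _).2

lemma IsSmoothField.sobolevNorm_lt_top [IsFiniteMeasure μ] {F : W → H} (hF : IsSmoothField F) :
    sobolevNorm i μ p F < ∞ :=
  ENNReal.add_lt_top.2 ⟨(hF.memLp p).2, hF.eLpNorm_hsNorm_lt_top⟩

lemma IsSmoothField.sobolevNorm_add_le (e : HilbertBasis ℕ ℝ H) (hp : 1 ≤ p) {F G : W → H}
    (hF : IsSmoothField F) (hG : IsSmoothField G) :
    sobolevNorm i μ p (fun x => F x + G x) ≤ sobolevNorm i μ p F + sobolevNorm i μ p G := by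
  have h1 : eLpNorm (fun x => F x + G x) p μ ≤ eLpNorm F p μ + eLpNorm G p μ :=
    eLpNorm_add_le hF.aestronglyMeasurable hG.aestronglyMeasurable hp
  have h2 : eLpNorm (fun w => hsNorm (fieldGrad i (fun x => F x + G x) w)) p μ ≤
      eLpNorm (fun w => hsNorm (fieldGrad i F w)) p μ +
        eLpNorm (fun w => hsNorm (fieldGrad i G w)) p μ := by
    refine le_trans (eLpNorm_mono_enorm fun w => ?_) (eLpNorm_add_le
      (hF.aemeasurable_hsNorm e).aestronglyMeasurable
      (hG.aemeasurable_hsNorm e).aestronglyMeasurable hp)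
    simp only [enorm_eq_self, Pi.add_apply]
    rw [hF.fieldGrad_add hG]
    exact hsNorm_add_le _ _
  calc _ ≤ _ := add_le_add h1 h2
    _ = _ := add_add_add_comm _ _ _ _

lemma IsSmoothField.sobolevNorm_const_smul_le {F : W → H} (hF : IsSmoothField F) (c : ℝ) :
    sobolevNorm i μ p (fun x => c • F x) ≤ ‖c‖ₑ * sobolevNorm i μ p F := by
  rw [sobolevNorm, sobolevNorm, mul_add]
  refine add_le_add (eLpNorm_const_smul_le (c := c) (f := F)) ?_
  simp only [hF.fieldGrad_const_smul]
  refine eLpNorm_le_mul_eLpNorm_of_ae_le_mul' (c := ‖c‖₊) (ae_of_all _ fun w => ?_) p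
  simp only [enorm_eq_self]
  exact hsNorm_smul_le c _

end SobolevNorm

/-! ### An open mapping argument for closed relations -/

section AbstractRelation

variable {V Y : Type*} [SeminormedAddCommGroup V] [NormedSpace ℝ V] [NormedAddCommGroup Y]
  [NormedSpace ℝ Y] [CompleteSpace Y]

/-- A closed linear relation on `Y`, defined on the image of the completion of `V`, is bounded with
respect to the norm of the completion. -/
lemma exists_bound_of_closed_relation (J : UniformSpace.Completion V →L[ℝ] Y)
    (R : Submodule ℝ (Y × Y)) (hR : IsClosed (R : Set (Y × Y)))
    (hD : ∀ x : UniformSpace.Completion V, ∃ y, (J x, J y) ∈ R) :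
    ∃ C > 0, ∀ x, ∃ y, (J x, J y) ∈ R ∧ ‖y‖ ≤ C * ‖x‖ := by
  -- `J` may fail to be injective, so on the completion the relation may be multivalued. Its graph
  -- is closed, hence complete, the first projection is onto, and the open mapping theorem selects a
  -- preimage of controlled norm.
  let G : Submodule ℝ (UniformSpace.Completion V × UniformSpace.Completion V) :=
    R.comap (J.prodMap J).toLinearMap
  have hG : IsClosed (G : Set (UniformSpace.Completion V × UniformSpace.Completion V)) :=
    hR.preimage (J.prodMap J).continuous
  have : CompleteSpace G := hG.completeSpace_coe
  let π : G →L[ℝ] UniformSpace.Completion V :=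
    (ContinuousLinearMap.fst ℝ _ _).comp G.subtypeL
  have hπ : Function.Surjective π := fun x => by
    obtain ⟨y, hy⟩ := hD x
    exact ⟨⟨(x, y), hy⟩, rfl⟩
  obtain ⟨C, hC, h⟩ := π.exists_preimage_norm_le hπ
  refine ⟨C, hC, fun x => ?_⟩
  obtain ⟨⟨⟨x', y⟩, hxy⟩, rfl, hle⟩ := h x
  exact ⟨y, hxy, (le_max_right _ _).trans hle⟩

end AbstractRelation

/-! ### Iterates of a skew-symmetric operator -/

section Skew

variable {H : Type*} [NormedAddCommGroup H] [InnerProductSpace ℝ H]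

/-- `‖S h‖² = -⟪h, S² h⟫`, and Cauchy–Schwarz applies. -/
lemma norm_sq_le_of_skew {S : H →L[ℝ] H} (hS : ∀ h k : H, ⟪S h, k⟫_ℝ = -⟪h, S k⟫_ℝ) (h : H) :
    ‖S h‖ ^ 2 ≤ ‖h‖ * ‖S (S h)‖ := by
  rw [← real_inner_self_eq_norm_sq, hS, ← inner_neg_right]
  exact (real_inner_le_norm _ _).trans (by rw [norm_neg])

/-- The norms of the iterates of a skew-symmetric operator are log-convex. -/
lemma pow_norm_le_norm_iterate {S : H →L[ℝ] H} (hS : ∀ h k : H, ⟪S h, k⟫_ℝ = -⟪h, S k⟫_ℝ)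
    {h : H} (hh : ‖h‖ = 1) (n : ℕ) : ‖S h‖ ^ n ≤ ‖(S : H → H)^[n] h‖ := by
  -- By `norm_sq_le_of_skew` the ratios of consecutive norms do not decrease, so each is at least
  -- the first one, which is `‖S h‖`. The product form also covers vanishing iterates.
  have key : ∀ n, ‖S h‖ * ‖(S : H → H)^[n] h‖ ≤ ‖(S : H → H)^[n + 1] h‖ := by
    intro n
    induction n with
    | zero => simp [hh]
    | succ n ih =>
      set a := ‖(S : H → H)^[n] h‖ with ha
      have h1 := norm_sq_le_of_skew hS ((S : H → H)^[n] h)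
      rw [Function.iterate_succ_apply'] at ih
      rw [Function.iterate_succ_apply' S (n + 1), Function.iterate_succ_apply' S n]
      rw [← ha] at h1
      rcases eq_or_lt_of_le (norm_nonneg ((S : H → H)^[n] h)) with h0 | h0
      · rw [← ha] at h0
        have h2 : ‖S ((S : H → H)^[n] h)‖ = 0 := by
          rw [← h0, zero_mul] at h1
          exact pow_eq_zero_iff two_ne_zero |>.1 (le_antisymm h1 (by positivity))
        rw [h2, mul_zero]
        exact norm_nonneg _
      · rw [← ha] at h0
        refine le_of_mul_le_mul_left (le_trans ?_ h1) h0
        rw [sq, ← mul_assoc, mul_comm a]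
        gcongr
  induction n with
  | zero => simp [hh]
  | succ n ih =>
    rw [pow_succ']
    exact (by gcongr : ‖S h‖ * ‖S h‖ ^ n ≤ ‖S h‖ * ‖(S : H → H)^[n] h‖).trans (key n)

end Skew

/-! ### Boundedness of A on 𝔻_{p,1}(H) and essential boundedness -/

section BoundedOperator

variable {W H : Type*} [NormedAddCommGroup W] [NormedSpace ℝ W] [CompleteSpace W]
    [TopologicalSpace.SeparableSpace W] [MeasurableSpace W] [BorelSpace W]
    [NormedAddCommGroup H] [InnerProductSpace ℝ H] [CompleteSpace H]
    {i : H →L[ℝ] W} {μ : Measure W} {p : ℝ≥0∞}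

/-- Measurability is only known for `A` applied to a fixed vector, so a random argument is expanded
in the basis and the partial sums converge pointwise. -/
lemma aestronglyMeasurable_clm_apply (e : HilbertBasis ℕ ℝ H) {Ω : Type*} [MeasurableSpace Ω]
    {P : Measure Ω} {A : Ω → H →L[ℝ] H} (hA : ∀ h, AEStronglyMeasurable (fun x => A x h) P)
    {v : Ω → H} (hv : AEStronglyMeasurable v P) :
    AEStronglyMeasurable (fun x => A x (v x)) P := by
  refine aestronglyMeasurable_of_tendsto_ae (u := atTop)
    (f := fun n x => ∑ k ∈ Finset.range n, ⟪e k, v x⟫_ℝ • A x (e k)) (fun n => ?_)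
    (ae_of_all _ fun x => ?_)
  · exact Finset.aestronglyMeasurable_fun_sum _ fun k _ =>
      ((aestronglyMeasurable_const (b := e k)).inner hv).smul (hA (e k))
  · have h1 := (e.hasSum_repr (v x)).tendsto_sum_nat
    have h2 := ((A x).continuous.tendsto _).comp h1
    refine h2.congr fun n => ?_
    simp [HilbertBasis.repr_apply_apply]

/-- The smooth fields as a vector space. -/
def smoothFields (W H : Type*) [NormedAddCommGroup W] [NormedSpace ℝ W]
    [NormedAddCommGroup H] [InnerProductSpace ℝ H] [CompleteSpace H] :
    Submodule ℝ (W → H) where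
  carrier := {F | IsSmoothField F}
  add_mem' hF hG := IsSmoothField.add hF hG
  zero_mem' := IsSmoothField.const 0
  smul_mem' c _ hF := IsSmoothField.const_smul hF c

/-- The space of smooth fields, without the topology of pointwise convergence. -/
def SmoothFieldSpace (W H : Type*) [NormedAddCommGroup W] [NormedSpace ℝ W]
    [NormedAddCommGroup H] [InnerProductSpace ℝ H] [CompleteSpace H] : Type _ :=
  smoothFields W H

instance : AddCommGroup (SmoothFieldSpace W H) := inferInstanceAs (AddCommGroup (smoothFields W H))

instance : Module ℝ (SmoothFieldSpace W H) := inferInstanceAs (Module ℝ (smoothFields W H))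

/-- The function underlying an element of `SmoothFieldSpace`. -/
def SmoothFieldSpace.val (F : SmoothFieldSpace W H) : W → H := Subtype.val (p := (· ∈ smoothFields W H)) F

lemma SmoothFieldSpace.prop (F : SmoothFieldSpace W H) : IsSmoothField F.val :=
  Subtype.prop (p := (· ∈ smoothFields W H)) F

/-- Smooth fields as elements of `SmoothFieldSpace`. -/
def SmoothFieldSpace.mk (F : W → H) (hF : IsSmoothField F) : SmoothFieldSpace W H :=
  (⟨F, hF⟩ : smoothFields W H)

lemma SmoothFieldSpace.val_mk (F : W → H) (hF : IsSmoothField F) :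
    (SmoothFieldSpace.mk F hF).val = F := rfl

lemma SmoothFieldSpace.val_zero : (0 : SmoothFieldSpace W H).val = 0 := rfl

lemma SmoothFieldSpace.val_sub (F G : SmoothFieldSpace W H) :
    (F - G).val = fun w => F.val w - G.val w := rfl

/-- The Sobolev norm as a seminorm on the space of smooth fields. -/
def sobolevSeminorm (i : H →L[ℝ] W) (μ : Measure W) [IsFiniteMeasure μ] (hp : 1 ≤ p)
    (e : HilbertBasis ℕ ℝ H) : Seminorm ℝ (SmoothFieldSpace W H) :=
  Seminorm.ofSMulLE (fun F => (sobolevNorm i μ p F.val).toReal)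
    (by
      have h : fieldGrad i (0 : W → H) = 0 := by
        funext w
        ext x
        simp [fieldGrad]
      simp [SmoothFieldSpace.val_zero, sobolevNorm, h, hsNorm_zero])
    (fun F G => by
      have hF := F.prop.sobolevNorm_lt_top (i := i) (μ := μ) (p := p)
      have hG := G.prop.sobolevNorm_lt_top (i := i) (μ := μ) (p := p)
      rw [← ENNReal.toReal_add hF.ne hG.ne]
      exact ENNReal.toReal_mono (ENNReal.add_lt_top.2 ⟨hF, hG⟩).ne
        (F.prop.sobolevNorm_add_le e hp G.prop))
    (fun c F => by
      have hF := F.prop.sobolevNorm_lt_top (i := i) (μ := μ) (p := p)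
      rw [← toReal_enorm c, ← ENNReal.toReal_mul]
      exact ENNReal.toReal_mono (ENNReal.mul_lt_top (by simp) hF).ne
        (F.prop.sobolevNorm_const_smul_le c))

/-- A pointwise defined operator which preserves `𝔻_{p,1}(H)` is bounded for the Sobolev norm:
the iterates of a smooth field are controlled in `L^p`, and the first one can be approximated by
smooth fields of controlled Sobolev norm. -/
lemma exists_sobolev_bound [IsFiniteMeasure μ] (hp : 1 ≤ p)
    (e : HilbertBasis ℕ ℝ H) {A : W → H →L[ℝ] H}
    (hAD : ∀ v : W → H, MemD1 i μ p v → MemD1 i μ p (fun ω => A ω (v ω))) :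
    ∃ C : ℝ, 0 < C ∧ ∀ F : W → H, IsSmoothField F →
      (∀ n : ℕ, eLpNorm (fun ω => (A ω : H → H)^[n] (F ω)) p μ ≤
        ENNReal.ofReal (C ^ n) * sobolevNorm i μ p F) ∧
      ∀ ε : ℝ≥0∞, ε ≠ 0 → ∃ G : W → H, IsSmoothField G ∧
        eLpNorm (fun ω => G ω - A ω (F ω)) p μ ≤ ε ∧
        sobolevNorm i μ p G ≤ ENNReal.ofReal C * sobolevNorm i μ p F + ε := by
  have : Fact (1 ≤ p) := ⟨hp⟩
  let N := sobolevSeminorm i μ hp e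
  let : SeminormedAddCommGroup (SmoothFieldSpace W H) := N.toSeminormedAddCommGroup
  let : NormedSpace ℝ (SmoothFieldSpace W H) := ⟨fun c F => (map_smul_eq_mul N c F).le⟩
  have hnorm (F : SmoothFieldSpace W H) : ‖F‖ = (sobolevNorm i μ p F.val).toReal := rfl
  have hfin (F : SmoothFieldSpace W H) : sobolevNorm i μ p F.val ≠ ∞ := F.prop.sobolevNorm_lt_top.ne
  let j : SmoothFieldSpace W H →L[ℝ] Lp H p μ := LinearMap.mkContinuous
    { toFun := fun F : SmoothFieldSpace W H => (F.prop.memLp p).toLp F.val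
      map_add' := fun F G => MemLp.toLp_add _ _
      map_smul' := fun c F => MemLp.toLp_const_smul c _ } 1 (fun F => by
      rw [one_mul, hnorm]
      exact (Lp.norm_toLp _ (F.prop.memLp p)).trans_le
        (ENNReal.toReal_mono (hfin F) le_self_add))
  have hj (F : SmoothFieldSpace W H) : j F = (F.prop.memLp p).toLp F.val := rfl
  have hjn (F : SmoothFieldSpace W H) : ‖j F‖ ≤ ‖F‖ := by
    rw [hj, hnorm]
    exact (Lp.norm_toLp _ _).trans_le (ENNReal.toReal_mono (hfin F) le_self_add)
  -- The completion models `𝔻_{p,1}(H)` and `J` sends it to functions. Injectivity of `J`, that is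
  -- closability of the gradient on fields, is never used.
  let J : UniformSpace.Completion (SmoothFieldSpace W H) →L[ℝ] Lp H p μ :=
    j.extend UniformSpace.Completion.toComplL
  have hJ (F : SmoothFieldSpace W H) : J (F : UniformSpace.Completion (SmoothFieldSpace W H)) = j F :=
    ContinuousLinearMap.extend_eq j (e := UniformSpace.Completion.toComplL)
      UniformSpace.Completion.denseRange_coe
      (UniformSpace.Completion.isUniformInducing_coe _) F
  have hJn (x : UniformSpace.Completion (SmoothFieldSpace W H)) : ‖J x‖ ≤ ‖x‖ := by
    induction x using UniformSpace.Completion.induction_on with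
    | hp => exact isClosed_le J.continuous.norm continuous_norm
    | ih F =>
      rw [hJ, UniformSpace.Completion.norm_coe]
      exact hjn F
  -- The graph of the pointwise action of `A`. It is closed without any bound on `A`: along a
  -- subsequence both components converge almost everywhere, and each `A ω` is continuous.
  let R : Submodule ℝ (Lp H p μ × Lp H p μ) :=
    { carrier := {z | ∀ᵐ ω ∂μ, z.2 ω = A ω (z.1 ω)}
      add_mem' := fun {a b} ha hb => by
        simp only [Set.mem_ofPred_eq, Prod.fst_add, Prod.snd_add] at ha hb ⊢
        filter_upwards [ha, hb, Lp.coeFn_add a.1 b.1, Lp.coeFn_add a.2 b.2] with ω h1 h2 h3 h4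
        rw [h3, h4, Pi.add_apply, Pi.add_apply, map_add, h1, h2]
      zero_mem' := by
        simp only [Set.mem_ofPred_eq, Prod.fst_zero, Prod.snd_zero]
        filter_upwards [Lp.coeFn_zero H p μ] with ω h1
        rw [h1]
        simp
      smul_mem' := fun c {a} ha => by
        simp only [Set.mem_ofPred_eq, Prod.smul_fst, Prod.smul_snd] at ha ⊢
        filter_upwards [ha, Lp.coeFn_smul c a.1, Lp.coeFn_smul c a.2] with ω h1 h3 h4
        rw [h3, h4, Pi.smul_apply, Pi.smul_apply, map_smul, h1] }
  have hp0 : p ≠ 0 := (lt_of_lt_of_le zero_lt_one hp).ne'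
  have hR : IsClosed (R : Set (Lp H p μ × Lp H p μ)) := by
    refine IsSeqClosed.isClosed fun z z₀ hz hlim => ?_
    have h1 : Tendsto (fun n => eLpNorm (fun ω => (z n).1 ω - z₀.1 ω) p μ) atTop (𝓝 0) :=
      Lp.tendsto_Lp_iff_tendsto_eLpNorm' _ _ |>.1 ((continuous_fst.tendsto z₀).comp hlim)
    obtain ⟨ns, hns, hae⟩ := exists_subseq_tendsto_ae hp0
      (fun n => Lp.aestronglyMeasurable _) (Lp.aestronglyMeasurable _) h1
    have h2 : Tendsto (fun n => eLpNorm (fun ω => (z (ns n)).2 ω - z₀.2 ω) p μ) atTop (𝓝 0) :=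
      Lp.tendsto_Lp_iff_tendsto_eLpNorm' _ _ |>.1
        (((continuous_snd.tendsto z₀).comp hlim).comp hns.tendsto_atTop)
    obtain ⟨ms, hms, hae'⟩ := exists_subseq_tendsto_ae hp0
      (fun n => Lp.aestronglyMeasurable _) (Lp.aestronglyMeasurable _) h2
    have h3 : ∀ᵐ ω ∂μ, ∀ n, (z n).2 ω = A ω ((z n).1 ω) := ae_all_iff.2 hz
    change ∀ᵐ ω ∂μ, z₀.2 ω = A ω (z₀.1 ω)
    filter_upwards [hae, hae', h3] with ω a1 a2 a3
    refine tendsto_nhds_unique a2 ?_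
    simp only [a3]
    exact ((A ω).continuous.tendsto _).comp (a1.comp hms.tendsto_atTop)
  have hseq (x : UniformSpace.Completion (SmoothFieldSpace W H)) :
      ∃ f : ℕ → SmoothFieldSpace W H, Tendsto (fun n =>
        (f n : UniformSpace.Completion (SmoothFieldSpace W H))) atTop (𝓝 x) ∧
        Tendsto (fun n => eLpNorm (fun ω => (f n).val ω - J x ω) p μ) atTop (𝓝 0) := by
    obtain ⟨F, hF1, hF⟩ := mem_closure_iff_seq_limit.1
      ((UniformSpace.Completion.denseRange_coe (α := SmoothFieldSpace W H)) x)
    choose f hf using hF1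
    have hF' : F = fun n => (f n : UniformSpace.Completion (SmoothFieldSpace W H)) :=
      funext fun n => (hf n).symm
    rw [hF'] at hF
    refine ⟨f, hF, ?_⟩
    have h1 := Lp.tendsto_Lp_iff_tendsto_eLpNorm' _ _ |>.1 ((J.continuous.tendsto x).comp hF)
    refine h1.congr fun n => eLpNorm_congr_ae ?_
    simp only [Function.comp_apply, hJ, hj]
    filter_upwards [MemLp.coeFn_toLp ((f n).prop.memLp (μ := μ) p)] with ω hω
    simp [hω]
  -- The function `J x` lies in `𝔻_{p,1}(H)`, hence by hypothesis so does its image under `A`.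
  -- Smooth fields approximating that image are Cauchy in the Sobolev norm, and `y` is their limit
  -- in the completion.
  have hD : ∀ x : UniformSpace.Completion (SmoothFieldSpace W H), ∃ y, (J x, J y) ∈ R := by
    intro x
    have hmem : MemD1 i μ p (J x) := by
      obtain ⟨f, hf, hfl⟩ := hseq x
      refine ⟨Lp.memLp _, fun n => (f n).val, fun n => (f n).prop, hfl, ?_⟩
      have h2 : Tendsto (fun k : ℕ × ℕ => ENNReal.ofReal ‖f k.1 - f k.2‖) atTop (𝓝 0) := by
        rw [← prod_atTop_atTop_eq]
        have h3 := (((hf.comp tendsto_fst).sub (hf.comp tendsto_snd)).norm :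
          Tendsto _ (atTop ×ˢ atTop : Filter (ℕ × ℕ)) _)
        rw [sub_self, norm_zero] at h3
        have h4 := ENNReal.tendsto_ofReal h3
        rw [ENNReal.ofReal_zero] at h4
        refine h4.congr fun k => ?_
        simp only [Function.comp_apply]
        rw [← UniformSpace.Completion.coe_sub, UniformSpace.Completion.norm_coe]
      refine tendsto_of_tendsto_of_tendsto_of_le_of_le tendsto_const_nhds h2 (fun _ => zero_le)
        fun k => ?_
      rw [hnorm, ENNReal.ofReal_toReal (hfin _)]
      refine le_trans (le_of_eq ?_) le_add_self
      congr 1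
      funext ω
      rw [← IsSmoothField.fieldGrad_sub (f k.1).prop (f k.2).prop]
      rfl
    obtain ⟨hm, F, hF, hFl, hFc⟩ := hAD _ hmem
    let f : ℕ → SmoothFieldSpace W H := fun n => SmoothFieldSpace.mk (F n) (hF n)
    have hc : CauchySeq fun n => (f n : UniformSpace.Completion (SmoothFieldSpace W H)) := by
      rw [cauchySeq_iff_tendsto_dist_atTop_0]
      have h5 : Tendsto (fun k : ℕ × ℕ => (eLpNorm (fun ω => F k.1 ω - A ω (J x ω)) p μ +
          eLpNorm (fun ω => F k.2 ω - A ω (J x ω)) p μ) +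
          eLpNorm (fun ω => hsNorm (fieldGrad i (F k.1) ω - fieldGrad i (F k.2) ω)) p μ)
          atTop (𝓝 0) := by
        have h6 := hFl.comp (tendsto_fst (f := (atTop : Filter ℕ)) (g := (atTop : Filter ℕ)))
        have h7 := hFl.comp (tendsto_snd (f := (atTop : Filter ℕ)) (g := (atTop : Filter ℕ)))
        rw [prod_atTop_atTop_eq] at h6 h7
        simpa using (h6.add h7).add hFc
      have h8 : Tendsto (fun k : ℕ × ℕ => sobolevNorm i μ p (f k.1 - f k.2).val) atTop (𝓝 0) := by
        refine tendsto_of_tendsto_of_tendsto_of_le_of_le tendsto_const_nhds h5 (fun _ => zero_le)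
          fun k => ?_
        refine add_le_add ?_ (le_of_eq ?_)
        · have h9 : (f k.1 - f k.2).val = (fun ω => F k.1 ω - A ω (J x ω)) -
              fun ω => F k.2 ω - A ω (J x ω) := by
            funext ω
            simp [f, SmoothFieldSpace.val_sub, SmoothFieldSpace.val_mk]
          rw [h9]
          exact eLpNorm_sub_le ((hF k.1).aestronglyMeasurable.sub hm.1)
            ((hF k.2).aestronglyMeasurable.sub hm.1) hp
        · congr 1
          funext ω
          rw [← IsSmoothField.fieldGrad_sub (hF k.1) (hF k.2)]
          rfl
      have h10 := (ENNReal.tendsto_toReal ENNReal.zero_ne_top).comp h8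
      rw [ENNReal.toReal_zero] at h10
      refine h10.congr fun k => ?_
      rw [dist_eq_norm, ← UniformSpace.Completion.coe_sub, UniformSpace.Completion.norm_coe, hnorm]
      rfl
    obtain ⟨y, hy⟩ := cauchySeq_tendsto_of_complete hc
    refine ⟨y, ?_⟩
    have h11 : Tendsto (fun n => j (f n)) atTop (𝓝 (hm.toLp _)) := by
      refine (Lp.tendsto_Lp_iff_tendsto_eLpNorm' _ _).2 (hFl.congr fun n => eLpNorm_congr_ae ?_)
      filter_upwards [MemLp.coeFn_toLp ((f n).prop.memLp (μ := μ) p), hm.coeFn_toLp] with ω h1 h2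
      rw [Pi.sub_apply, h2]
      exact congrArg (· - _) h1.symm
    have h12 : J y = hm.toLp _ := by
      refine tendsto_nhds_unique ((J.continuous.tendsto y).comp hy) (h11.congr fun n => ?_)
      simp only [Function.comp_apply, hJ]
    change ∀ᵐ ω ∂μ, J y ω = A ω (J x ω)
    rw [h12]
    exact hm.coeFn_toLp
  obtain ⟨C, hC, hbound⟩ := exists_bound_of_closed_relation J R hR hD
  have hnorm' (F : SmoothFieldSpace W H) : ENNReal.ofReal ‖F‖ = sobolevNorm i μ p F.val := by
    rw [hnorm, ENNReal.ofReal_toReal (hfin F)]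
  have hJF (F : SmoothFieldSpace W H) :
      ∀ᵐ ω ∂μ, J (F : UniformSpace.Completion (SmoothFieldSpace W H)) ω = F.val ω := by
    rw [hJ]
    exact MemLp.coeFn_toLp ((F.prop.memLp (μ := μ) p))
  refine ⟨C, hC, fun F hF => ⟨fun n => ?_, fun ε hε => ?_⟩⟩
  -- Iteration takes place in the completion, each step costing a factor `C`; only at the end is the
  -- Sobolev norm weakened to the `L^p` norm.
  · have hit : ∀ n : ℕ, ∃ x : UniformSpace.Completion (SmoothFieldSpace W H),
        (∀ᵐ ω ∂μ, J x ω = (A ω : H → H)^[n] (F ω)) ∧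
          ‖x‖ ≤ C ^ n * ‖SmoothFieldSpace.mk F hF‖ := by
      intro n
      induction n with
      | zero =>
        exact ⟨(SmoothFieldSpace.mk F hF : UniformSpace.Completion (SmoothFieldSpace W H)),
          hJF _, by simp⟩
      | succ n ih =>
        obtain ⟨x, hx, hxn⟩ := ih
        obtain ⟨y, hy, hyn⟩ := hbound x
        refine ⟨y, ?_, hyn.trans ?_⟩
        · filter_upwards [hx, hy] with ω h1 h2
          rw [h2, h1, Function.iterate_succ_apply']
        · rw [pow_succ', mul_assoc]
          gcongr
    obtain ⟨x, hx, hxn⟩ := hit n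
    calc eLpNorm (fun ω => (A ω : H → H)^[n] (F ω)) p μ = eLpNorm (J x) p μ :=
          eLpNorm_congr_ae (hx.mono fun ω h => h.symm)
      _ = ENNReal.ofReal ‖J x‖ := by
          rw [Lp.norm_def, ENNReal.ofReal_toReal (Lp.eLpNorm_ne_top _)]
      _ ≤ ENNReal.ofReal (C ^ n * ‖SmoothFieldSpace.mk F hF‖) :=
          ENNReal.ofReal_le_ofReal ((hJn x).trans hxn)
      _ = _ := by rw [ENNReal.ofReal_mul (by positivity), hnorm', SmoothFieldSpace.val_mk]
  · obtain ⟨y, hy, hyn⟩ := hbound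
      (SmoothFieldSpace.mk F hF : UniformSpace.Completion (SmoothFieldSpace W H))
    rw [UniformSpace.Completion.norm_coe] at hyn
    have hy' : ∀ᵐ ω ∂μ, J y ω = A ω (F ω) := by
      filter_upwards [hy, hJF (SmoothFieldSpace.mk F hF)] with ω h1 h2
      rw [h1, h2, SmoothFieldSpace.val_mk]
    obtain ⟨f, hf, hfl⟩ := hseq y
    have h1 : ∀ᶠ n in atTop, eLpNorm (fun ω => (f n).val ω - J y ω) p μ ≤ ε :=
      (ENNReal.tendsto_nhds_zero.1 hfl) ε (pos_iff_ne_zero.2 hε)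
    have h2 : ∀ᶠ n in atTop, ENNReal.ofReal ‖f n‖ ≤ ENNReal.ofReal ‖y‖ + ε := by
      have h3 := ENNReal.tendsto_ofReal hf.norm
      simp only [UniformSpace.Completion.norm_coe] at h3
      rcases eq_or_ne ε ∞ with rfl | hεt
      · simp
      · have h4 : ENNReal.ofReal ‖y‖ < ENNReal.ofReal ‖y‖ + ε :=
          ENNReal.lt_add_right ENNReal.ofReal_ne_top hε
        exact (h3.eventually (gt_mem_nhds h4)).mono fun n hn => hn.le
    obtain ⟨n, hn1, hn2⟩ := (h1.and h2).exists
    refine ⟨(f n).val, (f n).prop, ?_, ?_⟩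
    · refine le_trans (le_of_eq (eLpNorm_congr_ae ?_)) hn1
      filter_upwards [hy'] with ω h
      rw [h]
    · rw [← hnorm']
      refine hn2.trans ?_
      gcongr
      rw [← SmoothFieldSpace.val_mk F hF, ← hnorm' (SmoothFieldSpace.mk F hF), ← ENNReal.ofReal_mul hC.le]
      exact ENNReal.ofReal_le_ofReal hyn

/-- A skew-symmetric operator which preserves `𝔻_{p,1}(H)` is essentially bounded. -/
lemma ae_norm_le_of_skew [IsProbabilityMeasure μ] (hp : 1 ≤ p) (hp' : p ≠ ∞)
    (e : HilbertBasis ℕ ℝ H) {A : W → H →L[ℝ] H}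
    (hAmeas : ∀ h, AEStronglyMeasurable (fun ω => A ω h) μ)
    (hAskew : ∀ᵐ ω ∂μ, ∀ h k : H, ⟪A ω h, k⟫_ℝ = -⟪h, A ω k⟫_ℝ) {C : ℝ} (hC : 0 < C)
    (hbound : ∀ F : W → H, IsSmoothField F → ∀ n : ℕ,
      eLpNorm (fun ω => (A ω : H → H)^[n] (F ω)) p μ ≤
        ENNReal.ofReal (C ^ n) * sobolevNorm i μ p F) :
    ∀ᵐ ω ∂μ, ‖A ω‖ ≤ C := by
  have hp0 : p ≠ 0 := (lt_of_lt_of_le zero_lt_one hp).ne'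
  have hpr : 0 < p.toReal := ENNReal.toReal_pos hp0 hp'
  have hit (h : H) : ∀ n : ℕ, AEStronglyMeasurable (fun ω => (A ω : H → H)^[n] h) μ := by
    intro n
    induction n with
    | zero => exact aestronglyMeasurable_const
    | succ n ih =>
      simp only [Function.iterate_succ_apply']
      exact aestronglyMeasurable_clm_apply e hAmeas ih
  have hunit (h : H) (hh : ‖h‖ = 1) (D : ℝ) (hD : C < D) : ∀ᵐ ω ∂μ, ‖A ω h‖ < D := by
    have hD0 : 0 < D := hC.trans hD
    -- Where `‖A ω h‖ ≥ D` the iterates satisfy `‖Aⁿ h‖ ≥ Dⁿ`, whereas the `L^p` norm of `Aⁿ h` is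
    -- at most `Cⁿ`, the Sobolev norm of the constant field `h` being at most 1. Markov's inequality
    -- gives a geometric bound with ratio below 1.
    have h1 (n : ℕ) : μ {ω | ¬ ‖A ω h‖ < D} ≤
        ((ENNReal.ofReal C / ENNReal.ofReal D) ^ p.toReal) ^ n := by
      have h2 := mul_meas_ge_le_pow_eLpNorm' μ hp0 hp' (hit h n) (ENNReal.ofReal (D ^ n))
      have h3 : sobolevNorm i μ p (fun _ => h) ≤ 1 := by
        have h4 : fieldGrad i (fun _ : W => h) = 0 := by
          funext w
          ext x
          simp [fieldGrad]
        rw [sobolevNorm, h4]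
        simp only [Pi.zero_apply, hsNorm_zero]
        rw [eLpNorm_const _ hp0 (IsProbabilityMeasure.ne_zero μ)]
        simp [← ofReal_norm, hh]
      have h5 : eLpNorm (fun ω => (A ω : H → H)^[n] h) p μ ≤ ENNReal.ofReal (C ^ n) := by
        refine (hbound _ (IsSmoothField.const h) n).trans ?_
        calc _ ≤ ENNReal.ofReal (C ^ n) * 1 := by gcongr
          _ = _ := mul_one _
      have h6 : μ {ω | ¬ ‖A ω h‖ < D} ≤
          μ {ω | ENNReal.ofReal (D ^ n) ≤ ‖(A ω : H → H)^[n] h‖ₑ} := by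
        refine measure_mono_ae ?_
        filter_upwards [hAskew] with ω hω hlt
        have h7 : D ≤ ‖A ω h‖ := not_lt.1 hlt
        change ENNReal.ofReal (D ^ n) ≤ ‖(A ω : H → H)^[n] h‖ₑ
        rw [← ofReal_norm]
        refine ENNReal.ofReal_le_ofReal (le_trans ?_ (pow_norm_le_norm_iterate hω hh n))
        gcongr
      have h8 : ENNReal.ofReal (D ^ n) ^ p.toReal ≠ 0 := by
        simp only [ne_eq, ENNReal.rpow_eq_zero_iff, not_or]
        constructor
        · simp [hD0]
        · simp
      have h9 : ENNReal.ofReal (D ^ n) ^ p.toReal ≠ ∞ := by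
        simp [ENNReal.rpow_eq_top_iff, hpr.le]
      calc μ {ω | ¬ ‖A ω h‖ < D}
          ≤ ENNReal.ofReal (C ^ n) ^ p.toReal / ENNReal.ofReal (D ^ n) ^ p.toReal := by
            rw [ENNReal.le_div_iff_mul_le (Or.inl h8) (Or.inl h9), mul_comm]
            exact (mul_le_mul_right h6 _).trans (h2.trans (by gcongr))
        _ = _ := by
            rw [← ENNReal.div_rpow_of_nonneg _ _ hpr.le, ENNReal.ofReal_pow hC.le,
              ENNReal.ofReal_pow hD0.le, div_eq_mul_inv, ENNReal.inv_pow, ← mul_pow,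
              ← div_eq_mul_inv, ← ENNReal.rpow_natCast,
              ← ENNReal.rpow_mul, mul_comm, ENNReal.rpow_mul, ENNReal.rpow_natCast]
    have h10 : (ENNReal.ofReal C / ENNReal.ofReal D) ^ p.toReal < 1 := by
      refine ENNReal.rpow_lt_one ?_ hpr
      rw [ENNReal.div_lt_iff (by simp [hD0]) (by simp), one_mul]
      exact (ENNReal.ofReal_lt_ofReal_iff hD0).2 hD
    exact le_antisymm (ge_of_tendsto' (ENNReal.tendsto_pow_atTop_nhds_zero_of_lt_one h10) h1)
      zero_le
  have hall (h : H) : ∀ᵐ ω ∂μ, ‖A ω h‖ ≤ C * ‖h‖ := by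
    rcases eq_or_ne h 0 with rfl | h0
    · simp
    have h1 : ∀ᵐ ω ∂μ, ∀ n : ℕ, ‖A ω (‖h‖⁻¹ • h)‖ < C + 1 / (n + 1) :=
      ae_all_iff.2 fun n => hunit _ (norm_smul_inv_norm h0) _
        (by have : (0 : ℝ) < 1 / (n + 1) := by positivity
            linarith)
    filter_upwards [h1] with ω hω
    have h2 : ‖A ω (‖h‖⁻¹ • h)‖ ≤ C := by
      have h3 := (tendsto_one_div_add_atTop_nhds_zero_nat (𝕜 := ℝ)).const_add C
      rw [add_zero] at h3
      exact ge_of_tendsto' h3 fun n => (hω n).le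
    rw [map_smul, norm_smul, norm_inv, norm_norm] at h2
    have h3 : 0 < ‖h‖ := norm_pos_iff.2 h0
    rwa [inv_mul_le_iff₀ h3, mul_comm] at h2
  -- The exceptional null set depends on `h`; a countable dense set of vectors removes this
  -- dependence.
  have := separableSpace_of_hilbertBasis e
  have h1 : ∀ᵐ ω ∂μ, ∀ n, ‖A ω (TopologicalSpace.denseSeq H n)‖ ≤
      C * ‖TopologicalSpace.denseSeq H n‖ := ae_all_iff.2 fun n => hall _
  filter_upwards [h1] with ω hω
  refine ContinuousLinearMap.opNorm_le_bound _ hC.le fun h => ?_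
  have h2 : IsClosed {h : H | ‖A ω h‖ ≤ C * ‖h‖} :=
    isClosed_le (A ω).continuous.norm (continuous_const.mul continuous_norm)
  exact (TopologicalSpace.denseRange_denseSeq H).induction_on h h2 hω

end BoundedOperator

/-! ### Finite-dimensional projections and traces -/

section PartialProjection

variable {H : Type*} [NormedAddCommGroup H] [InnerProductSpace ℝ H] [CompleteSpace H]

/-- The orthogonal projection onto the span of the first `N` basis vectors. -/
def partialProj (e : HilbertBasis ℕ ℝ H) (N : ℕ) : H →L[ℝ] H :=
  ∑ k ∈ Finset.range N, (innerSL ℝ (e k)).smulRight (e k)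

lemma partialProj_apply (e : HilbertBasis ℕ ℝ H) (N : ℕ) (x : H) :
    partialProj e N x = ∑ k ∈ Finset.range N, ⟪e k, x⟫_ℝ • e k := by
  simp [partialProj]

lemma inner_partialProj (e : HilbertBasis ℕ ℝ H) (N : ℕ) (x y : H) :
    ⟪partialProj e N x, y⟫_ℝ = ∑ k ∈ Finset.range N, ⟪e k, x⟫_ℝ * ⟪e k, y⟫_ℝ := by
  simp only [partialProj_apply, sum_inner, real_inner_smul_left]

lemma inner_partialProj_comm (e : HilbertBasis ℕ ℝ H) (N : ℕ) (x y : H) :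
    ⟪partialProj e N x, y⟫_ℝ = ⟪x, partialProj e N y⟫_ℝ := by
  rw [real_inner_comm (partialProj e N y) x, inner_partialProj, inner_partialProj]
  exact Finset.sum_congr rfl fun k _ => mul_comm _ _

lemma inner_basis_partialProj (e : HilbertBasis ℕ ℝ H) (N k : ℕ) (x : H) :
    ⟪e k, partialProj e N x⟫_ℝ = if k < N then ⟪e k, x⟫_ℝ else 0 := by
  rw [partialProj_apply, inner_sum]
  simp only [real_inner_smul_right, orthonormal_iff_ite.1 e.orthonormal]
  simp

lemma partialProj_idem (e : HilbertBasis ℕ ℝ H) (N : ℕ) (x : H) :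
    partialProj e N (partialProj e N x) = partialProj e N x := by
  rw [partialProj_apply, partialProj_apply e N x]
  refine Finset.sum_congr rfl fun k hk => ?_
  rw [← partialProj_apply, inner_basis_partialProj, if_pos (Finset.mem_range.1 hk)]

lemma norm_partialProj_le (e : HilbertBasis ℕ ℝ H) (N : ℕ) (x : H) :
    ‖partialProj e N x‖ ≤ ‖x‖ := by
  have h1 : ‖partialProj e N x‖ ^ 2 ≤ ‖x‖ * ‖partialProj e N x‖ := by
    rw [← real_inner_self_eq_norm_sq, inner_partialProj_comm, partialProj_idem]
    exact real_inner_le_norm _ _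
  rcases eq_or_lt_of_le (norm_nonneg (partialProj e N x)) with h | h
  · rw [← h]; exact norm_nonneg x
  · exact le_of_mul_le_mul_right (by rwa [sq] at h1) h

lemma tendsto_partialProj (e : HilbertBasis ℕ ℝ H) (x : H) :
    Tendsto (fun N => partialProj e N x) atTop (𝓝 x) := by
  have h := (e.hasSum_repr x).tendsto_sum_nat
  refine h.congr fun N => ?_
  simp [partialProj_apply, HilbertBasis.repr_apply_apply]

/-- The partial traces of `A* S` for a finite rank operator `S`. -/
lemma sum_inner_finiteRank (e : HilbertBasis ℕ ℝ H) (A : H →L[ℝ] H) {m : ℕ} (a c : Fin m → H)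
    (N : ℕ) : ∑ n ∈ Finset.range N, ⟪A (e n), ∑ j, ⟪a j, e n⟫_ℝ • c j⟫_ℝ =
      ∑ j, ⟪A (partialProj e N (a j)), c j⟫_ℝ := by
  simp only [inner_sum, partialProj_apply, map_sum, map_smul, sum_inner]
  rw [Finset.sum_comm]
  refine Finset.sum_congr rfl fun j _ => Finset.sum_congr rfl fun n _ => ?_
  rw [real_inner_smul_left, real_inner_smul_right, real_inner_comm]

/-- The trace of the product of a skew-symmetric and a symmetric finite rank operator is zero. -/
lemma sum_inner_eq_zero_of_skew (e : HilbertBasis ℕ ℝ H) {A : H →L[ℝ] H}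
    (hA : ∀ h k : H, ⟪A h, k⟫_ℝ = -⟪h, A k⟫_ℝ) {m : ℕ} {a c : Fin m → H}
    (hS : ∀ x : H, ∑ j, ⟪a j, x⟫_ℝ • c j = ∑ j, ⟪c j, x⟫_ℝ • a j) :
    ∑ j, ⟪A (a j), c j⟫_ℝ = 0 := by
  -- The partial traces of `S = ∑ ⟪a j, ·⟫ c j` against `A` converge to `∑ ⟪A (a j), c j⟫`. Symmetry
  -- of `S` exchanges `a` and `c`, and skewness of `A` makes this exchange a change of sign.
  have hlim (a c : Fin m → H) : Tendsto (fun N => ∑ n ∈ Finset.range N,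
      ⟪A (e n), ∑ j, ⟪a j, e n⟫_ℝ • c j⟫_ℝ) atTop (𝓝 (∑ j, ⟪A (a j), c j⟫_ℝ)) := by
    simp only [sum_inner_finiteRank]
    refine tendsto_finsetSum _ fun j _ => ?_
    exact ((A.continuous.tendsto _).comp (tendsto_partialProj e (a j))).inner tendsto_const_nhds
  have h1 := hlim a c
  simp only [hS] at h1
  have h2 := tendsto_nhds_unique h1 (hlim c a)
  have h3 : ∑ j, ⟪A (c j), a j⟫_ℝ = -∑ j, ⟪A (a j), c j⟫_ℝ := by
    rw [← Finset.sum_neg_distrib]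
    refine Finset.sum_congr rfl fun j _ => ?_
    rw [hA, real_inner_comm]
  linarith

end PartialProjection

/-! ### The identity linking A and B -/

section DivergenceIdentities

variable {W H : Type*} [NormedAddCommGroup W] [NormedSpace ℝ W] [CompleteSpace W]
    [TopologicalSpace.SeparableSpace W] [MeasurableSpace W] [BorelSpace W]
    [NormedAddCommGroup H] [InnerProductSpace ℝ H] [CompleteSpace H]
    {i : H →L[ℝ] W} {μ : Measure W} {p : ℝ≥0∞}

lemma IsSmoothFunctional.aestronglyMeasurable_smoothGrad {Φ : W → ℝ}
    (h : IsSmoothFunctional Φ) : AEStronglyMeasurable (smoothGrad i Φ) μ := by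
  have := UniformSpace.secondCountable_of_separable W
  exact (h.cbSmooth.smoothGrad i).continuous.aestronglyMeasurable

/-- The gradient of the gradient of a smooth functional is a symmetric finite rank operator. -/
lemma IsSmoothFunctional.exists_second_grad (i : H →L[ℝ] W) {Φ : W → ℝ}
    (h : IsSmoothFunctional Φ) :
    ∃ (m : ℕ) (φ : Fin m → W → ℝ) (c : Fin m → H), (∀ j, IsSmoothFunctional (φ j)) ∧
      ∀ (x : W) (k : H), smoothGrad i (fun y => fderiv ℝ Φ y (i k)) x =
          ∑ j, ⟪smoothGrad i (φ j) x, k⟫_ℝ • c j ∧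
        ∑ j, ⟪smoothGrad i (φ j) x, k⟫_ℝ • c j = ∑ j, ⟪c j, k⟫_ℝ • smoothGrad i (φ j) x := by
  obtain ⟨m, l, φ, hφ, hd⟩ := h.exists_fderiv_eq
  have h1 (x : W) (w : W) : fderiv ℝ (fun y => fderiv ℝ Φ y w) x =
      ∑ j, l j w • fderiv ℝ (φ j) x := by
    have h2 : (fun y => fderiv ℝ Φ y w) = fun y => ∑ j, φ j y * l j w := by
      funext y
      simp [hd]
    rw [h2]
    have h3 : HasFDerivAt (fun y => ∑ j, φ j y * l j w) (∑ j, l j w • fderiv ℝ (φ j) x) x :=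
      HasFDerivAt.fun_sum fun j _ => ((hφ j).differentiable x).hasFDerivAt.mul_const (l j w)
    exact h3.fderiv
  have h4 (x : W) : fderiv ℝ (fderiv ℝ Φ) x = ∑ j, (fderiv ℝ (φ j) x).smulRight (l j) := by
    have h5 : fderiv ℝ Φ = fun y => ∑ j, φ j y • l j := funext hd
    rw [h5]
    exact (HasFDerivAt.fun_sum fun j _ =>
      ((hφ j).differentiable x).hasFDerivAt.smul_const (l j)).fderiv
  have h6 (x : W) (v w : W) : ∑ j, fderiv ℝ (φ j) x v * l j w =
      ∑ j, fderiv ℝ (φ j) x w * l j v := by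
    have h7 : IsSymmSndFDerivAt ℝ Φ x := by
      refine h.cbSmooth.contDiff.contDiffAt.isSymmSndFDerivAt ?_
      simp only [minSmoothness_of_isRCLikeNormedField]
      exact natCast_le_smooth 2
    have h8 := h7 v w
    rw [h4] at h8
    simpa using h8
  have h9 (x : W) (k : H) : ∑ j, ⟪smoothGrad i (φ j) x, k⟫_ℝ • dualEmb i (l j) =
      ∑ j, ⟪dualEmb i (l j), k⟫_ℝ • smoothGrad i (φ j) x := by
    refine ext_inner_right ℝ fun z => ?_
    simp only [sum_inner, real_inner_smul_left, smoothGrad_inner, dualEmb_inner]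
    rw [h6]
    exact Finset.sum_congr rfl fun j _ => mul_comm _ _
  refine ⟨m, φ, fun j => dualEmb i (l j), hφ, fun x k => ⟨?_, h9 x k⟩⟩
  rw [h9, smoothGrad, h1, ← dualEmbL_apply, map_sum]
  refine Finset.sum_congr rfl fun j _ => ?_
  rw [map_smul, dualEmb_inner]
  rfl

/-- The action of `B = ∑ δ(A eₙ) eₙ` on smooth functionals. -/
lemma integral_inner_smoothGrad [IsProbabilityMeasure μ] (e : HilbertBasis ℕ ℝ H)
    {A : W → H →L[ℝ] H} (hAmeas : ∀ h, AEStronglyMeasurable (fun ω => A ω h) μ)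
    (hAskew : ∀ᵐ ω ∂μ, ∀ h k : H, ⟪A ω h, k⟫_ℝ = -⟪h, A ω k⟫_ℝ) {C : ℝ}
    (hAbdd : ∀ᵐ ω ∂μ, ‖A ω‖ ≤ C) {b : ℕ → W → ℝ}
    (hb : ∀ n, IsDivergence i μ (fun ω => A ω (e n)) (b n))
    {B : W → W} (hB : MemLp B 1 μ)
    (hBsum : Tendsto
      (fun n => eLpNorm (fun ω => (∑ k ∈ Finset.range n, b k ω • i (e k)) - B ω) 1 μ)
      atTop (𝓝 0)) {Φ Ψ : W → ℝ} (hΦ : IsSmoothFunctional Φ) (hΨ : IsSmoothFunctional Ψ) :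
    ∫ ω, ⟪A ω (smoothGrad i Φ ω), smoothGrad i Ψ ω⟫_ℝ ∂μ = ∫ ω, Ψ ω * fderiv ℝ Φ ω (B ω) ∂μ := by
  have hC0 : 0 ≤ C := by
    obtain ⟨ω, hω⟩ := hAbdd.exists
    exact (norm_nonneg _).trans hω
  obtain ⟨CΨ, hCΨ⟩ := hΨ.exists_bound
  obtain ⟨CΨ', hCΨ'⟩ := (hΨ.cbSmooth.smoothGrad i).exists_bound
  obtain ⟨CΦ', hCΦ'⟩ := (hΦ.cbSmooth.smoothGrad i).exists_bound
  obtain ⟨CD, hCD⟩ := hΦ.cbSmooth.exists_fderiv_bound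
  obtain ⟨m, φ, c, hφ, hS⟩ := hΦ.exists_second_grad i
  choose Cφ hCφ using fun j => ((hφ j).cbSmooth.smoothGrad i).exists_bound
  have hbi (n : ℕ) : Integrable (b n) μ := (hb n).2.1
  have mgΦ : AEStronglyMeasurable (smoothGrad i Φ) μ := hΦ.aestronglyMeasurable_smoothGrad
  have mgΨ : AEStronglyMeasurable (smoothGrad i Ψ) μ := hΨ.aestronglyMeasurable_smoothGrad
  have hAle (ω : W) (hω : ‖A ω‖ ≤ C) (x : H) (R : ℝ) (hx : ‖x‖ ≤ R) : ‖A ω x‖ ≤ C * R :=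
    ((A ω).le_opNorm x).trans (mul_le_mul hω hx (norm_nonneg _) hC0)
  -- the identity for the partial sums
  have key (N : ℕ) : ∫ ω, Ψ ω * fderiv ℝ Φ ω (∑ k ∈ Finset.range N, b k ω • i (e k)) ∂μ =
      ∫ ω, Ψ ω * ∑ j, ⟪A ω (partialProj e N (smoothGrad i (φ j) ω)), c j⟫_ℝ ∂μ +
        ∫ ω, ⟪A ω (partialProj e N (smoothGrad i Φ ω)), smoothGrad i Ψ ω⟫_ℝ ∂μ := by
    have h1 (n : ℕ) : Integrable
        (fun ω => Ψ ω * ⟪A ω (e n), ∑ j, ⟪smoothGrad i (φ j) ω, e n⟫_ℝ • c j⟫_ℝ) μ := by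
      refine integrable_smooth_mul hΨ ?_
      simp only [← (hS _ _).1]
      obtain ⟨K, hK⟩ := ((hΦ.fderiv_apply (i (e n))).cbSmooth.smoothGrad i).exists_bound
      refine Integrable.of_bound ((hAmeas _).inner
        (hΦ.fderiv_apply (i (e n))).aestronglyMeasurable_smoothGrad) (C * 1 * K) ?_
      filter_upwards [hAbdd] with ω hω
      exact (norm_inner_le_norm _ _).trans (mul_le_mul
        (hAle ω hω _ 1 (e.orthonormal.1 n).le) (hK _) (norm_nonneg _) (by positivity))
    have h2 (n : ℕ) : Integrable
        (fun ω => fderiv ℝ Φ ω (i (e n)) * ⟪A ω (e n), smoothGrad i Ψ ω⟫_ℝ) μ := by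
      refine integrable_smooth_mul (hΦ.fderiv_apply _) ?_
      refine Integrable.of_bound ((hAmeas _).inner mgΨ) (C * 1 * CΨ') ?_
      filter_upwards [hAbdd] with ω hω
      exact (norm_inner_le_norm _ _).trans (mul_le_mul
        (hAle ω hω _ 1 (e.orthonormal.1 n).le) (hCΨ' _) (norm_nonneg _) (by positivity))
    have h3 (n : ℕ) : ∫ ω, Ψ ω * fderiv ℝ Φ ω (i (e n)) * b n ω ∂μ =
        ∫ ω, Ψ ω * ⟪A ω (e n), ∑ j, ⟪smoothGrad i (φ j) ω, e n⟫_ℝ • c j⟫_ℝ ∂μ +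
          ∫ ω, fderiv ℝ Φ ω (i (e n)) * ⟪A ω (e n), smoothGrad i Ψ ω⟫_ℝ ∂μ := by
      -- The divergence of `A eₙ` is tested on `Ψ ∂ₙΦ`. The product rule gives a second order term,
      -- which sums to a partial trace, and a term with `∇Ψ`, which sums to `A` applied to the
      -- projected `∇Φ`.
      have h4 := (hb n).2.2 _ (hΨ.mul (hΦ.fderiv_apply (i (e n))))
      rw [← h4, ← integral_add (h1 n) (h2 n)]
      congr 1
      funext ω
      rw [smoothGrad_mul i hΨ.differentiable (hΦ.fderiv_apply _).differentiable,
        inner_add_right, real_inner_smul_right, real_inner_smul_right, (hS ω (e n)).1]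
    calc ∫ ω, Ψ ω * fderiv ℝ Φ ω (∑ k ∈ Finset.range N, b k ω • i (e k)) ∂μ
        = ∫ ω, ∑ k ∈ Finset.range N, Ψ ω * fderiv ℝ Φ ω (i (e k)) * b k ω ∂μ := by
          congr 1
          funext ω
          rw [map_sum, Finset.mul_sum]
          refine Finset.sum_congr rfl fun k _ => ?_
          rw [map_smul, smul_eq_mul]
          ring
      _ = ∑ k ∈ Finset.range N, (∫ ω, Ψ ω * ⟪A ω (e k),
            ∑ j, ⟪smoothGrad i (φ j) ω, e k⟫_ℝ • c j⟫_ℝ ∂μ +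
          ∫ ω, fderiv ℝ Φ ω (i (e k)) * ⟪A ω (e k), smoothGrad i Ψ ω⟫_ℝ ∂μ) := by
          rw [integral_finsetSum _ fun k _ =>
            integrable_smooth_mul (hΨ.mul (hΦ.fderiv_apply (i (e k)))) (hbi k)]
          exact Finset.sum_congr rfl fun k _ => h3 k
      _ = _ := by
          rw [Finset.sum_add_distrib, ← integral_finsetSum _ fun k _ => h1 k,
            ← integral_finsetSum _ fun k _ => h2 k]
          congr 1
          · congr 1
            funext ω
            rw [← sum_inner_finiteRank, Finset.mul_sum]
          · congr 1
            funext ω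
            rw [partialProj_apply, map_sum, sum_inner]
            refine Finset.sum_congr rfl fun k _ => ?_
            rw [map_smul, real_inner_smul_left, inner_smoothGrad i Φ]
  -- the three limits
  have hL : Tendsto (fun N => ∫ ω, Ψ ω * fderiv ℝ Φ ω (∑ k ∈ Finset.range N, b k ω • i (e k)) ∂μ)
      atTop (𝓝 (∫ ω, Ψ ω * fderiv ℝ Φ ω (B ω) ∂μ)) := by
    have hsum (N : ℕ) : MemLp (fun ω => ∑ k ∈ Finset.range N, b k ω • i (e k)) 1 μ :=
      memLp_one_iff_integrable.2 (integrable_finsetSum _ fun k _ => (hbi k).smul_const _)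
    refine tendsto_integral_of_eLpNorm (Eventually.of_forall fun N => integrable_smooth_mul hΨ
      (memLp_one_iff_integrable.1 (hΦ.memLp_fderiv_apply (hsum N)))) (integrable_smooth_mul hΨ
      (memLp_one_iff_integrable.1 (hΦ.memLp_fderiv_apply hB))) ?_
    have h1 := ENNReal.Tendsto.const_mul (a := ENNReal.ofReal (CΨ * CD)) hBsum (Or.inr (by simp))
    rw [mul_zero] at h1
    refine tendsto_of_tendsto_of_tendsto_of_le_of_le tendsto_const_nhds h1 (fun _ => zero_le)
      fun N => ?_
    refine eLpNorm_le_mul_eLpNorm_of_ae_le_mul (ae_of_all _ fun ω => ?_) 1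
    rw [← mul_sub, ← map_sub, norm_mul, mul_assoc]
    have h0 : 0 ≤ CΨ := (norm_nonneg _).trans (hCΨ 0)
    gcongr
    · exact hCΨ ω
    · exact ((fderiv ℝ Φ ω).le_opNorm _).trans (by gcongr; exact hCD ω)
  -- The limit of the partial traces is the trace of the skew operator `A` against the symmetric
  -- second gradient of `Φ`, hence zero; the essential bound on `A` provides the domination.
  have hR1 : Tendsto (fun N => ∫ ω, Ψ ω *
      ∑ j, ⟪A ω (partialProj e N (smoothGrad i (φ j) ω)), c j⟫_ℝ ∂μ) atTop (𝓝 0) := by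
    have h0 : ∫ ω, Ψ ω * ∑ j, ⟪A ω (smoothGrad i (φ j) ω), c j⟫_ℝ ∂μ = 0 := by
      rw [integral_congr_ae (g := fun _ => (0 : ℝ)), integral_zero]
      filter_upwards [hAskew] with ω hω
      rw [sum_inner_eq_zero_of_skew e hω fun x => (hS ω x).2, mul_zero]
    rw [← h0]
    refine tendsto_integral_of_dominated_convergence
      (fun _ => CΨ * ∑ j, C * Cφ j * ‖c j‖) (fun N => ?_) (integrable_const _) (fun N => ?_) ?_
    · refine hΨ.aestronglyMeasurable.mul (Finset.aestronglyMeasurable_fun_sum _ fun j _ => ?_)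
      exact (aestronglyMeasurable_clm_apply e hAmeas ((partialProj e N).continuous.comp_aestronglyMeasurable
        (hφ j).aestronglyMeasurable_smoothGrad)).inner aestronglyMeasurable_const
    · filter_upwards [hAbdd] with ω hω
      rw [norm_mul]
      have h0 : 0 ≤ CΨ := (norm_nonneg _).trans (hCΨ 0)
      refine mul_le_mul (hCΨ ω) ((norm_sum_le _ _).trans (Finset.sum_le_sum fun j _ => ?_))
        (norm_nonneg _) h0
      refine (norm_inner_le_norm _ _).trans ?_
      gcongr
      exact hAle ω hω _ _ ((norm_partialProj_le e N _).trans (hCφ j ω))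
    · refine ae_of_all _ fun ω => ?_
      refine tendsto_const_nhds.mul (tendsto_finsetSum _ fun j _ => ?_)
      exact (((A ω).continuous.tendsto _).comp (tendsto_partialProj e _)).inner tendsto_const_nhds
  have hR2 : Tendsto (fun N => ∫ ω, ⟪A ω (partialProj e N (smoothGrad i Φ ω)),
      smoothGrad i Ψ ω⟫_ℝ ∂μ) atTop
      (𝓝 (∫ ω, ⟪A ω (smoothGrad i Φ ω), smoothGrad i Ψ ω⟫_ℝ ∂μ)) := by
    refine tendsto_integral_of_dominated_convergence
      (fun _ => C * CΦ' * CΨ') (fun N => ?_) (integrable_const _) (fun N => ?_) ?_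
    · exact (aestronglyMeasurable_clm_apply e hAmeas
        ((partialProj e N).continuous.comp_aestronglyMeasurable mgΦ)).inner mgΨ
    · filter_upwards [hAbdd] with ω hω
      refine (norm_inner_le_norm _ _).trans ?_
      have h0 : 0 ≤ CΦ' := (norm_nonneg _).trans (hCΦ' 0)
      exact mul_le_mul (hAle ω hω _ _ ((norm_partialProj_le e N _).trans (hCΦ' ω))) (hCΨ' ω)
        (norm_nonneg _) (by positivity)
    · refine ae_of_all _ fun ω => ?_
      exact (((A ω).continuous.tendsto _).comp (tendsto_partialProj e _)).inner tendsto_const_nhds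
  have hR := hR1.add hR2
  rw [zero_add] at hR
  refine (tendsto_nhds_unique hL (hR.congr fun N => (key N).symm)).symm

/-- A bounded function with a gradient is approximated by uniformly bounded smooth functionals. -/
lemma IsGradient.exists_bounded_seq [IsProbabilityMeasure μ] (hp : 1 ≤ p) {f : W → ℝ} {u : W → H}
    (h : IsGradient i μ p f u) {R : ℝ} (hR : ∀ᵐ ω ∂μ, |f ω| ≤ R) :
    ∃ (Φ : ℕ → W → ℝ) (C : ℝ), (∀ n, IsSmoothFunctional (Φ n)) ∧ (∀ n ω, ‖Φ n ω‖ ≤ C) ∧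
      (∀ᵐ ω ∂μ, Tendsto (fun n => Φ n ω) atTop (𝓝 (f ω))) ∧
      Tendsto (fun n => eLpNorm (fun ω => smoothGrad i (Φ n) ω - u ω) 1 μ) atTop (𝓝 0) := by
  obtain ⟨hf, hu, Φ, hΦ, hl, hlg⟩ := h
  have hp0 : p ≠ 0 := (lt_of_lt_of_le zero_lt_one hp).ne'
  obtain ⟨ns, hns, hae⟩ := exists_subseq_tendsto_ae hp0
    (fun n => (hΦ n).aestronglyMeasurable) hf.1 hl
  -- A uniform bound is wanted because the approximants will be paired with a function that is only
  -- integrable. Since `θ' = 1` on the range of `f`, truncation does not change the limit of the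
  -- gradients.
  obtain ⟨θ, hθ, hθR⟩ := exists_smooth_truncation R
  obtain ⟨C, hC⟩ := hθ.exists_bound
  obtain ⟨C', hC'⟩ := hθ.exists_fderiv_bound
  have hC'' (x : ℝ) : ‖deriv θ x‖ ≤ C' := by
    rw [norm_deriv_eq_norm_fderiv]
    exact hC' x
  have hθc : Continuous (deriv θ) := hθ.contDiff.continuous_deriv (by simp)
  refine ⟨fun n ω => θ (Φ (ns n) ω), C, fun n => (hΦ (ns n)).comp hθ, fun n ω => hC _, ?_, ?_⟩
  · filter_upwards [hae, hR] with ω h1 h2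
    have h3 := (hθ.continuous.tendsto (f ω)).comp h1
    rwa [(hθR _ h2).1] at h3
  · have hu1 : MemLp u 1 μ := hu.mono_exponent hp
    have hlg' : Tendsto (fun n => eLpNorm (fun ω => smoothGrad i (Φ (ns n)) ω - u ω) 1 μ)
        atTop (𝓝 0) :=
      tendsto_of_tendsto_of_tendsto_of_le_of_le tendsto_const_nhds
        (hlg.comp hns.tendsto_atTop) (fun _ => zero_le) fun n =>
        eLpNorm_le_eLpNorm_of_exponent_le hp
          ((hΦ _).aestronglyMeasurable_smoothGrad.sub hu.1)
    have h1 : Tendsto (fun n => eLpNorm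
        (fun ω => (deriv θ (Φ (ns n) ω) - 1) • u ω) 1 μ) atTop (𝓝 0) := by
      refine tendsto_eLpNorm_zero_of_dominated (G := fun ω => (C' + 1) * ‖u ω‖) one_ne_zero
        (by simp) (Eventually.of_forall fun n => ?_) (hu1.norm.const_mul (C' + 1))
        (Eventually.of_forall fun n => ae_of_all _ fun ω => ?_) ?_
      · exact ((hθc.comp_aestronglyMeasurable (hΦ _).aestronglyMeasurable).sub
          aestronglyMeasurable_const).smul hu.1
      · rw [norm_smul]
        gcongr
        exact (norm_sub_le _ _).trans (add_le_add (hC'' _) (by simp))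
      · filter_upwards [hae, hR] with ω h1 h2
        have h3 := (hθc.tendsto (f ω)).comp h1
        rw [(hθR _ h2).2] at h3
        have h4 := (h3.sub_const 1).smul_const (u ω)
        simpa using h4
    have h2 := (ENNReal.Tendsto.const_mul (a := ENNReal.ofReal C') hlg'
      (Or.inr (by simp))).add h1
    rw [mul_zero, zero_add] at h2
    refine tendsto_of_tendsto_of_tendsto_of_le_of_le tendsto_const_nhds h2 (fun _ => zero_le)
      fun n => ?_
    have h3 : (fun ω => smoothGrad i (fun ω => θ (Φ (ns n) ω)) ω - u ω) =
        (fun ω => deriv θ (Φ (ns n) ω) • (smoothGrad i (Φ (ns n)) ω - u ω)) +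
          fun ω => (deriv θ (Φ (ns n) ω) - 1) • u ω := by
      funext ω
      rw [smoothGrad_comp i (hΦ _).differentiable hθ.differentiable]
      simp only [Pi.add_apply, smul_sub, sub_smul, one_smul]
      abel
    have m1 : AEStronglyMeasurable (fun ω => deriv θ (Φ (ns n) ω)) μ :=
      hθc.comp_aestronglyMeasurable (hΦ _).aestronglyMeasurable
    rw [h3]
    refine (eLpNorm_add_le (m1.smul ((hΦ _).aestronglyMeasurable_smoothGrad.sub hu.1))
      ((m1.sub aestronglyMeasurable_const).smul hu.1) le_rfl).trans ?_
    refine add_le_add (eLpNorm_le_mul_eLpNorm_of_ae_le_mul (ae_of_all _ fun ω => ?_) 1) le_rfl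
    change ‖deriv θ (Φ (ns n) ω) • (smoothGrad i (Φ (ns n)) ω - u ω)‖ ≤ _
    rw [norm_smul]
    gcongr
    exact hC'' _

/-- The identity of `integral_inner_smoothGrad` extends to bounded functions with a gradient. -/
lemma IsGradient.integral_inner_eq [IsProbabilityMeasure μ] (hp : 1 ≤ p) (e : HilbertBasis ℕ ℝ H)
    {A : W → H →L[ℝ] H} (hAmeas : ∀ h, AEStronglyMeasurable (fun ω => A ω h) μ)
    {C : ℝ} (hAbdd : ∀ᵐ ω ∂μ, ‖A ω‖ ≤ C) {Ψ : W → ℝ} (hΨ : IsSmoothFunctional Ψ) {g : W → ℝ}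
    (hg : Integrable g μ)
    (hid : ∀ Φ : W → ℝ, IsSmoothFunctional Φ →
      ∫ ω, ⟪A ω (smoothGrad i Ψ ω), smoothGrad i Φ ω⟫_ℝ ∂μ = ∫ ω, Φ ω * g ω ∂μ)
    {f : W → ℝ} {u : W → H} (h : IsGradient i μ p f u) {R : ℝ} (hR : ∀ᵐ ω ∂μ, |f ω| ≤ R) :
    ∫ ω, ⟪A ω (smoothGrad i Ψ ω), u ω⟫_ℝ ∂μ = ∫ ω, f ω * g ω ∂μ := by
  obtain ⟨Φ, K, hΦ, hK, hae, hlg⟩ := h.exists_bounded_seq hp hR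
  have hu1 : MemLp u 1 μ := h.2.1.mono_exponent hp
  obtain ⟨CΨ', hCΨ'⟩ := (hΨ.cbSmooth.smoothGrad i).exists_bound
  have hv : AEStronglyMeasurable (fun ω => A ω (smoothGrad i Ψ ω)) μ :=
    aestronglyMeasurable_clm_apply e hAmeas hΨ.aestronglyMeasurable_smoothGrad
  have hvb : ∀ᵐ ω ∂μ, ‖A ω (smoothGrad i Ψ ω)‖ ≤ C * CΨ' := by
    filter_upwards [hAbdd] with ω hω
    exact ((A ω).le_opNorm _).trans (mul_le_mul hω (hCΨ' ω) (norm_nonneg _)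
      ((norm_nonneg _).trans hω))
  have hint (w : W → H) (hw : MemLp w 1 μ) :
      Integrable (fun ω => ⟪A ω (smoothGrad i Ψ ω), w ω⟫_ℝ) μ := by
    refine memLp_one_iff_integrable.1 (hw.of_le_mul (c := C * CΨ') (hv.inner hw.1) ?_)
    filter_upwards [hvb] with ω hω
    exact (norm_inner_le_norm _ _).trans (by gcongr)
  have hL : Tendsto (fun n => ∫ ω, ⟪A ω (smoothGrad i Ψ ω), smoothGrad i (Φ n) ω⟫_ℝ ∂μ) atTop
      (𝓝 (∫ ω, ⟪A ω (smoothGrad i Ψ ω), u ω⟫_ℝ ∂μ)) := by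
    have hm (n : ℕ) : MemLp (smoothGrad i (Φ n)) 1 μ :=
      ((hΦ n).isSmoothField_smoothGrad i).memLp 1
    refine tendsto_integral_of_eLpNorm (Eventually.of_forall fun n => hint _ (hm n))
      (hint u hu1) ?_
    have h1 := ENNReal.Tendsto.const_mul (a := ENNReal.ofReal (C * CΨ')) hlg (Or.inr (by simp))
    rw [mul_zero] at h1
    refine tendsto_of_tendsto_of_tendsto_of_le_of_le tendsto_const_nhds h1 (fun _ => zero_le)
      fun n => ?_
    refine eLpNorm_le_mul_eLpNorm_of_ae_le_mul ?_ 1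
    filter_upwards [hvb] with ω hω
    rw [← inner_sub_right]
    exact (norm_inner_le_norm _ _).trans (by gcongr)
  have hRl : Tendsto (fun n => ∫ ω, Φ n ω * g ω ∂μ) atTop (𝓝 (∫ ω, f ω * g ω ∂μ)) := by
    refine tendsto_integral_of_dominated_convergence (fun ω => K * ‖g ω‖)
      (fun n => (hΦ n).aestronglyMeasurable.mul hg.1) (hg.norm.const_mul K)
      (fun n => ae_of_all _ fun ω => ?_) ?_
    · rw [norm_mul]
      gcongr
      exact hK n ω
    · filter_upwards [hae] with ω hω
      exact hω.mul_const _
  exact tendsto_nhds_unique hL (hRl.congr fun n => (hid _ (hΦ n)).symm)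

end DivergenceIdentities

/-! ### The conjugate function on the circle: M. Riesz' theorem for exponents 4m -/

open Real Metric

/-- An inequality behind the `L^q` boundedness of the conjugate function. -/
theorem exists_pow_le_re_pow (m : ℕ) : ∃ C : ℝ, 0 ≤ C ∧ ∀ x y : ℝ,
    y ^ (4 * m) ≤ 2 * (((x : ℂ) - y * Complex.I) ^ (4 * m)).re + C * x ^ (4 * m) := by
  -- By homogeneity only `s = x / y` matters. The exponent is a multiple of 4, so `(s - i)^(4m)`
  -- equals 1 at `s = 0` and its real part exceeds 1/2 for `|s| < δ`. When `|x| ≥ δ |y|` the term in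
  -- `x` absorbs everything.
  have hcont : Continuous fun s : ℝ => (((s : ℂ) - Complex.I) ^ (4 * m)).re := by fun_prop
  have h0 : (((0 : ℝ) : ℂ) - Complex.I) ^ (4 * m) = 1 := by
    rw [pow_mul]
    simp [show (-Complex.I) ^ 4 = 1 by rw [neg_pow]; norm_num]
  have hev : ∀ᶠ s : ℝ in 𝓝 0, (1 / 2 : ℝ) < (((s : ℂ) - Complex.I) ^ (4 * m)).re := by
    refine hcont.continuousAt.eventually_const_lt ?_
    simp only [h0]; norm_num
  obtain ⟨δ, hδ, hδ'⟩ := Metric.eventually_nhds_iff.1 hev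
  -- The factor 3 is one for `y^(4m)` itself plus two for twice the possibly negative real part, in
  -- the case `|y| ≤ |x| / δ`.
  refine ⟨3 * (1 + 1 / δ) ^ (4 * m), by positivity, fun x y => ?_⟩
  have hev4 : Even (4 * m) := ⟨2 * m, by ring⟩
  have hx : 0 ≤ x ^ (4 * m) := hev4.pow_nonneg x
  by_cases hxy : |x| < δ * |y|
  · have hy : y ≠ 0 := by
      rintro rfl
      simp at hxy
      linarith [abs_nonneg x]
    have hs := hδ' (y := x / y) (by
      rw [Real.dist_eq, sub_zero, abs_div, div_lt_iff₀ (abs_pos.2 hy)]; exact hxy)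
    have he : ((x : ℂ) - y * Complex.I) ^ (4 * m) =
        ((y ^ (4 * m) : ℝ) : ℂ) * (((x / y : ℝ) : ℂ) - Complex.I) ^ (4 * m) := by
      have hyc : (y : ℂ) ≠ 0 := by exact_mod_cast hy
      push_cast
      rw [← mul_pow]
      congr 1
      field_simp
    rw [he, Complex.re_ofReal_mul]
    have hy4 : 0 ≤ y ^ (4 * m) := hev4.pow_nonneg y
    have : 0 ≤ 3 * (1 + 1 / δ) ^ (4 * m) * x ^ (4 * m) := by positivity
    nlinarith
  · push Not at hxy
    have hy : |y| ≤ |x| / δ := by rw [le_div_iff₀ hδ]; linarith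
    have h1 : y ^ (4 * m) ≤ (1 + 1 / δ) ^ (4 * m) * x ^ (4 * m) := by
      rw [← hev4.pow_abs y, ← hev4.pow_abs x, ← mul_pow]
      gcongr
      calc |y| ≤ |x| / δ := hy
        _ ≤ (1 + 1 / δ) * |x| := by
          have := abs_nonneg x
          rw [add_mul, one_mul, div_mul_eq_mul_div, one_mul]; linarith
    have h2 : -((1 + 1 / δ) ^ (4 * m) * x ^ (4 * m)) ≤
        (((x : ℂ) - y * Complex.I) ^ (4 * m)).re := by
      have h3 : ‖((x : ℂ) - y * Complex.I) ^ (4 * m)‖ ≤ (1 + 1 / δ) ^ (4 * m) * x ^ (4 * m) := by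
        rw [norm_pow, ← hev4.pow_abs x, ← mul_pow]
        gcongr
        calc ‖(x : ℂ) - y * Complex.I‖ ≤ ‖(x : ℂ)‖ + ‖(y : ℂ) * Complex.I‖ := norm_sub_le _ _
          _ = |x| + |y| := by simp
          _ ≤ |x| + |x| / δ := by gcongr
          _ = (1 + 1 / δ) * |x| := by ring
      have h4 := Complex.abs_re_le_norm (((x : ℂ) - y * Complex.I) ^ (4 * m))
      have h5 := neg_abs_le (((x : ℂ) - y * Complex.I) ^ (4 * m)).re
      linarith
    nlinarith

/-- The Poisson kernel of the disc, as a function of the angle. -/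
def poissonKer (ρ t : ℝ) : ℝ := (1 - ρ ^ 2) / (1 - 2 * ρ * cos t + ρ ^ 2)

/-- The conjugate Poisson kernel of the disc, as a function of the angle. -/
def conjPoissonKer (ρ t : ℝ) : ℝ := 2 * ρ * sin t / (1 - 2 * ρ * cos t + ρ ^ 2)

theorem poissonKer_denom_pos {ρ : ℝ} (h0 : 0 ≤ ρ) (h1 : ρ < 1) (t : ℝ) :
    0 < 1 - 2 * ρ * cos t + ρ ^ 2 := by
  nlinarith [cos_le_one t, mul_nonneg h0 (sub_nonneg.2 (cos_le_one t)), sq_nonneg (1 - ρ),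
    mul_pos (sub_pos.2 h1) (sub_pos.2 h1)]

theorem continuous_poissonKer {ρ : ℝ} (h0 : 0 ≤ ρ) (h1 : ρ < 1) : Continuous (poissonKer ρ) := by
  unfold poissonKer
  exact continuous_const.div (by fun_prop) fun t => (poissonKer_denom_pos h0 h1 t).ne'

theorem continuous_conjPoissonKer {ρ : ℝ} (h0 : 0 ≤ ρ) (h1 : ρ < 1) :
    Continuous (conjPoissonKer ρ) := by
  unfold conjPoissonKer
  exact Continuous.div (by fun_prop) (by fun_prop) fun t => (poissonKer_denom_pos h0 h1 t).ne'

theorem poissonKer_nonneg {ρ : ℝ} (h0 : 0 ≤ ρ) (h1 : ρ < 1) (t : ℝ) : 0 ≤ poissonKer ρ t :=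
  div_nonneg (by nlinarith) (poissonKer_denom_pos h0 h1 t).le

/-- After division by `exp(iφ)` only the difference of the angles remains. Real boundary data
integrated against this kernel thus produce a holomorphic function whose real and imaginary parts
are the Poisson and minus the conjugate Poisson transforms. -/
theorem herglotzRieszKernel_circleMap {ρ : ℝ} (h0 : 0 ≤ ρ) (h1 : ρ < 1) (φ t : ℝ) :
    herglotzRieszKernel 0 (circleMap 0 ρ φ) (circleMap 0 1 (t + φ)) =
      (poissonKer ρ t : ℂ) - (conjPoissonKer ρ t : ℂ) * Complex.I := by
  have hd := poissonKer_denom_pos h0 h1 t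
  have hdc : (1 - 2 * ρ * Complex.cos t + (ρ : ℂ) ^ 2) ≠ 0 := by
    have := hd.ne'
    exact_mod_cast this
  have hE : Complex.exp (φ * Complex.I) ≠ 0 := Complex.exp_ne_zero _
  have hcs : Complex.cos t ^ 2 + Complex.sin t ^ 2 = 1 := Complex.cos_sq_add_sin_sq _
  have hne : Complex.exp (t * Complex.I) - ρ ≠ 0 := by
    intro h
    have h2 : Complex.exp (t * Complex.I) = ρ := sub_eq_zero.1 h
    have := congrArg norm h2
    rw [Complex.norm_exp_ofReal_mul_I, Complex.norm_real, Real.norm_eq_abs, abs_of_nonneg h0] at this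
    linarith
  have hker : herglotzRieszKernel 0 (circleMap 0 ρ φ) (circleMap 0 1 (t + φ)) =
      (Complex.exp (t * Complex.I) + ρ) / (Complex.exp (t * Complex.I) - ρ) := by
    rw [herglotzRieszKernel_def]
    simp only [circleMap, sub_zero, zero_add, Complex.ofReal_one, one_mul, Complex.ofReal_add,
      add_mul, Complex.exp_add]
    rw [← add_mul, ← sub_mul, mul_div_mul_right _ _ hE]
  rw [hker, div_eq_iff hne, poissonKer, conjPoissonKer, Complex.exp_mul_I]
  push_cast
  have hI : Complex.I ^ 2 = -1 := Complex.I_sq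
  rw [div_mul_eq_mul_div, ← sub_div, div_mul_eq_mul_div, eq_div_iff hdc]
  linear_combination (-2 * (ρ : ℂ)) * hcs + 2 * (ρ : ℂ) * Complex.sin t ^ 2 * hI

/-- Poisson's formula for the constant function 1. -/
theorem integral_poissonKer {ρ : ℝ} (h0 : 0 ≤ ρ) (h1 : ρ < 1) :
    ∫ t in (0 : ℝ)..2 * π, poissonKer ρ t = 2 * π := by
  have h := DiffContOnCl.circleAverage_poissonKernel_smul (f := fun _ => (1 : ℂ)) (c := 0) (R := 1)
    (w := circleMap 0 ρ 0) diffContOnCl_const (by simpa [circleMap, abs_of_nonneg h0] using h1)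
  rw [circleAverage_def, intervalIntegral.integral_congr
    (g := fun t => ((poissonKer ρ t : ℝ) : ℂ))] at h
  · rw [intervalIntegral.integral_ofReal] at h
    rw [inv_smul_eq_iff₀ (by positivity)] at h
    have := congrArg Complex.re h
    simpa using this
  · intro t _
    have h2 := herglotzRieszKernel_circleMap h0 h1 0 t
    rw [add_zero] at h2
    simp [poissonKernel_eq_re_herglotzRieszKernel, h2]

/-- The tangent line inequality for even powers. -/
theorem tangent_le_pow {n : ℕ} (hn : Even n) (a c : ℝ) :
    c ^ n + n * c ^ (n - 1) * (a - c) ≤ a ^ n := by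
  rcases Nat.eq_zero_or_pos n with rfl | hpos
  · simp
  have key : ∀ a c : ℝ, 0 ≤ a → 0 ≤ c → n * c ^ (n - 1) * a ≤ a ^ n + (n - 1) * c ^ n := by
    intro a c ha hc
    have h1n : (1 : ℝ) ≤ n := by exact_mod_cast hpos
    rcases hc.eq_or_lt with rfl | hc
    · rw [zero_pow hpos.ne', mul_zero, add_zero]
      rcases Nat.eq_or_lt_of_le hpos with h | h
      · exact absurd hn (by rw [← h]; decide)
      · rw [zero_pow (by omega)]; simp [pow_nonneg ha]
    -- Bernoulli's inequality for the ratio `a / c`.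
    · have hb := one_add_mul_le_pow (a := a / c - 1) (by have := div_nonneg ha hc.le; linarith) n
      rw [add_sub_cancel, div_pow, le_div_iff₀ (by positivity)] at hb
      have hcn : c ^ n = c ^ (n - 1) * c := by rw [← pow_succ]; congr 1; omega
      have : (1 + n * (a / c - 1)) * c ^ n = c ^ n - n * c ^ n + n * c ^ (n - 1) * a := by
        rw [hcn]; field_simp; ring
      linarith
  have h1 := key |a| |c| (abs_nonneg _) (abs_nonneg _)
  rw [hn.pow_abs, hn.pow_abs] at h1
  have h2 : n * c ^ (n - 1) * a ≤ n * |c| ^ (n - 1) * |a| := by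
    rw [mul_assoc, mul_assoc, ← abs_pow, ← abs_mul]
    exact mul_le_mul_of_nonneg_left (le_abs_self _) (Nat.cast_nonneg _)
  have hcn : c ^ n = c ^ (n - 1) * c := by rw [← pow_succ]; congr 1; omega
  have h3 : c ^ n + n * c ^ (n - 1) * (a - c) = n * c ^ (n - 1) * a - (n - 1) * c ^ n := by
    rw [hcn]; ring
  linarith

/-- Jensen's inequality for even powers and a weight of integral one. -/
theorem pow_integral_mul_le {α : Type*} [MeasurableSpace α] {ν : Measure α} {w f : α → ℝ} {n : ℕ}
    (hn : Even n) (hw0 : ∀ x, 0 ≤ w x) (hw : Integrable w ν) (hw1 : ∫ x, w x ∂ν = 1)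
    (hwf : Integrable (fun x => w x * f x) ν) (hwfn : Integrable (fun x => w x * f x ^ n) ν) :
    (∫ x, w x * f x ∂ν) ^ n ≤ ∫ x, w x * f x ^ n ∂ν := by
  set c := ∫ x, w x * f x ∂ν with hc
  have h1 : ∫ x, (w x * (c ^ n - n * c ^ (n - 1) * c) + n * c ^ (n - 1) * (w x * f x)) ∂ν = c ^ n := by
    rw [integral_add (hw.mul_const _) (hwf.const_mul _), integral_mul_const, integral_const_mul,
      hw1, ← hc]
    ring
  rw [← h1]
  refine integral_mono ((hw.mul_const _).add (hwf.const_mul _)) hwfn fun x => ?_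
  have := mul_le_mul_of_nonneg_left (tangent_le_pow hn (f x) c) (hw0 x)
  simp only
  linarith

/-- Jensen's inequality for even powers on an interval. -/
theorem pow_intervalIntegral_mul_le {a b : ℝ} (hab : a ≤ b) {w f : ℝ → ℝ} {n : ℕ} (hn : Even n)
    (hw0 : ∀ x, 0 ≤ w x) (hw : Continuous w) (hw1 : ∫ x in a..b, w x = 1) (hf : Continuous f) :
    (∫ x in a..b, w x * f x) ^ n ≤ ∫ x in a..b, w x * f x ^ n := by
  have hi : ∀ g : ℝ → ℝ, Continuous g → Integrable g (volume.restrict (Set.Ioc a b)) :=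
    fun g hg => (hg.intervalIntegrable a b).1
  rw [intervalIntegral.integral_of_le hab] at hw1 ⊢
  rw [intervalIntegral.integral_of_le hab]
  exact pow_integral_mul_le hn hw0 (hi w hw) hw1 (hi _ (hw.mul hf)) (hi _ (hw.mul (hf.pow n)))

theorem integral_circleMap_add (f : ℂ → ℝ) (φ : ℝ) :
    ∫ t in (0 : ℝ)..2 * π, f (circleMap 0 1 (t + φ)) =
      ∫ t in (0 : ℝ)..2 * π, f (circleMap 0 1 t) := by
  have h1 := circleAverage_eq_integral_add (f := f) (c := 0) (R := 1) φ
  rw [circleAverage_def] at h1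
  exact (smul_right_injective ℝ (r := (2 * π)⁻¹) (by positivity) h1).symm

/-- The `L^q` boundedness of the conjugate function on the circle, `q ∈ 4ℕ`. -/
theorem exists_conjPoissonKer_bound (m : ℕ) : ∃ C : ℝ, 0 ≤ C ∧ ∀ ρ : ℝ, 0 ≤ ρ →
    ρ < 1 → ∀ G : ℂ → ℝ, Continuous G →
      ∫ φ in (0 : ℝ)..2 * π,
        (∫ t in (0 : ℝ)..2 * π, conjPoissonKer ρ t * G (circleMap 0 1 (t + φ))) ^ (4 * m) ≤
      C * ∫ t in (0 : ℝ)..2 * π, G (circleMap 0 1 t) ^ (4 * m) := by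
  obtain ⟨C, hC, hpow⟩ := exists_pow_le_re_pow m
  -- `P` carries the normalisation `1 / (2π)` and `Q` does not, whence the power of `2π`; 2 and `C`
  -- are the constants of the pointwise inequality.
  refine ⟨(2 * π) ^ (4 * m) * (2 + C), by positivity, fun ρ h0 h1 G hG => ?_⟩
  have hn : Even (4 * m) := ⟨2 * m, by ring⟩
  have h2π : (0 : ℝ) ≤ 2 * π := by positivity
  have hPc := continuous_poissonKer h0 h1
  have hQc := continuous_conjPoissonKer h0 h1
  set N := ∫ t in (0 : ℝ)..2 * π, G (circleMap 0 1 t) ^ (4 * m) with hN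
  have hNs : ∀ φ, ∫ t in (0 : ℝ)..2 * π, G (circleMap 0 1 (t + φ)) ^ (4 * m) = N := fun φ =>
    integral_circleMap_add (fun z => G z ^ (4 * m)) φ
  set P : ℝ → ℝ := fun φ =>
    ∫ t in (0 : ℝ)..2 * π, ((2 * π)⁻¹ * poissonKer ρ t) * G (circleMap 0 1 (t + φ)) with hP
  set Q : ℝ → ℝ := fun φ =>
    ∫ t in (0 : ℝ)..2 * π, conjPoissonKer ρ t * G (circleMap 0 1 (t + φ)) with hQ
  have hPcont : Continuous P := by
    refine intervalIntegral.continuous_parametric_intervalIntegral_of_continuous' ?_ _ _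
    simp only [Function.uncurry_def]
    fun_prop
  have hQcont : Continuous Q := by
    refine intervalIntegral.continuous_parametric_intervalIntegral_of_continuous' ?_ _ _
    simp only [Function.uncurry_def]
    fun_prop
  -- the holomorphic function with boundary real part `G`
  have hGint : CircleIntegrable (fun z => (G z : ℂ)) 0 1 :=
    (Complex.continuous_ofReal.comp hG).continuousOn.circleIntegrable zero_le_one
  set h : ℂ → ℂ := fun w =>
    circleAverage (fun ζ => herglotzRieszKernel 0 w ζ • (G ζ : ℂ)) 0 1 with hh
  have hval : ∀ φ, h (circleMap 0 ρ φ) = (P φ : ℂ) - ((2 * π)⁻¹ * Q φ : ℝ) * Complex.I := by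
    intro φ
    simp only [hh]
    rw [circleAverage_eq_integral_add φ]
    have hi1 : IntervalIntegrable (fun t => ((((2 * π)⁻¹ * poissonKer ρ t) *
        G (circleMap 0 1 (t + φ)) : ℝ) : ℂ)) volume 0 (2 * π) :=
      Continuous.intervalIntegrable (by fun_prop) _ _
    have hi2 : IntervalIntegrable (fun t => (2 * π : ℂ)⁻¹ * ((conjPoissonKer ρ t *
        G (circleMap 0 1 (t + φ)) : ℝ) : ℂ) * Complex.I) volume 0 (2 * π) :=
      Continuous.intervalIntegrable (by fun_prop) _ _
    have hP' : (P φ : ℂ) = ∫ t in (0 : ℝ)..2 * π, ((((2 * π)⁻¹ * poissonKer ρ t) *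
        G (circleMap 0 1 (t + φ)) : ℝ) : ℂ) := by
      rw [intervalIntegral.integral_ofReal]
    have hQ' : (((2 * π)⁻¹ * Q φ : ℝ) : ℂ) * Complex.I = ∫ t in (0 : ℝ)..2 * π,
        (2 * π : ℂ)⁻¹ * ((conjPoissonKer ρ t * G (circleMap 0 1 (t + φ)) : ℝ) : ℂ) *
          Complex.I := by
      rw [intervalIntegral.integral_mul_const, intervalIntegral.integral_const_mul,
        intervalIntegral.integral_ofReal]
      push_cast
      rfl
    rw [hP', hQ', ← intervalIntegral.integral_sub hi1 hi2, ← intervalIntegral.integral_smul]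
    refine intervalIntegral.integral_congr fun t _ => ?_
    rw [herglotzRieszKernel_circleMap h0 h1, smul_eq_mul, Complex.real_smul]
    push_cast
    ring
  -- By the mean value property the average of `h^(4m)` over the circle of radius `ρ` is
  -- `h(0)^(4m)`. Since `h(0)` is the mean of `G`, Jensen bounds this by the mean of `G^(4m)`.
  have hmean : ∫ φ in (0 : ℝ)..2 * π, (((P φ : ℂ) - ((2 * π)⁻¹ * Q φ : ℝ) * Complex.I) ^
      (4 * m)).re ≤ N := by
    have hdiff : DiffContOnCl ℂ (fun w => h w ^ (4 * m)) (ball 0 |ρ|) := by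
      rw [abs_of_nonneg h0]
      refine (DifferentiableOn.diffContOnCl ?_).mono (Set.Subset.refl _)
      refine DifferentiableOn.pow ?_ _
      refine (differentiableOn_circleAverage_herglotzRieszKernel_smul hGint).mono ?_
      exact closure_ball_subset_closedBall.trans (closedBall_subset_ball h1)
    have hm1 := hdiff.circleAverage
    rw [circleAverage_def] at hm1
    simp only [hval] at hm1
    rw [inv_smul_eq_iff₀ (by positivity)] at hm1
    have hre := congrArg Complex.reCLM hm1
    rw [← ContinuousLinearMap.intervalIntegral_comp_comm _
      (Continuous.intervalIntegrable (by fun_prop) _ _)] at hre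
    simp only [Complex.reCLM_apply] at hre
    rw [hre]
    have hz : h 0 = ((∫ t in (0 : ℝ)..2 * π, (2 * π)⁻¹ * G (circleMap 0 1 t) : ℝ) : ℂ) := by
      have hk : ∀ t : ℝ, herglotzRieszKernel 0 0 (circleMap 0 1 t) = 1 := by
        intro t
        rw [herglotzRieszKernel_def]
        simp only [sub_zero, add_zero]
        exact div_self (circleMap_ne_center one_ne_zero)
      simp only [hh]
      rw [circleAverage_def]
      simp only [hk, one_smul]
      rw [intervalIntegral.integral_const_mul, intervalIntegral.integral_ofReal]
      simp
    rw [hz, ← Complex.ofReal_pow, Complex.smul_re, Complex.ofReal_re, smul_eq_mul]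
    have hj := pow_intervalIntegral_mul_le h2π hn (w := fun _ => (2 * π)⁻¹)
      (f := fun t => G (circleMap 0 1 t)) (fun _ => by positivity) continuous_const
      (by rw [intervalIntegral.integral_const]; simp; field_simp) (by fun_prop)
    rw [intervalIntegral.integral_const_mul _ (fun t => G (circleMap 0 1 t) ^ (4 * m))] at hj
    calc 2 * π * _ ≤ 2 * π * ((2 * π)⁻¹ * N) := by gcongr
      _ = N := by field_simp
  -- The normalised Poisson kernel is a probability density: Jensen, then Fubini.
  have hPn : ∫ φ in (0 : ℝ)..2 * π, P φ ^ (4 * m) ≤ N := by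
    have hJ : ∀ φ, P φ ^ (4 * m) ≤ ∫ t in (0 : ℝ)..2 * π,
        ((2 * π)⁻¹ * poissonKer ρ t) * G (circleMap 0 1 (t + φ)) ^ (4 * m) := fun φ =>
      pow_intervalIntegral_mul_le h2π hn
        (fun t => mul_nonneg (by positivity) (poissonKer_nonneg h0 h1 t)) (by fun_prop)
        (by rw [intervalIntegral.integral_const_mul, integral_poissonKer h0 h1]; field_simp)
        (by fun_prop)
    have hcont : Continuous fun φ => ∫ t in (0 : ℝ)..2 * π,
        ((2 * π)⁻¹ * poissonKer ρ t) * G (circleMap 0 1 (t + φ)) ^ (4 * m) := by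
      refine intervalIntegral.continuous_parametric_intervalIntegral_of_continuous' ?_ _ _
      simp only [Function.uncurry_def]
      fun_prop
    refine (intervalIntegral.integral_mono_on h2π
      (Continuous.intervalIntegrable (by fun_prop) _ _) (hcont.intervalIntegrable _ _)
      fun φ _ => hJ φ).trans ?_
    rw [intervalIntegral_intervalIntegral_swap]
    · simp only [intervalIntegral.integral_const_mul]
      have : ∀ t, ∫ φ in (0 : ℝ)..2 * π, G (circleMap 0 1 (t + φ)) ^ (4 * m) = N := fun t => by
        simp only [add_comm t]; exact hNs t
      simp only [this]
      rw [intervalIntegral.integral_mul_const, intervalIntegral.integral_const_mul,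
        integral_poissonKer h0 h1]
      field_simp
      rfl
    · refine (ContinuousOn.integrableOn_compact (K := Set.Icc 0 (2 * π) ×ˢ Set.Icc 0 (2 * π))
        (isCompact_Icc.prod isCompact_Icc) (Continuous.continuousOn ?_)).mono_set
        (Set.prod_mono ?_ ?_)
      · simp only [Function.uncurry_def]
        fun_prop
      all_goals
        rw [Set.uIoc_of_le h2π]
        exact Set.Ioc_subset_Icc_self
  have hfin : ∀ φ, Q φ ^ (4 * m) ≤ (2 * π) ^ (4 * m) *
      (2 * (((P φ : ℂ) - ((2 * π)⁻¹ * Q φ : ℝ) * Complex.I) ^ (4 * m)).re +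
        C * P φ ^ (4 * m)) := by
    intro φ
    have := hpow (P φ) ((2 * π)⁻¹ * Q φ)
    rw [mul_pow, inv_pow, inv_mul_le_iff₀ (by positivity)] at this
    exact this
  calc ∫ φ in (0 : ℝ)..2 * π, Q φ ^ (4 * m)
      ≤ ∫ φ in (0 : ℝ)..2 * π, (2 * π) ^ (4 * m) *
        (2 * (((P φ : ℂ) - ((2 * π)⁻¹ * Q φ : ℝ) * Complex.I) ^ (4 * m)).re +
          C * P φ ^ (4 * m)) :=
        intervalIntegral.integral_mono_on h2π (Continuous.intervalIntegrable (by fun_prop) _ _)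
          (Continuous.intervalIntegrable (by fun_prop) _ _) fun φ _ => hfin φ
    _ = (2 * π) ^ (4 * m) * (2 * ∫ φ in (0 : ℝ)..2 * π,
          (((P φ : ℂ) - ((2 * π)⁻¹ * Q φ : ℝ) * Complex.I) ^ (4 * m)).re) +
        (2 * π) ^ (4 * m) * (C * ∫ φ in (0 : ℝ)..2 * π, P φ ^ (4 * m)) := by
        rw [intervalIntegral.integral_const_mul, intervalIntegral.integral_add
          (Continuous.intervalIntegrable (by fun_prop) _ _)
          (Continuous.intervalIntegrable (by fun_prop) _ _), intervalIntegral.integral_const_mul,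
          intervalIntegral.integral_const_mul, mul_add]
    _ ≤ (2 * π) ^ (4 * m) * (2 * N) + (2 * π) ^ (4 * m) * (C * N) := by gcongr
    _ = _ := by ring

/-! ### A singular kernel seeing only the right half circle in the limit -/

/-- The bounded correction making `sin θ * hilbertKer ρ θ` converge to `cos θ` on the right half
circle and to zero on the left half circle. -/
def hilbertCorr (t : ℝ) : ℝ := (if 0 < cos t then cos t - 1 else -(1 + cos t)) / (2 * sin t)

theorem sin_mul_hilbertCorr (t : ℝ) :
    sin t * hilbertCorr t = (if 0 < cos t then cos t - 1 else -(1 + cos t)) / 2 := by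
  unfold hilbertCorr
  by_cases hs : sin t = 0
  · rcases sin_eq_zero_iff_cos_eq.1 hs with h | h
    · simp [h]
    · simp [h]; norm_num
  · field_simp

/-- Up to the sign and a factor 1/2, the correction is `tan (t/2)` on the right half circle and `cot
(t/2)` on the left one, and both are bounded there. Where `sin t = 0` division by zero gives 0. -/
theorem abs_hilbertCorr_le (t : ℝ) : |hilbertCorr t| ≤ 1 := by
  have h := sin_sq_add_cos_sq t
  unfold hilbertCorr
  rw [abs_div]
  refine div_le_one_of_le₀ (sq_le_sq.1 ?_) (abs_nonneg _)
  split_ifs with hc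
  · nlinarith [cos_le_one t]
  · nlinarith [neg_one_le_cos t]

theorem measurable_hilbertCorr : Measurable hilbertCorr := by
  unfold hilbertCorr
  refine Measurable.div (Measurable.ite (measurableSet_lt measurable_const measurable_cos) ?_ ?_) ?_
  all_goals fun_prop

/-- A kernel on the circle, odd and singular at the origin as `ρ → 1`. -/
def hilbertKer (ρ t : ℝ) : ℝ := conjPoissonKer ρ t / 2 + hilbertCorr t

theorem measurable_hilbertKer {ρ : ℝ} (h0 : 0 ≤ ρ) (h1 : ρ < 1) : Measurable (hilbertKer ρ) :=
  ((continuous_conjPoissonKer h0 h1).measurable.div_const 2).add measurable_hilbertCorr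

/-- This bound degenerates as `ρ → 1` and serves only integrability and Fubini for fixed `ρ`. -/
theorem exists_abs_hilbertKer_le {ρ : ℝ} (h0 : 0 ≤ ρ) (h1 : ρ < 1) :
    ∃ C, ∀ t, |hilbertKer ρ t| ≤ C := by
  refine ⟨1 / (1 - ρ) ^ 2 + 1, fun t => (abs_add_le _ _).trans
    (add_le_add ?_ (abs_hilbertCorr_le t))⟩
  have hd := poissonKer_denom_pos h0 h1 t
  have h2 : (1 - ρ) ^ 2 ≤ 1 - 2 * ρ * cos t + ρ ^ 2 := by
    nlinarith [mul_nonneg h0 (sub_nonneg.2 (cos_le_one t))]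
  have h3 : 0 < (1 - ρ) ^ 2 := by have := sub_pos.2 h1; positivity
  rw [conjPoissonKer, abs_div, abs_div, abs_mul, abs_mul, abs_two, abs_of_nonneg h0,
    abs_of_pos hd, div_right_comm, mul_assoc, mul_div_cancel_left₀ _ two_ne_zero]
  gcongr
  calc ρ * |sin t| ≤ 1 * 1 := by gcongr; exact abs_sin_le_one t
    _ = 1 := one_mul 1

/-- The factor `sin t` cancels the singularity at the origin. The bound is uniform in `ρ` and
dominates the passage `ρ → 1`. -/
theorem abs_sin_mul_hilbertKer_le {ρ : ℝ} (h0 : 0 ≤ ρ) (h1 : ρ < 1) (t : ℝ) :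
    |sin t * hilbertKer ρ t| ≤ 3 := by
  have hd := poissonKer_denom_pos h0 h1 t
  have hs := sin_sq_add_cos_sq t
  rw [hilbertKer, mul_add]
  refine (abs_add_le _ _).trans ?_
  have h2 : |sin t * (conjPoissonKer ρ t / 2)| ≤ 2 := by
    have : sin t * (conjPoissonKer ρ t / 2) = ρ * sin t ^ 2 / (1 - 2 * ρ * cos t + ρ ^ 2) := by
      rw [conjPoissonKer]; field_simp
    rw [this, abs_of_nonneg (by positivity), div_le_iff₀ hd]
    nlinarith [cos_le_one t, neg_one_le_cos t, sq_nonneg (1 - ρ),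
      mul_nonneg h0 (sub_nonneg.2 (cos_le_one t)),
      mul_nonneg (mul_nonneg h0 (sub_nonneg.2 (cos_le_one t))) (sub_nonneg.2 (cos_le_one t))]
  have h3 : |sin t * hilbertCorr t| ≤ 1 := by
    rw [abs_mul]
    calc |sin t| * |hilbertCorr t| ≤ 1 * 1 := by
          gcongr
          exacts [abs_sin_le_one t, abs_hilbertCorr_le t]
      _ = 1 := one_mul 1
  linarith

/-- As `ρ → 1` the conjugate Poisson kernel tends to `cot (t/2)`, and `sin t * cot (t/2) / 2 = (1 +
cos t) / 2`. The correction turns this into `cos t` on the right half circle and 0 on the left. -/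
theorem tendsto_sin_mul_hilbertKer {t : ℝ} (hs : sin t ≠ 0) :
    Tendsto (fun n : ℕ => sin t * hilbertKer (1 - 1 / (n + 1)) t) atTop
      (𝓝 (max (cos t) 0)) := by
  have hρ : Tendsto (fun n : ℕ => (1 : ℝ) - 1 / (n + 1)) atTop (𝓝 1) := by
    simpa using tendsto_const_nhds.sub (tendsto_one_div_add_atTop_nhds_zero_nat (𝕜 := ℝ))
  have hval : max (cos t) 0 =
      (1 + cos t) / 2 + (if 0 < cos t then cos t - 1 else -(1 + cos t)) / 2 := by
    split_ifs with h
    · rw [max_eq_left h.le]; ring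
    · rw [max_eq_right (not_lt.1 h)]; ring
  rw [hval]
  simp only [hilbertKer, mul_add, sin_mul_hilbertCorr]
  refine Tendsto.add_const _ ?_
  · have hc : cos t ≠ 1 := fun h => hs (sin_eq_zero_iff_cos_eq.2 (Or.inl h))
    have hlim : Tendsto (fun ρ : ℝ => sin t * (conjPoissonKer ρ t / 2)) (𝓝 1)
        (𝓝 (sin t * (conjPoissonKer 1 t / 2))) := by
      refine ContinuousAt.tendsto (f := fun ρ : ℝ => sin t * (conjPoissonKer ρ t / 2)) ?_
      unfold conjPoissonKer
      have : (1 : ℝ) - 2 * 1 * cos t + 1 ^ 2 ≠ 0 := by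
        intro h; apply hc; linarith
      fun_prop (disch := assumption)
    have he : sin t * (conjPoissonKer 1 t / 2) = (1 + cos t) / 2 := by
      have h2 : (1 : ℝ) - 2 * 1 * cos t + 1 ^ 2 ≠ 0 := by
        intro h; apply hc; linarith
      rw [conjPoissonKer]
      rw [div_div, mul_div_assoc', div_eq_div_iff (by positivity) two_ne_zero]
      linear_combination 4 * sin_sq_add_cos_sq t
    rw [← he]
    exact hlim.comp hρ

theorem continuous_intervalIntegral_mul {X : Type*} [TopologicalSpace X]
    [FirstCountableTopology X] {k : ℝ → ℝ} {F : X → ℝ → ℝ} {C C' : ℝ} (hk : Measurable k)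
    (hkC : ∀ t, |k t| ≤ C) (hF : ∀ t, Continuous fun x => F x t) (hF' : ∀ x, Continuous (F x))
    (hFC : ∀ x t, |F x t| ≤ C') (a b : ℝ) : Continuous fun x => ∫ t in a..b, k t * F x t := by
  refine intervalIntegral.continuous_of_dominated_interval (bound := fun _ => C * C')
    (fun x => (hk.mul (hF' x).measurable).aestronglyMeasurable) (fun x => ?_)
    intervalIntegrable_const ?_
  · refine Eventually.of_forall fun t _ => ?_
    rw [Real.norm_eq_abs, abs_mul]
    exact mul_le_mul (hkC t) (hFC x t) (abs_nonneg _) ((abs_nonneg _).trans (hkC t))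
  · exact Eventually.of_forall fun t _ => continuous_const.mul (hF t)

theorem intervalIntegrable_of_abs_le {f : ℝ → ℝ} {C : ℝ} (hf : Measurable f)
    (hC : ∀ t, |f t| ≤ C) (a b : ℝ) : IntervalIntegrable f volume a b :=
  (intervalIntegrable_const (c := C)).mono_fun hf.aestronglyMeasurable
    (Eventually.of_forall fun t => (hC t).trans (le_abs_self C))

/-- The kernels `hilbertKer ρ` act boundedly on `L^q` of the circle, uniformly in `ρ`. -/
theorem exists_hilbertKer_bound (m : ℕ) : ∃ C : ℝ, 0 ≤ C ∧ ∀ ρ : ℝ, 0 ≤ ρ →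
    ρ < 1 → ∀ G : ℂ → ℝ, Continuous G →
      ∫ φ in (0 : ℝ)..2 * π,
        (∫ t in (0 : ℝ)..2 * π, hilbertKer ρ t * G (circleMap 0 1 (t + φ))) ^ (4 * m) ≤
      C * ∫ t in (0 : ℝ)..2 * π, G (circleMap 0 1 t) ^ (4 * m) := by
  obtain ⟨C, hC, hbd⟩ := exists_conjPoissonKer_bound m
  -- Convexity of the power splits the kernel at the cost of `2^(4m-1)`. The divisor `2^(4m)` comes
  -- from halving the conjugate kernel, and `(2π)^(4m)` from Jensen applied to the correction, which
  -- is bounded by 1.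
  refine ⟨2 ^ (4 * m - 1) * (C / 2 ^ (4 * m) + (2 * π) ^ (4 * m)), by positivity,
    fun ρ h0 h1 G hG => ?_⟩
  have hn : Even (4 * m) := ⟨2 * m, by ring⟩
  have h2π : (0 : ℝ) ≤ 2 * π := by positivity
  set N := ∫ t in (0 : ℝ)..2 * π, G (circleMap 0 1 t) ^ (4 * m) with hN
  have hQc := continuous_conjPoissonKer h0 h1
  obtain ⟨R, hR⟩ : ∃ R, ∀ t, |G (circleMap 0 1 t)| ≤ R := by
    obtain ⟨R, hR⟩ := (isCompact_sphere (0 : ℂ) 1).exists_bound_of_continuousOn hG.continuousOn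
    exact ⟨R, fun t => hR _ (circleMap_mem_sphere 0 zero_le_one t)⟩
  set Q : ℝ → ℝ := fun φ =>
    ∫ t in (0 : ℝ)..2 * π, conjPoissonKer ρ t * G (circleMap 0 1 (t + φ)) with hQ
  set S : ℝ → ℝ := fun φ =>
    ∫ t in (0 : ℝ)..2 * π, hilbertCorr t * G (circleMap 0 1 (t + φ)) with hS
  have hQcont : Continuous Q := by
    refine intervalIntegral.continuous_parametric_intervalIntegral_of_continuous' ?_ _ _
    simp only [Function.uncurry_def]
    fun_prop
  have hScont : Continuous S :=
    continuous_intervalIntegral_mul (F := fun φ t => G (circleMap 0 1 (t + φ)))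
      measurable_hilbertCorr abs_hilbertCorr_le (by fun_prop) (by fun_prop)
      (fun x t => hR (t + x)) _ _
  have hSint : ∀ φ, IntervalIntegrable (fun t => hilbertCorr t * G (circleMap 0 1 (t + φ)))
      volume 0 (2 * π) := fun φ =>
    intervalIntegrable_of_abs_le (C := 1 * R) (measurable_hilbertCorr.mul
      (Continuous.measurable (by fun_prop))) (fun t => by
        rw [Pi.mul_apply, abs_mul]
        exact mul_le_mul (abs_hilbertCorr_le t) (hR _) (abs_nonneg _) zero_le_one) _ _
  have hsplit : ∀ φ, ∫ t in (0 : ℝ)..2 * π, hilbertKer ρ t * G (circleMap 0 1 (t + φ)) =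
      Q φ / 2 + S φ := by
    intro φ
    rw [hQ, hS]
    simp only
    rw [← intervalIntegral.integral_div, ← intervalIntegral.integral_add
      (Continuous.intervalIntegrable (by fun_prop) _ _) (hSint φ)]
    refine intervalIntegral.integral_congr fun t _ => ?_
    simp only [hilbertKer]
    ring
  have hSn : ∀ φ, S φ ^ (4 * m) ≤ (2 * π) ^ (4 * m) * ((2 * π)⁻¹ * N) := by
    intro φ
    have hGn : IntervalIntegrable (fun t => (2 * π)⁻¹ * G (circleMap 0 1 (t + φ)) ^ (4 * m))
        volume 0 (2 * π) := Continuous.intervalIntegrable (by fun_prop) _ _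
    have hle : ∀ t, (hilbertCorr t * G (circleMap 0 1 (t + φ))) ^ (4 * m) ≤
        G (circleMap 0 1 (t + φ)) ^ (4 * m) := by
      intro t
      rw [← hn.pow_abs, ← hn.pow_abs (G _), abs_mul]
      gcongr
      calc _ ≤ 1 * |G (circleMap 0 1 (t + φ))| := by
            gcongr
            exact abs_hilbertCorr_le t
        _ = _ := one_mul _
    have hint : IntervalIntegrable (fun t => (2 * π)⁻¹ *
        (hilbertCorr t * G (circleMap 0 1 (t + φ))) ^ (4 * m)) volume 0 (2 * π) := by
      refine hGn.mono_fun (Measurable.aestronglyMeasurable ?_) (Eventually.of_forall fun t => ?_)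
      · exact ((measurable_hilbertCorr.mul (Continuous.measurable (by fun_prop))).pow_const
          _).const_mul _
      · simp only
        rw [norm_mul, norm_mul, Real.norm_of_nonneg (hn.pow_nonneg _),
          Real.norm_of_nonneg (hn.pow_nonneg _)]
        exact mul_le_mul_of_nonneg_left (hle t) (norm_nonneg _)
    have hj := pow_integral_mul_le (ν := volume.restrict (Set.Ioc 0 (2 * π))) hn
      (w := fun _ => (2 * π)⁻¹) (f := fun t => hilbertCorr t * G (circleMap 0 1 (t + φ)))
      (fun _ => by positivity) (integrable_const _) (by
        simp [h2π]; field_simp) ((hSint φ).1.const_mul _) hint.1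
    rw [← intervalIntegral.integral_of_le h2π, ← intervalIntegral.integral_of_le h2π,
      intervalIntegral.integral_const_mul, mul_pow, inv_pow, inv_mul_le_iff₀ (by positivity)] at hj
    refine hj.trans (mul_le_mul_of_nonneg_left ?_ (by positivity))
    refine (intervalIntegral.integral_mono_on h2π hint hGn fun t _ => ?_).trans ?_
    · exact mul_le_mul_of_nonneg_left (hle t) (by positivity)
    · rw [intervalIntegral.integral_const_mul,
        integral_circleMap_add (fun z => G z ^ (4 * m)) φ]
  have hfin : ∀ φ, (∫ t in (0 : ℝ)..2 * π, hilbertKer ρ t * G (circleMap 0 1 (t + φ))) ^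
      (4 * m) ≤ 2 ^ (4 * m - 1) * (Q φ ^ (4 * m) / 2 ^ (4 * m) +
        (2 * π) ^ (4 * m) * ((2 * π)⁻¹ * N)) := by
    intro φ
    rw [hsplit]
    refine hn.add_pow_le.trans ?_
    rw [div_pow]
    gcongr
    exact hSn φ
  refine (intervalIntegral.integral_mono_on h2π
    (Continuous.intervalIntegrable (by simp only [hsplit]; fun_prop) _ _)
    (Continuous.intervalIntegrable (by fun_prop) _ _) fun φ _ => hfin φ).trans ?_
  rw [intervalIntegral.integral_const_mul, intervalIntegral.integral_add
    (Continuous.intervalIntegrable (by fun_prop) _ _) intervalIntegrable_const,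
    intervalIntegral.integral_div, intervalIntegral.integral_const, smul_eq_mul, sub_zero]
  have h3 : (∫ φ in (0 : ℝ)..2 * π, Q φ ^ (4 * m)) / 2 ^ (4 * m) ≤ C * N / 2 ^ (4 * m) :=
    div_le_div_of_nonneg_right (hbd ρ h0 h1 G hG) (by positivity)
  have h4 : 2 * π * ((2 * π) ^ (4 * m) * ((2 * π)⁻¹ * N)) = (2 * π) ^ (4 * m) * N := by
    field_simp
  rw [h4, mul_assoc]
  refine mul_le_mul_of_nonneg_left ?_ (by positivity)
  calc _ ≤ C * N / 2 ^ (4 * m) + (2 * π) ^ (4 * m) * N := by gcongr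
    _ = _ := by ring

/-! ### Transference from the circle to Gaussian space -/

open Real

variable {W H : Type*} [NormedAddCommGroup W] [NormedSpace ℝ W] [CompleteSpace W]
  [TopologicalSpace.SeparableSpace W] [MeasurableSpace W] [BorelSpace W] [NormedAddCommGroup H]
  [InnerProductSpace ℝ H] [CompleteSpace H] {i : H →L[ℝ] W} {μ : Measure W}

theorem continuous_hilbertKer_rotation {E : Type*} [NormedAddCommGroup E] [NormedSpace ℝ E]
    {X : Type*} [TopologicalSpace X] [FirstCountableTopology X] {ρ : ℝ} (h0 : 0 ≤ ρ)
    (h1 : ρ < 1) {g : X → E → ℝ} (hg : Continuous fun z : X × E => g z.1 z.2) {R : ℝ}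
    (hR : ∀ x z, |g x z| ≤ R) {f₁ f₂ : X → E} (hf₁ : Continuous f₁) (hf₂ : Continuous f₂) :
    Continuous fun x : X =>
      ∫ t in (0 : ℝ)..2 * π, hilbertKer ρ t * g x (cos t • f₁ x + sin t • f₂ x) := by
  obtain ⟨C, hC⟩ := exists_abs_hilbertKer_le h0 h1
  exact continuous_intervalIntegral_mul (F := fun x t => g x (cos t • f₁ x + sin t • f₂ x))
    (measurable_hilbertKer h0 h1) hC
    (fun t => hg.comp (by fun_prop : Continuous fun x => (x, cos t • f₁ x + sin t • f₂ x)))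
    (fun x => hg.comp (by fun_prop : Continuous fun t => (x, cos t • f₁ x + sin t • f₂ x)))
    (fun x t => hR _ _) _ _

theorem abs_intervalIntegral_hilbertKer_le {ρ : ℝ} {C R : ℝ} (hC : ∀ t, |hilbertKer ρ t| ≤ C)
    {f : ℝ → ℝ} (hf : ∀ t, |f t| ≤ R) :
    |∫ t in (0 : ℝ)..2 * π, hilbertKer ρ t * f t| ≤ C * R * (2 * π) := by
  have := intervalIntegral.norm_integral_le_of_norm_le_const (a := 0) (b := 2 * π)
    (f := fun t => hilbertKer ρ t * f t) (C := C * R) (fun t _ => by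
      rw [Real.norm_eq_abs, abs_mul]
      exact mul_le_mul (hC t) (hf t) (abs_nonneg _) ((abs_nonneg _).trans (hC t)))
  rwa [sub_zero, abs_of_nonneg (by positivity : (0 : ℝ) ≤ 2 * π), Real.norm_eq_abs] at this

/-- Transference of the circle kernels to Gaussian space: by rotation invariance of `μ ⊗ μ`, the
operators `g ↦ ∫ hilbertKer ρ t * g (cos t x + sin t y) dt` are bounded from `L^q(μ)` to
`L^q(μ ⊗ μ)`, uniformly in `ρ`. -/
theorem IsAbstractWienerSpace.exists_transference_bound (hμ : IsAbstractWienerSpace i μ) (m : ℕ) :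
    ∃ C : ℝ, 0 ≤ C ∧ ∀ ρ : ℝ, 0 ≤ ρ → ρ < 1 → ∀ (g : W → ℝ) (R : ℝ), Continuous g →
      (∀ x, |g x| ≤ R) →
      ∫ x, (∫ t in (0 : ℝ)..2 * π, hilbertKer ρ t * g (cos t • x.1 + sin t • x.2)) ^ (4 * m)
        ∂(μ.prod μ) ≤ C * ∫ x, g x ^ (4 * m) ∂μ := by
  have := hμ.isProbabilityMeasure
  have := UniformSpace.secondCountable_of_separable W
  obtain ⟨C, hC0, hC⟩ := exists_hilbertKer_bound m
  refine ⟨C, hC0, fun ρ h0 h1 g R hg hR => ?_⟩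
  have h2π : (0 : ℝ) ≤ 2 * π := by positivity
  obtain ⟨C₁, hC₁⟩ := exists_abs_hilbertKer_le h0 h1
  have : IsFiniteMeasure ((volume : Measure ℝ).restrict (Set.uIoc 0 (2 * π))) := by
    rw [Set.uIoc_of_le h2π]; infer_instance
  set F : W × W → ℝ := fun x =>
    (∫ t in (0 : ℝ)..2 * π, hilbertKer ρ t * g (cos t • x.1 + sin t • x.2)) ^ (4 * m) with hF
  have hFc : Continuous F :=
    (continuous_hilbertKer_rotation h0 h1 (g := fun _ => g) (hg.comp continuous_snd)
      (fun _ => hR) continuous_fst continuous_snd).pow _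
  have hFb : ∀ x, ‖F x‖ ≤ (C₁ * R * (2 * π)) ^ (4 * m) := fun x => by
    simp only [hF]
    rw [norm_pow, Real.norm_eq_abs]
    exact pow_le_pow_left₀ (abs_nonneg _)
      (abs_intervalIntegral_hilbertKer_le hC₁ fun t => hR _) _
  set rot : ℝ → W × W → W × W := fun φ x =>
    (cos φ • x.1 + sin φ • x.2, -sin φ • x.1 + cos φ • x.2) with hrot
  have hrotc : Continuous fun z : ℝ × (W × W) => rot z.1 z.2 := by
    simp only [hrot]
    fun_prop
  have hJ : ∀ φ, ∫ x, F (rot φ x) ∂(μ.prod μ) = ∫ x, F x ∂(μ.prod μ) := fun φ =>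
    integral_comp_of_measurePreserving
      (hμ.measurePreserving_rotation_pair (by rw [cos_sq_add_sin_sq]))
      hFc.aestronglyMeasurable
  have hFi : Integrable (Function.uncurry fun φ x => F (rot φ x))
      ((volume.restrict (Set.uIoc 0 (2 * π))).prod (μ.prod μ)) := by
    refine Integrable.of_bound (hFc.comp hrotc).aestronglyMeasurable
      ((C₁ * R * (2 * π)) ^ (4 * m)) (Eventually.of_forall fun z => hFb _)
  have hgi : Integrable (Function.uncurry fun (t : ℝ) (x : W × W) =>
      g (cos t • x.1 + sin t • x.2) ^ (4 * m))
      ((volume.restrict (Set.uIoc 0 (2 * π))).prod (μ.prod μ)) := by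
    refine Integrable.of_bound (Continuous.aestronglyMeasurable ?_)
      (R ^ (4 * m)) (Eventually.of_forall fun z => ?_)
    · simp only [Function.uncurry_def]
      fun_prop
    · simp only [Function.uncurry_def]
      rw [norm_pow, Real.norm_eq_abs]
      exact pow_le_pow_left₀ (abs_nonneg _) (hR _) _
  -- For fixed `x`, `φ ↦ F (rot φ x)` is the power of the circle operator applied to `g` along the
  -- closed curve `cos t • x.1 + sin t • x.2`. Integrating the circle estimate over `x`, rotation
  -- invariance removes the angle on both sides.
  have hcircle : ∀ x : W × W, ∫ φ in (0 : ℝ)..2 * π, F (rot φ x) ≤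
      C * ∫ t in (0 : ℝ)..2 * π, g (cos t • x.1 + sin t • x.2) ^ (4 * m) := by
    intro x
    have h := hC ρ h0 h1 (fun z => g (z.re • x.1 + z.im • x.2)) (by fun_prop)
    have hre : ∀ t : ℝ, (circleMap 0 1 t).re = cos t := fun t => by
      simp [circleMap, Complex.exp_ofReal_mul_I_re]
    have him : ∀ t : ℝ, (circleMap 0 1 t).im = sin t := fun t => by
      simp [circleMap, Complex.exp_ofReal_mul_I_im]
    simp only [hre, him] at h
    refine le_trans (le_of_eq ?_) h
    simp only [hF, hrot]
    congr! 7 with φ t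
    rw [cos_add, sin_add]
    module
  have hswap : (2 * π) * ∫ x, F x ∂(μ.prod μ) =
      ∫ x, (∫ φ in (0 : ℝ)..2 * π, F (rot φ x)) ∂(μ.prod μ) := by
    rw [← intervalIntegral_integral_swap hFi]
    simp only [hJ]
    rw [intervalIntegral.integral_const, sub_zero, smul_eq_mul]
  have hswap' : ∫ x, (∫ t in (0 : ℝ)..2 * π, g (cos t • x.1 + sin t • x.2) ^ (4 * m))
      ∂(μ.prod μ) = (2 * π) * ∫ x, g x ^ (4 * m) ∂μ := by
    rw [← intervalIntegral_integral_swap hgi]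
    have : ∀ t : ℝ, ∫ x : W × W, g (cos t • x.1 + sin t • x.2) ^ (4 * m) ∂(μ.prod μ) =
        ∫ x, g x ^ (4 * m) ∂μ := fun t =>
      integral_comp_of_measurePreserving (g := fun x => g x ^ (4 * m))
        (hμ.measurePreserving_rotation (by rw [cos_sq_add_sin_sq]))
        (hg.pow _).aestronglyMeasurable
    simp only [this]
    rw [intervalIntegral.integral_const, sub_zero, smul_eq_mul]
  have hle : (2 * π) * ∫ x, F x ∂(μ.prod μ) ≤ (2 * π) * (C * ∫ x, g x ^ (4 * m) ∂μ) := by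
    rw [hswap, mul_left_comm, ← hswap', ← integral_const_mul]
    refine integral_mono ?_ ?_ hcircle
    · have := hFi.integral_prod_right
      simpa only [Function.uncurry_def, intervalIntegral.integral_of_le h2π,
        Set.uIoc_of_le h2π] using this
    · have := hgi.integral_prod_right
      refine Integrable.const_mul ?_ C
      simpa only [Function.uncurry_def, intervalIntegral.integral_of_le h2π,
        Set.uIoc_of_le h2π] using this
  exact le_of_mul_le_mul_left hle (by positivity)

/-! ### An integral over the half sphere -/

open Real

theorem integral_max_cos_pow (n : ℕ) :
    ∫ t in (0 : ℝ)..2 * π, max (cos t) 0 ^ (n + 1) = ∫ t in (0 : ℝ)..π, sin t ^ (n + 1) := by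
  have hper : Function.Periodic (fun t => max (cos t) 0 ^ (n + 1)) (2 * π) := fun t => by
    simp
  have h1 := hper.intervalIntegral_add_eq 0 (-(π / 2))
  rw [zero_add] at h1
  have hi : ∀ a b, IntervalIntegrable (fun t => max (cos t) 0 ^ (n + 1)) volume a b := fun a b =>
    Continuous.intervalIntegrable (by fun_prop) _ _
  rw [h1, ← intervalIntegral.integral_add_adjacent_intervals (hi _ (π / 2)) (hi _ _)]
  have h2 : ∫ t in (π / 2)..(-(π / 2) + 2 * π), max (cos t) 0 ^ (n + 1) = 0 := by
    rw [intervalIntegral.integral_congr (g := fun _ => 0)]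
    · simp
    · intro t ht
      rw [Set.uIcc_of_le (by linarith [pi_pos])] at ht
      have : cos t ≤ 0 := cos_nonpos_of_pi_div_two_le_of_le ht.1 (by linarith [ht.2])
      simp [this]
  have h3 : ∫ t in (-(π / 2))..(π / 2), max (cos t) 0 ^ (n + 1) =
      ∫ t in (-(π / 2))..(π / 2), sin (t + π / 2) ^ (n + 1) := by
    refine intervalIntegral.integral_congr fun t ht => ?_
    rw [Set.uIcc_of_le (by linarith [pi_pos])] at ht
    have : 0 ≤ cos t := cos_nonneg_of_mem_Icc ht
    simp only [max_eq_left this, sin_add_pi_div_two]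
  rw [h2, h3, add_zero, intervalIntegral.integral_comp_add_right (fun t => sin t ^ (n + 1))]
  congr 1 <;> ring

/-- Wallis' recursion makes the left side independent of `n`; at `n = 0` it is `π * 2`. -/
theorem integral_sin_pow_mul_integral_sin_pow_succ (n : ℕ) :
    (n + 1) * ((∫ t in (0 : ℝ)..π, sin t ^ n) * ∫ t in (0 : ℝ)..π, sin t ^ (n + 1)) = 2 * π := by
  induction n with
  | zero => simp; ring
  | succ n ih =>
    rw [integral_sin_pow (n := n)]
    simp only [sin_zero, sin_pi]
    rw [← ih]
    push_cast
    field_simp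
    ring

/-- A change of variables on the half sphere, for monomials. -/
theorem integral_halfSphere_pow (n : ℕ) :
    ∫ t in (0 : ℝ)..2 * π, max (cos t) 0 * ∫ s in (0 : ℝ)..2 * π,
      max (cos s) 0 ^ 2 * (max (cos t) 0 * max (cos s) 0) ^ n =
    2 * π * ∫ t in (0 : ℝ)..(π / 2), cos t * sin t * cos t ^ n := by
  have h1 : ∀ t s : ℝ, max (cos s) 0 ^ 2 * (max (cos t) 0 * max (cos s) 0) ^ n =
      max (cos t) 0 ^ n * max (cos s) 0 ^ (n + 1 + 1) := fun t s => by ring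
  simp only [h1, intervalIntegral.integral_const_mul, ← mul_assoc, ← pow_succ']
  rw [intervalIntegral.integral_mul_const, integral_max_cos_pow, integral_max_cos_pow]
  have h2 : ∫ t in (0 : ℝ)..(π / 2), cos t * sin t * cos t ^ n = 1 / (n + 2) := by
    have hd : ∀ t ∈ Set.uIcc (0 : ℝ) (π / 2), HasDerivAt (fun t => -(cos t ^ (n + 2)) / (n + 2))
        (cos t * sin t * cos t ^ n) t := fun t _ => by
      have := ((hasDerivAt_cos t).fun_pow (n + 2)).neg.div_const ((n : ℝ) + 2)
      refine this.congr_deriv ?_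
      have : (n : ℝ) + 2 ≠ 0 := by positivity
      field_simp
      push_cast
      ring
    rw [intervalIntegral.integral_eq_sub_of_hasDerivAt hd
      (Continuous.intervalIntegrable (by fun_prop) _ _)]
    simp
    ring
  have h3 := integral_sin_pow_mul_integral_sin_pow_succ (n + 1)
  push_cast at h3
  rw [h2]
  have : (n : ℝ) + 2 ≠ 0 := by positivity
  field_simp
  rw [← h3]
  ring

/-- A change of variables on the half sphere. -/
theorem integral_halfSphere {j : ℝ → ℝ} (hj : Continuous j) :
    ∫ t in (0 : ℝ)..2 * π, max (cos t) 0 * ∫ s in (0 : ℝ)..2 * π,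
      max (cos s) 0 ^ 2 * j (max (cos t) 0 * max (cos s) 0) =
    2 * π * ∫ t in (0 : ℝ)..(π / 2), cos t * sin t * j (cos t) := by
  -- Geometrically, `(cos t cos s, sin t cos s, sin s)` parametrises the sphere with area element
  -- `cos s dt ds`, and the slices where the first coordinate is `cos θ` have area `2π sin θ dθ`.
  -- Surface measure is avoided: the defect `L` is additive on continuous functions, vanishes on
  -- polynomials, and is bounded by the supremum on `[0, 1]`, so Weierstrass' theorem gives the
  -- claim.
  set L : (ℝ → ℝ) → ℝ := fun j => (∫ t in (0 : ℝ)..2 * π, max (cos t) 0 *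
    ∫ s in (0 : ℝ)..2 * π, max (cos s) 0 ^ 2 * j (max (cos t) 0 * max (cos s) 0)) -
    2 * π * ∫ t in (0 : ℝ)..(π / 2), cos t * sin t * j (cos t) with hL
  have hin : ∀ f : ℝ → ℝ, Continuous f → Continuous fun t : ℝ => max (cos t) 0 *
      ∫ s in (0 : ℝ)..2 * π, max (cos s) 0 ^ 2 * f (max (cos t) 0 * max (cos s) 0) := by
    intro f hf
    refine Continuous.mul (by fun_prop) ?_
    refine intervalIntegral.continuous_parametric_intervalIntegral_of_continuous' ?_ _ _
    simp only [Function.uncurry_def]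
    fun_prop
  have hadd : ∀ f g : ℝ → ℝ, Continuous f → Continuous g → L (fun c => f c + g c) = L f + L g := by
    intro f g hf hg
    simp only [hL, mul_add]
    have e1 : ∀ t : ℝ, ∫ s in (0 : ℝ)..2 * π, (max (cos s) 0 ^ 2 * f (max (cos t) 0 * max (cos s) 0) +
        max (cos s) 0 ^ 2 * g (max (cos t) 0 * max (cos s) 0)) =
        (∫ s in (0 : ℝ)..2 * π, max (cos s) 0 ^ 2 * f (max (cos t) 0 * max (cos s) 0)) +
        ∫ s in (0 : ℝ)..2 * π, max (cos s) 0 ^ 2 * g (max (cos t) 0 * max (cos s) 0) := fun t =>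
      intervalIntegral.integral_add (Continuous.intervalIntegrable (by fun_prop) _ _)
        (Continuous.intervalIntegrable (by fun_prop) _ _)
    simp only [e1, mul_add]
    rw [intervalIntegral.integral_add ((hin f hf).intervalIntegrable _ _)
      ((hin g hg).intervalIntegrable _ _), intervalIntegral.integral_add
      (Continuous.intervalIntegrable (by fun_prop) _ _)
      (Continuous.intervalIntegrable (by fun_prop) _ _)]
    ring
  have hsmul : ∀ (a : ℝ) (f : ℝ → ℝ), L (fun c => a * f c) = a * L f := by
    intro a f
    have e1 : ∀ b c : ℝ, b * (a * c) = a * (b * c) := fun b c => by ring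
    simp only [hL, e1 _ _, intervalIntegral.integral_const_mul]
    ring
  have hpoly : ∀ P : Polynomial ℝ, L (fun c => P.eval c) = 0 := by
    intro P
    induction P using Polynomial.induction_on' with
    | add P Q hP hQ =>
      simp only [Polynomial.eval_add]
      rw [hadd _ _ P.continuous Q.continuous, hP, hQ, add_zero]
    | monomial n a =>
      simp only [Polynomial.eval_monomial]
      rw [hsmul a fun c => c ^ n]
      simp only [hL, integral_halfSphere_pow, sub_self, mul_zero]
  have hbd : ∀ (f : ℝ → ℝ) (ε : ℝ), Continuous f → (∀ c ∈ Set.Icc (0 : ℝ) 1, |f c| ≤ ε) →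
      |L f| ≤ ε * ((2 * π) * (2 * π) + 2 * π * (π / 2)) := by
    intro f ε hf hε
    have hε0 : 0 ≤ ε := (abs_nonneg _).trans (hε 0 (by simp))
    have hc0 : ∀ t : ℝ, 0 ≤ max (cos t) 0 := fun t => le_max_right _ _
    have hc1 : ∀ t : ℝ, max (cos t) 0 ≤ 1 := fun t => max_le (cos_le_one t) zero_le_one
    have i1 : ∀ t : ℝ, |∫ s in (0 : ℝ)..2 * π,
        max (cos s) 0 ^ 2 * f (max (cos t) 0 * max (cos s) 0)| ≤ ε * (2 * π) := by
      intro t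
      have := intervalIntegral.norm_integral_le_of_norm_le_const (a := 0) (b := 2 * π)
        (f := fun s => max (cos s) 0 ^ 2 * f (max (cos t) 0 * max (cos s) 0)) (C := ε)
        (fun s _ => by
          rw [norm_mul, norm_pow, Real.norm_of_nonneg (hc0 s)]
          calc _ ≤ 1 * ε := mul_le_mul (pow_le_one₀ (hc0 s) (hc1 s))
                (hε _ ⟨mul_nonneg (hc0 t) (hc0 s), mul_le_one₀ (hc1 t) (hc0 s) (hc1 s)⟩)
                (abs_nonneg _) zero_le_one
            _ = ε := one_mul ε)
      rwa [sub_zero, abs_of_nonneg (by positivity : (0 : ℝ) ≤ 2 * π), Real.norm_eq_abs] at this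
    have i2 := intervalIntegral.norm_integral_le_of_norm_le_const (a := 0) (b := 2 * π)
      (f := fun t => max (cos t) 0 * ∫ s in (0 : ℝ)..2 * π,
        max (cos s) 0 ^ 2 * f (max (cos t) 0 * max (cos s) 0)) (C := ε * (2 * π))
      (fun t _ => by
          rw [norm_mul, Real.norm_of_nonneg (hc0 t)]
          calc _ ≤ 1 * (ε * (2 * π)) := mul_le_mul (hc1 t) (i1 t) (abs_nonneg _) zero_le_one
            _ = _ := one_mul _)
    have i3 := intervalIntegral.norm_integral_le_of_norm_le_const (a := 0) (b := π / 2)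
      (f := fun t => cos t * sin t * f (cos t)) (C := ε)
      (fun t ht => by
          rw [Set.uIoc_of_le (by positivity)] at ht
          rw [norm_mul, norm_mul]
          calc _ ≤ (1 * 1) * ε := by
                gcongr
                exacts [abs_cos_le_one t, abs_sin_le_one t, hε _ ⟨cos_nonneg_of_mem_Icc
                  ⟨by linarith [ht.1, pi_pos], ht.2⟩, cos_le_one t⟩]
            _ = ε := by ring)
    rw [sub_zero, abs_of_nonneg (by positivity : (0 : ℝ) ≤ 2 * π)] at i2
    rw [sub_zero, abs_of_nonneg (by positivity : (0 : ℝ) ≤ π / 2)] at i3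
    simp only [hL]
    refine (abs_sub _ _).trans ?_
    rw [abs_mul, abs_of_nonneg (by positivity : (0 : ℝ) ≤ 2 * π), mul_add]
    refine add_le_add (i2.trans_eq (by ring)) ?_
    calc _ ≤ 2 * π * (ε * (π / 2)) := mul_le_mul_of_nonneg_left i3 (by positivity)
      _ = _ := by ring
  suffices hz : L j = 0 by simpa only [hL, sub_eq_zero] using hz
  rw [← abs_eq_zero]
  refine le_antisymm (le_of_forall_pos_le_add fun ε hε => ?_) (abs_nonneg _)
  set D := (2 * π) * (2 * π) + 2 * π * (π / 2) with hD
  have hDpos : 0 < D := by positivity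
  obtain ⟨P, hP⟩ := exists_polynomial_near_of_continuousOn 0 1 j hj.continuousOn (ε / D)
    (by positivity)
  have h1 := hadd (fun c => P.eval c) (fun c => j c - P.eval c) P.continuous
    (hj.sub P.continuous)
  simp only [add_sub_cancel] at h1
  rw [h1, hpoly, zero_add, zero_add]
  refine (hbd _ (ε / D) (hj.sub P.continuous) fun c hc => ?_).trans_eq (by field_simp)
  rw [Pi.sub_apply, abs_sub_comm]
  exact (hP c hc).le

theorem ae_sin_ne_zero : ∀ᵐ t : ℝ, sin t ≠ 0 := by
  have : {t : ℝ | ¬ sin t ≠ 0} ⊆ Set.range fun n : ℤ => (n : ℝ) * π := by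
    intro t ht
    obtain ⟨n, hn⟩ := sin_eq_zero_iff.1 (not_not.1 ht)
    exact ⟨n, hn⟩
  exact ((Set.countable_range _).mono this).measure_zero volume

/-- The singular integral giving the integral over the half sphere. -/
theorem tendsto_integral_hilbertKer {j : ℝ → ℝ} (hj : Continuous j) {R : ℝ}
    (hR : ∀ c, |j c| ≤ R) :
    Tendsto (fun n : ℕ => ∫ t in (0 : ℝ)..2 * π, ∫ s in (0 : ℝ)..2 * π,
        (sin t * hilbertKer (1 - 1 / (n + 1)) t) * ((sin s * hilbertKer (1 - 1 / (n + 1)) s) *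
          (cos s * j (cos t * cos s)))) atTop
      (𝓝 (2 * π * ∫ t in (0 : ℝ)..(π / 2), cos t * sin t * j (cos t))) := by
  have hR0 : 0 ≤ R := (abs_nonneg _).trans (hR 0)
  have hρ : ∀ n : ℕ, (0 : ℝ) ≤ 1 - 1 / (n + 1) ∧ (1 : ℝ) - 1 / (n + 1) < 1 := fun n =>
    ⟨by rw [sub_nonneg, div_le_one (by positivity)]; simp, by simp; positivity⟩
  have hin : ∀ t s : ℝ, max (cos t) 0 * (max (cos s) 0 * (cos s * j (cos t * cos s))) =
      max (cos t) 0 * (max (cos s) 0 ^ 2 * j (max (cos t) 0 * max (cos s) 0)) := by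
    intro t s
    rcases le_or_gt (cos t) 0 with ht | ht
    · simp [ht]
    rcases le_or_gt (cos s) 0 with hs | hs
    · simp [hs]
    rw [max_eq_left ht.le, max_eq_left hs.le]
    ring
  have hb : ∀ (n : ℕ) (s c : ℝ), |(sin s * hilbertKer (1 - 1 / (n + 1)) s) *
      (cos s * j c)| ≤ 3 * (1 * R) := by
    intro n s c
    rw [abs_mul, abs_mul (cos s)]
    exact mul_le_mul (abs_sin_mul_hilbertKer_le (hρ n).1 (hρ n).2 s)
      (mul_le_mul (abs_cos_le_one s) (hR _) (abs_nonneg _) zero_le_one) (by positivity)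
      (by norm_num)
  have hbb : ∀ (n : ℕ) (t s c : ℝ), |(sin t * hilbertKer (1 - 1 / (n + 1)) t) *
      ((sin s * hilbertKer (1 - 1 / (n + 1)) s) * (cos s * j c))| ≤ 3 * (3 * (1 * R)) := by
    intro n t s c
    rw [abs_mul]
    exact mul_le_mul (abs_sin_mul_hilbertKer_le (hρ n).1 (hρ n).2 t) (hb n s c) (abs_nonneg _)
      (by norm_num)
  have hm : ∀ n : ℕ, Measurable fun z : ℝ × ℝ => (sin z.1 * hilbertKer (1 - 1 / (n + 1)) z.1) *
      ((sin z.2 * hilbertKer (1 - 1 / (n + 1)) z.2) * (cos z.2 * j (cos z.1 * cos z.2))) := by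
    intro n
    have := measurable_hilbertKer (hρ n).1 (hρ n).2
    have hjm := hj.measurable
    fun_prop
  have hlim : 2 * π * ∫ t in (0 : ℝ)..(π / 2), cos t * sin t * j (cos t) =
      ∫ t in (0 : ℝ)..2 * π, ∫ s in (0 : ℝ)..2 * π,
        max (cos t) 0 * (max (cos s) 0 * (cos s * j (cos t * cos s))) := by
    rw [← integral_halfSphere hj]
    simp only [hin, intervalIntegral.integral_const_mul]
  rw [hlim]
  refine intervalIntegral.tendsto_integral_filter_of_dominated_convergence
    (fun _ => 3 * (3 * (1 * R)) * (2 * π)) (Eventually.of_forall fun n => ?_)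
    (Eventually.of_forall fun n => Eventually.of_forall fun t _ => ?_) intervalIntegrable_const ?_
  · have := (hm n).stronglyMeasurable.integral_prod_right' (ν := volume.restrict (Set.Ioc 0 (2 * π)))
    simp only [intervalIntegral.integral_of_le (by positivity : (0 : ℝ) ≤ 2 * π)]
    exact this.aestronglyMeasurable
  · have := intervalIntegral.norm_integral_le_of_norm_le_const (a := 0) (b := 2 * π)
      (f := fun s => (sin t * hilbertKer (1 - 1 / (n + 1)) t) *
        ((sin s * hilbertKer (1 - 1 / (n + 1)) s) * (cos s * j (cos t * cos s))))
      (C := 3 * (3 * (1 * R))) fun s _ => hbb n t s _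
    rwa [sub_zero, abs_of_nonneg (by positivity : (0 : ℝ) ≤ 2 * π)] at this
  · filter_upwards [ae_sin_ne_zero] with t ht _
    refine intervalIntegral.tendsto_integral_filter_of_dominated_convergence
      (fun _ => 3 * (3 * (1 * R))) (Eventually.of_forall fun n => ?_)
      (Eventually.of_forall fun n => Eventually.of_forall fun s _ => hbb n t s _)
      intervalIntegrable_const ?_
    · exact ((hm n).comp (measurable_prodMk_left (x := t))).aestronglyMeasurable
    · filter_upwards [ae_sin_ne_zero] with s hs _
      exact (tendsto_sin_mul_hilbertKer ht).mul
        ((tendsto_sin_mul_hilbertKer hs).mul tendsto_const_nhds)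

/-! ### Integration by parts along rotations; orthonormal frames -/

open Real

variable {W H : Type*} [NormedAddCommGroup W] [NormedSpace ℝ W] [CompleteSpace W]
  [TopologicalSpace.SeparableSpace W] [MeasurableSpace W] [BorelSpace W] [NormedAddCommGroup H]
  [InnerProductSpace ℝ H] [CompleteSpace H] {i : H →L[ℝ] W} {μ : Measure W}

theorem CbSmooth.comp_smul_add {E F : Type*} [NormedAddCommGroup E] [NormedSpace ℝ E]
    [NormedAddCommGroup F] [NormedSpace ℝ F] {h : E → F} (hh : CbSmooth h) (β : ℝ) (a : E) :
    CbSmooth fun y => h (a + β • y) := by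
  have := (hh.comp_add_right a).comp_clm (β • ContinuousLinearMap.id ℝ E)
  simpa [add_comm] using this

theorem fderiv_comp_smul_add {E F : Type*} [NormedAddCommGroup E] [NormedSpace ℝ E]
    [NormedAddCommGroup F] [NormedSpace ℝ F] {h : E → F} (hh : Differentiable ℝ h) (β : ℝ)
    (a y w : E) : fderiv ℝ (fun y => h (a + β • y)) y w = β • fderiv ℝ h (a + β • y) w := by
  have h1 : HasFDerivAt (fun y : E => a + β • y) (β • ContinuousLinearMap.id ℝ E) y :=
    ((hasFDerivAt_id y).const_smul β).const_add a
  have h2 := (hh (a + β • y)).hasFDerivAt.comp y h1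
  rw [show (fun y => h (a + β • y)) = h ∘ fun y => a + β • y from rfl, h2.fderiv]
  simp

theorem IsAbstractWienerSpace.integrable_mul_comp_smul_add (hμ : IsAbstractWienerSpace i μ)
    {G : W × W → ℝ} (hG : Integrable G (μ.prod μ)) {h : W → ℝ} (hh : CbSmooth h) (α β : ℝ) :
    Integrable (fun x : W × W => G x * h (α • x.1 + β • x.2)) (μ.prod μ) := by
  have := hμ.isProbabilityMeasure
  have := UniformSpace.secondCountable_of_separable W
  obtain ⟨C, hC⟩ := hh.exists_bound
  refine hG.mul_bdd (c := C) ?_ (Eventually.of_forall fun x => hC _)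
  exact (hh.continuous.comp (by fun_prop : Continuous fun x : W × W =>
    α • x.1 + β • x.2)).aestronglyMeasurable

/-- Gaussian integration by parts in the second variable of a rotation. -/
theorem IsAbstractWienerSpace.integral_mul_dual_snd (hμ : IsAbstractWienerSpace i μ)
    (l : StrongDual ℝ W) {g : W → ℝ} (hg : Integrable g μ) {h : W → ℝ} (hh : CbSmooth h)
    (α β : ℝ) :
    ∫ x, g x.1 * l x.2 * h (α • x.1 + β • x.2) ∂(μ.prod μ) =
      β * ∫ x, g x.1 * fderiv ℝ h (α • x.1 + β • x.2) (i (dualEmb i l)) ∂(μ.prod μ) := by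
  have := hμ.isProbabilityMeasure
  rw [integral_prod _ (hμ.integrable_mul_comp_smul_add (hg.mul_prod (hμ.integrable_dual l)) hh α β),
    integral_prod _ (hμ.integrable_mul_comp_smul_add (hg.comp_fst μ)
      (hh.fderiv_apply (i (dualEmb i l))) α β), ← integral_const_mul]
  refine integral_congr_ae (Eventually.of_forall fun x => ?_)
  simp only [mul_assoc]
  rw [integral_const_mul, integral_const_mul, hμ.integral_mul_eq l (hh.comp_smul_add β (α • x))]
  simp only [fderiv_comp_smul_add hh.differentiable, smul_eq_mul, integral_const_mul]
  ring

/-- Gaussian integration by parts in the first variable of a rotation. -/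
theorem IsAbstractWienerSpace.integral_dual_fst_mul (hμ : IsAbstractWienerSpace i μ)
    (l : StrongDual ℝ W) {g : W → ℝ} (hg : CbSmooth g) {h : W → ℝ} (hh : CbSmooth h) (α β : ℝ) :
    ∫ x, l x.1 * g x.1 * h (α • x.1 + β • x.2) ∂(μ.prod μ) =
      (∫ x, fderiv ℝ g x.1 (i (dualEmb i l)) * h (α • x.1 + β • x.2) ∂(μ.prod μ)) +
      α * ∫ x, g x.1 * fderiv ℝ h (α • x.1 + β • x.2) (i (dualEmb i l)) ∂(μ.prod μ) := by
  have := hμ.isProbabilityMeasure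
  have := UniformSpace.secondCountable_of_separable W
  have hint : ∀ {k : W → ℝ}, CbSmooth k → Integrable k μ := fun {k} hk => by
    obtain ⟨C, hC⟩ := hk.exists_bound
    exact Integrable.of_bound hk.continuous.aestronglyMeasurable C (Eventually.of_forall hC)
  have hlg : Integrable (fun x => l x * g x) μ := by
    obtain ⟨C, hC⟩ := hg.exists_bound
    exact (hμ.integrable_dual l).mul_bdd (c := C) hg.continuous.aestronglyMeasurable
      (Eventually.of_forall hC)
  have i1 := hμ.integrable_mul_comp_smul_add (hlg.comp_fst μ) hh α β
  have i2 := hμ.integrable_mul_comp_smul_add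
    ((hint (hg.fderiv_apply (i (dualEmb i l)))).comp_fst μ) hh α β
  have i3 := (hμ.integrable_mul_comp_smul_add ((hint hg).comp_fst μ)
    (hh.fderiv_apply (i (dualEmb i l))) α β).const_mul α
  have e := integral_prod_symm _ (i2.add i3)
  simp only [Pi.add_apply] at e
  rw [← integral_const_mul, ← integral_add i2 i3, integral_prod_symm _ i1, e]
  refine integral_congr_ae (Eventually.of_forall fun y => ?_)
  have hh' := hh.comp_smul_add α (β • y)
  simp only [mul_assoc, add_comm (α • _) (β • y)]
  rw [hμ.integral_mul_eq l (hg.mul hh')]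
  refine integral_congr_ae (Eventually.of_forall fun x => ?_)
  simp only
  rw [fderiv_fun_mul (hg.differentiable x) (hh'.differentiable x)]
  simp only [add_apply, smul_apply, smul_eq_mul,
    fderiv_comp_smul_add hh.differentiable]
  ring

/-- Functionals `Λ a` with orthonormal `i* (Λ a)` through which `χ` factors. -/
structure IsFrame {d : ℕ} (i : H →L[ℝ] W) (Λ : Fin d → StrongDual ℝ W) (χ : W → ℝ) : Prop where
  orthonormal : Orthonormal ℝ fun a => dualEmb i (Λ a)
  eq_of_forall_eq : ∀ x y, (∀ a, Λ a x = Λ a y) → χ x = χ y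

theorem IsFrame.fderiv_apply {d : ℕ} {Λ : Fin d → StrongDual ℝ W} {χ : W → ℝ}
    (hΛ : IsFrame i Λ χ) (w : W) : IsFrame i Λ fun x => fderiv ℝ χ x w := by
  classical
  refine ⟨hΛ.orthonormal, fun x y h => ?_⟩
  rw [fderiv_eq_of_cylindrical (s := Finset.univ.image Λ)
    (fun x y h => hΛ.eq_of_forall_eq x y fun a => h _ (by simp)) (x := x) (y := y) (by simpa using h)]

/-- What remains of `w` after subtracting its frame components is killed by every `Λ a`, and `χ`
does not vary in such a direction. -/
theorem IsFrame.fderiv_eq {d : ℕ} {Λ : Fin d → StrongDual ℝ W} {χ : W → ℝ}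
    (hΛ : IsFrame i Λ χ) (hχ : Differentiable ℝ χ) (x w : W) :
    fderiv ℝ χ x w = ∑ a, Λ a w * fderiv ℝ χ x (i (dualEmb i (Λ a))) := by
  classical
  have h0 : fderiv ℝ χ x (w - ∑ a, Λ a w • i (dualEmb i (Λ a))) = 0 := by
    refine fderiv_apply_eq_zero_of_cylindrical hχ (s := Finset.univ.image Λ)
      (fun x y h => hΛ.eq_of_forall_eq x y fun a => h _ (by simp)) x fun l hl => ?_
    obtain ⟨b, -, rfl⟩ := Finset.mem_image.1 hl
    have : ∀ a, Λ b (i (dualEmb i (Λ a))) = if b = a then 1 else 0 := fun a => by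
      rw [← dualEmb_inner]
      exact orthonormal_iff_ite.1 hΛ.orthonormal b a
    simp [map_sub, map_sum, this]
  rw [map_sub, sub_eq_zero] at h0
  rw [h0, map_sum]
  simp

/-- The range of `i` is dense, so a functional is determined by its restriction to `H`. -/
theorem IsAbstractWienerSpace.dualEmb_injective (hμ : IsAbstractWienerSpace i μ) :
    Function.Injective (dualEmb i) := by
  intro l l' h
  have h1 : ∀ x, l (i x) = l' (i x) := fun x => by rw [← dualEmb_inner, ← dualEmb_inner, h]
  have := hμ.dense.equalizer l.continuous l'.continuous (funext h1)
  exact ContinuousLinearMap.ext fun x => congrFun this x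

/-- The vectors `i* l` span a finite-dimensional subspace of the range of `i*`, so an orthonormal
basis of it lifts to `W*`; injectivity of `i*` then expresses each `l` through the lifted basis. -/
theorem IsSmoothFunctional.exists_isFrame (hμ : IsAbstractWienerSpace i μ) {χ : W → ℝ}
    (hχ : IsSmoothFunctional χ) :
    ∃ (d : ℕ) (Λ : Fin d → StrongDual ℝ W), IsFrame i Λ χ := by
  classical
  obtain ⟨s, hs⟩ := hχ.isCylindrical
  set V := Submodule.span ℝ (dualEmb i '' (s : Set (StrongDual ℝ W))) with hV
  have : FiniteDimensional ℝ V := FiniteDimensional.span_of_finite ℝ (s.finite_toSet.image _)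
  have hVr : ∀ v ∈ V, ∃ l, dualEmb i l = v := by
    intro v hv
    have : V ≤ LinearMap.range (dualEmbL i).toLinearMap := by
      rw [hV, Submodule.span_le]
      rintro _ ⟨l, -, rfl⟩
      exact ⟨l, rfl⟩
    obtain ⟨l, hl⟩ := this hv
    exact ⟨l, hl⟩
  let v := stdOrthonormalBasis ℝ V
  choose Λ hΛ using fun a => hVr (v a) (v a).2
  refine ⟨_, Λ, ⟨?_, fun x y h => hs x y fun l hl => ?_⟩⟩
  · simp only [hΛ]
    exact v.orthonormal.comp_linearIsometry V.subtypeₗᵢ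
  · have hlV : dualEmb i l ∈ V := Submodule.subset_span ⟨l, hl, rfl⟩
    have hl' : l = ∑ a, ⟪v a, (⟨dualEmb i l, hlV⟩ : V)⟫_ℝ • Λ a := by
      apply hμ.dualEmb_injective
      have h1 := congrArg (Subtype.val) (v.sum_repr' ⟨dualEmb i l, hlV⟩)
      rw [← dualEmbL_apply i (∑ a, _), map_sum]
      simp only [map_smul, dualEmbL_apply, hΛ]
      refine h1.symm.trans ?_
      simp
    rw [hl']
    simp [h]

/-! ### E⟪F, ∇χ⟫ as an integral over rotations -/

open Real

variable {W H : Type*} [NormedAddCommGroup W] [NormedSpace ℝ W] [CompleteSpace W]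
  [TopologicalSpace.SeparableSpace W] [MeasurableSpace W] [BorelSpace W] [NormedAddCommGroup H]
  [InnerProductSpace ℝ H] [CompleteSpace H] {i : H →L[ℝ] W} {μ : Measure W}

theorem IsAbstractWienerSpace.integrable_cbSmooth (hμ : IsAbstractWienerSpace i μ) {g : W → ℝ}
    (hg : CbSmooth g) : Integrable g μ := by
  have := hμ.isProbabilityMeasure
  have := UniformSpace.secondCountable_of_separable W
  obtain ⟨C, hC⟩ := hg.exists_bound
  exact Integrable.of_bound hg.continuous.aestronglyMeasurable C (Eventually.of_forall hC)

/-- Differentiation in `θ` applies `Dh` to `-sin θ x + cos θ y`. Integration by parts in `x` and in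
`y` yields second derivatives of `h` with coefficients `-sin θ cos θ` and `sin θ cos θ`, which
cancel; only the term that differentiates `g` survives. -/
theorem IsAbstractWienerSpace.hasDerivAt_integral_rotation (hμ : IsAbstractWienerSpace i μ)
    {d : ℕ} {Λ : Fin d → StrongDual ℝ W} {g h : W → ℝ} (hg : CbSmooth g) (hh : CbSmooth h)
    (hΛ : IsFrame i Λ h) (θ : ℝ) :
    HasDerivAt (fun θ => ∫ x, g x.1 * h (cos θ • x.1 + sin θ • x.2) ∂(μ.prod μ))
      (-sin θ * ∑ b, ∫ x, fderiv ℝ g x.1 (i (dualEmb i (Λ b))) *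
        fderiv ℝ h (cos θ • x.1 + sin θ • x.2) (i (dualEmb i (Λ b))) ∂(μ.prod μ)) θ := by
  have := hμ.isProbabilityMeasure
  have := UniformSpace.secondCountable_of_separable W
  set w : Fin d → W := fun b => i (dualEmb i (Λ b)) with hw
  obtain ⟨Cg, hCg⟩ := hg.exists_bound
  obtain ⟨Ch, hCh⟩ := hh.exists_fderiv_bound
  have hgc := hg.continuous
  have hhc := hh.continuous
  have hi := hμ.integrable_cbSmooth hg
  have i1 : ∀ b, Integrable (fun x : W × W => Λ b x.1 * g x.1 *
      fderiv ℝ h (cos θ • x.1 + sin θ • x.2) (w b)) (μ.prod μ) := fun b => by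
    refine hμ.integrable_mul_comp_smul_add (G := fun x => Λ b x.1 * g x.1) ?_
      (hh.fderiv_apply (w b)) _ _
    exact ((hμ.integrable_dual (Λ b)).mul_bdd (c := Cg) hgc.aestronglyMeasurable
      (Eventually.of_forall hCg)).comp_fst μ
  have i2 : ∀ b, Integrable (fun x : W × W => g x.1 * Λ b x.2 *
      fderiv ℝ h (cos θ • x.1 + sin θ • x.2) (w b)) (μ.prod μ) := fun b =>
    hμ.integrable_mul_comp_smul_add (hi.mul_prod (hμ.integrable_dual (Λ b)))
      (hh.fderiv_apply (w b)) _ _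
  have key := hasDerivAt_integral_of_dominated_loc_of_deriv_le (μ := μ.prod μ) (x₀ := θ)
    (s := Set.univ) (F := fun (θ : ℝ) (x : W × W) => g x.1 * h (cos θ • x.1 + sin θ • x.2))
    (F' := fun (θ : ℝ) (x : W × W) => ∑ b, (-sin θ * (Λ b x.1 * g x.1 *
        fderiv ℝ h (cos θ • x.1 + sin θ • x.2) (w b)) +
      cos θ * (g x.1 * Λ b x.2 * fderiv ℝ h (cos θ • x.1 + sin θ • x.2) (w b))))
    (bound := fun x => ∑ b, (|Λ b x.1| + |Λ b x.2|) * (Cg * (Ch * ‖w b‖)))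
    Filter.univ_mem
    (Eventually.of_forall fun θ => Continuous.aestronglyMeasurable (by fun_prop))
    (hμ.integrable_mul_comp_smul_add (hi.comp_fst μ) hh _ _)
    (Continuous.aestronglyMeasurable (by
      have : ∀ b, Continuous fun x => fderiv ℝ h x (w b) := fun b => (hh.fderiv_apply _).continuous
      fun_prop))
    (Eventually.of_forall fun x θ _ => ?_) ?_ (Eventually.of_forall fun x θ _ => ?_)
  · refine key.2.congr_deriv ?_
    have i3 : ∀ b, Integrable (fun x : W × W => -sin θ * (Λ b x.1 * g x.1 *
        fderiv ℝ h (cos θ • x.1 + sin θ • x.2) (w b)) +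
      cos θ * (g x.1 * Λ b x.2 * fderiv ℝ h (cos θ • x.1 + sin θ • x.2) (w b))) (μ.prod μ) :=
      fun b => ((i1 b).const_mul _).add ((i2 b).const_mul _)
    rw [integral_finsetSum _ fun b _ => i3 b, Finset.mul_sum]
    refine Finset.sum_congr rfl fun b _ => ?_
    rw [integral_add ((i1 b).const_mul _) ((i2 b).const_mul _), integral_const_mul,
      integral_const_mul, hμ.integral_dual_fst_mul (Λ b) hg (hh.fderiv_apply (w b)),
      hμ.integral_mul_dual_snd (Λ b) hi (hh.fderiv_apply (w b))]
    ring
  · refine (norm_sum_le _ _).trans (Finset.sum_le_sum fun b _ => ?_)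
    have hb : |fderiv ℝ h (cos θ • x.1 + sin θ • x.2) (w b)| ≤ Ch * ‖w b‖ :=
      (ContinuousLinearMap.le_opNorm _ _).trans (mul_le_mul_of_nonneg_right (hCh _) (norm_nonneg _))
    have hg' : |g x.1| ≤ Cg := hCg _
    refine (norm_add_le _ _).trans ?_
    rw [add_mul]
    simp only [norm_mul, Real.norm_eq_abs, abs_neg]
    have hCg0 : 0 ≤ Cg := (abs_nonneg _).trans hg'
    have hP : |g x.1| * |fderiv ℝ h (cos θ • x.1 + sin θ • x.2) (w b)| ≤ Cg * (Ch * ‖w b‖) :=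
      mul_le_mul hg' hb (abs_nonneg _) hCg0
    refine add_le_add ?_ ?_
    · calc _ = |sin θ| * (|Λ b x.1| * (|g x.1| *
            |fderiv ℝ h (cos θ • x.1 + sin θ • x.2) (w b)|)) := by ring
        _ ≤ 1 * (|Λ b x.1| * (Cg * (Ch * ‖w b‖))) := by
            gcongr
            exact abs_sin_le_one θ
        _ = _ := one_mul _
    · calc _ = |cos θ| * (|Λ b x.2| * (|g x.1| *
            |fderiv ℝ h (cos θ • x.1 + sin θ • x.2) (w b)|)) := by ring
        _ ≤ 1 * (|Λ b x.2| * (Cg * (Ch * ‖w b‖))) := by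
            gcongr
            exact abs_cos_le_one θ
        _ = _ := one_mul _
  · refine integrable_finsetSum _ fun b _ => Integrable.mul_const ?_ _
    exact ((hμ.integrable_dual (Λ b)).abs.comp_fst μ).add
      ((hμ.integrable_dual (Λ b)).abs.comp_snd μ)
  · have h1 : HasDerivAt (fun θ : ℝ => cos θ • x.1 + sin θ • x.2)
        (-sin θ • x.1 + cos θ • x.2) θ :=
      ((hasDerivAt_cos θ).smul_const x.1).add ((hasDerivAt_sin θ).smul_const x.2)
    have h2 := ((hh.differentiable _).hasFDerivAt.comp_hasDerivAt θ h1).const_mul (g x.1)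
    refine h2.congr_deriv ?_
    rw [hΛ.fderiv_eq hh.differentiable, Finset.mul_sum]
    refine Finset.sum_congr rfl fun b _ => ?_
    simp only [map_add, map_smul, smul_eq_mul]
    ring

theorem IsAbstractWienerSpace.continuous_integral_rotation (hμ : IsAbstractWienerSpace i μ)
    {g h : W → ℝ} (hg : CbSmooth g) (hh : CbSmooth h) {α β : ℝ → ℝ} (hα : Continuous α)
    (hβ : Continuous β) :
    Continuous fun c => ∫ x, g x.1 * h (α c • x.1 + β c • x.2) ∂(μ.prod μ) := by
  have := hμ.isProbabilityMeasure
  have := UniformSpace.secondCountable_of_separable W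
  obtain ⟨Cg, hCg⟩ := hg.exists_bound
  obtain ⟨Ch, hCh⟩ := hh.exists_bound
  have hgc := hg.continuous
  have hhc := hh.continuous
  refine continuous_of_dominated (bound := fun _ => Cg * Ch)
    (fun c => Continuous.aestronglyMeasurable (by fun_prop))
    (fun c => Eventually.of_forall fun x => ?_) (integrable_const _)
    (Eventually.of_forall fun x => by fun_prop)
  rw [norm_mul]
  exact mul_le_mul (hCg _) (hCh _) (norm_nonneg _) ((norm_nonneg _).trans (hCg x.1))

/-- Representation of `E ⟪F, ∇χ⟫` through rotations; here `g a` are the coordinates of `F`. -/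
theorem IsAbstractWienerSpace.sum_integral_mul_fderiv_eq (hμ : IsAbstractWienerSpace i μ)
    {d : ℕ} {Λ : Fin d → StrongDual ℝ W} {χ : W → ℝ} (hχ : CbSmooth χ) (hΛ : IsFrame i Λ χ)
    {g : Fin d → W → ℝ} (hg : ∀ a, CbSmooth (g a)) :
    ∑ a, ∫ x, g a x * fderiv ℝ χ x (i (dualEmb i (Λ a))) ∂μ =
      (∫ θ in (0 : ℝ)..(π / 2),
        ∫ x, (∑ a, g a x.1 * Λ a x.2) * χ (cos θ • x.1 + sin θ • x.2) ∂(μ.prod μ)) +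
      ∫ θ in (0 : ℝ)..(π / 2), cos θ * sin θ *
        ∑ a, ∑ b, ∫ x, fderiv ℝ (g a) x.1 (i (dualEmb i (Λ b))) *
          fderiv ℝ (fun y => fderiv ℝ χ y (i (dualEmb i (Λ a))))
            (cos θ • x.1 + √(1 - cos θ ^ 2) • x.2) (i (dualEmb i (Λ b))) ∂(μ.prod μ) := by
  have := hμ.isProbabilityMeasure
  have := UniformSpace.secondCountable_of_separable W
  set w : Fin d → W := fun b => i (dualEmb i (Λ b)) with hw
  set χ' : Fin d → W → ℝ := fun a y => fderiv ℝ χ y (w a) with hχ'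
  have hs : ∀ a, CbSmooth (χ' a) := fun a => hχ.fderiv_apply (w a)
  have hfr : ∀ a, IsFrame i Λ (χ' a) := fun a => hΛ.fderiv_apply (w a)
  set M : ℝ → ℝ := fun θ => ∑ a, ∫ x, g a x.1 * χ' a (cos θ • x.1 + sin θ • x.2) ∂(μ.prod μ)
    with hM
  set J : ℝ → ℝ := fun θ => ∑ a, ∑ b, ∫ x, fderiv ℝ (g a) x.1 (w b) *
    fderiv ℝ (χ' a) (cos θ • x.1 + sin θ • x.2) (w b) ∂(μ.prod μ) with hJ
  have hMd : ∀ θ, HasDerivAt M (-sin θ * J θ) θ := fun θ => by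
    have := HasDerivAt.fun_sum (u := Finset.univ) fun a _ =>
      hμ.hasDerivAt_integral_rotation (hg a) (hs a) (hfr a) θ
    rwa [← Finset.mul_sum] at this
  have hJc : Continuous J := continuous_finsetSum _ fun a _ => continuous_finsetSum _ fun b _ =>
    hμ.continuous_integral_rotation ((hg a).fderiv_apply (w b)) ((hs a).fderiv_apply (w b))
      continuous_cos continuous_sin
  have hMc : Continuous M := continuous_iff_continuousAt.2 fun θ => (hMd θ).continuousAt
  -- A primitive of the integrand is `-cos θ * M θ`, which vanishes at `π / 2` and is `-M 0` at 0.
  -- Integration by parts read backwards will turn `sin θ * M θ` into the term with `Λ a x.2`, free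
  -- of derivatives of `χ`.
  have h1 : ∫ θ in (0 : ℝ)..(π / 2), (sin θ * M θ + cos θ * sin θ * J θ) = M 0 := by
    rw [intervalIntegral.integral_eq_sub_of_hasDerivAt (f := fun θ => -cos θ * M θ)
      (fun θ _ => ?_) (Continuous.intervalIntegrable (by fun_prop) _ _)]
    · simp
    · exact ((hasDerivAt_cos θ).neg.mul (hMd θ)).congr_deriv (by simp only [Pi.neg_apply]; ring)
  have h2 : M 0 = ∑ a, ∫ x, g a x * χ' a x ∂μ := by
    simp only [hM, cos_zero, sin_zero, one_smul, zero_smul, add_zero]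
    refine Finset.sum_congr rfl fun a _ => ?_
    exact integral_comp_of_measurePreserving (g := fun x => g a x * χ' a x)
      (measurePreserving_fst (μ := μ) (ν := μ))
      ((hg a).continuous.mul (hs a).continuous).aestronglyMeasurable
  rw [← h2, ← h1, intervalIntegral.integral_add (Continuous.intervalIntegrable (by fun_prop) _ _)
    (Continuous.intervalIntegrable (by fun_prop) _ _)]
  congr 1
  · refine intervalIntegral.integral_congr fun θ _ => ?_
    simp only [hM, Finset.sum_mul, Finset.mul_sum]
    rw [integral_finsetSum _ fun a _ => hμ.integrable_mul_comp_smul_add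
      ((hμ.integrable_cbSmooth (hg a)).mul_prod (hμ.integrable_dual (Λ a))) hχ _ _]
    refine Finset.sum_congr rfl fun a _ => ?_
    rw [hμ.integral_mul_dual_snd (Λ a) (hμ.integrable_cbSmooth (hg a)) hχ]
  · refine intervalIntegral.integral_congr fun θ hθ => ?_
    rw [Set.uIcc_of_le (by positivity)] at hθ
    -- On `[0, π/2]` the sine is nonnegative, so the second order term depends on `θ` through `cos
    -- θ` alone, as the half sphere formula requires.
    have : √(1 - cos θ ^ 2) = sin θ := by
      rw [← sin_sq, sqrt_sq (sin_nonneg_of_nonneg_of_le_pi hθ.1 (by linarith [hθ.2, pi_pos]))]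
    simp only [hJ, this]
    rfl

/-! ### The second order term as a double singular integral -/

open Real

variable {W H : Type*} [NormedAddCommGroup W] [NormedSpace ℝ W] [CompleteSpace W]
  [TopologicalSpace.SeparableSpace W] [MeasurableSpace W] [BorelSpace W] [NormedAddCommGroup H]
  [InnerProductSpace ℝ H] [CompleteSpace H] {i : H →L[ℝ] W} {μ : Measure W}

/-- Two Gaussian integrations by parts for a function of a combination of three independent
variables. -/
theorem IsAbstractWienerSpace.integral_mul_dual_mul_dual (hμ : IsAbstractWienerSpace i μ)
    (l l' : StrongDual ℝ W) {g : W → ℝ} (hg : CbSmooth g) {χ : W → ℝ} (hχ : CbSmooth χ)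
    {α β γ : ℝ} (habc : α ^ 2 + β ^ 2 + γ ^ 2 = 1) :
    ∫ x, (g x.1.1 * l x.1.2 * l' x.2) * χ (α • x.1.1 + β • x.1.2 + γ • x.2)
        ∂((μ.prod μ).prod μ) =
      β * γ * ∫ x, g x.1 * fderiv ℝ (fun y => fderiv ℝ χ y (i (dualEmb i l')))
        (α • x.1 + √(1 - α ^ 2) • x.2) (i (dualEmb i l)) ∂(μ.prod μ) := by
  have := hμ.isProbabilityMeasure
  have := UniformSpace.secondCountable_of_separable W
  set χ' : W → ℝ := fun y => fderiv ℝ χ y (i (dualEmb i l')) with hχ'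
  have hs : CbSmooth χ' := hχ.fderiv_apply _
  set χ'' : W → ℝ := fun y => fderiv ℝ χ' y (i (dualEmb i l)) with hχ''
  have hs' : CbSmooth χ'' := hs.fderiv_apply _
  have hgi := hμ.integrable_cbSmooth hg
  have hint : ∀ {G : (W × W) × W → ℝ}, Integrable G ((μ.prod μ).prod μ) → ∀ {h : W → ℝ},
      CbSmooth h → Integrable (fun x : (W × W) × W =>
        G x * h (α • x.1.1 + β • x.1.2 + γ • x.2)) ((μ.prod μ).prod μ) := by
    intro G hG h hh
    obtain ⟨C, hC⟩ := hh.exists_bound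
    have hhc := hh.continuous
    exact hG.mul_bdd (c := C) (Continuous.aestronglyMeasurable (by fun_prop))
      (Eventually.of_forall fun x => hC _)
  have hgl : Integrable (fun x : W × W => g x.1 * l x.2) (μ.prod μ) :=
    hgi.mul_prod (hμ.integrable_dual l)
  have h1 : ∫ x, (g x.1.1 * l x.1.2 * l' x.2) * χ (α • x.1.1 + β • x.1.2 + γ • x.2)
      ∂((μ.prod μ).prod μ) = γ * ∫ x, (g x.1.1 * l x.1.2) *
        χ' (α • x.1.1 + β • x.1.2 + γ • x.2) ∂((μ.prod μ).prod μ) := by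
    rw [integral_prod _ (hint (hgl.mul_prod (hμ.integrable_dual l')) hχ),
      integral_prod _ (hint (hgl.comp_fst μ) hs), ← integral_const_mul]
    refine integral_congr_ae (Eventually.of_forall fun x => ?_)
    simp only
    simp only [mul_assoc _ (l' _) (χ _)]
    rw [integral_const_mul, integral_const_mul, hμ.integral_mul_eq l' (hχ.comp_smul_add γ _)]
    simp only [fderiv_comp_smul_add hχ.differentiable, smul_eq_mul, integral_const_mul]
    ring
  have h2 : ∫ x, (g x.1.1 * l x.1.2) * χ' (α • x.1.1 + β • x.1.2 + γ • x.2)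
      ∂((μ.prod μ).prod μ) = β * ∫ x, g x.1.1 * χ'' (α • x.1.1 + β • x.1.2 + γ • x.2)
        ∂((μ.prod μ).prod μ) := by
    rw [integral_prod_symm _ (hint (hgl.comp_fst μ) hs),
      integral_prod_symm _ (hint ((hgi.comp_fst μ).comp_fst μ) hs'), ← integral_const_mul]
    refine integral_congr_ae (Eventually.of_forall fun z => ?_)
    simp only
    rw [hμ.integral_mul_dual_snd l hgi (hs.comp_add_right (γ • z))]
    simp only [fderiv_comp_add_right, hχ'']
  rw [h1, h2]
  -- Unless both coefficients vanish, the second and third variables combined with weights `β` and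
  -- `γ` and normalised form one variable of law `μ`, independent of the first: three variables
  -- merge into two.
  rcases eq_or_ne (β ^ 2 + γ ^ 2) 0 with h0 | h0
  · have hβ : β = 0 := by nlinarith [sq_nonneg β, sq_nonneg γ]
    simp [hβ]
  · set s := √(1 - α ^ 2) with hsdef
    have hss : s ^ 2 = β ^ 2 + γ ^ 2 := by
      rw [hsdef, sq_sqrt (by nlinarith [sq_nonneg β, sq_nonneg γ])]; linarith
    have hs0 : s ≠ 0 := fun h => h0 (by rw [← hss, h]; simp)
    have hmp : MeasurePreserving (fun x : (W × W) × W =>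
        (x.1.1, (β / s) • x.1.2 + (γ / s) • x.2)) ((μ.prod μ).prod μ) (μ.prod μ) :=
      ((MeasurePreserving.id μ).prod (hμ.measurePreserving_rotation (a := β / s) (b := γ / s)
        (by rw [div_pow, div_pow, ← add_div, hss, div_self h0]))).comp
          (measurePreserving_prodAssoc μ μ μ)
    have hcont := hg.continuous
    have hcont' := hs'.continuous
    have h3 := integral_comp_of_measurePreserving hmp
      (g := fun x : W × W => g x.1 * χ'' (α • x.1 + s • x.2))
      (Continuous.aestronglyMeasurable (by fun_prop))
    rw [← h3, ← mul_assoc, mul_comm γ β]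
    congr 1
    refine integral_congr_ae (Eventually.of_forall fun x => ?_)
    simp only [smul_add, smul_smul, mul_div_cancel₀ _ hs0, add_assoc]

theorem integral_mul_intervalIntegral {X : Type*} [MeasurableSpace X] {ν : Measure X} [SFinite ν]
    {G : X → ℝ} (hG : Integrable G ν) {f : ℝ → X → ℝ} {a b C : ℝ}
    (hf : AEStronglyMeasurable (Function.uncurry f) ((volume.restrict (Set.uIoc a b)).prod ν))
    (hC : ∀ t x, |f t x| ≤ C) :
    ∫ x, G x * (∫ t in a..b, f t x) ∂ν = ∫ t in a..b, (∫ x, G x * f t x ∂ν) := by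
  have : IsFiniteMeasure ((volume : Measure ℝ).restrict (Set.uIoc a b)) := by
    unfold Set.uIoc; infer_instance
  rw [intervalIntegral_integral_swap (f := fun t x => G x * f t x)]
  · simp only [intervalIntegral.integral_const_mul]
  · exact (hG.comp_snd (volume.restrict (Set.uIoc a b))).mul_bdd (c := C) hf
      (Eventually.of_forall fun z => hC z.1 z.2)

/-- The iterated transform of `χ` with kernel `hilbertKer ρ`. -/
def doubleTransform (ρ : ℝ) (χ : W → ℝ) (x : (W × W) × W) : ℝ :=
  ∫ t in (0 : ℝ)..2 * π, hilbertKer ρ t * ∫ s in (0 : ℝ)..2 * π, hilbertKer ρ s *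
    χ (cos s • (cos t • x.1.1 + sin t • x.1.2) + sin s • x.2)

theorem continuous_doubleTransform {ρ : ℝ} (h0 : 0 ≤ ρ) (h1 : ρ < 1) {χ : W → ℝ}
    (hχ : Continuous χ) {R : ℝ} (hR : ∀ x, |χ x| ≤ R) : Continuous (doubleTransform ρ χ) := by
  obtain ⟨C, hC⟩ := exists_abs_hilbertKer_le h0 h1
  refine continuous_hilbertKer_rotation h0 h1 (X := (W × W) × W) (E := W)
    (g := fun x u => ∫ s in (0 : ℝ)..2 * π, hilbertKer ρ s * χ (cos s • u + sin s • x.2))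
    (R := C * R * (2 * π)) ?_ (fun x u => abs_intervalIntegral_hilbertKer_le hC fun t => hR _)
    (by fun_prop) (by fun_prop)
  exact continuous_hilbertKer_rotation h0 h1 (g := fun _ => χ) (hχ.comp continuous_snd)
    (fun _ => hR) (by fun_prop) (by fun_prop)

theorem IsAbstractWienerSpace.integral_mul_doubleTransform (hμ : IsAbstractWienerSpace i μ)
    {ρ : ℝ} (h0 : 0 ≤ ρ) (h1 : ρ < 1) {χ : W → ℝ} (hχ : CbSmooth χ) {G : (W × W) × W → ℝ}
    (hG : Integrable G ((μ.prod μ).prod μ)) :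
    ∫ x, G x * doubleTransform ρ χ x ∂((μ.prod μ).prod μ) =
      ∫ t in (0 : ℝ)..2 * π, ∫ s in (0 : ℝ)..2 * π, hilbertKer ρ t * (hilbertKer ρ s *
        ∫ x, G x * χ ((cos t * cos s) • x.1.1 + (sin t * cos s) • x.1.2 + sin s • x.2)
          ∂((μ.prod μ).prod μ)) := by
  have := hμ.isProbabilityMeasure
  have := UniformSpace.secondCountable_of_separable W
  obtain ⟨C, hC⟩ := exists_abs_hilbertKer_le h0 h1
  obtain ⟨R, hR⟩ := hχ.exists_bound
  have hC0 : 0 ≤ C := (abs_nonneg _).trans (hC 0)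
  have hχc := hχ.continuous
  have hk := measurable_hilbertKer h0 h1
  have hb : ∀ (t : ℝ) (x : (W × W) × W), |∫ s in (0 : ℝ)..2 * π, hilbertKer ρ s *
      χ (cos s • (cos t • x.1.1 + sin t • x.1.2) + sin s • x.2)| ≤ C * R * (2 * π) := fun t x =>
    abs_intervalIntegral_hilbertKer_le hC fun t => hR _
  unfold doubleTransform
  rw [integral_mul_intervalIntegral hG (C := C * (C * R * (2 * π))) ?_ fun t x => ?_]
  · refine intervalIntegral.integral_congr fun t _ => ?_
    simp only [intervalIntegral.integral_const_mul, mul_left_comm _ (hilbertKer ρ t),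
      integral_const_mul]
    rw [integral_mul_intervalIntegral hG (C := C * R) ?_ fun t x => ?_]
    · congr 1
      refine intervalIntegral.integral_congr fun s _ => ?_
      simp only [mul_left_comm _ (hilbertKer ρ s), integral_const_mul, smul_add, smul_smul,
        mul_comm (cos s)]
    · refine ((hk.comp measurable_fst).mul (Continuous.measurable ?_)).aestronglyMeasurable
      fun_prop
    · rw [abs_mul]
      exact mul_le_mul (hC _) (hR _) (abs_nonneg _) hC0
  · refine ((hk.comp measurable_fst).mul (Continuous.measurable ?_)).aestronglyMeasurable
    exact continuous_hilbertKer_rotation h0 h1 (X := ℝ × ((W × W) × W)) (g := fun _ => χ)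
      (hχc.comp continuous_snd) (fun _ => hR)
      (f₁ := fun z => cos z.1 • z.2.1.1 + sin z.1 • z.2.1.2) (f₂ := fun z => z.2.2)
      (by fun_prop) (by fun_prop)
  · rw [abs_mul]
    exact mul_le_mul (hC _) (hb _ _) (abs_nonneg _) hC0

/-- The second order term in the representation of `E ⟪F, ∇χ⟫` as a singular integral. -/
theorem IsAbstractWienerSpace.tendsto_integral_mul_doubleTransform
    (hμ : IsAbstractWienerSpace i μ) {d : ℕ} {Λ : Fin d → StrongDual ℝ W} {χ : W → ℝ}
    (hχ : CbSmooth χ) {g : Fin d → W → ℝ} (hg : ∀ a, CbSmooth (g a)) :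
    Tendsto (fun n : ℕ => ∫ x, (∑ a, ∑ b, fderiv ℝ (g a) x.1.1 (i (dualEmb i (Λ b))) *
        Λ b x.1.2 * Λ a x.2) * doubleTransform (1 - 1 / (n + 1)) χ x ∂((μ.prod μ).prod μ)) atTop
      (𝓝 (2 * π * ∫ θ in (0 : ℝ)..(π / 2), cos θ * sin θ *
        ∑ a, ∑ b, ∫ x, fderiv ℝ (g a) x.1 (i (dualEmb i (Λ b))) *
          fderiv ℝ (fun y => fderiv ℝ χ y (i (dualEmb i (Λ a))))
            (cos θ • x.1 + √(1 - cos θ ^ 2) • x.2) (i (dualEmb i (Λ b))) ∂(μ.prod μ))) := by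
  have := hμ.isProbabilityMeasure
  have := UniformSpace.secondCountable_of_separable W
  set w : Fin d → W := fun b => i (dualEmb i (Λ b)) with hw
  set j : ℝ → ℝ := fun c => ∑ a, ∑ b, ∫ x, fderiv ℝ (g a) x.1 (w b) *
    fderiv ℝ (fun y => fderiv ℝ χ y (w a)) (c • x.1 + √(1 - c ^ 2) • x.2) (w b) ∂(μ.prod μ) with hj
  have hsm : ∀ a b, CbSmooth fun x => fderiv ℝ (fun y => fderiv ℝ χ y (w a)) x (w b) :=
    fun a b => (hχ.fderiv_apply (w a)).fderiv_apply (w b)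
  have hjc : Continuous j := continuous_finsetSum _ fun a _ => continuous_finsetSum _ fun b _ =>
    hμ.continuous_integral_rotation ((hg a).fderiv_apply (w b)) (hsm a b) continuous_id
      (by fun_prop)
  obtain ⟨R, hR⟩ : ∃ R, ∀ c, |j c| ≤ R := by
    have : ∀ a b, ∃ R, ∀ c : ℝ, |∫ x, fderiv ℝ (g a) x.1 (w b) *
        fderiv ℝ (fun y => fderiv ℝ χ y (w a)) (c • x.1 + √(1 - c ^ 2) • x.2) (w b)
          ∂(μ.prod μ)| ≤ R := by
      intro a b
      obtain ⟨C, hC⟩ := ((hg a).fderiv_apply (w b)).exists_bound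
      obtain ⟨C', hC'⟩ := (hsm a b).exists_bound
      refine ⟨C * C', fun c => ?_⟩
      have := norm_integral_le_of_norm_le_const (μ := μ.prod μ) (C := C * C')
        (f := fun x => fderiv ℝ (g a) x.1 (w b) *
          fderiv ℝ (fun y => fderiv ℝ χ y (w a)) (c • x.1 + √(1 - c ^ 2) • x.2) (w b))
        (Eventually.of_forall fun x => by
          rw [norm_mul]
          exact mul_le_mul (hC _) (hC' _) (norm_nonneg _) ((norm_nonneg _).trans (hC x.1)))
      simpa using this
    choose R hR using this
    refine ⟨∑ a, ∑ b, R a b, fun c => ?_⟩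
    exact (Finset.abs_sum_le_sum_abs _ _).trans (Finset.sum_le_sum fun a _ =>
      (Finset.abs_sum_le_sum_abs _ _).trans (Finset.sum_le_sum fun b _ => hR a b c))
  have hZi : ∀ a b, Integrable (fun x : (W × W) × W => fderiv ℝ (g a) x.1.1 (w b) * Λ b x.1.2 *
      Λ a x.2) ((μ.prod μ).prod μ) := fun a b =>
    ((hμ.integrable_cbSmooth ((hg a).fderiv_apply (w b))).mul_prod
      (hμ.integrable_dual (Λ b))).mul_prod (hμ.integrable_dual (Λ a))
  have hZ : Integrable (fun x : (W × W) × W => ∑ a, ∑ b, fderiv ℝ (g a) x.1.1 (w b) * Λ b x.1.2 *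
      Λ a x.2) ((μ.prod μ).prod μ) :=
    integrable_finsetSum _ fun a _ => integrable_finsetSum _ fun b _ => hZi a b
  refine (tendsto_integral_hilbertKer hjc hR).congr fun n => ?_
  have hρ : (0 : ℝ) ≤ 1 - 1 / (n + 1) ∧ (1 : ℝ) - 1 / (n + 1) < 1 :=
    ⟨by rw [sub_nonneg, div_le_one (by positivity)]; simp, by simp; positivity⟩
  rw [hμ.integral_mul_doubleTransform hρ.1 hρ.2 hχ hZ]
  refine intervalIntegral.integral_congr fun t _ => intervalIntegral.integral_congr fun s _ => ?_
  -- The three coefficients form a point of the unit sphere, so both integrations by parts apply.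
  -- Their factor `sin t * cos s * sin s` provides the sines that tame the two kernels.
  have hts : (cos t * cos s) ^ 2 + (sin t * cos s) ^ 2 + sin s ^ 2 = 1 := by
    have h1 := sin_sq_add_cos_sq t
    have h2 := sin_sq_add_cos_sq s
    linear_combination (cos s ^ 2) * h1 + h2
  have hval : ∫ x, (∑ a, ∑ b, fderiv ℝ (g a) x.1.1 (w b) * Λ b x.1.2 * Λ a x.2) *
      χ ((cos t * cos s) • x.1.1 + (sin t * cos s) • x.1.2 + sin s • x.2) ∂((μ.prod μ).prod μ) =
      (sin t * cos s) * sin s * j (cos t * cos s) := by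
    obtain ⟨Cχ, hCχ⟩ := hχ.exists_bound
    have hχc := hχ.continuous
    have hi : ∀ a b, Integrable (fun x : (W × W) × W => (fderiv ℝ (g a) x.1.1 (w b) * Λ b x.1.2 *
        Λ a x.2) * χ ((cos t * cos s) • x.1.1 + (sin t * cos s) • x.1.2 + sin s • x.2))
        ((μ.prod μ).prod μ) := fun a b =>
      (hZi a b).mul_bdd (c := Cχ) (Continuous.aestronglyMeasurable (by fun_prop))
        (Eventually.of_forall fun x => hCχ _)
    simp only [Finset.sum_mul]
    rw [integral_finsetSum _ fun a _ => integrable_finsetSum _ fun b _ => hi a b]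
    simp only [hj, Finset.mul_sum]
    refine Finset.sum_congr rfl fun a _ => ?_
    rw [integral_finsetSum _ fun b _ => hi a b]
    refine Finset.sum_congr rfl fun b _ => ?_
    exact hμ.integral_mul_dual_mul_dual (Λ b) (Λ a) ((hg a).fderiv_apply (w b)) hχ hts
  simp only [hval]
  ring

/-! ### L^r norms of Gaussian forms and of the double transform -/

open Real

variable {W H : Type*} [NormedAddCommGroup W] [NormedSpace ℝ W] [CompleteSpace W]
  [TopologicalSpace.SeparableSpace W] [MeasurableSpace W] [BorelSpace W] [NormedAddCommGroup H]
  [InnerProductSpace ℝ H] [CompleteSpace H] {i : H →L[ℝ] W} {μ : Measure W}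

/-- Hölder's inequality for an integral of a product. -/
theorem enorm_integral_mul_le {X : Type*} [MeasurableSpace X] {ν : Measure X} {f g : X → ℝ}
    (hf : AEStronglyMeasurable f ν) (hg : AEStronglyMeasurable g ν) (r q : ℝ≥0∞)
    [ENNReal.HolderConjugate r q] :
    ‖∫ x, f x * g x ∂ν‖ₑ ≤ eLpNorm f r ν * eLpNorm g q ν := by
  refine (enorm_integral_le_lintegral_enorm _).trans ?_
  rw [← eLpNorm_one_eq_lintegral_enorm]
  have h := eLpNorm_smul_le_mul_eLpNorm (p := r) (q := q) (r := 1) hg hf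
  have e : (fun x => f x * g x) = f • g := rfl
  rw [e]
  exact h

theorem eLpNorm_rpow_eq_lintegral {X ε : Type*} [MeasurableSpace X] {ν : Measure X} [ENorm ε]
    {f : X → ε} {r : ℝ≥0∞} (hr0 : r ≠ 0) (hr : r ≠ ∞) :
    eLpNorm f r ν ^ r.toReal = ∫⁻ x, ‖f x‖ₑ ^ r.toReal ∂ν := by
  have h : 0 < r.toReal := ENNReal.toReal_pos hr0 hr
  rw [eLpNorm_eq_lintegral_rpow_enorm_toReal hr0 hr, ← ENNReal.rpow_mul, one_div,
    inv_mul_cancel₀ h.ne', ENNReal.rpow_one]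

theorem eLpNorm_prod_eq {X Y ε : Type*} [MeasurableSpace X] [MeasurableSpace Y] [ENorm ε]
    {ν : Measure X} {κ : Measure Y} [SFinite ν] [SFinite κ] {f : X × Y → ε}
    (hf : AEMeasurable (fun x => ‖f x‖ₑ) (ν.prod κ)) {r : ℝ≥0∞} (hr0 : r ≠ 0) (hr : r ≠ ∞) :
    eLpNorm (fun x => eLpNorm (fun y => f (x, y)) r κ) r ν = eLpNorm f r (ν.prod κ) := by
  have h : 0 < r.toReal := ENNReal.toReal_pos hr0 hr
  refine (ENNReal.rpow_left_injective h.ne') ?_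
  simp only [eLpNorm_rpow_eq_lintegral hr0 hr, enorm_eq_self]
  rw [lintegral_prod _ (hf.pow_const _)]

theorem eLpNorm_prod_le {X Y E : Type*} [MeasurableSpace X] [MeasurableSpace Y]
    [NormedAddCommGroup E] {ν : Measure X} {κ : Measure Y} [SFinite ν] [SFinite κ] {f : X × Y → E}
    (hf : AEStronglyMeasurable f (ν.prod κ)) {r : ℝ≥0∞} (hr0 : r ≠ 0) (hr : r ≠ ∞)
    {b : X → ℝ≥0∞} (hb : ∀ x, eLpNorm (fun y => f (x, y)) r κ ≤ b x) :
    eLpNorm f r (ν.prod κ) ≤ eLpNorm b r ν := by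
  rw [← eLpNorm_prod_eq hf.enorm hr0 hr]
  exact eLpNorm_mono_enorm fun x => by simpa using hb x

theorem eLpNorm_two_sq {X ε : Type*} [MeasurableSpace X] {ν : Measure X} [ENorm ε] (f : X → ε) :
    eLpNorm f 2 ν ^ 2 = ∫⁻ x, ‖f x‖ₑ ^ 2 ∂ν := by
  have := eLpNorm_rpow_eq_lintegral (f := f) (ν := ν) (r := 2) two_ne_zero ENNReal.ofNat_ne_top
  simpa using this

theorem IsAbstractWienerSpace.lintegral_enorm_dual_sq (hμ : IsAbstractWienerSpace i μ)
    (l : StrongDual ℝ W) : ∫⁻ x, ‖l x‖ₑ ^ 2 ∂μ = ‖dualEmb i l‖ₑ ^ 2 := by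
  have h := hμ.integral_sq l
  have h1 := ofReal_integral_eq_lintegral_ofReal
    (hμ.memLp_dual l (p := 2) (by simp)).integrable_sq (Eventually.of_forall fun x => sq_nonneg _)
  rw [h] at h1
  rw [← ofReal_norm (dualEmb i l), ← ENNReal.ofReal_pow (norm_nonneg _), h1]
  refine lintegral_congr fun x => ?_
  rw [← ofReal_norm, ← ENNReal.ofReal_pow (norm_nonneg _), Real.norm_eq_abs, sq_abs]

/-- For `r ≤ 2` the `L^r` norm is at most the `L²` norm, which is the standard deviation. With
exponents at most 2 no comparison of higher Gaussian moments is necessary. -/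
theorem IsAbstractWienerSpace.eLpNorm_dual_le (hμ : IsAbstractWienerSpace i μ)
    (l : StrongDual ℝ W) {r : ℝ≥0∞} (hr : r ≤ 2) : eLpNorm l r μ ≤ ‖dualEmb i l‖ₑ := by
  have := hμ.isProbabilityMeasure
  have := UniformSpace.secondCountable_of_separable W
  refine (eLpNorm_le_eLpNorm_of_exponent_le hr l.continuous.aestronglyMeasurable).trans ?_
  rw [← ENNReal.pow_le_pow_left_iff two_ne_zero, eLpNorm_two_sq,
    hμ.lintegral_enorm_dual_sq]

theorem enorm_sum_smul_sq {d : ℕ} {v : Fin d → H} (hv : Orthonormal ℝ v) (c : Fin d → ℝ) :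
    ‖∑ a, c a • v a‖ₑ ^ 2 = ∑ a, ‖c a‖ₑ ^ 2 := by
  simp only [← ofReal_norm, ← ENNReal.ofReal_pow (norm_nonneg _)]
  rw [← ENNReal.ofReal_sum_of_nonneg fun j _ => by positivity, ← real_inner_self_eq_norm_sq,
    hv.inner_sum]
  simp [sq]

theorem dualEmb_sum_smul {d : ℕ} (Λ : Fin d → StrongDual ℝ W) (c : Fin d → ℝ) :
    dualEmb i (∑ a, c a • Λ a) = ∑ a, c a • dualEmb i (Λ a) := by
  rw [← dualEmbL_apply, map_sum]
  simp only [map_smul, dualEmbL_apply]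

/-- The `L^r` norm of the Gaussian linear form in an orthonormal frame. -/
theorem IsAbstractWienerSpace.eLpNorm_sum_mul_dual_le (hμ : IsAbstractWienerSpace i μ) {d : ℕ}
    {Λ : Fin d → StrongDual ℝ W} (hΛ : Orthonormal ℝ fun a => dualEmb i (Λ a)) {F : W → H}
    (hF : Continuous F) {r : ℝ≥0∞} (hr0 : r ≠ 0) (hr : r ≤ 2) :
    eLpNorm (fun x : W × W => ∑ a, ⟪F x.1, dualEmb i (Λ a)⟫_ℝ * Λ a x.2) r (μ.prod μ) ≤
      eLpNorm F r μ := by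
  have := hμ.isProbabilityMeasure
  have := UniformSpace.secondCountable_of_separable W
  have hrt : r ≠ ∞ := (hr.trans_lt ENNReal.ofNat_lt_top).ne
  refine (eLpNorm_prod_le (Continuous.aestronglyMeasurable (by fun_prop)) hr0 hrt
    (b := fun x => ‖F x‖ₑ) fun x => ?_).trans ?_
  · have h := hμ.eLpNorm_dual_le (∑ a, ⟪F x, dualEmb i (Λ a)⟫_ℝ • Λ a) hr
    rw [dualEmb_sum_smul] at h
    have e : (⇑(∑ a, ⟪F x, dualEmb i (Λ a)⟫_ℝ • Λ a) : W → ℝ) =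
        fun y => ∑ a, ⟪F x, dualEmb i (Λ a)⟫_ℝ * Λ a y := by
      funext y; simp
    rw [e] at h
    refine h.trans ?_
    rw [← ENNReal.pow_le_pow_left_iff two_ne_zero, enorm_sum_smul_sq hΛ]
    simp only [real_inner_comm (dualEmb i _)]
    exact sum_enorm_inner_sq_le hΛ (F x)
  · exact eLpNorm_mono_enorm fun x => by simp

/-- The `L^r` norm of the Gaussian bilinear form in an orthonormal frame. -/
theorem IsAbstractWienerSpace.eLpNorm_sum_mul_dual_mul_dual_le (hμ : IsAbstractWienerSpace i μ)
    {d : ℕ} {Λ : Fin d → StrongDual ℝ W} (hΛ : Orthonormal ℝ fun a => dualEmb i (Λ a)) {F : W → H}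
    (hF : CbSmooth F) {r : ℝ≥0∞} (hr0 : r ≠ 0) (hr : r ≤ 2) :
    eLpNorm (fun x : (W × W) × W => ∑ a, ∑ b,
        fderiv ℝ (fun y => ⟪F y, dualEmb i (Λ a)⟫_ℝ) x.1.1 (i (dualEmb i (Λ b))) *
          Λ b x.1.2 * Λ a x.2) r ((μ.prod μ).prod μ) ≤
      eLpNorm (fun x => hsNorm (fieldGrad i F x)) r μ := by
  have := hμ.isProbabilityMeasure
  have := UniformSpace.secondCountable_of_separable W
  have hrt : r ≠ ∞ := (hr.trans_lt ENNReal.ofNat_lt_top).ne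
  set c : Fin d → Fin d → W → ℝ := fun a b x =>
    fderiv ℝ (fun y => ⟪F y, dualEmb i (Λ a)⟫_ℝ) x (i (dualEmb i (Λ b))) with hc
  have hcv : ∀ a b x, c a b x = ⟪dualEmb i (Λ a), fieldGrad i F x (dualEmb i (Λ b))⟫_ℝ := by
    intro a b x
    simp only [hc]
    have h1 : HasFDerivAt (fun y => ⟪F y, dualEmb i (Λ a)⟫_ℝ)
        ((innerSL ℝ (dualEmb i (Λ a))).comp (fderiv ℝ F x)) x := by
      have := (innerSL ℝ (dualEmb i (Λ a))).hasFDerivAt.comp x (hF.differentiable x).hasFDerivAt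
      refine this.congr_of_eventuallyEq (Eventually.of_forall fun y => ?_)
      simp [real_inner_comm]
    rw [h1.fderiv]
    rfl
  have hcc : ∀ a b, Continuous (c a b) := fun a b => by
    have := (hF.fderiv_apply (i (dualEmb i (Λ b)))).continuous
    have h2 : c a b = fun x => ⟪dualEmb i (Λ a), fderiv ℝ F x (i (dualEmb i (Λ b)))⟫_ℝ :=
      funext fun x => hcv a b x
    rw [h2]
    fun_prop
  set Z : W × (W × W) → ℝ := fun x => ∑ a, ∑ b, c a b x.1 * Λ b x.2.1 * Λ a x.2.2 with hZ
  have hZc : Continuous Z := by simp only [hZ]; fun_prop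
  have h1 := eLpNorm_comp_measurePreserving (p := r) hZc.aestronglyMeasurable
    (measurePreserving_prodAssoc μ μ μ)
  change eLpNorm (Z ∘ MeasurableEquiv.prodAssoc) r ((μ.prod μ).prod μ) ≤ _
  rw [h1]
  refine eLpNorm_prod_le hZc.aestronglyMeasurable hr0 hrt fun x => ?_
  -- With `x` frozen, the form is estimated in `L²` of the two remaining variables, where
  -- orthonormality of the frame leaves the sum of squares of the entries of `∇F` in the frame.
  refine (eLpNorm_le_eLpNorm_of_exponent_le hr
    (Continuous.aestronglyMeasurable (by fun_prop))).trans ?_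
  rw [← ENNReal.pow_le_pow_left_iff two_ne_zero, eLpNorm_two_sq,
    lintegral_prod _ (Continuous.aemeasurable (by fun_prop))]
  have h2 : ∀ y, ∫⁻ z, ‖Z (x, (y, z))‖ₑ ^ 2 ∂μ = ∑ a, ‖∑ b, c a b x * Λ b y‖ₑ ^ 2 := by
    intro y
    have := hμ.lintegral_enorm_dual_sq (∑ a, (∑ b, c a b x * Λ b y) • Λ a)
    rw [dualEmb_sum_smul, enorm_sum_smul_sq hΛ] at this
    rw [← this]
    refine lintegral_congr fun z => ?_
    simp [hZ, Finset.sum_mul]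
  have h3 : ∀ a, ∫⁻ y, ‖∑ b, c a b x * Λ b y‖ₑ ^ 2 ∂μ = ∑ b, ‖c a b x‖ₑ ^ 2 := by
    intro a
    have := hμ.lintegral_enorm_dual_sq (∑ b, c a b x • Λ b)
    rw [dualEmb_sum_smul, enorm_sum_smul_sq hΛ] at this
    rw [← this]
    refine lintegral_congr fun z => ?_
    simp
  simp only [h2]
  rw [lintegral_finsetSum _ fun a _ => Continuous.measurable (by fun_prop)]
  simp only [h3]
  rw [Finset.sum_comm]
  simp only [hcv]
  exact (Finset.sum_le_sum fun b _ => sum_enorm_inner_sq_le hΛ _).trans (sum_le_hsNorm_sq _ hΛ)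

theorem eLpNorm_natCast_pow {X : Type*} [MeasurableSpace X] {ν : Measure X} {n : ℕ} (hn : n ≠ 0)
    (hev : Even n) {f : X → ℝ} (hf : Integrable (fun x => f x ^ n) ν) :
    eLpNorm f n ν ^ n = ENNReal.ofReal (∫ x, f x ^ n ∂ν) := by
  have h := eLpNorm_rpow_eq_lintegral (f := f) (ν := ν) (r := n) (by exact_mod_cast hn)
    (ENNReal.natCast_ne_top n)
  simp only [ENNReal.toReal_natCast, ENNReal.rpow_natCast] at h
  rw [h, ofReal_integral_eq_lintegral_ofReal hf (Eventually.of_forall fun x => hev.pow_nonneg _)]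
  refine lintegral_congr fun x => ?_
  rw [← ofReal_norm, ← ENNReal.ofReal_pow (norm_nonneg _), Real.norm_eq_abs, hev.pow_abs]

/-- Uniform `L^q` bound for the iterated transforms. -/
theorem IsAbstractWienerSpace.exists_eLpNorm_doubleTransform_le (hμ : IsAbstractWienerSpace i μ)
    {m : ℕ} (hm : 0 < m) : ∃ C : ℝ, 0 ≤ C ∧ ∀ ρ : ℝ, 0 ≤ ρ → ρ < 1 → ∀ χ : W → ℝ, CbSmooth χ →
      eLpNorm (doubleTransform ρ χ) (4 * m : ℕ) ((μ.prod μ).prod μ) ≤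
        ENNReal.ofReal C * eLpNorm χ (4 * m : ℕ) μ := by
  have := hμ.isProbabilityMeasure
  have := UniformSpace.secondCountable_of_separable W
  obtain ⟨C, hC0, hC⟩ := hμ.exists_transference_bound m
  -- One factor `C` for each angle. Adding 1 makes the constant at most its own `4m`-th power, so no
  -- root has to be extracted.
  refine ⟨1 + C * C, by positivity, fun ρ h0 h1 χ hχ => ?_⟩
  have hn : 4 * m ≠ 0 := by omega
  have hev : Even (4 * m) := ⟨2 * m, by ring⟩
  obtain ⟨R, hR⟩ := hχ.exists_bound
  obtain ⟨k, hk⟩ := exists_abs_hilbertKer_le h0 h1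
  have hχc := hχ.continuous
  have hTc := continuous_doubleTransform h0 h1 hχc hR
  set G : W × W → ℝ := fun u => ∫ s in (0 : ℝ)..2 * π, hilbertKer ρ s *
    χ (cos s • u.1 + sin s • u.2) with hG
  have hGc : Continuous G := continuous_hilbertKer_rotation h0 h1 (g := fun _ => χ)
    (hχc.comp continuous_snd) (fun _ => hR) continuous_fst continuous_snd
  have hGb : ∀ u, |G u| ≤ k * R * (2 * π) := fun u =>
    abs_intervalIntegral_hilbertKer_le hk fun t => hR _
  have hTb : ∀ x, |doubleTransform ρ χ x| ≤ k * (k * R * (2 * π)) * (2 * π) := fun x =>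
    abs_intervalIntegral_hilbertKer_le hk fun t => hGb (_, x.2)
  have hint : ∀ {X : Type _} [TopologicalSpace X] [MeasurableSpace X] [BorelSpace X]
      [SecondCountableTopology X] {ν : Measure X} [IsFiniteMeasure ν] {f : X → ℝ} {K : ℝ},
      Continuous f → (∀ x, |f x| ≤ K) → Integrable (fun x => f x ^ (4 * m)) ν := by
    intro X _ _ _ _ ν _ f K hf hK
    refine Integrable.of_bound (hf.pow _).aestronglyMeasurable (K ^ (4 * m))
      (Eventually.of_forall fun x => ?_)
    rw [norm_pow]
    exact pow_le_pow_left₀ (norm_nonneg _) (hK x) _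
  have i1 : Integrable (fun x => doubleTransform ρ χ x ^ (4 * m)) ((μ.prod μ).prod μ) :=
    hint hTc hTb
  have i2 : Integrable (fun u => G u ^ (4 * m)) (μ.prod μ) := hint hGc hGb
  have i3 : Integrable (fun x => χ x ^ (4 * m)) μ := hint hχc hR
  have key : ∫ x, doubleTransform ρ χ x ^ (4 * m) ∂((μ.prod μ).prod μ) ≤
      C * C * ∫ x, χ x ^ (4 * m) ∂μ := by
    rw [integral_prod_symm _ i1]
    calc ∫ z, (∫ x, doubleTransform ρ χ (x, z) ^ (4 * m) ∂(μ.prod μ)) ∂μ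
        ≤ ∫ z, C * (∫ u, G (u, z) ^ (4 * m) ∂μ) ∂μ := by
          refine integral_mono i1.integral_prod_right (i2.integral_prod_right.const_mul C)
            fun z => ?_
          exact hC ρ h0 h1 (fun u => G (u, z)) _ (hGc.comp (by fun_prop)) fun u => hGb _
      _ = C * ∫ u, G u ^ (4 * m) ∂(μ.prod μ) := by
          rw [integral_const_mul, integral_prod_symm _ i2]
      _ ≤ C * (C * ∫ x, χ x ^ (4 * m) ∂μ) :=
          mul_le_mul_of_nonneg_left (hC ρ h0 h1 χ R hχc hR) hC0
      _ = _ := by ring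
  rw [← ENNReal.pow_le_pow_left_iff hn, mul_pow, eLpNorm_natCast_pow hn hev i1,
    eLpNorm_natCast_pow hn hev i3, ← ENNReal.ofReal_pow (by positivity),
    ← ENNReal.ofReal_mul (by positivity)]
  refine ENNReal.ofReal_le_ofReal (key.trans ?_)
  refine mul_le_mul_of_nonneg_right ?_ (integral_nonneg fun x => hev.pow_nonneg _)
  exact (le_add_of_nonneg_left zero_le_one).trans
    (le_self_pow₀ (by linarith [mul_nonneg hC0 hC0]) hn)

/-! ### Continuity of the divergence from 𝔻_{r,1}(H) to L^r -/

open Real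

variable {W H : Type*} [NormedAddCommGroup W] [NormedSpace ℝ W] [CompleteSpace W]
  [TopologicalSpace.SeparableSpace W] [MeasurableSpace W] [BorelSpace W] [NormedAddCommGroup H]
  [InnerProductSpace ℝ H] [CompleteSpace H] {i : H →L[ℝ] W} {μ : Measure W} {p : ℝ≥0∞}

/-- Needed because Gaussian forms are estimated only in `L^r` with `r ≤ 2`; it follows from `4m ≥
2`. -/
theorem le_two_of_holderConjugate {r : ℝ≥0∞} {m : ℕ} (hm : 0 < m)
    [h : ENNReal.HolderConjugate r (4 * m : ℕ)] : r ≤ 2 := by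
  by_contra hr
  push Not at hr
  have h1 : r⁻¹ < 2⁻¹ := ENNReal.inv_lt_inv.2 hr
  have h2 : ((4 * m : ℕ) : ℝ≥0∞)⁻¹ ≤ 2⁻¹ := by
    refine ENNReal.inv_le_inv.2 ?_
    have : 2 ≤ 4 * m := by omega
    exact_mod_cast this
  have h3 := ENNReal.add_lt_add_of_lt_of_le (by simp [show m ≠ 0 by omega]) h1 h2
  rw [ENNReal.HolderConjugate.inv_add_inv_eq_one, ENNReal.inv_two_add_inv_two] at h3
  exact lt_irrefl _ h3

theorem abs_le_toReal_of_enorm_le {a : ℝ} {c : ℝ≥0∞} (hc : c ≠ ∞) (h : ‖a‖ₑ ≤ c) :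
    |a| ≤ c.toReal := by
  have := ENNReal.toReal_mono hc h
  rwa [toReal_enorm, Real.norm_eq_abs] at this

/-- The divergence is bounded from `𝔻_{r,1}(H)` to `L^r`, in dual form. -/
theorem IsAbstractWienerSpace.exists_divergence_bound (hμ : IsAbstractWienerSpace i μ) {m : ℕ}
    (hm : 0 < m) (r : ℝ≥0∞) [ENNReal.HolderConjugate r (4 * m : ℕ)] :
    ∃ K : ℝ, 0 ≤ K ∧ ∀ F : W → H, IsSmoothField F → ∀ χ : W → ℝ, IsSmoothFunctional χ →
      ‖∫ x, ⟪F x, smoothGrad i χ x⟫_ℝ ∂μ‖ₑ ≤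
        ENNReal.ofReal K * (sobolevNorm i μ r F * eLpNorm χ (4 * m : ℕ) μ) := by
  have := hμ.isProbabilityMeasure
  have := UniformSpace.secondCountable_of_separable W
  have hr2 : r ≤ 2 := le_two_of_holderConjugate hm
  have hr0 : r ≠ 0 := ENNReal.HolderConjugate.ne_zero r (4 * m : ℕ)
  obtain ⟨C, hC0, hC⟩ := hμ.exists_eLpNorm_doubleTransform_le hm
  -- `π / 2` is the length of the interval of angles in the first order term and `C` bounds the
  -- double transform; the factor `2π` gained in the singular integral is discarded.
  refine ⟨π / 2 + C, by positivity, fun F hF χ hχ => ?_⟩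
  obtain ⟨d, Λ, hΛ⟩ := hχ.exists_isFrame hμ
  set S := sobolevNorm i μ r F with hS
  set N := eLpNorm χ (4 * m : ℕ) μ with hN
  have hSN : S * N ≠ ∞ := ENNReal.mul_ne_top hF.sobolevNorm_lt_top.ne (hχ.memLp _).2.ne
  set g : Fin d → W → ℝ := fun a x => ⟪F x, dualEmb i (Λ a)⟫_ℝ with hg
  have hgs : ∀ a, CbSmooth (g a) := fun a => (hF.inner _).cbSmooth
  have hFc := hF.cbSmooth.continuous
  have hχc := hχ.continuous
  have hrep : ∫ x, ⟪F x, smoothGrad i χ x⟫_ℝ ∂μ =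
      ∑ a, ∫ x, g a x * fderiv ℝ χ x (i (dualEmb i (Λ a))) ∂μ := by
    rw [← integral_finsetSum _ fun a _ =>
      hμ.integrable_cbSmooth ((hgs a).mul (hχ.cbSmooth.fderiv_apply _))]
    refine integral_congr_ae (Eventually.of_forall fun x => ?_)
    simp only [hg]
    rw [inner_smoothGrad, hΛ.fderiv_eq hχ.differentiable]
    simp only [inner_dualEmb]
  rw [hrep, hμ.sum_integral_mul_fderiv_eq hχ.cbSmooth hΛ hgs]
  have b1 : ∀ θ : ℝ, |∫ x, (∑ a, g a x.1 * Λ a x.2) * χ (cos θ • x.1 + sin θ • x.2)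
      ∂(μ.prod μ)| ≤ (S * N).toReal := by
    intro θ
    refine abs_le_toReal_of_enorm_le hSN ((enorm_integral_mul_le
      (Continuous.aestronglyMeasurable (by
        have := fun a => (hgs a).continuous
        fun_prop)) (Continuous.aestronglyMeasurable (by fun_prop)) r (4 * m : ℕ)).trans ?_)
    refine mul_le_mul' ((hμ.eLpNorm_sum_mul_dual_le hΛ.orthonormal hFc hr0 hr2).trans
      le_self_add) (le_of_eq ?_)
    exact eLpNorm_comp_measurePreserving (g := χ) hχc.aestronglyMeasurable
      (hμ.measurePreserving_rotation (cos_sq_add_sin_sq θ))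
  -- Hölder: the bilinear form in `∇F` in `L^r` against the double transform of `χ` in `L^(4m)`,
  -- uniformly in `n`, so the bound passes to the limit.
  have b2 : ∀ n : ℕ, |∫ x, (∑ a, ∑ b, fderiv ℝ (g a) x.1.1 (i (dualEmb i (Λ b))) *
        Λ b x.1.2 * Λ a x.2) * doubleTransform (1 - 1 / (n + 1)) χ x ∂((μ.prod μ).prod μ)| ≤
      C * (S * N).toReal := by
    intro n
    have hρ : (0 : ℝ) ≤ 1 - 1 / (n + 1) ∧ (1 : ℝ) - 1 / (n + 1) < 1 :=
      ⟨by rw [sub_nonneg, div_le_one (by positivity)]; simp, by simp; positivity⟩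
    obtain ⟨R, hR⟩ := hχ.exists_bound
    have h1 := abs_le_toReal_of_enorm_le (ENNReal.mul_ne_top ENNReal.ofReal_ne_top hSN)
      ((enorm_integral_mul_le (ν := (μ.prod μ).prod μ) (Continuous.aestronglyMeasurable (by
        have := fun a b => ((hgs a).fderiv_apply (i (dualEmb i (Λ b)))).continuous
        fun_prop)) (continuous_doubleTransform hρ.1 hρ.2 hχc hR).aestronglyMeasurable
          r (4 * m : ℕ)).trans ((mul_le_mul'
          ((hμ.eLpNorm_sum_mul_dual_mul_dual_le hΛ.orthonormal hF.cbSmooth hr0 hr2).trans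
            le_add_self) (hC _ hρ.1 hρ.2 χ hχ.cbSmooth)).trans_eq (mul_left_comm S _ N)))
    rwa [ENNReal.toReal_mul, ENNReal.toReal_ofReal hC0] at h1
  have t1 := intervalIntegral.norm_integral_le_of_norm_le_const (a := 0) (b := π / 2)
    (f := fun θ => ∫ x, (∑ a, g a x.1 * Λ a x.2) * χ (cos θ • x.1 + sin θ • x.2) ∂(μ.prod μ))
    (C := (S * N).toReal) fun θ _ => b1 θ
  rw [sub_zero, abs_of_nonneg (by positivity : (0 : ℝ) ≤ π / 2)] at t1
  have t2 := le_of_tendsto (hμ.tendsto_integral_mul_doubleTransform (Λ := Λ) hχ.cbSmooth hgs).abs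
    (Eventually.of_forall b2)
  rw [abs_mul, abs_of_nonneg (by positivity : (0 : ℝ) ≤ 2 * π)] at t2
  have hπ : (1 : ℝ) ≤ 2 * π := by linarith [pi_gt_three]
  have t3 := (le_mul_of_one_le_left (abs_nonneg _) hπ).trans t2
  rw [← ENNReal.ofReal_toReal hSN, ← ENNReal.ofReal_mul (by positivity), ← ofReal_norm]
  refine ENNReal.ofReal_le_ofReal ((norm_add_le _ _).trans ?_)
  rw [Real.norm_eq_abs (∫ θ in (0 : ℝ)..(π / 2), cos θ * sin θ * _)]
  calc _ ≤ (S * N).toReal * (π / 2) + C * (S * N).toReal := add_le_add t1 t3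
    _ = _ := by ring

/-- The bound on iterates, used for a single iteration. -/
theorem memLp_clm_apply [IsProbabilityMeasure μ] (hp : 1 ≤ p) (e : HilbertBasis ℕ ℝ H)
    {A : W → H →L[ℝ] H} (hAmeas : ∀ h, AEStronglyMeasurable (fun ω => A ω h) μ)
    (hAD : ∀ v : W → H, MemD1 i μ p v → MemD1 i μ p (fun ω => A ω (v ω))) {F : W → H}
    (hF : IsSmoothField F) : MemLp (fun ω => A ω (F ω)) p μ := by
  have := UniformSpace.secondCountable_of_separable W
  obtain ⟨C, -, hC⟩ := exists_sobolev_bound hp e hAD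
  have h := (hC F hF).1 1
  simp only [Function.iterate_one] at h
  exact ⟨aestronglyMeasurable_clm_apply e hAmeas hF.cbSmooth.continuous.aestronglyMeasurable,
    h.trans_lt (ENNReal.mul_lt_top ENNReal.ofReal_lt_top hF.sobolevNorm_lt_top)⟩

/-- Boundedness in `L^r` of `F ↦ δ (A F)`, in dual form. -/
theorem IsAbstractWienerSpace.exists_divergence_clm_bound (hμ : IsAbstractWienerSpace i μ) {m : ℕ}
    (hm : 0 < m) (r : ℝ≥0∞) [ENNReal.HolderConjugate r (4 * m : ℕ)] (hp : 1 ≤ p) (hrp : r ≤ p)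
    (e : HilbertBasis ℕ ℝ H) {A : W → H →L[ℝ] H}
    (hAmeas : ∀ h, AEStronglyMeasurable (fun ω => A ω h) μ)
    (hAD : ∀ v : W → H, MemD1 i μ p v → MemD1 i μ p (fun ω => A ω (v ω))) :
    ∃ K : ℝ, 0 ≤ K ∧ ∀ F : W → H, IsSmoothField F → ∀ χ : W → ℝ, IsSmoothFunctional χ →
      ‖∫ x, ⟪A x (F x), smoothGrad i χ x⟫_ℝ ∂μ‖ₑ ≤
        ENNReal.ofReal K * (sobolevNorm i μ p F * eLpNorm χ (4 * m : ℕ) μ) := by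
  have := hμ.isProbabilityMeasure
  have := UniformSpace.secondCountable_of_separable W
  obtain ⟨C, hC0, hC⟩ := exists_sobolev_bound hp e hAD
  obtain ⟨K, hK0, hK⟩ := hμ.exists_divergence_bound hm r
  refine ⟨K * C, by positivity, fun F hF χ hχ => ?_⟩
  set N := eLpNorm χ (4 * m : ℕ) μ with hN
  set S := sobolevNorm i μ p F with hS
  have hNt : N ≠ ∞ := (hχ.memLp _).2.ne
  obtain ⟨D, hD⟩ := (hχ.cbSmooth.smoothGrad i).exists_bound
  have hAF := (memLp_clm_apply hp e hAmeas hAD hF).integrable hp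
  have hχm := hχ.aestronglyMeasurable_smoothGrad (i := i) (μ := μ)
  -- `A F` is not a smooth field, so it is replaced by a smooth `G` which is `ε`-close in `L^p` and
  -- has controlled Sobolev norm. The error costs only the bound `D` of `∇χ`, which does not depend
  -- on `ε`.
  have hle : ∀ ε : ℝ≥0∞, ε ≠ 0 → ‖∫ x, ⟪A x (F x), smoothGrad i χ x⟫_ℝ ∂μ‖ₑ ≤
      ENNReal.ofReal K * ((ENNReal.ofReal C * S + ε) * N) + ENNReal.ofReal D * ε := by
    intro ε hε
    obtain ⟨G, hG, hGA, hGS⟩ := (hC F hF).2 ε hε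
    have hGi := (hG.memLp (μ := μ) 1).integrable le_rfl
    have hin : ∀ {v : W → H}, Integrable v μ → Integrable (fun x => ⟪v x, smoothGrad i χ x⟫_ℝ) μ :=
      fun {v} hv => by
        refine (hv.norm.const_mul D).mono' (hv.aestronglyMeasurable.inner hχm)
          (Eventually.of_forall fun x => ?_)
        refine (norm_inner_le_norm _ _).trans ?_
        rw [mul_comm]
        exact mul_le_mul_of_nonneg_right (hD x) (norm_nonneg _)
    have hsplit : ∫ x, ⟪A x (F x), smoothGrad i χ x⟫_ℝ ∂μ = (∫ x, ⟪G x, smoothGrad i χ x⟫_ℝ ∂μ) -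
        ∫ x, ⟪G x - A x (F x), smoothGrad i χ x⟫_ℝ ∂μ := by
      rw [← integral_sub (hin hGi) (hin (v := fun x => G x - A x (F x)) (hGi.sub hAF))]
      refine integral_congr_ae (Eventually.of_forall fun x => ?_)
      simp only [inner_sub_left]
      ring
    rw [hsplit]
    refine enorm_sub_le.trans (add_le_add ((hK G hG χ hχ).trans ?_) ?_)
    · gcongr
      refine le_trans (add_le_add ?_ ?_) hGS
      · exact eLpNorm_le_eLpNorm_of_exponent_le hrp hGi.aestronglyMeasurable
      · exact eLpNorm_le_eLpNorm_of_exponent_le hrp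
          (hG.aemeasurable_hsNorm e).aestronglyMeasurable
    · refine (enorm_integral_le_lintegral_enorm _).trans ?_
      rw [← eLpNorm_one_eq_lintegral_enorm]
      have h1 : eLpNorm (fun x => ⟪G x - A x (F x), smoothGrad i χ x⟫_ℝ) 1 μ ≤
          ENNReal.ofReal D * eLpNorm (fun x => G x - A x (F x)) 1 μ :=
        eLpNorm_le_mul_eLpNorm_of_ae_le_mul (Eventually.of_forall fun x => by
          refine (norm_inner_le_norm _ _).trans ?_
          rw [mul_comm]
          exact mul_le_mul_of_nonneg_right (hD x) (norm_nonneg _)) 1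
      refine h1.trans (mul_le_mul_right ?_ _)
      exact (eLpNorm_le_eLpNorm_of_exponent_le hp
        (hGi.sub hAF).aestronglyMeasurable).trans hGA
  have hlim : Tendsto (fun n : ℕ => ENNReal.ofReal K *
      ((ENNReal.ofReal C * S + ((n : ℝ≥0∞) + 1)⁻¹) * N) + ENNReal.ofReal D * ((n : ℝ≥0∞) + 1)⁻¹) atTop
      (𝓝 (ENNReal.ofReal K * ((ENNReal.ofReal C * S + 0) * N) + ENNReal.ofReal D * 0)) := by
    have h0 : Tendsto (fun n : ℕ => ((n : ℝ≥0∞) + 1)⁻¹) atTop (𝓝 0) := by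
      have := (tendsto_add_atTop_iff_nat 1).2 ENNReal.tendsto_inv_nat_nhds_zero
      simpa using this
    refine Tendsto.add ?_ ?_
    · refine ENNReal.Tendsto.const_mul ?_ (Or.inr ENNReal.ofReal_ne_top)
      exact ENNReal.Tendsto.mul_const (tendsto_const_nhds.add h0) (Or.inr hNt)
    · exact ENNReal.Tendsto.const_mul h0 (Or.inr ENNReal.ofReal_ne_top)
  have := ge_of_tendsto hlim (Eventually.of_forall fun n => hle _ (by simp))
  refine this.trans_eq ?_
  rw [ENNReal.ofReal_mul hK0, add_zero, mul_zero, add_zero]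
  ring

/-! ### Resampling the coordinates beyond the first N -/

variable {W H : Type*} [NormedAddCommGroup W] [NormedSpace ℝ W] [CompleteSpace W]
  [TopologicalSpace.SeparableSpace W] [MeasurableSpace W] [BorelSpace W] [NormedAddCommGroup H]
  [InnerProductSpace ℝ H] [CompleteSpace H] {i : H →L[ℝ] W} {μ : Measure W} {p : ℝ≥0∞}

/-- For functionals `l k` with `i* (l k) = e k`, the extension `x ↦ ∑ k < N, l k x • e k` to `W`
of the orthogonal projection on the span of the first `N` basis vectors. -/
def cylProj (l : ℕ → StrongDual ℝ W) (e : HilbertBasis ℕ ℝ H) (N : ℕ) : W →L[ℝ] H :=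
  ∑ k ∈ Finset.range N, (l k).smulRight (e k)

theorem cylProj_apply (l : ℕ → StrongDual ℝ W) (e : HilbertBasis ℕ ℝ H) (N : ℕ) (x : W) :
    cylProj l e N x = ∑ k ∈ Finset.range N, l k x • e k := by
  simp [cylProj]

theorem cylProj_embedding {l : ℕ → StrongDual ℝ W} {e : HilbertBasis ℕ ℝ H}
    (hl : ∀ k, dualEmb i (l k) = e k) (N : ℕ) (h : H) :
    cylProj l e N (i h) = partialProj e N h := by
  rw [cylProj_apply, partialProj_apply]
  refine Finset.sum_congr rfl fun k _ => ?_
  rw [← hl k, dualEmb_inner]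

theorem dualEmb_comp_cylProj {l : ℕ → StrongDual ℝ W} {e : HilbertBasis ℕ ℝ H}
    (hl : ∀ k, dualEmb i (l k) = e k) (N : ℕ) (m : StrongDual ℝ W) :
    dualEmb i (m.comp (i.comp (cylProj l e N))) = partialProj e N (dualEmb i m) := by
  refine ext_inner_right ℝ fun h => ?_
  rw [dualEmb_inner, inner_partialProj_comm, dualEmb_inner]
  simp [cylProj_embedding hl]

/-- The vector whose first coordinates are those of `x` and the remaining ones those of `y`. -/
def mixCoords (i : H →L[ℝ] W) (P : W →L[ℝ] H) (x y : W) : W := i (P x) + (y - i (P y))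

theorem continuous_mixCoords (i : H →L[ℝ] W) (P : W →L[ℝ] H) :
    Continuous fun x : W × W => mixCoords i P x.1 x.2 := by
  unfold mixCoords
  fun_prop

/-- Exchanging the tails of a pair twice restores the pair, because `i ∘ P` is idempotent. This
involution is the change of variables on which the resampled identities rest. -/
theorem mixCoords_mixCoords {l : ℕ → StrongDual ℝ W} {e : HilbertBasis ℕ ℝ H}
    (hl : ∀ k, dualEmb i (l k) = e k) (N : ℕ) (x y : W) :
    mixCoords i (cylProj l e N) (mixCoords i (cylProj l e N) x y)
      (mixCoords i (cylProj l e N) y x) = x := by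
  have h : ∀ z, cylProj l e N (i (cylProj l e N z)) = cylProj l e N z := fun z => by
    rw [cylProj_embedding hl]
    simp only [cylProj_apply]
    rw [map_sum]
    refine Finset.sum_congr rfl fun k hk => ?_
    rw [map_smul]
    congr 1
    refine e.repr.injective ?_
    ext j
    rw [e.repr_apply_apply, e.repr_apply_apply, inner_basis_partialProj]
    split_ifs with hj
    · rfl
    · rw [orthonormal_iff_ite.1 e.orthonormal, if_neg]
      rintro rfl
      exact hj (Finset.mem_range.1 hk)
  simp only [mixCoords, map_add, map_sub, h]
  abel

/-- On `H` the projection is self-adjoint and idempotent, so exchanging tails is an orthogonal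
transformation of the pair. -/
theorem IsAbstractWienerSpace.measurePreserving_mixCoords_pair (hμ : IsAbstractWienerSpace i μ)
    {l : ℕ → StrongDual ℝ W} {e : HilbertBasis ℕ ℝ H} (hl : ∀ k, dualEmb i (l k) = e k) (N : ℕ) :
    MeasurePreserving (fun x : W × W => (mixCoords i (cylProj l e N) x.1 x.2,
      mixCoords i (cylProj l e N) x.2 x.1)) (μ.prod μ) (μ.prod μ) := by
  set Q : W →L[ℝ] W := i.comp (cylProj l e N) with hQ
  have h := hμ.measurePreserving_pair Q (ContinuousLinearMap.id ℝ W - Q)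
    (ContinuousLinearMap.id ℝ W - Q) Q (fun m m' => by
      have h1 : ∀ m : StrongDual ℝ W, dualEmb i (m.comp Q) = partialProj e N (dualEmb i m) :=
        dualEmb_comp_cylProj hl N
      have h2 : ∀ m : StrongDual ℝ W, dualEmb i (m.comp (ContinuousLinearMap.id ℝ W - Q)) =
          dualEmb i m - partialProj e N (dualEmb i m) := fun m => by
        rw [ContinuousLinearMap.comp_sub, ContinuousLinearMap.comp_id, ← dualEmbL_apply, map_sub,
          dualEmbL_apply, dualEmbL_apply, h1]
      rw [← dualEmbL_apply, ← dualEmbL_apply, map_add, map_add]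
      simp only [dualEmbL_apply, h1, h2]
      set a := dualEmb i m
      set b := dualEmb i m'
      have e1 : ∀ x y : H, ⟪partialProj e N x, partialProj e N y⟫_ℝ = ⟪x, partialProj e N y⟫_ℝ :=
        fun x y => by rw [inner_partialProj_comm, partialProj_idem]
      have e2 : ∀ x y : H, ⟪partialProj e N x, y⟫_ℝ = ⟪x, partialProj e N y⟫_ℝ := fun x y =>
        inner_partialProj_comm e N x y
      simp only [← real_inner_self_eq_norm_sq, inner_add_left, inner_add_right, inner_sub_left,
        inner_sub_right, e1, e2]
      simp only [real_inner_comm (partialProj e N a) b, ← e2]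
      ring)
  convert h using 2
  simp only [mixCoords, hQ, ContinuousLinearMap.comp_apply, sub_apply,
    ContinuousLinearMap.id_apply, Prod.mk.injEq, true_and]
  abel

theorem IsAbstractWienerSpace.measurePreserving_mixCoords (hμ : IsAbstractWienerSpace i μ)
    {l : ℕ → StrongDual ℝ W} {e : HilbertBasis ℕ ℝ H} (hl : ∀ k, dualEmb i (l k) = e k) (N : ℕ) :
    MeasurePreserving (fun x : W × W => mixCoords i (cylProj l e N) x.1 x.2) (μ.prod μ) μ := by
  have := hμ.isProbabilityMeasure
  exact measurePreserving_fst.comp (hμ.measurePreserving_mixCoords_pair hl N)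

theorem IsSmoothFunctional.mixCoords {Φ : W → ℝ} (hΦ : IsSmoothFunctional Φ) (P : W →L[ℝ] H)
    (y : W) : IsSmoothFunctional fun x => Φ (mixCoords i P x y) :=
  hΦ.comp_affine (i.comp P) (y - i (P y))

theorem hasFDerivAt_comp_mixCoords {F : Type*} [NormedAddCommGroup F] [NormedSpace ℝ F]
    {Φ : W → F} (hΦ : Differentiable ℝ Φ) (P : W →L[ℝ] H) (x y : W) :
    HasFDerivAt (fun x => Φ (mixCoords i P x y))
      ((fderiv ℝ Φ (mixCoords i P x y)).comp (i.comp P)) x := by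
  refine HasFDerivAt.comp x (hΦ _).hasFDerivAt ?_
  exact (i.comp P).hasFDerivAt.add_const _

theorem smoothGrad_mixCoords {l : ℕ → StrongDual ℝ W} {e : HilbertBasis ℕ ℝ H}
    (hl : ∀ k, dualEmb i (l k) = e k) (N : ℕ) {Φ : W → ℝ} (hΦ : Differentiable ℝ Φ) (x y : W) :
    smoothGrad i (fun x => Φ (mixCoords i (cylProj l e N) x y)) x =
      partialProj e N (smoothGrad i Φ (mixCoords i (cylProj l e N) x y)) := by
  rw [smoothGrad, (hasFDerivAt_comp_mixCoords hΦ _ x y).fderiv, dualEmb_comp_cylProj hl]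
  rfl

theorem fieldGrad_smoothGrad_mixCoords {l : ℕ → StrongDual ℝ W} {e : HilbertBasis ℕ ℝ H}
    (hl : ∀ k, dualEmb i (l k) = e k) (N : ℕ) {Φ : W → ℝ} (hΦ : CbSmooth Φ) (x y : W) :
    fieldGrad i (smoothGrad i fun x => Φ (mixCoords i (cylProj l e N) x y)) x =
      (partialProj e N).comp ((fieldGrad i (smoothGrad i Φ)
        (mixCoords i (cylProj l e N) x y)).comp (partialProj e N)) := by
  have h1 : (smoothGrad i fun x => Φ (mixCoords i (cylProj l e N) x y)) = fun x =>
      partialProj e N (smoothGrad i Φ (mixCoords i (cylProj l e N) x y)) :=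
    funext fun x => smoothGrad_mixCoords hl N hΦ.differentiable x y
  have h2 := (partialProj e N).hasFDerivAt.comp x
    (hasFDerivAt_comp_mixCoords (i := i) (hΦ.smoothGrad i).differentiable (cylProj l e N) x y)
  rw [fieldGrad, h1, show (fun x => partialProj e N (smoothGrad i Φ
    (WienerFlow.mixCoords i (cylProj l e N) x y))) = partialProj e N ∘ fun x => smoothGrad i Φ
    (WienerFlow.mixCoords i (cylProj l e N) x y) from rfl, h2.fderiv]
  ext h
  simp [fieldGrad, cylProj_embedding hl]

/-- In the adapted basis the projection keeps or kills each basis vector, and on the left it does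
not increase norms. -/
theorem hsNorm_partialProj_comp_le (e : HilbertBasis ℕ ℝ H) (N : ℕ) (K : H →L[ℝ] H) :
    hsNorm ((partialProj e N).comp (K.comp (partialProj e N))) ≤ hsNorm K := by
  rw [← ENNReal.pow_le_pow_left_iff two_ne_zero, hsNorm_sq_eq_tsum e, hsNorm_sq_eq_tsum e]
  refine ENNReal.tsum_le_tsum fun k => ?_
  refine ENNReal.pow_le_pow_left ?_
  have h1 : partialProj e N (e k) = if k < N then e k else 0 := by
    refine e.repr.injective ?_
    ext j
    rw [e.repr_apply_apply, e.repr_apply_apply, inner_basis_partialProj]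
    have := orthonormal_iff_ite.1 e.orthonormal j k
    split_ifs with h1 h2 h2
    · rfl
    · rw [inner_zero_right, this, if_neg (by rintro rfl; exact h2 h1)]
    · rw [this, if_neg (by rintro rfl; exact h1 h2)]
    · simp
  simp only [ContinuousLinearMap.comp_apply, h1]
  split_ifs with hk
  · rw [enorm_le_iff_norm_le]
    exact norm_partialProj_le e N _
  · simp

/-! ### Duality bounds under resampling -/

variable {W H : Type*} [NormedAddCommGroup W] [NormedSpace ℝ W] [CompleteSpace W]
  [TopologicalSpace.SeparableSpace W] [MeasurableSpace W] [BorelSpace W] [NormedAddCommGroup H]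
  [InnerProductSpace ℝ H] [CompleteSpace H] {i : H →L[ℝ] W} {μ : Measure W} {p : ℝ≥0∞}

theorem lintegral_mul_le_eLpNorm {X : Type*} [MeasurableSpace X] {ν : Measure X}
    {f g : X → ℝ≥0∞} (hf : AEMeasurable f ν) (hg : AEMeasurable g ν) {r q : ℝ≥0∞} (hr : r ≠ ∞)
    (hq : q ≠ ∞) [ENNReal.HolderConjugate r q] :
    ∫⁻ x, f x * g x ∂ν ≤ eLpNorm f r ν * eLpNorm g q ν := by
  rw [eLpNorm_eq_lintegral_rpow_enorm_toReal (ENNReal.HolderConjugate.ne_zero r q) hr,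
    eLpNorm_eq_lintegral_rpow_enorm_toReal (ENNReal.HolderConjugate.ne_zero q r) hq]
  exact ENNReal.lintegral_mul_le_Lp_mul_Lq ν
    (ENNReal.HolderConjugate.toReal_of_ne_top hr hq) hf hg

theorem aemeasurable_eLpNorm_prod {X Y : Type*} [MeasurableSpace X] [MeasurableSpace Y]
    {ν : Measure X} {κ : Measure Y} [SFinite ν] [SFinite κ] {f : X × Y → ℝ≥0∞}
    (hf : AEMeasurable f (ν.prod κ)) {r : ℝ≥0∞} (hr0 : r ≠ 0) (hr : r ≠ ∞) :
    AEMeasurable (fun x => eLpNorm (fun y => f (x, y)) r κ) ν := by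
  simp only [eLpNorm_eq_lintegral_rpow_enorm_toReal hr0 hr, enorm_eq_self]
  exact (AEMeasurable.lintegral_prod_right' (hf.pow_const _)).pow_const _

theorem IsAbstractWienerSpace.aemeasurable_comp_mixCoords (hμ : IsAbstractWienerSpace i μ)
    {l : ℕ → StrongDual ℝ W} {e : HilbertBasis ℕ ℝ H} (hl : ∀ k, dualEmb i (l k) = e k) (N : ℕ)
    {g : W → ℝ≥0∞} (hg : AEMeasurable g μ) :
    AEMeasurable (fun z : W × W => g (mixCoords i (cylProj l e N) z.2 z.1)) (μ.prod μ) := by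
  have := hμ.isProbabilityMeasure
  exact hg.comp_quasiMeasurePreserving ((hμ.measurePreserving_mixCoords hl N).comp
    Measure.measurePreserving_swap).quasiMeasurePreserving

theorem IsAbstractWienerSpace.eLpNorm_eLpNorm_mixCoords (hμ : IsAbstractWienerSpace i μ)
    {l : ℕ → StrongDual ℝ W} {e : HilbertBasis ℕ ℝ H} (hl : ∀ k, dualEmb i (l k) = e k) (N : ℕ)
    {g : W → ℝ≥0∞} (hg : AEMeasurable g μ) {r : ℝ≥0∞} (hr0 : r ≠ 0) (hr : r ≠ ∞) :
    eLpNorm (fun y => eLpNorm (fun x => g (mixCoords i (cylProj l e N) x y)) r μ) r μ =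
      eLpNorm g r μ := by
  have := hμ.isProbabilityMeasure
  have h := eLpNorm_prod_eq (f := fun z : W × W => g (mixCoords i (cylProj l e N) z.2 z.1))
    (ν := μ) (κ := μ) (hμ.aemeasurable_comp_mixCoords hl N hg) hr0 hr
  rw [h]
  exact eLpNorm_comp_measurePreserving hg.aestronglyMeasurable
    ((hμ.measurePreserving_mixCoords hl N).comp Measure.measurePreserving_swap)

/-- A bound for a bilinear form in smooth functionals is kept when the functionals are
composed with a partial resampling of the coordinates and the resampling is averaged. -/
theorem IsAbstractWienerSpace.lintegral_mixCoords_le (hμ : IsAbstractWienerSpace i μ)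
    {l : ℕ → StrongDual ℝ W} {e : HilbertBasis ℕ ℝ H} (hl : ∀ k, dualEmb i (l k) = e k)
    (N : ℕ) {r q : ℝ≥0∞} (hr : r ≠ ∞) (hq : q ≠ ∞) [ENNReal.HolderConjugate r q]
    (hp' : p ≠ ∞) (hrp : r ≤ p) {Φ χ : W → ℝ} (hΦ : IsSmoothFunctional Φ)
    (hχ : IsSmoothFunctional χ) :
    ∫⁻ y, sobolevNorm i μ p (smoothGrad i fun x => Φ (mixCoords i (cylProj l e N) x y)) *
        eLpNorm (fun x => χ (mixCoords i (cylProj l e N) x y)) q μ ∂μ ≤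
      sobolevNorm i μ p (smoothGrad i Φ) * eLpNorm χ q μ := by
  have := hμ.isProbabilityMeasure
  have := UniformSpace.secondCountable_of_separable W
  have hr0 : r ≠ 0 := ENNReal.HolderConjugate.ne_zero r q
  have hq0 : q ≠ 0 := ENNReal.HolderConjugate.ne_zero q r
  have hp0 : p ≠ 0 := (lt_of_lt_of_le (pos_iff_ne_zero.2 hr0) hrp).ne'
  have hF : IsSmoothField (smoothGrad i Φ) := hΦ.isSmoothField_smoothGrad i
  set mix := mixCoords i (cylProj l e N) with hmix
  set g₁ : W → ℝ≥0∞ := fun x => ‖smoothGrad i Φ x‖ₑ with hg₁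
  set g₂ : W → ℝ≥0∞ := fun x => hsNorm (fieldGrad i (smoothGrad i Φ) x) with hg₂
  have m₁ : AEMeasurable g₁ μ := hF.aestronglyMeasurable.enorm
  have m₂ : AEMeasurable g₂ μ := hF.aemeasurable_hsNorm e
  have m₃ : AEMeasurable (fun x => ‖χ x‖ₑ) μ := hχ.aestronglyMeasurable.enorm
  have M₁ := aemeasurable_eLpNorm_prod (hμ.aemeasurable_comp_mixCoords hl N m₁) hp0 hp'
  have M₂ := aemeasurable_eLpNorm_prod (hμ.aemeasurable_comp_mixCoords hl N m₂) hp0 hp'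
  have M₃ := aemeasurable_eLpNorm_prod (hμ.aemeasurable_comp_mixCoords hl N m₃) hq0 hq
  have h1 (y : W) : sobolevNorm i μ p (smoothGrad i fun x => Φ (mix x y)) ≤
      eLpNorm (fun x => g₁ (mix x y)) p μ + eLpNorm (fun x => g₂ (mix x y)) p μ := by
    refine add_le_add (eLpNorm_mono_enorm fun x => ?_) (eLpNorm_mono_enorm fun x => ?_)
    · rw [smoothGrad_mixCoords hl N hΦ.differentiable, enorm_eq_self, enorm_le_iff_norm_le]
      exact norm_partialProj_le e N _
    · rw [fieldGrad_smoothGrad_mixCoords hl N hΦ.cbSmooth, enorm_eq_self, enorm_eq_self]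
      exact hsNorm_partialProj_comp_le e N _
  have hmono {f : W → ℝ≥0∞} (hf : AEMeasurable f μ) : eLpNorm f r μ ≤ eLpNorm f p μ :=
    eLpNorm_le_eLpNorm_of_exponent_le hrp hf.aestronglyMeasurable
  -- For fixed `y` the substitution inserts only projections, which do not increase norms. Hölder in
  -- `y` with exponents `r` and `q`, then `r ≤ p` on a probability space, and Fubini restore the
  -- original norms, since mixing preserves the measure.
  calc _ ≤ ∫⁻ y, (eLpNorm (fun x => g₁ (mix x y)) p μ + eLpNorm (fun x => g₂ (mix x y)) p μ) *
        eLpNorm (fun x => ‖χ (mix x y)‖ₑ) q μ ∂μ := by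
        refine lintegral_mono fun y => mul_le_mul' (h1 y) ?_
        rw [eLpNorm_enorm]
    _ ≤ eLpNorm (fun y => eLpNorm (fun x => g₁ (mix x y)) p μ +
          eLpNorm (fun x => g₂ (mix x y)) p μ) r μ *
        eLpNorm (fun y => eLpNorm (fun x => ‖χ (mix x y)‖ₑ) q μ) q μ :=
        lintegral_mul_le_eLpNorm (M₁.add M₂) M₃ hr hq
    _ ≤ _ := by
        refine mul_le_mul' ((hmono (M₁.add M₂)).trans ?_) ?_
        · refine (eLpNorm_add_le M₁.aestronglyMeasurable M₂.aestronglyMeasurable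
            ((ENNReal.HolderConjugate.one_le r q).trans hrp)).trans ?_
          refine add_le_add ?_ ?_
          · exact (hμ.eLpNorm_eLpNorm_mixCoords hl N m₁ hp0 hp').le.trans
              (eLpNorm_enorm _).le
          · exact (hμ.eLpNorm_eLpNorm_mixCoords hl N m₂ hp0 hp').le
        · exact (hμ.eLpNorm_eLpNorm_mixCoords hl N m₃ hq0 hq).le.trans (eLpNorm_enorm _).le

theorem integrable_mul_fderiv_mixCoords (hμ : IsAbstractWienerSpace i μ) {l : ℕ → StrongDual ℝ W}
    {e : HilbertBasis ℕ ℝ H} (hl : ∀ k, dualEmb i (l k) = e k) (N : ℕ)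
    {B : W → W} (hB : MemLp B 1 μ)
    {Φ χ : W → ℝ} (hΦ : IsSmoothFunctional Φ)
    (hχ : IsSmoothFunctional χ) :
    Integrable (fun z : W × W => χ z.1 * fderiv ℝ Φ z.1 (i (cylProj l e N
      (B (mixCoords i (cylProj l e N) z.1 z.2))))) (μ.prod μ) := by
  have := hμ.isProbabilityMeasure
  have := UniformSpace.secondCountable_of_separable W
  obtain ⟨Cχ, hCχ⟩ := hχ.exists_bound
  obtain ⟨CΦ, hCΦ⟩ := hΦ.cbSmooth.exists_fderiv_bound
  have h1 : Integrable (fun z : W × W => B (mixCoords i (cylProj l e N) z.1 z.2)) (μ.prod μ) :=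
    (hμ.measurePreserving_mixCoords hl N).integrable_comp_of_integrable
      (memLp_one_iff_integrable.1 hB)
  have h2 := (i.comp (cylProj l e N)).integrable_comp h1
  have h3 : Integrable (fun z : W × W => fderiv ℝ Φ z.1 (i (cylProj l e N
      (B (mixCoords i (cylProj l e N) z.1 z.2))))) (μ.prod μ) := by
    refine (h2.norm.const_mul CΦ).mono' ?_ (ae_of_all _ fun z => ?_)
    · have h4 : AEStronglyMeasurable (fun z : W × W => fderiv ℝ Φ z.1) (μ.prod μ) :=
        (hΦ.cbSmooth.fderiv.continuous.comp continuous_fst).aestronglyMeasurable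
      exact (ContinuousLinearMap.apply ℝ ℝ (E := W)).flip.aestronglyMeasurable_comp₂ h4 h2.1
    · exact ((fderiv ℝ Φ z.1).le_opNorm _).trans
        (mul_le_mul_of_nonneg_right (hCΦ _) (norm_nonneg _))
  exact h3.bdd_mul (c := Cχ) (hχ.continuous.comp continuous_fst).aestronglyMeasurable
    (ae_of_all _ fun z => hCχ _)

theorem integrable_inner_partialProj_mixCoords (hμ : IsAbstractWienerSpace i μ) {l : ℕ → StrongDual ℝ W}
    {e : HilbertBasis ℕ ℝ H} (hl : ∀ k, dualEmb i (l k) = e k) (N : ℕ) {A : W → H →L[ℝ] H}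
    (hAmeas : ∀ h, AEStronglyMeasurable (fun ω => A ω h) μ) {C : ℝ} (hAbdd : ∀ᵐ ω ∂μ, ‖A ω‖ ≤ C)
    {Φ χ : W → ℝ} (hΦ : IsSmoothFunctional Φ)
    (hχ : IsSmoothFunctional χ) :
    Integrable (fun z : W × W => ⟪A (mixCoords i (cylProj l e N) z.1 z.2)
      (partialProj e N (smoothGrad i Φ z.1)), partialProj e N (smoothGrad i χ z.1)⟫_ℝ)
      (μ.prod μ) := by
  have := hμ.isProbabilityMeasure
  have := UniformSpace.secondCountable_of_separable W
  have hmp := hμ.measurePreserving_mixCoords hl N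
  obtain ⟨Cχ, hCχ⟩ := (hχ.cbSmooth.smoothGrad i).exists_bound
  obtain ⟨CΦ, hCΦ⟩ := (hΦ.cbSmooth.smoothGrad i).exists_bound
  have c₁ : Continuous fun z : W × W => partialProj e N (smoothGrad i Φ z.1) :=
    (partialProj e N).continuous.comp ((hΦ.cbSmooth.smoothGrad i).continuous.comp continuous_fst)
  have c₂ : Continuous fun z : W × W => partialProj e N (smoothGrad i χ z.1) :=
    (partialProj e N).continuous.comp ((hχ.cbSmooth.smoothGrad i).continuous.comp continuous_fst)
  refine Integrable.of_bound (AEStronglyMeasurable.inner (aestronglyMeasurable_clm_apply e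
    (fun h => (hAmeas h).comp_measurePreserving hmp) c₁.aestronglyMeasurable)
    c₂.aestronglyMeasurable) (C * CΦ * Cχ) ?_
  filter_upwards [hmp.quasiMeasurePreserving.ae hAbdd] with z hz
  have h0 := (norm_nonneg _).trans hz
  refine (norm_inner_le_norm _ _).trans ?_
  refine mul_le_mul (((A _).le_opNorm _).trans (mul_le_mul hz ((norm_partialProj_le e N _).trans
    (hCΦ _)) (norm_nonneg _) h0)) ((norm_partialProj_le e N _).trans (hCχ _)) (norm_nonneg _)
    (mul_nonneg h0 ((norm_nonneg _).trans (hCΦ 0)))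

/-- After exchanging tails, `B` is evaluated at the integration variable `x`, and `i P (B x)` is
what the direction `B x` becomes under `x ↦ mixCoords i P x y`. The identity between `A` and `B`
therefore applies for each `y`; exchanging tails back puts the resampled point inside `A`. -/
theorem integral_mul_fderiv_mixCoords (hμ : IsAbstractWienerSpace i μ) {l : ℕ → StrongDual ℝ W}
    {e : HilbertBasis ℕ ℝ H} (hl : ∀ k, dualEmb i (l k) = e k) (N : ℕ) {A : W → H →L[ℝ] H}
    (hAmeas : ∀ h, AEStronglyMeasurable (fun ω => A ω h) μ) {C : ℝ} (hAbdd : ∀ᵐ ω ∂μ, ‖A ω‖ ≤ C)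
    {B : W → W} (hB : MemLp B 1 μ)
    (hid : ∀ Φ Ψ : W → ℝ, IsSmoothFunctional Φ → IsSmoothFunctional Ψ →
      ∫ ω, ⟪A ω (smoothGrad i Φ ω), smoothGrad i Ψ ω⟫_ℝ ∂μ = ∫ ω, Ψ ω * fderiv ℝ Φ ω (B ω) ∂μ)
    {Φ χ : W → ℝ} (hΦ : IsSmoothFunctional Φ)
    (hχ : IsSmoothFunctional χ) :
    ∫ z, χ z.1 * fderiv ℝ Φ z.1 (i (cylProj l e N (B (mixCoords i (cylProj l e N) z.1 z.2))))
        ∂(μ.prod μ) =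
      ∫ z, ⟪A (mixCoords i (cylProj l e N) z.1 z.2) (partialProj e N (smoothGrad i Φ z.1)),
        partialProj e N (smoothGrad i χ z.1)⟫_ℝ ∂(μ.prod μ) ∧
    ∫ z, χ z.1 * fderiv ℝ Φ z.1 (i (cylProj l e N (B (mixCoords i (cylProj l e N) z.1 z.2))))
        ∂(μ.prod μ) =
      ∫ y, ∫ x, ⟪A x (smoothGrad i (fun x => Φ (mixCoords i (cylProj l e N) x y)) x),
        smoothGrad i (fun x => χ (mixCoords i (cylProj l e N) x y)) x⟫_ℝ ∂μ ∂μ := by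
  have := hμ.isProbabilityMeasure
  have hσ := hμ.measurePreserving_mixCoords_pair hl N
  have i₁ := integrable_mul_fderiv_mixCoords hμ hl N hB hΦ hχ
  have i₂ := integrable_inner_partialProj_mixCoords hμ hl N hAmeas hAbdd hΦ hχ
  have e₁ := integral_comp_of_measurePreserving hσ i₁.1
  have e₂ := integral_comp_of_measurePreserving hσ i₂.1
  have j₁ := hσ.integrable_comp_of_integrable i₁
  have j₂ := hσ.integrable_comp_of_integrable i₂
  simp only [Function.comp_def, mixCoords_mixCoords hl] at e₁ e₂ j₁ j₂
  have e₃ : ∀ y, ∫ x, χ (mixCoords i (cylProj l e N) x y) *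
        fderiv ℝ Φ (mixCoords i (cylProj l e N) x y) (i (cylProj l e N (B x))) ∂μ =
      ∫ x, ⟪A x (smoothGrad i (fun x => Φ (mixCoords i (cylProj l e N) x y)) x),
        smoothGrad i (fun x => χ (mixCoords i (cylProj l e N) x y)) x⟫_ℝ ∂μ := fun y => by
    rw [hid _ _ (hΦ.mixCoords _ y) (hχ.mixCoords _ y)]
    refine integral_congr_ae (ae_of_all _ fun x => ?_)
    simp only [(hasFDerivAt_comp_mixCoords hΦ.differentiable _ x y).fderiv]
    rfl
  have e₄ : ∫ z, χ z.1 * fderiv ℝ Φ z.1 (i (cylProj l e N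
        (B (mixCoords i (cylProj l e N) z.1 z.2)))) ∂(μ.prod μ) =
      ∫ y, ∫ x, ⟪A x (smoothGrad i (fun x => Φ (mixCoords i (cylProj l e N) x y)) x),
        smoothGrad i (fun x => χ (mixCoords i (cylProj l e N) x y)) x⟫_ℝ ∂μ ∂μ := by
    rw [← e₁, integral_prod_symm _ j₁]
    exact integral_congr_ae (ae_of_all _ e₃)
  refine ⟨?_, e₄⟩
  rw [e₄, ← e₂, integral_prod_symm _ j₂]
  refine integral_congr_ae (ae_of_all _ fun y => integral_congr_ae (ae_of_all _ fun x => ?_))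
  simp only [smoothGrad_mixCoords hl N hΦ.differentiable,
    smoothGrad_mixCoords hl N hχ.differentiable]

/-- The bound for each fixed `y` is averaged. The constant does not depend on `N`, which is what
uniform integrability will require. -/
theorem enorm_integral_mul_fderiv_mixCoords_le (hμ : IsAbstractWienerSpace i μ) {l : ℕ → StrongDual ℝ W}
    {e : HilbertBasis ℕ ℝ H} (hl : ∀ k, dualEmb i (l k) = e k) (N : ℕ) {A : W → H →L[ℝ] H}
    (hAmeas : ∀ h, AEStronglyMeasurable (fun ω => A ω h) μ) {C : ℝ} (hAbdd : ∀ᵐ ω ∂μ, ‖A ω‖ ≤ C)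
    {B : W → W} (hB : MemLp B 1 μ)
    (hid : ∀ Φ Ψ : W → ℝ, IsSmoothFunctional Φ → IsSmoothFunctional Ψ →
      ∫ ω, ⟪A ω (smoothGrad i Φ ω), smoothGrad i Ψ ω⟫_ℝ ∂μ = ∫ ω, Ψ ω * fderiv ℝ Φ ω (B ω) ∂μ)
    {r q : ℝ≥0∞} (hr : r ≠ ∞) (hq : q ≠ ∞)
    [ENNReal.HolderConjugate r q] (hp' : p ≠ ∞) (hrp : r ≤ p) {K : ℝ}
    (hK : ∀ Φ χ : W → ℝ, IsSmoothFunctional Φ → IsSmoothFunctional χ →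
      ‖∫ x, ⟪A x (smoothGrad i Φ x), smoothGrad i χ x⟫_ℝ ∂μ‖ₑ ≤
        ENNReal.ofReal K * (sobolevNorm i μ p (smoothGrad i Φ) * eLpNorm χ q μ))
    {Φ χ : W → ℝ} (hΦ : IsSmoothFunctional Φ) (hχ : IsSmoothFunctional χ) :
    ‖∫ z, χ z.1 * fderiv ℝ Φ z.1 (i (cylProj l e N (B (mixCoords i (cylProj l e N) z.1 z.2))))
        ∂(μ.prod μ)‖ₑ ≤
      ENNReal.ofReal K * (sobolevNorm i μ p (smoothGrad i Φ) * eLpNorm χ q μ) := by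
  rw [(integral_mul_fderiv_mixCoords hμ hl N hAmeas hAbdd hB hid hΦ hχ).2]
  refine (enorm_integral_le_lintegral_enorm _).trans ((lintegral_mono fun y =>
    hK _ _ (hΦ.mixCoords _ y) (hχ.mixCoords _ y)).trans ?_)
  rw [lintegral_const_mul' _ _ ENNReal.ofReal_ne_top]
  gcongr
  exact hμ.lintegral_mixCoords_le hl N hr hq hp' hrp hΦ hχ

/-! ### Convergence of the resampled objects as N → ∞ -/

variable {W H : Type*} [NormedAddCommGroup W] [NormedSpace ℝ W] [CompleteSpace W]
  [TopologicalSpace.SeparableSpace W] [MeasurableSpace W] [BorelSpace W] [NormedAddCommGroup H]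
  [InnerProductSpace ℝ H] [CompleteSpace H] {i : H →L[ℝ] W} {μ : Measure W} {p : ℝ≥0∞}

/-- The increment is `m' z.2 - m' z.1`, where `i* m'` is the tail of `i* m`; each term is at most
its standard deviation. -/
theorem IsAbstractWienerSpace.eLpNorm_dual_mixCoords_sub_le (hμ : IsAbstractWienerSpace i μ)
    {l : ℕ → StrongDual ℝ W} {e : HilbertBasis ℕ ℝ H} (hl : ∀ k, dualEmb i (l k) = e k) (N : ℕ)
    (m : StrongDual ℝ W) :
    eLpNorm (fun z : W × W => m (mixCoords i (cylProj l e N) z.1 z.2 - z.1)) 1 (μ.prod μ) ≤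
      2 * ‖dualEmb i m - partialProj e N (dualEmb i m)‖ₑ := by
  have := hμ.isProbabilityMeasure
  have := UniformSpace.secondCountable_of_separable W
  set m' : StrongDual ℝ W := m - m.comp (i.comp (cylProj l e N)) with hm'
  have h1 : dualEmb i m' = dualEmb i m - partialProj e N (dualEmb i m) := by
    rw [hm', ← dualEmbL_apply, map_sub, dualEmbL_apply, dualEmbL_apply,
      dualEmb_comp_cylProj hl]
  have h2 : (fun z : W × W => m (mixCoords i (cylProj l e N) z.1 z.2 - z.1)) =
      (fun z => m' z.2) - fun z => m' z.1 := by
    funext z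
    simp only [mixCoords, hm', map_sub, map_add, Pi.sub_apply, sub_apply,
      ContinuousLinearMap.comp_apply]
    ring
  have h3 : eLpNorm m' 1 μ ≤ ‖dualEmb i m - partialProj e N (dualEmb i m)‖ₑ :=
    h1 ▸ hμ.eLpNorm_dual_le m' (by norm_num)
  have hm := m'.continuous.aestronglyMeasurable (μ := μ)
  rw [h2, two_mul]
  refine (eLpNorm_sub_le (m'.continuous.comp continuous_snd).aestronglyMeasurable
    (m'.continuous.comp continuous_fst).aestronglyMeasurable le_rfl).trans (add_le_add ?_ ?_)
  · exact (eLpNorm_comp_measurePreserving hm (measurePreserving_snd (μ := μ) (ν := μ))).le.trans h3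
  · exact (eLpNorm_comp_measurePreserving hm (measurePreserving_fst (μ := μ) (ν := μ))).le.trans h3

theorem IsAbstractWienerSpace.tendsto_eLpNorm_smooth_mixCoords (hμ : IsAbstractWienerSpace i μ)
    {l : ℕ → StrongDual ℝ W} {e : HilbertBasis ℕ ℝ H} (hl : ∀ k, dualEmb i (l k) = e k)
    {Φ : W → ℝ} (hΦ : IsSmoothFunctional Φ) :
    Tendsto (fun N => eLpNorm (fun z : W × W =>
      Φ (mixCoords i (cylProj l e N) z.1 z.2) - Φ z.1) 1 (μ.prod μ)) atTop (𝓝 0) := by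
  have := hμ.isProbabilityMeasure
  have := UniformSpace.secondCountable_of_separable W
  obtain ⟨n, m, φ, hφ, rfl⟩ := hΦ
  obtain ⟨L, hL⟩ := CbSmooth.exists_fderiv_bound (f := φ) hφ
  have hL0 : 0 ≤ L := (norm_nonneg _).trans (hL 0)
  have h1 (N : ℕ) : eLpNorm (fun z : W × W =>
      φ (fun j => m j (mixCoords i (cylProj l e N) z.1 z.2)) - φ (fun j => m j z.1)) 1
        (μ.prod μ) ≤ ENNReal.ofReal L *
          ∑ j, 2 * ‖dualEmb i (m j) - partialProj e N (dualEmb i (m j))‖ₑ := by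
    have h2 : ∀ z : W × W, ‖φ (fun j => m j (mixCoords i (cylProj l e N) z.1 z.2)) -
        φ (fun j => m j z.1)‖ ≤
        L * ‖∑ j, ‖m j (mixCoords i (cylProj l e N) z.1 z.2 - z.1)‖‖ := fun z => by
      refine (Convex.norm_image_sub_le_of_norm_fderiv_le (𝕜 := ℝ)
        (fun x _ => CbSmooth.differentiable hφ x) (fun x _ => hL x) convex_univ
        (Set.mem_univ _) (Set.mem_univ _)).trans ?_
      gcongr
      rw [Real.norm_of_nonneg (Finset.sum_nonneg fun j _ => norm_nonneg _)]
      refine (pi_norm_le_iff_of_nonneg (Finset.sum_nonneg fun j _ => norm_nonneg _)).2 fun j => ?_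
      refine le_trans (le_of_eq ?_) (Finset.single_le_sum
        (f := fun j => ‖m j (mixCoords i (cylProj l e N) z.1 z.2 - z.1)‖)
        (fun j _ => norm_nonneg _) (Finset.mem_univ j))
      rw [map_sub]
      rfl
    refine (eLpNorm_le_mul_eLpNorm_of_ae_le_mul (ae_of_all _ h2) 1).trans ?_
    gcongr
    have h3 : (fun z : W × W => ∑ j, ‖m j (mixCoords i (cylProj l e N) z.1 z.2 - z.1)‖) =
        ∑ j, fun z : W × W => ‖m j (mixCoords i (cylProj l e N) z.1 z.2 - z.1)‖ := by
      funext z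
      simp
    rw [h3]
    refine (eLpNorm_sum_le (fun j _ => ?_) le_rfl).trans (Finset.sum_le_sum fun j _ => ?_)
    · exact (((m j).continuous.comp ((continuous_mixCoords i _).sub continuous_fst)).norm
        ).aestronglyMeasurable
    · rw [eLpNorm_norm]
      exact hμ.eLpNorm_dual_mixCoords_sub_le hl N (m j)
  refine tendsto_of_tendsto_of_tendsto_of_le_of_le tendsto_const_nhds ?_ (fun _ => zero_le) h1
  have h4 : Tendsto (fun N => ENNReal.ofReal L *
      ∑ j, 2 * ‖dualEmb i (m j) - partialProj e N (dualEmb i (m j))‖ₑ) atTop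
      (𝓝 (ENNReal.ofReal L * ∑ j : Fin n, 2 * 0)) := by
    refine ENNReal.Tendsto.const_mul (tendsto_finsetSum _ fun j _ =>
      ENNReal.Tendsto.const_mul ?_ (Or.inr (by simp))) (Or.inr ENNReal.ofReal_ne_top)
    have h5 := ((tendsto_const_nhds (x := dualEmb i (m j))).sub
      (tendsto_partialProj e (dualEmb i (m j)))).enorm
    simpa using h5
  simpa using h4

theorem IsAbstractWienerSpace.tendsto_eLpNorm_mixCoords (hμ : IsAbstractWienerSpace i μ)
    {l : ℕ → StrongDual ℝ W} {e : HilbertBasis ℕ ℝ H} (hl : ∀ k, dualEmb i (l k) = e k)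
    {E : Type*} [NormedAddCommGroup E] [NormedSpace ℝ E] {g : W → E} (hg : MemLp g 1 μ) :
    Tendsto (fun N => eLpNorm (fun z : W × W =>
      g (mixCoords i (cylProj l e N) z.1 z.2) - g z.1) 1 (μ.prod μ)) atTop (𝓝 0) := by
  have := hμ.isProbabilityMeasure
  exact tendsto_eLpNorm_comp_sub (fun N => hμ.measurePreserving_mixCoords hl N)
    measurePreserving_fst (fun Φ hΦ => hμ.tendsto_eLpNorm_smooth_mixCoords hl hΦ) hg

/-- The coordinates of a sum `B = ∑ b k • i (e k)`. -/
theorem ae_eq_apply_of_tendsto {l : ℕ → StrongDual ℝ W} {e : HilbertBasis ℕ ℝ H}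
    (hl : ∀ k, dualEmb i (l k) = e k) {b : ℕ → W → ℝ} (hb : ∀ k, Integrable (b k) μ)
    {B : W → W} (hB : MemLp B 1 μ)
    (hBsum : Tendsto
      (fun n => eLpNorm (fun ω => (∑ k ∈ Finset.range n, b k ω • i (e k)) - B ω) 1 μ)
      atTop (𝓝 0)) (k : ℕ) : b k =ᵐ[μ] fun ω => l k (B ω) := by
  have h1 (n : ℕ) (hn : k < n) : eLpNorm (fun ω => b k ω - l k (B ω)) 1 μ ≤
      ENNReal.ofReal ‖l k‖ *
        eLpNorm (fun ω => (∑ j ∈ Finset.range n, b j ω • i (e j)) - B ω) 1 μ := by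
    refine eLpNorm_le_mul_eLpNorm_of_ae_le_mul (ae_of_all _ fun ω => ?_) 1
    refine le_trans (le_of_eq ?_) ((l k).le_opNorm _)
    congr 1
    rw [map_sub, map_sum]
    congr 1
    rw [Finset.sum_eq_single k]
    · rw [map_smul, ← dualEmb_inner, hl, real_inner_self_eq_norm_sq, e.orthonormal.1]
      simp
    · intro j _ hj
      rw [map_smul, ← dualEmb_inner, hl, e.orthonormal.2 hj.symm, smul_zero]
    · intro h
      exact absurd (Finset.mem_range.2 hn) h
  have h2 : Tendsto (fun n => ENNReal.ofReal ‖l k‖ *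
      eLpNorm (fun ω => (∑ j ∈ Finset.range n, b j ω • i (e j)) - B ω) 1 μ) atTop (𝓝 0) := by
    simpa using ENNReal.Tendsto.const_mul hBsum (Or.inr (ENNReal.ofReal_ne_top (r := ‖l k‖)))
  have h3 : eLpNorm (fun ω => b k ω - l k (B ω)) 1 μ = 0 := by
    refine le_antisymm (ge_of_tendsto h2 ?_) zero_le
    filter_upwards [eventually_gt_atTop k] with n hn using h1 n hn
  have h4 := (eLpNorm_eq_zero_iff ((hb k).1.sub
    ((l k).continuous.comp_aestronglyMeasurable hB.1)) one_ne_zero).1 h3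
  filter_upwards [h4] with ω hω
  simpa [sub_eq_zero] using hω

theorem tendsto_eLpNorm_cylProj_sub {l : ℕ → StrongDual ℝ W} {e : HilbertBasis ℕ ℝ H}
    (hl : ∀ k, dualEmb i (l k) = e k) {b : ℕ → W → ℝ} (hb : ∀ k, Integrable (b k) μ)
    {B : W → W} (hB : MemLp B 1 μ)
    (hBsum : Tendsto
      (fun n => eLpNorm (fun ω => (∑ k ∈ Finset.range n, b k ω • i (e k)) - B ω) 1 μ)
      atTop (𝓝 0)) :
    Tendsto (fun n => eLpNorm (fun ω => i (cylProj l e n (B ω)) - B ω) 1 μ) atTop (𝓝 0) := by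
  refine hBsum.congr fun n => eLpNorm_congr_ae ?_
  have h1 := ae_all_iff.2 fun k => ae_eq_apply_of_tendsto hl hb hB hBsum k
  filter_upwards [h1] with ω hω
  simp only [cylProj_apply, map_sum, map_smul, hω]

/-- The average of `B` over the coordinates of index at least `N`. -/
def condCoords (i : H →L[ℝ] W) (μ : Measure W) (P : W →L[ℝ] H) (B : W → W) (x : W) : W :=
  ∫ y, B (mixCoords i P x y) ∂μ

theorem IsAbstractWienerSpace.integrable_mixCoords (hμ : IsAbstractWienerSpace i μ)
    {l : ℕ → StrongDual ℝ W} {e : HilbertBasis ℕ ℝ H} (hl : ∀ k, dualEmb i (l k) = e k) (N : ℕ)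
    {B : W → W} (hB : MemLp B 1 μ) :
    Integrable (fun z : W × W => B (mixCoords i (cylProj l e N) z.1 z.2)) (μ.prod μ) := by
  have := hμ.isProbabilityMeasure
  exact (hμ.measurePreserving_mixCoords hl N).integrable_comp_of_integrable
    (memLp_one_iff_integrable.1 hB)

theorem IsAbstractWienerSpace.integrable_condCoords (hμ : IsAbstractWienerSpace i μ)
    {l : ℕ → StrongDual ℝ W} {e : HilbertBasis ℕ ℝ H} (hl : ∀ k, dualEmb i (l k) = e k) (N : ℕ)
    {B : W → W} (hB : MemLp B 1 μ) : Integrable (condCoords i μ (cylProj l e N) B) μ := by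
  have := hμ.isProbabilityMeasure
  exact (hμ.integrable_mixCoords hl N hB).integral_prod_left

/-- The resampled variable enters only through a linear map applied to `B`, so integrating it out
replaces `B` by its average and returns to a single copy of `W`. -/
theorem IsAbstractWienerSpace.integral_mul_fderiv_condCoords (hμ : IsAbstractWienerSpace i μ)
    {l : ℕ → StrongDual ℝ W} {e : HilbertBasis ℕ ℝ H} (hl : ∀ k, dualEmb i (l k) = e k) (N : ℕ)
    {B : W → W} (hB : MemLp B 1 μ) {Φ χ : W → ℝ} (hΦ : IsSmoothFunctional Φ)
    (hχ : IsSmoothFunctional χ) :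
    ∫ z, χ z.1 * fderiv ℝ Φ z.1 (i (cylProj l e N (B (mixCoords i (cylProj l e N) z.1 z.2))))
        ∂(μ.prod μ) =
      ∫ x, χ x * fderiv ℝ Φ x (i (cylProj l e N (condCoords i μ (cylProj l e N) B x))) ∂μ := by
  have := hμ.isProbabilityMeasure
  rw [integral_prod _ (integrable_mul_fderiv_mixCoords hμ hl N hB hΦ hχ)]
  refine integral_congr_ae ?_
  filter_upwards [(hμ.integrable_mixCoords hl N hB).prod_right_ae] with x hx
  simp only [integral_const_mul]
  congr 1
  exact ((fderiv ℝ Φ x).comp (i.comp (cylProj l e N))).integral_comp_comm hx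

/-- Averaging contracts the `L¹` norm, so the comparison is made before integrating out `y`. There
the error is that of the partial sum of the series at the mixed point plus the change of `B` under
resampling. -/
theorem IsAbstractWienerSpace.tendsto_eLpNorm_condCoords (hμ : IsAbstractWienerSpace i μ)
    {l : ℕ → StrongDual ℝ W} {e : HilbertBasis ℕ ℝ H} (hl : ∀ k, dualEmb i (l k) = e k)
    {b : ℕ → W → ℝ} (hb : ∀ k, Integrable (b k) μ) {B : W → W} (hB : MemLp B 1 μ)
    (hBsum : Tendsto
      (fun n => eLpNorm (fun ω => (∑ k ∈ Finset.range n, b k ω • i (e k)) - B ω) 1 μ)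
      atTop (𝓝 0)) :
    Tendsto (fun N => eLpNorm (fun ω =>
      i (cylProj l e N (condCoords i μ (cylProj l e N) B ω)) - B ω) 1 μ) atTop (𝓝 0) := by
  have := hμ.isProbabilityMeasure
  have h1 := tendsto_eLpNorm_cylProj_sub hl hb hB hBsum
  have h2 := hμ.tendsto_eLpNorm_mixCoords hl hB
  have h3 := h1.add h2
  rw [add_zero] at h3
  refine tendsto_of_tendsto_of_tendsto_of_le_of_le tendsto_const_nhds h3 (fun _ => zero_le)
    fun N => ?_
  set P := cylProj l e N with hP
  have hmix := hμ.measurePreserving_mixCoords hl N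
  have hBm := hμ.integrable_mixCoords hl N hB
  have hBi := memLp_one_iff_integrable.1 hB
  have a1 : eLpNorm (fun z : W × W => i (P (B (mixCoords i P z.1 z.2))) - B z.1) 1 (μ.prod μ) ≤
      eLpNorm (fun ω => i (P (B ω)) - B ω) 1 μ +
        eLpNorm (fun z : W × W => B (mixCoords i P z.1 z.2) - B z.1) 1 (μ.prod μ) := by
    have hm : AEStronglyMeasurable (fun ω => i (P (B ω)) - B ω) μ :=
      ((i.comp P).continuous.comp_aestronglyMeasurable hB.1).sub hB.1
    rw [← eLpNorm_comp_measurePreserving hm hmix]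
    refine le_trans (le_of_eq ?_) (eLpNorm_add_le (hm.comp_measurePreserving hmix)
      (hBm.1.sub (hBi.comp_fst μ).1) le_rfl)
    congr 1
    funext z
    simp [Function.comp_def, hP]
  refine le_trans ?_ a1
  have a2 : Integrable (fun z : W × W => i (P (B (mixCoords i P z.1 z.2))) - B z.1)
      (μ.prod μ) := ((i.comp P).integrable_comp hBm).sub (hBi.comp_fst μ)
  rw [eLpNorm_one_eq_lintegral_enorm, eLpNorm_one_eq_lintegral_enorm,
    lintegral_prod _ a2.1.enorm]
  refine lintegral_mono_ae ?_
  filter_upwards [hBm.prod_right_ae] with x hx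
  refine le_trans (le_of_eq ?_) (enorm_integral_le_lintegral_enorm _)
  congr 1
  have a3 := (i.comp P).integral_comp_comm hx
  have a4 : ∫ y, (i (P (B (mixCoords i P x y))) - B x) ∂μ =
      (∫ y, i (P (B (mixCoords i P x y))) ∂μ) - B x := by
    have a5 : Integrable (fun y => i (P (B (mixCoords i P x y)))) μ :=
      (i.comp P).integrable_comp hx
    rw [integral_sub a5 (integrable_const _)]
    simp
  rw [a4]
  congr 1
  exact a3.symm

/-! ### Closability, approximation in 𝔻_{p,2}, uniform integrability -/

variable {W H : Type*} [NormedAddCommGroup W] [NormedSpace ℝ W] [CompleteSpace W]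
  [TopologicalSpace.SeparableSpace W] [MeasurableSpace W] [BorelSpace W] [NormedAddCommGroup H]
  [InnerProductSpace ℝ H] [CompleteSpace H] {i : H →L[ℝ] W} {μ : Measure W} {p : ℝ≥0∞}

/-- The gradient is closable in `L^p`, `p > 1`. -/
theorem IsAbstractWienerSpace.ae_eq_zero_of_tendsto_smoothGrad (hμ : IsAbstractWienerSpace i μ)
    {l : ℕ → StrongDual ℝ W} {e : HilbertBasis ℕ ℝ H} (hl : ∀ k, dualEmb i (l k) = e k)
    (p' : ℝ≥0∞) [ENNReal.HolderConjugate p p'] (hp' : p' ≠ ∞) {D : ℕ → W → ℝ}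
    (hD : ∀ k, IsSmoothFunctional (D k)) (h0 : Tendsto (fun k => eLpNorm (D k) p μ) atTop (𝓝 0))
    {w : W → H} (hw : MemLp w p μ)
    (h1 : Tendsto (fun k => eLpNorm (fun x => smoothGrad i (D k) x - w x) p μ) atTop (𝓝 0)) :
    w =ᵐ[μ] 0 := by
  have := hμ.isProbabilityMeasure
  have := UniformSpace.secondCountable_of_separable W
  have hp1 : 1 ≤ p := ENNReal.HolderConjugate.one_le p p'
  have hw1 : MemLp w 1 μ := hw.mono_exponent hp1
  have hgm (k : ℕ) : AEStronglyMeasurable (smoothGrad i (D k)) μ :=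
    (hD k).aestronglyMeasurable_smoothGrad
  have key (n : ℕ) : (fun x => ⟪e n, w x⟫_ℝ) =ᵐ[μ] 0 := by
    have hwi : Integrable (fun x => ⟪e n, w x⟫_ℝ) μ :=
      (memLp_one_iff_integrable.1 hw1).const_inner (e n)
    refine ae_eq_zero_of_forall_integral_smooth hwi fun ψ hψ => ?_
    have hd := hψ.fderiv_apply (i (e n))
    -- This function is the divergence of `ψ e n`. It lies in the dual space `L^p'` because Gaussian
    -- variables have finite moments of every finite order; here `p' ≠ ∞`, that is `p > 1`, enters.
    have hlψ : MemLp (fun x => l n x * ψ x - fderiv ℝ ψ x (i (e n))) p' μ := by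
      obtain ⟨C, hC⟩ := hψ.exists_bound
      have hm : MemLp (fun x => ψ x * l n x) p' μ :=
        MemLp.of_le_mul (hμ.memLp_dual (l n) hp') (c := C)
          (hψ.aestronglyMeasurable.mul (l n).continuous.aestronglyMeasurable)
          (ae_of_all _ fun x => by
            rw [norm_mul]
            exact mul_le_mul_of_nonneg_right (hC x) (norm_nonneg _))
      simp only [mul_comm (ψ _)] at hm
      exact hm.sub (hd.memLp p')
    have e1 (k : ℕ) : ∫ x, ψ x * ⟪e n, smoothGrad i (D k) x⟫_ℝ ∂μ =
        ∫ x, D k x * (l n x * ψ x - fderiv ℝ ψ x (i (e n))) ∂μ := by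
      have h2 := hμ.integral_mul_eq (l n) (hψ.mul (hD k)).cbSmooth
      have h3 : ∀ x, fderiv ℝ (fun x => ψ x * D k x) x (i (dualEmb i (l n))) =
          ψ x * fderiv ℝ (D k) x (i (e n)) + D k x * fderiv ℝ ψ x (i (e n)) := fun x => by
        rw [fderiv_fun_mul (hψ.differentiable x) ((hD k).differentiable x), hl]
        simp
      simp only [h3] at h2
      have j1 : Integrable (fun x => ψ x * fderiv ℝ (D k) x (i (e n))) μ :=
        (hψ.mul ((hD k).fderiv_apply (i (e n)))).integrable
      have j2 : Integrable (fun x => D k x * fderiv ℝ ψ x (i (e n))) μ :=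
        ((hD k).mul hd).integrable
      have j3 : Integrable (fun x => l n x * (ψ x * D k x)) μ := by
        simp only [mul_comm (l n _)]
        exact integrable_smooth_mul (hψ.mul (hD k)) (hμ.integrable_dual (l n))
      rw [integral_add j1 j2] at h2
      simp only [inner_smoothGrad]
      rw [eq_sub_of_add_eq h2.symm, ← integral_sub j3 j2]
      congr 1
      funext x
      ring
    have e2 : Tendsto (fun k => ∫ x, ψ x * ⟪e n, smoothGrad i (D k) x⟫_ℝ ∂μ) atTop (𝓝 0) := by
      rw [tendsto_zero_iff_enorm_tendsto_zero]
      have h2 : Tendsto (fun k => eLpNorm (D k) p μ *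
          eLpNorm (fun x => l n x * ψ x - fderiv ℝ ψ x (i (e n))) p' μ) atTop (𝓝 0) := by
        simpa using ENNReal.Tendsto.mul_const h0 (Or.inr hlψ.2.ne)
      refine tendsto_of_tendsto_of_tendsto_of_le_of_le tendsto_const_nhds h2 (fun _ => zero_le)
        fun k => ?_
      simp only [e1]
      exact enorm_integral_mul_le (hD k).aestronglyMeasurable hlψ.1 p p'
    obtain ⟨C, hC⟩ := hψ.exists_bound
    have e3 : Tendsto (fun k => ∫ x, ψ x * ⟪e n, smoothGrad i (D k) x⟫_ℝ ∂μ) atTop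
        (𝓝 (∫ x, ψ x * ⟪e n, w x⟫_ℝ ∂μ)) := by
      refine tendsto_integral_of_eLpNorm (Eventually.of_forall fun k => ?_)
        (integrable_smooth_mul hψ hwi) ?_
      · simp only [inner_smoothGrad]
        exact (hψ.mul ((hD k).fderiv_apply (i (e n)))).integrable
      · have h2 : Tendsto (fun k => ENNReal.ofReal C *
            eLpNorm (fun x => smoothGrad i (D k) x - w x) p μ) atTop (𝓝 0) := by
          simpa using ENNReal.Tendsto.const_mul h1 (Or.inr (ENNReal.ofReal_ne_top (r := C)))
        refine tendsto_of_tendsto_of_tendsto_of_le_of_le tendsto_const_nhds h2 (fun _ => zero_le)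
          fun k => ?_
        refine le_trans ?_ (mul_le_mul_right (eLpNorm_le_eLpNorm_of_exponent_le hp1
          ((hgm k).sub hw.1)) _)
        refine eLpNorm_le_mul_eLpNorm_of_ae_le_mul (ae_of_all _ fun x => ?_) 1
        rw [← mul_sub, ← inner_sub_right, norm_mul]
        refine mul_le_mul (hC x) ((norm_inner_le_norm _ _).trans ?_) (norm_nonneg _)
          ((norm_nonneg _).trans (hC x))
        rw [e.orthonormal.1, one_mul]
        exact le_rfl
    exact tendsto_nhds_unique e3 e2
  filter_upwards [ae_all_iff.2 key] with x hx
  refine e.repr.injective ?_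
  ext n
  rw [e.repr_apply_apply, hx n]
  simp

/-- A function of `𝔻_{p,2}`, `p > 1`, is approximated by smooth functionals which are bounded in
`𝔻_{p,2}` and the gradients of which converge almost everywhere to its gradient. -/
theorem IsAbstractWienerSpace.exists_seq_of_memD2 (hμ : IsAbstractWienerSpace i μ)
    {l : ℕ → StrongDual ℝ W} {e : HilbertBasis ℕ ℝ H} (hl : ∀ k, dualEmb i (l k) = e k)
    (p' : ℝ≥0∞) [ENNReal.HolderConjugate p p'] (hp' : p' ≠ ∞) {f : W → ℝ} {u : W → H}
    (hf : MemD2 i μ p f) (hu : IsGradient i μ p f u) :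
    ∃ (Φ : ℕ → W → ℝ) (M : ℝ≥0∞), M ≠ ∞ ∧ (∀ k, IsSmoothFunctional (Φ k)) ∧
      (∀ k, sobolevNorm i μ p (smoothGrad i (Φ k)) ≤ M) ∧
      Tendsto (fun k => eLpNorm (fun x => smoothGrad i (Φ k) x - u x) p μ) atTop (𝓝 0) ∧
      ∀ᵐ x ∂μ, Tendsto (fun k => smoothGrad i (Φ k) x) atTop (𝓝 (u x)) := by
  have := hμ.isProbabilityMeasure
  have hp1 : 1 ≤ p := ENNReal.HolderConjugate.one_le p p'
  have hp0 : p ≠ 0 := ENNReal.HolderConjugate.ne_zero p p'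
  have : Fact (1 ≤ p) := ⟨hp1⟩
  obtain ⟨hfp, Φ, hΦ, hΦf, hΦ1, hΦ2⟩ := hf
  obtain ⟨-, hup, Ψ, hΨ, hΨf, hΨu⟩ := hu
  have hgΦ (k : ℕ) : IsSmoothField (smoothGrad i (Φ k)) := (hΦ k).isSmoothField_smoothGrad i
  have hgΨ (k : ℕ) : IsSmoothField (smoothGrad i (Ψ k)) := (hΨ k).isSmoothField_smoothGrad i
  obtain ⟨v, hv, hΦv⟩ : ∃ v : W → H, MemLp v p μ ∧
      Tendsto (fun k => eLpNorm (fun x => smoothGrad i (Φ k) x - v x) p μ) atTop (𝓝 0) := by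
    have hc : CauchySeq fun k => ((hgΦ k).memLp (μ := μ) p).toLp (smoothGrad i (Φ k)) := by
      rw [cauchySeq_iff_tendsto_dist_atTop_0]
      have h1 := (ENNReal.tendsto_toReal ENNReal.zero_ne_top).comp hΦ1
      refine h1.congr fun k => ?_
      rw [dist_edist, Lp.edist_toLp_toLp]
      rfl
    obtain ⟨v, hv⟩ := cauchySeq_tendsto_of_complete hc
    refine ⟨v, Lp.memLp v, ?_⟩
    have h1 := (Lp.tendsto_Lp_iff_tendsto_eLpNorm'' (fun k => smoothGrad i (Φ k))
      (fun k => (hgΦ k).memLp p) v (Lp.memLp v)).1 (by rwa [Lp.toLp_coeFn])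
    exact h1
  -- The sequence witnessing membership in `𝔻_{p,2}` and the one defining `u` may be different;
  -- closability identifies the limits of their gradients.
  have hvu : (fun x => v x - u x) =ᵐ[μ] 0 := by
    refine hμ.ae_eq_zero_of_tendsto_smoothGrad hl p' hp' (D := fun k x => Φ k x - Ψ k x)
      (fun k => (hΦ k).sub (hΨ k)) ?_ (hv.sub hup) ?_
    · have h1 := hΦf.add hΨf
      rw [add_zero] at h1
      refine tendsto_of_tendsto_of_tendsto_of_le_of_le tendsto_const_nhds h1 (fun _ => zero_le)
        fun k => ?_
      refine le_trans (le_of_eq ?_) (eLpNorm_sub_le ((hΦ k).aestronglyMeasurable.sub hfp.1)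
        ((hΨ k).aestronglyMeasurable.sub hfp.1) hp1)
      congr 1
      funext x
      simp
    · have h1 := hΦv.add hΨu
      rw [add_zero] at h1
      refine tendsto_of_tendsto_of_tendsto_of_le_of_le tendsto_const_nhds h1 (fun _ => zero_le)
        fun k => ?_
      refine le_trans (le_of_eq ?_) (eLpNorm_sub_le ((hgΦ k).aestronglyMeasurable.sub hv.1)
        ((hgΨ k).aestronglyMeasurable.sub hup.1) hp1)
      congr 1
      funext x
      have h2 : smoothGrad i (fun x => Φ k x - Ψ k x) x = smoothGrad i (Φ k) x -
          smoothGrad i (Ψ k) x := by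
        rw [smoothGrad, fderiv_fun_sub ((hΦ k).differentiable x) ((hΨ k).differentiable x),
          ← dualEmbL_apply, map_sub]
        rfl
      simp only [h2, Pi.sub_apply]
      abel
  have hΦu : Tendsto (fun k => eLpNorm (fun x => smoothGrad i (Φ k) x - u x) p μ) atTop (𝓝 0) := by
    refine hΦv.congr fun k => eLpNorm_congr_ae ?_
    filter_upwards [hvu] with x hx
    rw [sub_eq_zero.1 hx]
  obtain ⟨N, hN⟩ : ∃ N, ∀ k ≥ N, eLpNorm (fun x => smoothGrad i (Φ k) x - u x) p μ ≤ 1 ∧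
      eLpNorm (fun x => hsNorm (fieldGrad i (smoothGrad i (Φ k)) x -
        fieldGrad i (smoothGrad i (Φ N)) x)) p μ ≤ 1 := by
    have h1 := hΦu.eventually_le_const zero_lt_one
    have h2 := hΦ2.eventually_le_const zero_lt_one
    rw [eventually_atTop] at h1 h2
    obtain ⟨N₁, h1⟩ := h1
    obtain ⟨⟨a, b⟩, h2⟩ := h2
    -- The reference index is compared with every later `k` in the Cauchy condition, so it must
    -- itself lie beyond both thresholds `a` and `b`.
    refine ⟨max N₁ (max a b), fun k hk => ⟨h1 k ((le_max_left _ _).trans hk), ?_⟩⟩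
    exact h2 (k, max N₁ (max a b)) ⟨((le_max_left _ _).trans (le_max_right _ _)).trans hk,
      (le_max_right _ _).trans (le_max_right _ _)⟩
  obtain ⟨ns, hns, hae⟩ := exists_subseq_tendsto_ae hp0 (fun k => (hgΦ (k + N)).aestronglyMeasurable)
    hup.1 ((tendsto_add_atTop_iff_nat N).2 hΦu)
  refine ⟨fun k => Φ (ns k + N), (1 + eLpNorm u p μ) +
    (1 + eLpNorm (fun x => hsNorm (fieldGrad i (smoothGrad i (Φ N)) x)) p μ), ?_,
    fun k => hΦ _, fun k => add_le_add ?_ ?_,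
    ((tendsto_add_atTop_iff_nat N).2 hΦu).comp hns.tendsto_atTop, hae⟩
  · have h1 := (hgΦ N).eLpNorm_hsNorm_lt_top (i := i) (μ := μ) (p := p)
    simp [hup.2.ne, h1.ne]
  · refine le_trans ?_ (add_le_add (hN (ns k + N) (Nat.le_add_left _ _)).1 le_rfl)
    refine le_trans (le_of_eq ?_) (eLpNorm_add_le ((hgΦ (ns k + N)).aestronglyMeasurable.sub hup.1)
      hup.1 hp1)
    congr 1
    funext x
    simp
  · refine le_trans ?_ (add_le_add (hN (ns k + N) (Nat.le_add_left _ _)).2 le_rfl)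
    have hm (k : ℕ) := (hgΦ k).aemeasurable_hsNorm (i := i) (μ := μ) e
    have hm' : AEMeasurable (fun x => hsNorm (fieldGrad i (smoothGrad i (Φ (ns k + N))) x -
        fieldGrad i (smoothGrad i (Φ N)) x)) μ :=
      aemeasurable_hsNorm e fun j => ((hgΦ _).aestronglyMeasurable_fieldGrad (e j)).sub
        ((hgΦ _).aestronglyMeasurable_fieldGrad (e j))
    refine le_trans (eLpNorm_mono_enorm fun x => ?_) (eLpNorm_add_le hm'.aestronglyMeasurable
      (hm N).aestronglyMeasurable hp1)
    simp only [Pi.add_apply, enorm_eq_self]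
    refine le_trans (le_of_eq ?_) (hsNorm_add_le _ _)
    rw [sub_add_cancel]

/-- Duality bounds in `L^q` tested on smooth functionals give uniform integrability. -/
theorem setLIntegral_enorm_le_of_forall_smooth [IsFiniteMeasure μ] {y : W → ℝ}
    (hy : Integrable y μ) {q M : ℝ≥0∞} (hq1 : 1 ≤ q) (hq : q ≠ ∞) (hM : M ≠ ∞)
    (h : ∀ χ : W → ℝ, IsSmoothFunctional χ → ‖∫ x, χ x * y x ∂μ‖ₑ ≤ M * eLpNorm χ q μ)
    {s : Set W} (hs : MeasurableSet s) : ∫⁻ x in s, ‖y x‖ₑ ∂μ ≤ M * μ s ^ (1 / q.toReal) := by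
  have hq0 : q ≠ 0 := (zero_lt_one.trans_le hq1).ne'
  -- The sign of `y` on `s`: pairing with it gives the integral of `|y|` over `s`, while its `L^q`
  -- norm is at most `μ(s)^(1/q)`. Smooth functionals reach it by bounded convergence.
  set f : W → ℝ := s.indicator fun x => y x / |y x| with hf
  have hfm : AEStronglyMeasurable f μ :=
    ((hy.1.aemeasurable.div hy.1.aemeasurable.norm).aestronglyMeasurable).indicator hs
  have hf1 : ∀ x, |f x| ≤ 1 := fun x => by
    by_cases hx : x ∈ s
    · rw [hf, Set.indicator_of_mem hx, abs_div, abs_abs]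
      exact div_self_le_one _
    · rw [hf, Set.indicator_of_notMem hx]
      simp
  have hfy : ∀ x, f x * y x = s.indicator (fun x => |y x|) x := fun x => by
    by_cases hx : x ∈ s
    · rw [hf, Set.indicator_of_mem hx, Set.indicator_of_mem hx]
      rcases eq_or_ne (y x) 0 with h0 | h0
      · simp [h0]
      · have : |y x| ≠ 0 := abs_ne_zero.2 h0
        rw [div_mul_eq_mul_div, ← abs_mul_abs_self, mul_div_cancel_right₀ _ this]
    · rw [hf, Set.indicator_of_notMem hx, Set.indicator_of_notMem hx, zero_mul]
  obtain ⟨Φ, C, hΦ, hC, hae⟩ := exists_smooth_bounded_tendsto_ae hfm (ae_of_all _ hf1)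
  have h1 : Tendsto (fun n => ∫ x, Φ n x * y x ∂μ) atTop (𝓝 (∫ x, f x * y x ∂μ)) := by
    refine tendsto_integral_of_dominated_convergence (fun x => C * ‖y x‖)
      (fun n => (hΦ n).aestronglyMeasurable.mul hy.1) (hy.norm.const_mul C)
      (fun n => ae_of_all _ fun x => ?_) ?_
    · rw [norm_mul]
      exact mul_le_mul_of_nonneg_right (hC n x) (norm_nonneg _)
    · filter_upwards [hae] with x hx using hx.mul_const _
  have h2 : Tendsto (fun n => eLpNorm (fun x => Φ n x - f x) q μ) atTop (𝓝 0) := by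
    refine tendsto_eLpNorm_zero_of_bounded (C := C + 1) hq0 hq
      (Eventually.of_forall fun n => (hΦ n).aestronglyMeasurable.sub hfm)
      (Eventually.of_forall fun n => ae_of_all _ fun x =>
        (norm_sub_le _ _).trans (add_le_add (hC n x) (hf1 x))) ?_
    filter_upwards [hae] with x hx
    simpa using hx.sub_const (f x)
  have h3 : Tendsto (fun n => M * (eLpNorm (fun x => Φ n x - f x) q μ + eLpNorm f q μ)) atTop
      (𝓝 (M * (0 + eLpNorm f q μ))) :=
    ENNReal.Tendsto.const_mul (h2.add_const _) (Or.inr hM)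
  rw [zero_add] at h3
  have h4 : ‖∫ x, f x * y x ∂μ‖ₑ ≤ M * eLpNorm f q μ := by
    refine le_of_tendsto_of_tendsto' h1.enorm h3 fun n => (h _ (hΦ n)).trans ?_
    gcongr
    refine le_trans (le_of_eq ?_) (eLpNorm_add_le ((hΦ n).aestronglyMeasurable.sub hfm) hfm hq1)
    congr 1
    funext x
    simp
  have h5 : eLpNorm f q μ ≤ μ s ^ (1 / q.toReal) := by
    have h6 := eLpNorm_indicator_const (c := (1 : ℝ)) (μ := μ) hs hq0 hq
    rw [enorm_one, one_mul] at h6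
    rw [← h6]
    refine eLpNorm_mono fun x => ?_
    by_cases hx : x ∈ s
    · rw [Set.indicator_of_mem hx, norm_one]
      exact hf1 x
    · rw [hf, Set.indicator_of_notMem hx, norm_zero]
      exact norm_nonneg _
  calc ∫⁻ x in s, ‖y x‖ₑ ∂μ = ‖∫ x, f x * y x ∂μ‖ₑ := by
        simp only [hfy]
        rw [integral_indicator hs, ← ofReal_norm, Real.norm_of_nonneg
          (integral_nonneg fun x => abs_nonneg _),
          ofReal_integral_eq_lintegral_ofReal hy.abs.restrict (ae_of_all _ fun x => abs_nonneg _)]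
        simp only [← Real.norm_eq_abs, ofReal_norm]
    _ ≤ _ := h4.trans (mul_le_mul_right h5 _)

/-- Fatou's lemma hands the modulus on to the limit, and since the modulus tends to 0 with `ν s`
Vitali's theorem applies. The modulus of the limit is part of the conclusion because the lemma is
used twice in succession. -/
theorem tendsto_eLpNorm_of_setLIntegral_le {X : Type*} [MeasurableSpace X] {ν : Measure X}
    [IsFiniteMeasure ν] {y : ℕ → X → ℝ} {z : X → ℝ} (hy : ∀ n, AEStronglyMeasurable (y n) ν)
    {M : ℝ≥0∞} (hM : M ≠ ∞) {a : ℝ} (ha : 0 < a)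
    (h : ∀ n s, MeasurableSet s → ∫⁻ x in s, ‖y n x‖ₑ ∂ν ≤ M * ν s ^ a)
    (hae : ∀ᵐ x ∂ν, Tendsto (fun n => y n x) atTop (𝓝 (z x))) :
    (∀ s, MeasurableSet s → ∫⁻ x in s, ‖z x‖ₑ ∂ν ≤ M * ν s ^ a) ∧ Integrable z ν ∧
      Tendsto (fun n => eLpNorm (fun x => y n x - z x) 1 ν) atTop (𝓝 0) := by
  have hz : ∀ s, MeasurableSet s → ∫⁻ x in s, ‖z x‖ₑ ∂ν ≤ M * ν s ^ a := fun s hs => by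
    calc ∫⁻ x in s, ‖z x‖ₑ ∂ν = ∫⁻ x in s, liminf (fun n => ‖y n x‖ₑ) atTop ∂ν := by
          refine lintegral_congr_ae (ae_restrict_of_ae ?_)
          filter_upwards [hae] with x hx using hx.enorm.liminf_eq.symm
      _ ≤ liminf (fun n => ∫⁻ x in s, ‖y n x‖ₑ ∂ν) atTop :=
          lintegral_liminf_le' fun n => (hy n).enorm.restrict
      _ ≤ M * ν s ^ a := liminf_le_of_le (by isBoundedDefault) fun b hb => by
          obtain ⟨n, hn⟩ := hb.exists
          exact hn.trans (h n s hs)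
  have hzm : AEStronglyMeasurable z ν := aestronglyMeasurable_of_tendsto_ae atTop hy hae
  have hzi : Integrable z ν := by
    refine ⟨hzm, ?_⟩
    have h1 := hz Set.univ MeasurableSet.univ
    rw [Measure.restrict_univ] at h1
    exact h1.trans_lt (ENNReal.mul_lt_top hM.lt_top
      (ENNReal.rpow_lt_top_of_nonneg ha.le (measure_ne_top _ _)))
  refine ⟨hz, hzi, tendsto_Lp_finite_of_tendsto_ae le_rfl ENNReal.one_ne_top hy
    (memLp_one_iff_integrable.2 hzi) ?_ hae⟩
  intro ε hε
  have h1 : Tendsto (fun δ : ℝ => M * ENNReal.ofReal δ ^ a) (𝓝[>] 0) (𝓝 (M * 0 ^ a)) := by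
    refine ENNReal.Tendsto.const_mul ?_ (Or.inr hM)
    have h2 : Tendsto (fun δ : ℝ => ENNReal.ofReal δ ^ a) (𝓝 0) (𝓝 (ENNReal.ofReal 0 ^ a)) :=
      ((ENNReal.continuous_rpow_const.comp ENNReal.continuous_ofReal).tendsto 0)
    rw [ENNReal.ofReal_zero] at h2
    exact h2.mono_left nhdsWithin_le_nhds
  rw [ENNReal.zero_rpow_of_pos ha, mul_zero] at h1
  have h3 := (h1.eventually_le_const (ENNReal.ofReal_pos.2 hε)).and self_mem_nhdsWithin
  obtain ⟨δ, hδ, hδ0⟩ := h3.exists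
  refine ⟨δ, hδ0, fun n s hs hsδ => ?_⟩
  rw [eLpNorm_one_eq_lintegral_enorm]
  simp only [enorm_indicator_eq_indicator_enorm]
  rw [lintegral_indicator hs]
  refine (h n s hs).trans (le_trans ?_ hδ)
  gcongr

/-! ### Identification of U(B) with the divergence of A u -/

variable {W H : Type*} [NormedAddCommGroup W] [NormedSpace ℝ W] [CompleteSpace W]
  [TopologicalSpace.SeparableSpace W] [MeasurableSpace W] [BorelSpace W] [NormedAddCommGroup H]
  [InnerProductSpace ℝ H] [CompleteSpace H] {i : H →L[ℝ] W} {μ : Measure W} {p : ℝ≥0∞}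

theorem tendsto_integral_smooth_mul [IsFiniteMeasure μ] {χ : W → ℝ} (hχ : IsSmoothFunctional χ)
    {y : ℕ → W → ℝ} {z : W → ℝ} (hy : ∀ n, Integrable (y n) μ) (hz : Integrable z μ)
    (h : Tendsto (fun n => eLpNorm (fun x => y n x - z x) 1 μ) atTop (𝓝 0)) :
    Tendsto (fun n => ∫ x, χ x * y n x ∂μ) atTop (𝓝 (∫ x, χ x * z x ∂μ)) := by
  obtain ⟨C, hC⟩ := hχ.exists_bound
  refine tendsto_integral_of_eLpNorm (Eventually.of_forall fun n => integrable_smooth_mul hχ (hy n))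
    (integrable_smooth_mul hχ hz) ?_
  have h2 : Tendsto (fun n => ENNReal.ofReal C * eLpNorm (fun x => y n x - z x) 1 μ) atTop
      (𝓝 0) := by
    simpa using ENNReal.Tendsto.const_mul h (Or.inr (ENNReal.ofReal_ne_top (r := C)))
  refine tendsto_of_tendsto_of_tendsto_of_le_of_le tendsto_const_nhds h2 (fun _ => zero_le)
    fun n => ?_
  simp only [← mul_sub]
  exact eLpNorm_one_mul_le (ae_of_all _ hC)

/-- Strong convergence of a bounded random operator under resampling of the high coordinates. -/
theorem IsAbstractWienerSpace.tendsto_eLpNorm_clm_mixCoords (hμ : IsAbstractWienerSpace i μ)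
    {l : ℕ → StrongDual ℝ W} {e : HilbertBasis ℕ ℝ H} (hl : ∀ k, dualEmb i (l k) = e k)
    {A : W → H →L[ℝ] H} (hAmeas : ∀ h, AEStronglyMeasurable (fun ω => A ω h) μ) {C : ℝ}
    (hAbdd : ∀ᵐ ω ∂μ, ‖A ω‖ ≤ C) {χ : W → ℝ} (hχ : IsSmoothFunctional χ) :
    Tendsto (fun N => eLpNorm (fun z : W × W =>
      A (mixCoords i (cylProj l e N) z.1 z.2) (smoothGrad i χ z.1) -
        A z.1 (smoothGrad i χ z.1)) 1 (μ.prod μ)) atTop (𝓝 0) := by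
  have := hμ.isProbabilityMeasure
  have := UniformSpace.secondCountable_of_separable W
  -- The gradient of `χ` stays in the span of finitely many fixed vectors, so convergence of `A` on
  -- fixed vectors is enough and none in operator norm is required.
  obtain ⟨n, m, φ, hφ, hd⟩ := hχ.exists_fderiv_eq
  choose K hK using fun j => (hφ j).exists_bound
  have hgrad (x : W) : smoothGrad i χ x = ∑ j, φ j x • dualEmb i (m j) := by
    rw [smoothGrad, hd, dualEmb_sum_smul]
  have hAh (h : H) : MemLp (fun ω => A ω h) 1 μ := by
    refine MemLp.of_bound (hAmeas h) (C * ‖h‖) ?_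
    filter_upwards [hAbdd] with ω hω
    exact ((A ω).le_opNorm h).trans (mul_le_mul_of_nonneg_right hω (norm_nonneg _))
  have h0 (j : Fin n) := hμ.tendsto_eLpNorm_mixCoords hl (hAh (dualEmb i (m j)))
  have h1 : Tendsto (fun N => ∑ j, ENNReal.ofReal (K j) * eLpNorm (fun z : W × W =>
      A (mixCoords i (cylProj l e N) z.1 z.2) (dualEmb i (m j)) - A z.1 (dualEmb i (m j))) 1
        (μ.prod μ)) atTop (𝓝 (∑ j : Fin n, ENNReal.ofReal (K j) * 0)) :=
    tendsto_finsetSum _ fun j _ => ENNReal.Tendsto.const_mul (h0 j) (Or.inr ENNReal.ofReal_ne_top)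
  simp only [mul_zero, Finset.sum_const_zero] at h1
  refine tendsto_of_tendsto_of_tendsto_of_le_of_le tendsto_const_nhds h1 (fun _ => zero_le)
    fun N => ?_
  have hmix := hμ.measurePreserving_mixCoords hl N
  have e1 : (fun z : W × W => A (mixCoords i (cylProj l e N) z.1 z.2) (smoothGrad i χ z.1) -
      A z.1 (smoothGrad i χ z.1)) = ∑ j, fun z : W × W => φ j z.1 •
        (A (mixCoords i (cylProj l e N) z.1 z.2) (dualEmb i (m j)) - A z.1 (dualEmb i (m j))) := by
    funext z
    simp only [hgrad, map_sum, map_smul, Finset.sum_apply, smul_sub, Finset.sum_sub_distrib]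
  rw [e1]
  refine (eLpNorm_sum_le (fun j _ => ?_) le_rfl).trans (Finset.sum_le_sum fun j _ => ?_)
  · have m1 : AEStronglyMeasurable (fun z : W × W =>
        A (mixCoords i (cylProj l e N) z.1 z.2) (dualEmb i (m j))) (μ.prod μ) :=
      (hAmeas _).comp_measurePreserving hmix
    have m2 : AEStronglyMeasurable (fun z : W × W => A z.1 (dualEmb i (m j))) (μ.prod μ) :=
      (hAmeas _).comp_measurePreserving measurePreserving_fst
    have m3 : AEStronglyMeasurable (fun z : W × W => φ j z.1) (μ.prod μ) :=
      ((hφ j).continuous.comp continuous_fst).aestronglyMeasurable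
    exact m3.smul (m1.sub m2)
  · refine eLpNorm_le_mul_eLpNorm_of_ae_le_mul (ae_of_all _ fun z => ?_) 1
    rw [norm_smul]
    exact mul_le_mul_of_nonneg_right (hK j z.1) (norm_nonneg _)

theorem IsAbstractWienerSpace.tendsto_integral_inner_mixCoords (hμ : IsAbstractWienerSpace i μ)
    {l : ℕ → StrongDual ℝ W} {e : HilbertBasis ℕ ℝ H} (hl : ∀ k, dualEmb i (l k) = e k) (N : ℕ)
    {A : W → H →L[ℝ] H} (hAmeas : ∀ h, AEStronglyMeasurable (fun ω => A ω h) μ) {C : ℝ}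
    (hAbdd : ∀ᵐ ω ∂μ, ‖A ω‖ ≤ C) {Φ : ℕ → W → ℝ} (hΦ : ∀ k, IsSmoothFunctional (Φ k))
    {u : W → H} (hu : MemLp u 1 μ)
    (hlim : Tendsto (fun k => eLpNorm (fun x => smoothGrad i (Φ k) x - u x) 1 μ) atTop (𝓝 0))
    {χ : W → ℝ} (hχ : IsSmoothFunctional χ) :
    Tendsto (fun k => ∫ z, ⟪A (mixCoords i (cylProj l e N) z.1 z.2)
        (partialProj e N (smoothGrad i (Φ k) z.1)), partialProj e N (smoothGrad i χ z.1)⟫_ℝ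
          ∂(μ.prod μ)) atTop
      (𝓝 (∫ z, ⟪A (mixCoords i (cylProj l e N) z.1 z.2) (partialProj e N (u z.1)),
        partialProj e N (smoothGrad i χ z.1)⟫_ℝ ∂(μ.prod μ))) := by
  have := hμ.isProbabilityMeasure
  have := UniformSpace.secondCountable_of_separable W
  have hmix := hμ.measurePreserving_mixCoords hl N
  obtain ⟨Cχ, hCχ⟩ := (hχ.cbSmooth.smoothGrad i).exists_bound
  have hAz := hmix.quasiMeasurePreserving.ae hAbdd
  have hbound (z : W × W) (hz : ‖A (mixCoords i (cylProj l e N) z.1 z.2)‖ ≤ C) (w : H) :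
      ‖⟪A (mixCoords i (cylProj l e N) z.1 z.2) (partialProj e N w),
        partialProj e N (smoothGrad i χ z.1)⟫_ℝ‖ ≤ C * Cχ * ‖w‖ := by
    have h0 := (norm_nonneg _).trans hz
    refine (norm_inner_le_norm _ _).trans ((mul_le_mul (((A _).le_opNorm _).trans
      (mul_le_mul hz (norm_partialProj_le e N w) (norm_nonneg _) h0))
      ((norm_partialProj_le e N _).trans (hCχ _)) (norm_nonneg _)
      (mul_nonneg h0 (norm_nonneg _))).trans (le_of_eq ?_))
    ring
  have hm {w : W → H} (hw : AEStronglyMeasurable w μ) : AEStronglyMeasurable (fun z : W × W =>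
      ⟪A (mixCoords i (cylProj l e N) z.1 z.2) (partialProj e N (w z.1)),
        partialProj e N (smoothGrad i χ z.1)⟫_ℝ) (μ.prod μ) :=
    (aestronglyMeasurable_clm_apply e (fun h => (hAmeas h).comp_measurePreserving hmix)
      ((partialProj e N).continuous.comp_aestronglyMeasurable
        (hw.comp_measurePreserving measurePreserving_fst))).inner
      ((partialProj e N).continuous.comp ((hχ.cbSmooth.smoothGrad i).continuous.comp
        continuous_fst)).aestronglyMeasurable
  have hint : Integrable (fun z : W × W => ⟪A (mixCoords i (cylProj l e N) z.1 z.2)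
      (partialProj e N (u z.1)), partialProj e N (smoothGrad i χ z.1)⟫_ℝ) (μ.prod μ) := by
    refine (((memLp_one_iff_integrable.1 hu).comp_fst μ).norm.const_mul (C * Cχ)).mono'
      (hm hu.1) ?_
    filter_upwards [hAz] with z hz using hbound z hz _
  refine tendsto_integral_of_eLpNorm (Eventually.of_forall fun k =>
    integrable_inner_partialProj_mixCoords hμ hl N hAmeas hAbdd (hΦ k) hχ) hint ?_
  have h2 : Tendsto (fun k => ENNReal.ofReal (C * Cχ) *
      eLpNorm (fun x => smoothGrad i (Φ k) x - u x) 1 μ) atTop (𝓝 0) := by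
    simpa using ENNReal.Tendsto.const_mul hlim (Or.inr (ENNReal.ofReal_ne_top (r := C * Cχ)))
  refine tendsto_of_tendsto_of_tendsto_of_le_of_le tendsto_const_nhds h2 (fun _ => zero_le)
    fun k => ?_
  rw [← eLpNorm_comp_measurePreserving (g := fun x => smoothGrad i (Φ k) x - u x)
    ((hΦ k).aestronglyMeasurable_smoothGrad.sub hu.1) (measurePreserving_fst (μ := μ) (ν := μ))]
  refine eLpNorm_le_mul_eLpNorm_of_ae_le_mul ?_ 1
  filter_upwards [hAz] with z hz
  rw [← inner_sub_left, ← map_sub, ← map_sub]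
  exact hbound z hz _

/-- Skewness moves the resampled operator from the general field `u` to `∇χ`, on which it converges.
The subsequence makes this convergence hold almost everywhere, and the essential bound on `A` gives
a dominating multiple of `‖u‖`. -/
theorem IsAbstractWienerSpace.exists_subseq_tendsto_integral_inner_mixCoords
    (hμ : IsAbstractWienerSpace i μ)
    {l : ℕ → StrongDual ℝ W} {e : HilbertBasis ℕ ℝ H} (hl : ∀ k, dualEmb i (l k) = e k)
    {A : W → H →L[ℝ] H} (hAmeas : ∀ h, AEStronglyMeasurable (fun ω => A ω h) μ)
    (hAskew : ∀ᵐ ω ∂μ, ∀ h k : H, ⟪A ω h, k⟫_ℝ = -⟪h, A ω k⟫_ℝ) {C : ℝ}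
    (hAbdd : ∀ᵐ ω ∂μ, ‖A ω‖ ≤ C) {u : W → H} (hu : MemLp u 1 μ) {χ : W → ℝ}
    (hχ : IsSmoothFunctional χ) {ns : ℕ → ℕ} (hns : StrictMono ns) :
    ∃ ms : ℕ → ℕ, StrictMono ms ∧ Tendsto (fun j => ∫ z,
        ⟪A (mixCoords i (cylProj l e (ns (ms j))) z.1 z.2) (partialProj e (ns (ms j)) (u z.1)),
          partialProj e (ns (ms j)) (smoothGrad i χ z.1)⟫_ℝ ∂(μ.prod μ)) atTop
      (𝓝 (∫ x, ⟪A x (u x), smoothGrad i χ x⟫_ℝ ∂μ)) := by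
  have := hμ.isProbabilityMeasure
  have := UniformSpace.secondCountable_of_separable W
  obtain ⟨Cχ, hCχ⟩ := (hχ.cbSmooth.smoothGrad i).exists_bound
  have hmix (N : ℕ) := hμ.measurePreserving_mixCoords hl N
  have hgm : AEStronglyMeasurable (fun z : W × W => smoothGrad i χ z.1) (μ.prod μ) :=
    ((hχ.cbSmooth.smoothGrad i).continuous.comp continuous_fst).aestronglyMeasurable
  have hfst := measurePreserving_fst (μ := μ) (ν := μ)
  have hum : AEStronglyMeasurable (fun z : W × W => u z.1) (μ.prod μ) :=
    hu.1.comp_measurePreserving hfst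
  obtain ⟨ms, hms, hae⟩ := exists_subseq_tendsto_ae one_ne_zero
    (f := fun j (z : W × W) => A (mixCoords i (cylProj l e (ns j)) z.1 z.2) (smoothGrad i χ z.1))
    (g := fun z : W × W => A z.1 (smoothGrad i χ z.1))
    (fun j => aestronglyMeasurable_clm_apply e
      (fun h => (hAmeas h).comp_measurePreserving (hmix (ns j))) hgm)
    (aestronglyMeasurable_clm_apply e (fun h => (hAmeas h).comp_measurePreserving hfst) hgm)
    ((hμ.tendsto_eLpNorm_clm_mixCoords hl hAmeas hAbdd hχ).comp hns.tendsto_atTop)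
  refine ⟨ms, hms, ?_⟩
  have e1 : ∫ x, ⟪A x (u x), smoothGrad i χ x⟫_ℝ ∂μ =
      ∫ z, ⟪A z.1 (u z.1), smoothGrad i χ z.1⟫_ℝ ∂(μ.prod μ) :=
    (integral_comp_of_measurePreserving hfst
      ((aestronglyMeasurable_clm_apply e hAmeas hu.1).inner
        hχ.aestronglyMeasurable_smoothGrad)).symm
  rw [e1]
  have hAz : ∀ᵐ z ∂(μ.prod μ), ∀ N, ‖A (mixCoords i (cylProj l e N) z.1 z.2)‖ ≤ C :=
    ae_all_iff.2 fun N => (hmix N).quasiMeasurePreserving.ae hAbdd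
  have hSz : ∀ᵐ z ∂(μ.prod μ), ∀ N, ∀ h k : H,
      ⟪A (mixCoords i (cylProj l e N) z.1 z.2) h, k⟫_ℝ =
        -⟪h, A (mixCoords i (cylProj l e N) z.1 z.2) k⟫_ℝ :=
    ae_all_iff.2 fun N => (hmix N).quasiMeasurePreserving.ae hAskew
  have hN : Tendsto (fun j => ns (ms j)) atTop atTop :=
    hns.tendsto_atTop.comp hms.tendsto_atTop
  refine tendsto_integral_of_dominated_convergence (fun z => C * Cχ * ‖u z.1‖) (fun j => ?_)
    (((memLp_one_iff_integrable.1 hu).comp_fst μ).norm.const_mul (C * Cχ)) (fun j => ?_) ?_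
  · exact (aestronglyMeasurable_clm_apply e (fun h => (hAmeas h).comp_measurePreserving (hmix _))
      ((partialProj e _).continuous.comp_aestronglyMeasurable hum)).inner
      ((partialProj e _).continuous.comp_aestronglyMeasurable hgm)
  · filter_upwards [hAz] with z hz
    have h0 := (norm_nonneg _).trans (hz 0)
    refine (norm_inner_le_norm _ _).trans ((mul_le_mul (((A _).le_opNorm _).trans
      (mul_le_mul (hz _) (norm_partialProj_le e _ _) (norm_nonneg _) h0))
      ((norm_partialProj_le e _ _).trans (hCχ _)) (norm_nonneg _)
      (mul_nonneg h0 (norm_nonneg _))).trans (le_of_eq ?_))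
    ring
  · filter_upwards [hae, hAz, hSz, hfst.quasiMeasurePreserving.ae hAskew] with z h1 h2 h3 h4
    simp only [h3, h4]
    refine Tendsto.neg (((tendsto_partialProj e (u z.1)).comp hN).inner ?_)
    have h5 : Tendsto (fun j => A (mixCoords i (cylProj l e (ns (ms j))) z.1 z.2)
        (partialProj e (ns (ms j)) (smoothGrad i χ z.1) - smoothGrad i χ z.1)) atTop (𝓝 0) := by
      have h6 : Tendsto (fun j => C * ‖partialProj e (ns (ms j)) (smoothGrad i χ z.1) -
          smoothGrad i χ z.1‖) atTop (𝓝 0) := by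
        have h7 := (((tendsto_partialProj e (smoothGrad i χ z.1)).comp hN).sub_const
          (smoothGrad i χ z.1)).norm.const_mul C
        simpa using h7
      exact squeeze_zero_norm (fun j => ((A _).le_opNorm _).trans
        (mul_le_mul_of_nonneg_right (h2 _) (norm_nonneg _))) h6
    have h8 := h5.add h1
    rw [zero_add] at h8
    refine h8.congr fun j => ?_
    rw [map_sub, sub_add_cancel]

/-- If the gradient `u` of a function of `𝔻_{p,2}` takes values `U` in `W*` then `U(B)` is the
divergence of `A u`. -/
theorem IsAbstractWienerSpace.integral_mul_apply_eq (hμ : IsAbstractWienerSpace i μ)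
    {l : ℕ → StrongDual ℝ W} {e : HilbertBasis ℕ ℝ H} (hl : ∀ k, dualEmb i (l k) = e k)
    {A : W → H →L[ℝ] H} (hAmeas : ∀ h, AEStronglyMeasurable (fun ω => A ω h) μ)
    (hAskew : ∀ᵐ ω ∂μ, ∀ h k : H, ⟪A ω h, k⟫_ℝ = -⟪h, A ω k⟫_ℝ) {C : ℝ}
    (hAbdd : ∀ᵐ ω ∂μ, ‖A ω‖ ≤ C) {b : ℕ → W → ℝ} (hb : ∀ k, Integrable (b k) μ) {B : W → W}
    (hB : MemLp B 1 μ)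
    (hBsum : Tendsto
      (fun n => eLpNorm (fun ω => (∑ k ∈ Finset.range n, b k ω • i (e k)) - B ω) 1 μ)
      atTop (𝓝 0))
    (hid : ∀ Φ Ψ : W → ℝ, IsSmoothFunctional Φ → IsSmoothFunctional Ψ →
      ∫ ω, ⟪A ω (smoothGrad i Φ ω), smoothGrad i Ψ ω⟫_ℝ ∂μ = ∫ ω, Ψ ω * fderiv ℝ Φ ω (B ω) ∂μ)
    {r q : ℝ≥0∞} (hr : r ≠ ∞) (hq : q ≠ ∞) [ENNReal.HolderConjugate r q] (hpt : p ≠ ∞)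
    (hrp : r ≤ p) {K : ℝ}
    (hK : ∀ Φ χ : W → ℝ, IsSmoothFunctional Φ → IsSmoothFunctional χ →
      ‖∫ x, ⟪A x (smoothGrad i Φ x), smoothGrad i χ x⟫_ℝ ∂μ‖ₑ ≤
        ENNReal.ofReal K * (sobolevNorm i μ p (smoothGrad i Φ) * eLpNorm χ q μ))
    (p' : ℝ≥0∞) [ENNReal.HolderConjugate p p'] (hp' : p' ≠ ∞) {f : W → ℝ} {u : W → H}
    (hf : MemD2 i μ p f) (hu : IsGradient i μ p f u) {U : W → StrongDual ℝ W}
    (hU : ∀ᵐ ω ∂μ, dualEmb i (U ω) = u ω) :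
    Integrable (fun ω => U ω (B ω)) μ ∧ ∀ χ : W → ℝ, IsSmoothFunctional χ →
      ∫ ω, χ ω * U ω (B ω) ∂μ = ∫ ω, ⟪A ω (u ω), smoothGrad i χ ω⟫_ℝ ∂μ := by
  have := hμ.isProbabilityMeasure
  have := UniformSpace.secondCountable_of_separable W
  have hp1 : 1 ≤ p := ENNReal.HolderConjugate.one_le p p'
  have hq1 : 1 ≤ q := ENNReal.HolderConjugate.one_le q r
  have hq0 : q ≠ 0 := ENNReal.HolderConjugate.ne_zero q r
  have ha : 0 < 1 / q.toReal := one_div_pos.2 (ENNReal.toReal_pos hq0 hq)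
  have hu1 : MemLp u 1 μ := hu.2.1.mono_exponent hp1
  obtain ⟨Φ, M, hM, hΦ, hΦM, hΦu, hΦae⟩ := hμ.exists_seq_of_memD2 hl p' hp' hf hu
  have hΦu1 : Tendsto (fun k => eLpNorm (fun x => smoothGrad i (Φ k) x - u x) 1 μ) atTop
      (𝓝 0) :=
    tendsto_of_tendsto_of_tendsto_of_le_of_le tendsto_const_nhds hΦu (fun _ => zero_le)
      fun k => eLpNorm_le_eLpNorm_of_exponent_le hp1
        ((hΦ k).aestronglyMeasurable_smoothGrad (i := i).sub hu1.1)
  -- `S N` mediates between two topologies: being `H`-valued it pairs with the limit of `∇Φ k` in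
  -- `H`, while `i (S N)` tends to `B` in `W`, where `U` is continuous.
  set S : ℕ → W → H := fun N x => cylProj l e N (condCoords i μ (cylProj l e N) B x) with hS
  have hSi (N : ℕ) : Integrable (fun x => i (S N x)) μ :=
    (i.comp (cylProj l e N)).integrable_comp (hμ.integrable_condCoords hl N hB)
  have hyi (N k : ℕ) : Integrable (fun x => fderiv ℝ (Φ k) x (i (S N x))) μ := by
    obtain ⟨D, hD⟩ := (hΦ k).cbSmooth.exists_fderiv_bound
    refine ((hSi N).norm.const_mul D).mono' ?_ (ae_of_all _ fun x => ?_)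
    · exact (ContinuousLinearMap.apply ℝ ℝ (E := W)).flip.aestronglyMeasurable_comp₂
        (hΦ k).cbSmooth.fderiv.continuous.aestronglyMeasurable (hSi N).1
    · exact ((fderiv ℝ (Φ k) x).le_opNorm _).trans
        (mul_le_mul_of_nonneg_right (hD _) (norm_nonneg _))
  have hMK : ENNReal.ofReal K * M ≠ ∞ := ENNReal.mul_ne_top ENNReal.ofReal_ne_top hM
  -- The modulus depends neither on `N` nor on `k`, so Vitali's theorem can be used first for `k →
  -- ∞` and then for `N → ∞`.
  have hmod (N k : ℕ) (s : Set W) (hs : MeasurableSet s) :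
      ∫⁻ x in s, ‖fderiv ℝ (Φ k) x (i (S N x))‖ₑ ∂μ ≤
        ENNReal.ofReal K * M * μ s ^ (1 / q.toReal) := by
    refine setLIntegral_enorm_le_of_forall_smooth (hyi N k) hq1 hq hMK (fun χ hχ => ?_) hs
    rw [← hμ.integral_mul_fderiv_condCoords hl N hB (hΦ k) hχ, mul_assoc]
    refine (enorm_integral_mul_fderiv_mixCoords_le hμ hl N hAmeas hAbdd hB hid hr hq hpt hrp hK
      (hΦ k) hχ).trans ?_
    gcongr
    exact hΦM k
  have hyN (N : ℕ) := tendsto_eLpNorm_of_setLIntegral_le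
    (z := fun x => U x (i (S N x))) (fun k => (hyi N k).1) hMK ha (hmod N) (by
      filter_upwards [hΦae, hU] with x hx hUx
      have h1 := hx.inner (𝕜 := ℝ) (tendsto_const_nhds (x := S N x))
      simp only [smoothGrad_inner] at h1
      rwa [← hUx, dualEmb_inner] at h1)
  have hR (N : ℕ) (χ : W → ℝ) (hχ : IsSmoothFunctional χ) :
      ∫ x, χ x * U x (i (S N x)) ∂μ =
        ∫ z, ⟪A (mixCoords i (cylProj l e N) z.1 z.2) (partialProj e N (u z.1)),
          partialProj e N (smoothGrad i χ z.1)⟫_ℝ ∂(μ.prod μ) := by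
    refine tendsto_nhds_unique (tendsto_integral_smooth_mul hχ (hyi N) (hyN N).2.1 (hyN N).2.2) ?_
    refine (hμ.tendsto_integral_inner_mixCoords hl N hAmeas hAbdd hΦ hu1 hΦu1 hχ).congr fun k => ?_
    rw [← (integral_mul_fderiv_mixCoords hμ hl N hAmeas hAbdd hB hid (hΦ k) hχ).1,
      hμ.integral_mul_fderiv_condCoords hl N hB (hΦ k) hχ]
  obtain ⟨ns, hns, hSae⟩ := exists_subseq_tendsto_ae one_ne_zero (fun N => (hSi N).1) hB.1
    (hμ.tendsto_eLpNorm_condCoords hl hb hB hBsum)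
  -- Second passage to the limit. Convergence almost everywhere uses continuity of each `U ω` on
  -- `W`, and integrability of `U(B)` is obtained here rather than assumed.
  have hlim := tendsto_eLpNorm_of_setLIntegral_le (y := fun j x => U x (i (S (ns j) x)))
    (z := fun x => U x (B x)) (fun j => (hyN (ns j)).2.1.1) hMK ha
    (fun j => (hyN (ns j)).1) (by
      filter_upwards [hSae] with x hx
      exact ((U x).continuous.tendsto _).comp hx)
  refine ⟨hlim.2.1, fun χ hχ => ?_⟩
  obtain ⟨ms, hms, hms'⟩ := hμ.exists_subseq_tendsto_integral_inner_mixCoords hl hAmeas hAskew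
    hAbdd hu1 hχ hns
  refine tendsto_nhds_unique ((tendsto_integral_smooth_mul hχ (fun j => (hyN (ns j)).2.1) hlim.2.1
    hlim.2.2).comp hms.tendsto_atTop) (hms'.congr fun j => ?_)
  exact (hR _ χ hχ).symm

/-! ### Choice of exponents and conclusion -/

variable {W H : Type*} [NormedAddCommGroup W] [NormedSpace ℝ W] [CompleteSpace W]
  [TopologicalSpace.SeparableSpace W] [MeasurableSpace W] [BorelSpace W] [NormedAddCommGroup H]
  [InnerProductSpace ℝ H] [CompleteSpace H] {i : H →L[ℝ] W} {μ : Measure W} {p : ℝ≥0∞}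

/-- As `p > 1`, its conjugate exponent is finite and lies below some `4m`; conjugation reverses the
inequality. Exponents of this form are those for which the circle estimate holds. -/
theorem exists_holderConjugate_four_mul (hp : 1 < p) :
    ∃ (m : ℕ) (r : ℝ≥0∞), 0 < m ∧ r ≤ p ∧ ENNReal.HolderConjugate r (4 * m : ℕ) := by
  have h1 : ENNReal.HolderConjugate p p.conjExponent := .conjExponent hp.le
  have h2 : p.conjExponent ≠ ∞ :=
    (ENNReal.HolderConjugate.ne_top_iff_ne_one p.conjExponent p).2 hp.ne'
  obtain ⟨n, hn⟩ := ENNReal.exists_nat_gt h2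
  have h3 : p.conjExponent ≤ (4 * (n + 1) : ℕ) := by
    refine hn.le.trans ?_
    exact_mod_cast (by omega : n ≤ 4 * (n + 1))
  have h4 : (1 : ℝ≥0∞) ≤ (4 * (n + 1) : ℕ) := by exact_mod_cast (by omega : 1 ≤ 4 * (n + 1))
  have h5 : ENNReal.HolderConjugate (4 * (n + 1) : ℕ) (ENNReal.conjExponent (4 * (n + 1) : ℕ)) :=
    .conjExponent h4
  refine ⟨n + 1, ENNReal.conjExponent (4 * (n + 1) : ℕ), by omega, ?_, .symm⟩
  rw [← ENNReal.inv_le_inv, ← ENNReal.HolderConjugate.one_sub_inv p.conjExponent p,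
    ← ENNReal.HolderConjugate.one_sub_inv ((4 * (n + 1) : ℕ) : ℝ≥0∞)
      (ENNReal.conjExponent (4 * (n + 1) : ℕ))]
  exact tsub_le_tsub_left (ENNReal.inv_le_inv.2 h3) 1

/-- The divergence of `A ∇f(t, ·)` is the derivative of `f(t, ·)` along the flow. -/
theorem isDivergence_clm_of_flow [IsProbabilityMeasure μ] (hp : 1 ≤ p) (e : HilbertBasis ℕ ℝ H)
    {A : W → H →L[ℝ] H} (hAmeas : ∀ h, AEStronglyMeasurable (fun ω => A ω h) μ)
    (hAskew : ∀ᵐ ω ∂μ, ∀ h k : H, ⟪A ω h, k⟫_ℝ = -⟪h, A ω k⟫_ℝ) {C : ℝ}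
    (hAbdd : ∀ᵐ ω ∂μ, ‖A ω‖ ≤ C) {B : W → W} (hB : MemLp B 1 μ)
    (hid : ∀ Φ Ψ : W → ℝ, IsSmoothFunctional Φ → IsSmoothFunctional Ψ →
      ∫ ω, ⟪A ω (smoothGrad i Φ ω), smoothGrad i Ψ ω⟫_ℝ ∂μ = ∫ ω, Ψ ω * fderiv ℝ Φ ω (B ω) ∂μ)
    {T : ℝ → W → W} (hTm : Measurable (Function.uncurry T)) (hTs : IsStationaryProcess μ T)
    (hT : SolvesPathwise μ T (fun t x => B (T t x)) id) {Φ : W → ℝ} (hΦ : IsSmoothFunctional Φ)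
    (t : ℝ) {u : W → H} (hu : IsGradient i μ p (fun ω => Φ (T t ω)) u) :
    IsDivergence i μ (fun ω => A ω (u ω)) fun ω => fderiv ℝ Φ (T t ω) (B (T t ω)) := by
  have hu1 : MemLp u 1 μ := hu.2.1.mono_exponent hp
  refine ⟨?_, ?_, fun Ψ hΨ => ?_⟩
  · refine ((memLp_one_iff_integrable.1 hu1).norm.const_mul C).mono'
      (aestronglyMeasurable_clm_apply e hAmeas hu1.1) ?_
    filter_upwards [hAbdd] with ω hω
    exact ((A ω).le_opNorm _).trans (mul_le_mul_of_nonneg_right hω (norm_nonneg _))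
  · exact (hTs.measurePreserving t).integrable_comp_of_integrable
      (memLp_one_iff_integrable.1 (hΦ.memLp_fderiv_apply hB))
  · obtain ⟨R, hR⟩ := hΦ.exists_bound
    -- The identity between `A` and `B` is used with `Ψ` as the differentiated functional and `f(t,
    -- ·)`, bounded because `f₀` is, as the test function. Stationarity and skewness each contribute
    -- a minus sign.
    have h1 := IsGradient.integral_inner_eq hp e hAmeas hAbdd hΨ
      (memLp_one_iff_integrable.1 (hΨ.memLp_fderiv_apply hB)) (fun Θ hΘ => hid Ψ Θ hΨ hΘ) hu
      (R := R) (ae_of_all _ fun ω => hR _)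
    rw [hTs.integral_mul_fderiv hTm hB hT hΦ hΨ t, ← h1, ← integral_neg]
    refine integral_congr_ae ?_
    filter_upwards [hAskew] with ω hω
    rw [hω, real_inner_comm]

end WienerFlow

end

theorem mainTheorem11 {W H : Type*}
    [NormedAddCommGroup W] [NormedSpace ℝ W] [CompleteSpace W]
    [TopologicalSpace.SeparableSpace W] [MeasurableSpace W] [BorelSpace W]
    [NormedAddCommGroup H] [InnerProductSpace ℝ H] [CompleteSpace H]
    (i : H →L[ℝ] W) (μ : Measure W) (hμ : WienerFlow.IsAbstractWienerSpace i μ)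
    (p : ℝ≥0∞) (hp : 1 ≤ p) (hp' : p ≠ ∞)
    -- a smooth orthonormal basis of `H`
    (e : HilbertBasis ℕ ℝ H) (he : ∀ n, e n ∈ Set.range (WienerFlow.dualEmb i))
    -- the random skew-symmetric operator
    (A : W → H →L[ℝ] H)
    (hAmeas : ∀ h, AEStronglyMeasurable (fun ω => A ω h) μ)
    (hAskew : ∀ᵐ ω ∂μ, ∀ h k : H, ⟪A ω h, k⟫_ℝ = -⟪h, A ω k⟫_ℝ)
    (hAD : ∀ v : W → H, WienerFlow.MemD1 i μ p v →
      WienerFlow.MemD1 i μ p (fun ω => A ω (v ω)))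
    -- `B = ∑ δ(A eₙ) eₙ` in `L¹(μ; W)`
    (b : ℕ → W → ℝ) (hb : ∀ n, WienerFlow.IsDivergence i μ (fun ω => A ω (e n)) (b n))
    (B : W → W) (hB : MemLp B 1 μ)
    (hBsum : Tendsto
      (fun n => eLpNorm (fun ω => (∑ k ∈ Finset.range n, b k ω • i (e k)) - B ω) 1 μ)
      atTop (𝓝 0))
    -- the stationary solution of `dT_t/dt = B(T_t)`, `T_0 ω = ω`
    (T : ℝ → W → W) (hTmeas : Measurable (Function.uncurry T))
    (hTstat : WienerFlow.IsStationaryProcess μ T)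
    (hTsol : WienerFlow.SolvesPathwise μ T (fun t ω => B (T t ω)) id)
    -- the initial value
    (f₀ : W → ℝ) (hf₀ : WienerFlow.IsSmoothFunctional f₀)
    (hf₀D : ∀ t, WienerFlow.MemD2 i μ p (fun ω => f₀ (T t ω)))
    -- the gradient `u t = ∇f(t, ·)` of `f(t, ω) = f₀(T_t ω)`
    (u : ℝ → W → H) (hu : ∀ t, WienerFlow.IsGradient i μ p (fun ω => f₀ (T t ω)) (u t)) :
    ∃ d : ℝ → W → ℝ,
      AEStronglyMeasurable (Function.uncurry d) ((volume : Measure ℝ).prod μ) ∧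
      -- `d t = δ(A ∇f(t, ·))`
      (∀ t, WienerFlow.IsDivergence i μ (fun ω => A ω (u t ω)) (d t)) ∧
      -- `df/dt = d`: as a derivative in `L¹(μ)` at every time
      (∀ t, Tendsto (fun ε : ℝ => eLpNorm
          (fun ω => ε⁻¹ * (f₀ (T (t + ε) ω) - f₀ (T t ω)) - d t ω) 1 μ)
        (𝓝[≠] 0) (𝓝 0)) ∧
      -- and along almost every path, with `f(0, ω) = f₀(ω)`
      WienerFlow.SolvesPathwise μ (fun t ω => f₀ (T t ω)) d f₀ ∧
      -- in the classical sense wherever the equation for `T` holds in the classical sense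
      (∀ᵐ ω ∂μ, ∀ t, HasDerivAt (fun s => T s ω) (B (T t ω)) t →
        HasDerivAt (fun s => f₀ (T s ω)) (d t ω) t) ∧
      -- if `∇f(t, ·) = U` takes values in `W*`, then `df/dt = ⟨∇f, B⟩`
      (1 < p → ∀ (t : ℝ) (U : W → StrongDual ℝ W),
        (∀ᵐ ω ∂μ, WienerFlow.dualEmb i (U ω) = u t ω) →
        ∀ᵐ ω ∂μ, d t ω = U ω (B ω)) := by
  have := hμ.isProbabilityMeasure
  choose l hl using he
  obtain ⟨C, hC0, hC⟩ := WienerFlow.exists_sobolev_bound hp e hAD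
  have hAbdd : ∀ᵐ ω ∂μ, ‖A ω‖ ≤ C :=
    WienerFlow.ae_norm_le_of_skew hp hp' e hAmeas hAskew hC0 fun F hF => (hC F hF).1
  have hid : ∀ Φ Ψ : W → ℝ, WienerFlow.IsSmoothFunctional Φ → WienerFlow.IsSmoothFunctional Ψ →
      ∫ ω, ⟪A ω (WienerFlow.smoothGrad i Φ ω), WienerFlow.smoothGrad i Ψ ω⟫_ℝ ∂μ =
        ∫ ω, Ψ ω * fderiv ℝ Φ ω (B ω) ∂μ := fun Φ Ψ hΦ hΨ =>
    WienerFlow.integral_inner_smoothGrad e hAmeas hAskew hAbdd hb hB hBsum hΦ hΨ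
  have hg : MemLp (fun x => fderiv ℝ f₀ x (B x)) 1 μ := hf₀.memLp_fderiv_apply hB
  have hdiv (t : ℝ) := WienerFlow.isDivergence_clm_of_flow hp e hAmeas hAskew hAbdd hB hid hTmeas
    hTstat hTsol hf₀ t (hu t)
  -- The chain rule derivative is the candidate: all claims on differentiation concern the flow
  -- alone, and only its identification as a divergence involves `A`.
  refine ⟨fun t ω => fderiv ℝ f₀ (T t ω) (B (T t ω)),
    WienerFlow.aestronglyMeasurable_uncurry_flow hTmeas hTstat.measurePreserving hg.1 volume,
    hdiv, WienerFlow.tendsto_eLpNorm_slope_flow hTmeas hTstat.measurePreserving hB hTsol hf₀,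
    hTsol.comp_smooth hf₀, ae_of_all _ fun ω t h =>
      (hf₀.differentiable (T t ω)).hasFDerivAt.comp_hasDerivAt t h, fun hp1 t U hU => ?_⟩
  obtain ⟨m, r, hm, hrp, hconj⟩ := WienerFlow.exists_holderConjugate_four_mul hp1
  obtain ⟨K, -, hK⟩ := hμ.exists_divergence_clm_bound hm r hp hrp e hAmeas hAD
  have hconj' : ENNReal.HolderConjugate p p.conjExponent := .conjExponent hp
  obtain ⟨hUi, hUB⟩ := hμ.integral_mul_apply_eq hl hAmeas hAskew hAbdd (fun k => (hb k).2.1) hB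
    hBsum hid (hrp.trans_lt hp'.lt_top).ne (ENNReal.natCast_ne_top (4 * m)) hp' hrp
    (fun Φ χ hΦ hχ => hK _ (hΦ.isSmoothField_smoothGrad i) χ hχ) p.conjExponent
    ((ENNReal.HolderConjugate.ne_top_iff_ne_one p.conjExponent p).2 hp1.ne') (hf₀D t) (hu t) hU
  -- `d t` and `U(B)` are both integrable and both represent the divergence of `A u t` against
  -- smooth functionals.
  exact WienerFlow.ae_eq_of_forall_integral_smooth (hdiv t).2.1 hUi fun χ hχ => by
    rw [hUB χ hχ, (hdiv t).2.2 χ hχ]
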